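/- Let $\nu,\alpha,\beta>0$, $\gamma\in(0,1)$, let $\delta\ge 1$ be an integer, $T>0$ and $p\ge 2\delta+1$ a real number. Write $\mathrm L^q=\mathrm L^q(0,1)$, $\mathrm H^1_0=\mathrm H^1_0(0,1)$, $(f,g)=\int_0^1 fg\,dx$, and $$\mathfrak p(u)=u^{\delta+1},\qquad \mathfrak c(u)=u(1-u^\delta)(u^\delta-\gamma),$$ and let $$G_\nu(t,x,y)=\frac1{\sqrt{4\pi\nu t}}\sum_{n\in\mathbb Z}\Big[e^{-\frac{(y-x-2n)^2}{4\nu t}}-e^{-\frac{(y+x-2n)^2}{4\nu t}}\Big]$$ be the fundamental solution of $\partial_t u=\nu\,\partial_{xx}u$ on $[0,1]$ with Dirichlet boundary conditions. Let $u_0\in\mathrm L^p$ and let $\varphi\in \mathrm C([0,T];\mathrm L^p)$ with $\sup_{t\in[0,T]}\|\varphi(t)\|_{\mathrm L^{p(\delta+1)}}<\infty$ (for instance $\varphi$ continuous on $[0,T]\times[0,1]$). Then there is a unique $v\in \mathrm C([0,T];\mathrm L^p)$ such that $v(0)=u_0$ and, for every $t\in(0,T]$ and almost every $x\in(0,1)$,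 $$v(t,x)=\int_0^1 G_\nu(t,x,y)u_0(y)\,dy+\beta\int_0^t\!\int_0^1 G_\nu(t-s,x,y)\,\mathfrak c\big(v(s,y)+\varphi(s,y)\big)\,dy\,ds+\frac{\alpha}{\delta+1}\int_0^t\!\int_0^1\frac{\partial G_\nu}{\partial y}(t-s,x,y)\,\mathfrak p\big(v(s,y)+\varphi(s,y)\big)\,dy\,ds .$$ This $v$ is also the unique weak solution of $$\partial_t v=\nu\,\partial_{xx}v-\frac{\alpha}{\delta+1}\,\partial_x\,\mathfrak p(v+\varphi)+\beta\,\mathfrak c(v+\varphi),\qquad v(0)=u_0,$$ that is, the unique $v\in \mathrm C([0,T];\mathrm L^2)\cap \mathrm L^\infty(0,T;\mathrm L^p)\cap \mathrm L^2(0,T;\mathrm H^1_0)$ such that, for all $\zeta\in \mathrm H^1_0$ and $t\in[0,T]$, $$(v(t),\zeta)=(u_0,\zeta)-\int_0^t\Big[\nu(\partial_xv,\partial_x\zeta)-\frac{\alpha}{\delta+1}\big(\mathfrak p(v+\varphi),\partial_x\zeta\big)-\beta\big(\mathfrak c(v+\varphi),\zeta\big)\Big](s)\,ds .$$ Moreover,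 for all $t\in[0,T]$, $$\|v(t)\|_{\mathrm L^p}^p+\frac{\nu p(p-1)}2\int_0^t\big\||v(s)|^{\frac{p-2}2}\partial_xv(s)\big\|_{\mathrm L^2}^2ds+\beta p\gamma\int_0^t\|v(s)\|_{\mathrm L^p}^p\,ds+\frac{\beta p}8\int_0^t\|v(s)\|_{\mathrm L^{p+2\delta}}^{p+2\delta}\,ds$$ $$\le\|u_0\|_{\mathrm L^p}^p+pK_1T+pK_2T\sup_{t\in[0,T]}\|\varphi(t)\|_{\mathrm L^{p(\delta+1)}}^{p(\delta+1)}+pK_3T\sup_{t\in[0,T]}\|\varphi(t)\|_{\mathrm L^{p+2\delta}}^{p+2\delta},$$ where $$K_1=\frac{2\delta}{p+2\delta}\Big(\frac{8p}{\beta(p+2\delta)}\Big)^{\frac p{2\delta}}\Big\{\frac{2^\delta(p-1)^2\alpha^2}{4\nu}+2^{2\delta}\beta(1+\gamma)^2+2^\delta\beta(1+\gamma)+2^{2\delta-1}\beta(2\delta+1)\Big\}^{\frac{p+2\delta}{2\delta}},$$ $$K_2=\frac{2^\delta\beta(1+\gamma)}p\Big(\frac{p-1}p\Big)^{p-1}+\frac{2^\delta(p-1)^2\alpha^2}{\nu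 p}\Big(\frac{2(p-2)}p\Big)^{\frac2{p-2}},$$ $$K_3=\frac1{p+2\delta}\Big\{\Big(\frac{4(p+2\delta-1)}{\beta(p+2\delta)}\Big)^{p+2\delta-1}\big(2^{2\delta-1}\beta(2\delta+1)\big)^{p+2\delta}+2\Big(\frac{4(p+2\delta-2)}{\beta(p+2\delta)}\Big)^{\frac{p+2\delta-2}2}\Big(\frac{2^\delta(p-1)^2\alpha^2}{2\nu}\Big)^{\frac{p+2\delta}2}\Big\}.$$ -/

import Mathlib

open MeasureTheory Set Filter
open scoped Topology ENNReal NNReal ContDiff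

noncomputable section

namespace GBH

/-- Lebesgue measure on the interval `(0,1)`. -/
abbrev mu : Measure ℝ := volume.restrict (Ioo (0 : ℝ) 1)

/-- The norm of `L^q(0,1)` for a real exponent `q > 0`, with values in `[0,∞]`. -/
def normL (q : ℝ) (f : ℝ → ℝ) : ℝ≥0∞ := eLpNorm f (ENNReal.ofReal q) mu

/-- Membership in `L^q(0,1)` for a real exponent `q > 0`. -/
def InL (q : ℝ) (f : ℝ → ℝ) : Prop := MemLp f (ENNReal.ofReal q) mu

/-- `v ∈ C([0,T]; L^q(0,1))`, where `v t` is the function `x ↦ v(t,x)`. -/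
def ContL (T q : ℝ) (v : ℝ → ℝ → ℝ) : Prop :=
  (∀ t ∈ Icc 0 T, InL q (v t)) ∧
  ∀ t ∈ Icc 0 T, Tendsto (fun s => normL q (fun x => v s x - v t x)) (𝓝[Icc 0 T] t) (𝓝 0)

/-- `f ∈ H¹₀(0,1)` with weak derivative `g`: the pair `(f, g)` is the limit in `L² × L²` of pairs
`(ψ, ψ')` with `ψ` smooth and compactly supported in `(0,1)`, i.e. `f` is in the closure of
`C_c^∞(0,1)` for the `H¹` norm. -/
def HasH10Deriv (f g : ℝ → ℝ) : Prop :=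
  InL 2 f ∧ InL 2 g ∧
  ∃ ψ : ℕ → ℝ → ℝ,
    (∀ n, ContDiff ℝ ∞ (ψ n) ∧ HasCompactSupport (ψ n) ∧ tsupport (ψ n) ⊆ Ioo 0 1) ∧
    Tendsto (fun n => normL 2 (fun x => ψ n x - f x)) atTop (𝓝 0) ∧
    Tendsto (fun n => normL 2 (fun x => deriv (ψ n) x - g x)) atTop (𝓝 0)

/-- `v ∈ L²(0,T; H¹₀(0,1))` with spatial weak derivative `w = ∂ₓ v`. It is used only for
`v ∈ C([0,T]; L²(0,1))`, and then the measurability of `t ↦ w t` as a map into `L²(0,1)` is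
automatic: `w` is weakly measurable (test with `C_c^∞` functions) and `L²(0,1)` is separable. -/
def HasSpaceDeriv (T : ℝ) (v w : ℝ → ℝ → ℝ) : Prop :=
  (∀ᵐ t ∂(volume.restrict (Icc 0 T)), HasH10Deriv (v t) (w t)) ∧
  (∫⁻ t in Icc 0 T, normL 2 (w t) ^ 2) < ⊤

/-- The fundamental solution `G(t,x,y)` of `∂ₜ u = ∂ₓₓ u` on `[0,1]` with Dirichlet boundary
conditions, for `t > 0`. That of `∂ₜ u = ν ∂ₓₓ u` is `G (ν * t) x y`. -/
def G (t x y : ℝ) : ℝ :=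
  (1 / Real.sqrt (4 * Real.pi * t)) *
    ∑' n : ℤ, (Real.exp (-(y - x - 2 * n) ^ 2 / (4 * t))
      - Real.exp (-(y + x - 2 * n) ^ 2 / (4 * t)))

/-- The partial derivative `∂G/∂y (t,x,y)`. -/
def dG (t x y : ℝ) : ℝ := deriv (fun z => G t x z) y

/-- The nonlinearity `𝔭(u) = u^(δ+1)`. -/
def pp (δ : ℕ) (u : ℝ) : ℝ := u ^ (δ + 1)

/-- The nonlinearity `𝔠(u) = u (1 - u^δ) (u^δ - γ)`. -/
def cc (γ : ℝ) (δ : ℕ) (u : ℝ) : ℝ := u * (1 - u ^ δ) * (u ^ δ - γ)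

/-- `v` is a solution in `C([0,T]; L^p(0,1))` of the shifted integral equation: `v(0) = u₀` and,
for every `t ∈ (0,T]` and almost every `x ∈ (0,1)`, the time integrals converge absolutely and
`v(t,x) = ∫ G_ν(t,x,y) u₀(y) dy + β ∫₀ᵗ∫ G_ν(t-s,x,y) 𝔠(v+φ)(s,y) dy ds
  + α/(δ+1) ∫₀ᵗ∫ ∂_y G_ν(t-s,x,y) 𝔭(v+φ)(s,y) dy ds`, with `G_ν(t,x,y) = G(νt,x,y)`. -/
def IsMildSolution (ν α β γ : ℝ) (δ : ℕ) (p T : ℝ) (φ : ℝ → ℝ → ℝ) (u₀ : ℝ → ℝ)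
    (v : ℝ → ℝ → ℝ) : Prop :=
  ContL T p v ∧ v 0 =ᵐ[mu] u₀ ∧
  ∀ t ∈ Ioc 0 T, ∀ᵐ x ∂mu,
    IntervalIntegrable
      (fun s => ∫ y, G (ν * (t - s)) x y * cc γ δ (v s y + φ s y) ∂mu) volume 0 t ∧
    IntervalIntegrable
      (fun s => ∫ y, dG (ν * (t - s)) x y * pp δ (v s y + φ s y) ∂mu) volume 0 t ∧
    v t x = (∫ y, G (ν * t) x y * u₀ y ∂mu)
      + β * (∫ s in (0 : ℝ)..t, ∫ y, G (ν * (t - s)) x y * cc γ δ (v s y + φ s y) ∂mu)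
      + α / (δ + 1) *
        (∫ s in (0 : ℝ)..t, ∫ y, dG (ν * (t - s)) x y * pp δ (v s y + φ s y) ∂mu)

/-- The pairing `⟨𝔄(ψ), ζ⟩` of the operator `𝔄 : H¹₀ → H⁻¹` at a function `ψ` with derivative `ψ'`,
shifted by `φ`, with a test function `ζ` with derivative `ζ'`. -/
def pairing (ν α β γ : ℝ) (δ : ℕ) (φ ψ ψ' ζ ζ' : ℝ → ℝ) : ℝ :=
  ν * (∫ x, ψ' x * ζ' x ∂mu)
    - α / (δ + 1) * (∫ x, pp δ (ψ x + φ x) * ζ' x ∂mu)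
    - β * (∫ x, cc γ δ (ψ x + φ x) * ζ x ∂mu)

/-- `v` is a weak solution, in `C([0,T]; L²) ∩ L^∞(0,T; L^p) ∩ L²(0,T; H¹₀)`, of
`∂ₜ v = ν ∂ₓₓ v - α/(δ+1) ∂ₓ 𝔭(v+φ) + β 𝔠(v+φ)`, `v(0) = u₀`: for all `ζ ∈ H¹₀(0,1)` and
`t ∈ [0,T]`, `(v(t), ζ) = (u₀, ζ) - ∫₀ᵗ ⟨𝔄(v(s)), ζ⟩ ds`, the integral converging absolutely. -/
def IsWeakSolution (ν α β γ : ℝ) (δ : ℕ) (p T : ℝ) (φ : ℝ → ℝ → ℝ) (u₀ : ℝ → ℝ)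
    (v : ℝ → ℝ → ℝ) : Prop :=
  ContL T 2 v ∧
  (∃ C : ℝ≥0, ∀ᵐ t ∂(volume.restrict (Icc 0 T)), normL p (v t) ≤ C) ∧
  ∃ w : ℝ → ℝ → ℝ, HasSpaceDeriv T v w ∧
    ∀ ζ ζ' : ℝ → ℝ, HasH10Deriv ζ ζ' → ∀ t ∈ Icc 0 T,
      IntervalIntegrable (fun s => pairing ν α β γ δ (φ s) (v s) (w s) ζ ζ') volume 0 t ∧
      (∫ x, v t x * ζ x ∂mu) = (∫ x, u₀ x * ζ x ∂mu)
        - ∫ s in (0 : ℝ)..t, pairing ν α β γ δ (φ s) (v s) (w s) ζ ζ'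

/-- The constant `K₁` of the energy estimate. -/
def K1 (ν α β γ : ℝ) (δ : ℕ) (p : ℝ) : ℝ :=
  (2 * δ / (p + 2 * δ)) * (8 * p / (β * (p + 2 * δ))) ^ (p / (2 * δ)) *
    (2 ^ δ * (p - 1) ^ 2 * α ^ 2 / (4 * ν) + 2 ^ (2 * δ) * β * (1 + γ) ^ 2
      + 2 ^ δ * β * (1 + γ) + 2 ^ (2 * δ - 1) * β * (2 * δ + 1)) ^ ((p + 2 * δ) / (2 * δ))

/-- The constant `K₂` of the energy estimate. -/
def K2 (ν α β γ : ℝ) (δ : ℕ) (p : ℝ) : ℝ :=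
  (2 ^ δ * β * (1 + γ) / p) * ((p - 1) / p) ^ (p - 1)
    + (2 ^ δ * (p - 1) ^ 2 * α ^ 2 / (ν * p)) * (2 * (p - 2) / p) ^ (2 / (p - 2))

/-- The constant `K₃` of the energy estimate. -/
def K3 (ν α β : ℝ) (δ : ℕ) (p : ℝ) : ℝ :=
  (1 / (p + 2 * δ)) *
    ((4 * (p + 2 * δ - 1) / (β * (p + 2 * δ))) ^ (p + 2 * δ - 1)
        * (2 ^ (2 * δ - 1) * β * (2 * δ + 1)) ^ (p + 2 * δ)
      + 2 * (4 * (p + 2 * δ - 2) / (β * (p + 2 * δ))) ^ ((p + 2 * δ - 2) / 2)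
        * (2 ^ δ * (p - 1) ^ 2 * α ^ 2 / (2 * ν)) ^ ((p + 2 * δ) / 2))

end GBH

end

noncomputable section
namespace GBH

/-! The sines diagonalise the Dirichlet heat flow, and Poisson summation identifies the image sum
`G` with its spectral series. The series gives bounds with an integrable singularity at time zero:
the semigroup maps L¹ into bounded continuous functions with norm O(t^(-5/8)) (`norm_S1_le`), and
the operator with kernel ∂G/∂y maps L^{3/2} there with norm O(t^(-11/12)) (`norm_D1_le`). Since p ≥
2δ+1, the reaction sends L^p to L¹ and the flux sends L^p to L^{3/2}, both locally Lipschitz. The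
integral equation is therefore a weakly singular Volterra equation in L^p. Once the argument of the
nonlinearity is retracted to a ball, the equation is globally Lipschitz and is solved on all of
[0,T] by a contraction in an exponentially weighted norm (`volterra_exists`, `volterra_unique`). Two
mild solutions solve the same truncated equation for a large radius, hence coincide.

Removing the truncation needs the energy estimate. At positive times a mild solution has a bounded
continuous representative `VX`, whose sine coefficients satisfy scalar linear equations. On [a,T]
with a > 0 all source terms are bounded in L²; Galerkin truncation, the chain rule, integration by
parts and dominated convergence then give the energy identity for every Φ with bounded second
derivative (`LinData.energy_identity`). The choice Φ = u² shows that v is in L²(0,T;H¹₀) down to t =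
0 (`MildE.spaceDeriv`). The choice |u|^p, modified only above the supremum of the solution, gives
the L^p estimate. There the flux of v alone integrates to zero (`integral_comp_mul_eq_zero`), so
that only 𝔭(v+φ) - 𝔭(v) matters; half of the viscous dissipation absorbs it, and a scalar inequality
remains, `pointwise_energy`. If 3|φ| ≤ |v|, Young's inequality with its optimal constants produces
K₁ and K₃ exactly. If |v| ≤ 3|φ|, everything is bounded by powers of |φ|, and it has to be checked
that K₁ and K₃ are large enough (`three_mul_le_K1`, `K3_lower`). No K₂ term arises; the stated bound
is weaker by that nonnegative term. Letting a tend to 0 gives `MildE.energy`. With a truncation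
radius above this a priori bound, the truncated solution never reaches the sphere, so it solves the
original equation (`exists_mildE`).

Mild and weak solutions are compared mode by mode, using the description of H¹₀ by sine coefficients
(`hasH10Deriv_iff`). Summing the scalar equations against the coefficients of a test function shows
that mild solutions are weak (`MildE.weak_formula`). Conversely, testing with sines gives Duhamel's
formula for each coefficient, and the coefficients determine the function, so weak solutions are
mild (`IsWeakSolution.exists_mildE`) and inherit uniqueness. -/

instance : IsProbabilityMeasure mu := ⟨by simp [mu]⟩

/-! ### The sine and cosine systems on (0,1). -/

lemma integral_mu_eq (f : ℝ → ℝ) : ∫ x, f x ∂mu = ∫ x in (0 : ℝ)..1, f x := by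
  rw [intervalIntegral.integral_of_le zero_le_one, integral_Ioc_eq_integral_Ioo]

lemma ae_mu_of_forall {P : ℝ → Prop} (h : ∀ x ∈ Ioo (0 : ℝ) 1, P x) : ∀ᵐ x ∂mu, P x :=
  (ae_restrict_iff' measurableSet_Ioo).2 (ae_of_all _ h)

/-- The frequency `(k+1)π`. -/
def ev (k : ℕ) : ℝ := ((k : ℝ) + 1) * Real.pi

lemma ev_pos (k : ℕ) : 0 < ev k := by unfold ev; positivity

/-- The normalized sine functions. -/
def sf (k : ℕ) (x : ℝ) : ℝ := Real.sqrt 2 * Real.sin (ev k * x)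

/-- The normalized nonconstant cosine functions. -/
def cf (k : ℕ) (x : ℝ) : ℝ := Real.sqrt 2 * Real.cos (ev k * x)

/-- The normalized cosine functions, including the constant one. -/
def cb : ℕ → ℝ → ℝ
  | 0 => fun _ => 1
  | k + 1 => cf k

lemma continuous_sf (k : ℕ) : Continuous (sf k) := by unfold sf; fun_prop
lemma continuous_cf (k : ℕ) : Continuous (cf k) := by unfold cf; fun_prop
lemma continuous_cb (k : ℕ) : Continuous (cb k) := by
  cases k with
  | zero => exact continuous_const
  | succ k => exact continuous_cf k

lemma abs_sf_le (k : ℕ) (x : ℝ) : |sf k x| ≤ 2 := by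
  unfold sf
  rw [abs_mul, abs_of_nonneg (Real.sqrt_nonneg _)]
  have h1 := Real.abs_sin_le_one (ev k * x)
  have h2 : Real.sqrt 2 ≤ 2 := by rw [Real.sqrt_le_left (by norm_num)]; norm_num
  nlinarith [abs_nonneg (Real.sin (ev k * x)), Real.sqrt_nonneg 2]

lemma abs_cf_le (k : ℕ) (x : ℝ) : |cf k x| ≤ 2 := by
  unfold cf
  rw [abs_mul, abs_of_nonneg (Real.sqrt_nonneg _)]
  have h1 := Real.abs_cos_le_one (ev k * x)
  have h2 : Real.sqrt 2 ≤ 2 := by rw [Real.sqrt_le_left (by norm_num)]; norm_num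
  nlinarith [abs_nonneg (Real.cos (ev k * x)), Real.sqrt_nonneg 2]

lemma abs_cb_le (k : ℕ) (x : ℝ) : |cb k x| ≤ 2 := by
  cases k with
  | zero => simp [cb]
  | succ k => exact abs_cf_le k x

lemma hasDerivAt_sf (k : ℕ) (x : ℝ) : HasDerivAt (sf k) (ev k * cf k x) x := by
  unfold sf cf
  have := (((hasDerivAt_id x).const_mul (ev k)).sin).const_mul (Real.sqrt 2)
  simp only [id, mul_one] at this
  exact this.congr_deriv (by ring)

lemma hasDerivAt_cf (k : ℕ) (x : ℝ) : HasDerivAt (cf k) (-(ev k * sf k x)) x := by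
  unfold sf cf
  have := (((hasDerivAt_id x).const_mul (ev k)).cos).const_mul (Real.sqrt 2)
  simp only [id, mul_one] at this
  exact this.congr_deriv (by ring)

lemma sf_zero (k : ℕ) : sf k 0 = 0 := by simp [sf]
lemma sf_one (k : ℕ) : sf k 1 = 0 := by
  have := Real.sin_nat_mul_pi (k + 1)
  push_cast at this
  simp [sf, ev, this]

lemma integral_cos_int_mul_pi {m : ℤ} (hm : m ≠ 0) : ∫ x, Real.cos (m * Real.pi * x) ∂mu = 0 := by
  rw [integral_mu_eq]
  have h : (m : ℝ) * Real.pi ≠ 0 := mul_ne_zero (by exact_mod_cast hm) Real.pi_ne_zero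
  rw [intervalIntegral.integral_comp_mul_left (fun x => Real.cos x) h]
  simp [Real.sin_int_mul_pi]

lemma integrable_mu_of_continuous {f : ℝ → ℝ} (hf : Continuous f) : Integrable f mu :=
  (hf.integrableOn_Icc (a := 0) (b := 1)).mono_set Ioo_subset_Icc_self

lemma sf_mul_sf (j k : ℕ) (x : ℝ) : sf j x * sf k x =
    Real.cos (((j : ℤ) - k : ℤ) * Real.pi * x) - Real.cos (((j : ℤ) + k + 2 : ℤ) * Real.pi * x) := by
  unfold sf ev
  have e1 : (((j : ℤ) - k : ℤ) : ℝ) * Real.pi * x = ((j : ℝ) + 1) * Real.pi * x - ((k : ℝ) + 1) * Real.pi * x := by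
    push_cast; ring
  have e2 : (((j : ℤ) + k + 2 : ℤ) : ℝ) * Real.pi * x = ((j : ℝ) + 1) * Real.pi * x + ((k : ℝ) + 1) * Real.pi * x := by
    push_cast; ring
  rw [e1, e2, Real.cos_sub, Real.cos_add]
  have h2 : Real.sqrt 2 * Real.sqrt 2 = 2 := Real.mul_self_sqrt (by norm_num)
  linear_combination (Real.sin (((j : ℝ) + 1) * Real.pi * x) * Real.sin (((k : ℝ) + 1) * Real.pi * x)) * h2

lemma cf_mul_cf (j k : ℕ) (x : ℝ) : cf j x * cf k x =
    Real.cos (((j : ℤ) - k : ℤ) * Real.pi * x) + Real.cos (((j : ℤ) + k + 2 : ℤ) * Real.pi * x) := by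
  unfold cf ev
  have e1 : (((j : ℤ) - k : ℤ) : ℝ) * Real.pi * x = ((j : ℝ) + 1) * Real.pi * x - ((k : ℝ) + 1) * Real.pi * x := by
    push_cast; ring
  have e2 : (((j : ℤ) + k + 2 : ℤ) : ℝ) * Real.pi * x = ((j : ℝ) + 1) * Real.pi * x + ((k : ℝ) + 1) * Real.pi * x := by
    push_cast; ring
  rw [e1, e2, Real.cos_sub, Real.cos_add]
  have h2 : Real.sqrt 2 * Real.sqrt 2 = 2 := Real.mul_self_sqrt (by norm_num)
  linear_combination (Real.cos (((j : ℝ) + 1) * Real.pi * x) * Real.cos (((k : ℝ) + 1) * Real.pi * x)) * h2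

lemma integral_sf_mul_sf (j k : ℕ) : ∫ x, sf j x * sf k x ∂mu = if j = k then 1 else 0 := by
  simp_rw [sf_mul_sf]
  rw [integral_sub (integrable_mu_of_continuous (by fun_prop))
    (integrable_mu_of_continuous (by fun_prop)),
    integral_cos_int_mul_pi (m := (j : ℤ) + k + 2) (by omega)]
  split_ifs with h
  · subst h; simp
  · rw [integral_cos_int_mul_pi (by omega)]; simp

lemma integral_cf_mul_cf (j k : ℕ) : ∫ x, cf j x * cf k x ∂mu = if j = k then 1 else 0 := by
  simp_rw [cf_mul_cf]
  rw [integral_add (integrable_mu_of_continuous (by fun_prop))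
    (integrable_mu_of_continuous (by fun_prop)),
    integral_cos_int_mul_pi (m := (j : ℤ) + k + 2) (by omega)]
  split_ifs with h
  · subst h; simp
  · rw [integral_cos_int_mul_pi (by omega)]; simp

lemma integral_cf (k : ℕ) : ∫ x, cf k x ∂mu = 0 := by
  unfold cf ev
  rw [integral_const_mul]
  have := integral_cos_int_mul_pi (m := (k : ℤ) + 1) (by omega)
  push_cast at this
  rw [this, mul_zero]

lemma integral_cb_mul_cb (j k : ℕ) : ∫ x, cb j x * cb k x ∂mu = if j = k then 1 else 0 := by
  cases j <;> cases k <;> simp [cb, integral_cf, integral_cf_mul_cf]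

/-- Continuous functions on `[0,1]` are uniform limits of polynomials in `cos (π x)`. -/
lemma exists_polynomial_cos_near {h : ℝ → ℝ} (hh : Continuous h) {ε : ℝ} (hε : 0 < ε) :
    ∃ P : Polynomial ℝ, ∀ x ∈ Icc (0 : ℝ) 1, |P.eval (Real.cos (Real.pi * x)) - h x| < ε := by
  obtain ⟨P, hP⟩ := exists_polynomial_near_of_continuousOn (-1) 1
    (fun y => h (Real.arccos y / Real.pi))
    (by have := Real.continuous_arccos; fun_prop) ε hε
  refine ⟨P, fun x hx => ?_⟩
  have := hP (Real.cos (Real.pi * x)) ⟨Real.neg_one_le_cos _, Real.cos_le_one _⟩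
  rwa [Real.arccos_cos (by have := Real.pi_pos; nlinarith [hx.1]) (by have := Real.pi_pos; nlinarith [hx.2]),
    mul_div_cancel_left₀ _ Real.pi_ne_zero] at this

/-- By product-to-sum, multiplication by cos πx averages the two neighbouring modes. The span is
thus a module over the polynomials in cos πx, which are uniformly dense in C[0,1]. -/
lemma cos_mul_mem_span_sf {f : ℝ → ℝ} (hf : f ∈ Submodule.span ℝ (range sf)) :
    (fun x => Real.cos (Real.pi * x) * f x) ∈ Submodule.span ℝ (range sf) := by
  induction hf using Submodule.span_induction with
  | mem f hf =>
    obtain ⟨k, rfl⟩ := hf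
    have h0 : (fun x => Real.cos (Real.pi * x) * sf k x) = (1 / 2 : ℝ) • sf (k + 1)
        + (1 / 2 : ℝ) • (fun x => Real.sqrt 2 * Real.sin (k * Real.pi * x)) := by
      funext x
      simp only [sf, ev, Pi.add_apply, Pi.smul_apply, smul_eq_mul]
      have e1 : ((k + 1 : ℕ) + 1 : ℝ) * Real.pi * x = (k + 1) * Real.pi * x + Real.pi * x := by
        push_cast; ring
      have e2 : (k : ℝ) * Real.pi * x = (k + 1) * Real.pi * x - Real.pi * x := by ring
      rw [e1, e2, Real.sin_add, Real.sin_sub]; ring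
    rw [h0]
    refine Submodule.add_mem _ (Submodule.smul_mem _ _ (Submodule.subset_span ⟨_, rfl⟩))
      (Submodule.smul_mem _ _ ?_)
    -- The lower neighbour of the first mode is sin 0 = 0, so the span is not left at the bottom
    -- end.
    cases k with
    | zero =>
      simp only [CharP.cast_eq_zero, zero_mul, Real.sin_zero, mul_zero]
      exact (Submodule.span ℝ (range sf)).zero_mem
    | succ k =>
      refine Submodule.subset_span ⟨k, ?_⟩
      funext x; simp [sf, ev]
  | zero =>
    simp only [Pi.zero_apply, mul_zero]
    exact (Submodule.span ℝ (range sf)).zero_mem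
  | add f g _ _ hf hg =>
    simp only [Pi.add_apply, mul_add]
    exact Submodule.add_mem _ hf hg
  | smul a f _ hf =>
    convert Submodule.smul_mem _ a hf using 1
    funext x; simp; ring

lemma cos_mul_mem_span_cb {f : ℝ → ℝ} (hf : f ∈ Submodule.span ℝ (range cb)) :
    (fun x => Real.cos (Real.pi * x) * f x) ∈ Submodule.span ℝ (range cb) := by
  induction hf using Submodule.span_induction with
  | mem f hf =>
    obtain ⟨k, rfl⟩ := hf
    have key : ∀ k : ℕ, (fun x => Real.cos (k * Real.pi * x)) ∈ Submodule.span ℝ (range cb) := by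
      intro k
      cases k with
      | zero =>
        simp only [CharP.cast_eq_zero, zero_mul, Real.cos_zero]
        exact Submodule.subset_span (mem_range_self (f := cb) 0)
      | succ k =>
        have : (fun x => Real.cos ((k + 1 : ℕ) * Real.pi * x)) = (1 / Real.sqrt 2) • cb (k + 1) := by
          funext x
          have h2 : Real.sqrt 2 ≠ 0 := by positivity
          simp [cb, cf, ev]
        rw [this]
        exact Submodule.smul_mem _ _ (Submodule.subset_span ⟨_, rfl⟩)
    cases k with
    | zero => simpa [cb] using key 1
    | succ k =>
      have h0 : (fun x => Real.cos (Real.pi * x) * cb (k + 1) x) =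
          (Real.sqrt 2 / 2 : ℝ) • (fun x => Real.cos ((k + 2 : ℕ) * Real.pi * x))
          + (Real.sqrt 2 / 2 : ℝ) • (fun x => Real.cos (k * Real.pi * x)) := by
        funext x
        simp only [cb, cf, ev, Pi.add_apply, Pi.smul_apply, smul_eq_mul]
        have e1 : ((k + 2 : ℕ) : ℝ) * Real.pi * x = (k + 1) * Real.pi * x + Real.pi * x := by
          push_cast; ring
        have e2 : (k : ℝ) * Real.pi * x = (k + 1) * Real.pi * x - Real.pi * x := by ring
        rw [e1, e2, Real.cos_add, Real.cos_sub]; ring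
      rw [h0]
      exact Submodule.add_mem _ (Submodule.smul_mem _ _ (key _)) (Submodule.smul_mem _ _ (key _))
  | zero =>
    simp only [Pi.zero_apply, mul_zero]
    exact (Submodule.span ℝ (range cb)).zero_mem
  | add f g _ _ hf hg =>
    simp only [Pi.add_apply, mul_add]
    exact Submodule.add_mem _ hf hg
  | smul a f _ hf =>
    convert Submodule.smul_mem _ a hf using 1
    funext x; simp; ring

lemma polynomial_cos_mul_mem {S : Submodule ℝ (ℝ → ℝ)}
    (hS : ∀ f ∈ S, (fun x => Real.cos (Real.pi * x) * f x) ∈ S) {f : ℝ → ℝ} (hf : f ∈ S)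
    (P : Polynomial ℝ) : (fun x => P.eval (Real.cos (Real.pi * x)) * f x) ∈ S := by
  induction P using Polynomial.induction_on' with
  | add P Q hP hQ =>
    simp only [Polynomial.eval_add, add_mul]
    exact Submodule.add_mem _ hP hQ
  | monomial n a =>
    have h : (fun x => Real.cos (Real.pi * x) ^ n * f x) ∈ S := by
      induction n with
      | zero => simpa using hf
      | succ n ih =>
        convert hS _ ih using 1
        funext x; ring
    convert Submodule.smul_mem _ a h using 1
    funext x; simp; ring

lemma memLp_of_continuous_bdd {f : ℝ → ℝ} (hf : Continuous f) {C : ℝ} (hC : ∀ x, |f x| ≤ C)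
    (q : ℝ≥0∞) : MemLp f q mu :=
  MemLp.of_bound hf.aestronglyMeasurable C (ae_of_all _ fun x => by simpa using hC x)

lemma memLp_sf (k : ℕ) (q : ℝ≥0∞) : MemLp (sf k) q mu :=
  memLp_of_continuous_bdd (continuous_sf k) (abs_sf_le k) q
lemma memLp_cb (k : ℕ) (q : ℝ≥0∞) : MemLp (cb k) q mu :=
  memLp_of_continuous_bdd (continuous_cb k) (abs_cb_le k) q

lemma span_memLp {b : ℕ → ℝ → ℝ} {q : ℝ≥0∞} (hb : ∀ k, MemLp (b k) q mu)
    {f : ℝ → ℝ} (hf : f ∈ Submodule.span ℝ (range b)) :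
    ∃ h : MemLp f q mu, h.toLp f ∈ Submodule.span ℝ (range fun k => (hb k).toLp (b k)) := by
  induction hf using Submodule.span_induction with
  | mem f hf =>
    obtain ⟨k, rfl⟩ := hf
    exact ⟨hb k, Submodule.subset_span ⟨k, rfl⟩⟩
  | zero => exact ⟨MemLp.zero', by simp⟩
  | add f g _ _ hf hg =>
    obtain ⟨h1, h2⟩ := hf
    obtain ⟨h3, h4⟩ := hg
    exact ⟨h1.add h3, Submodule.add_mem _ h2 h4⟩
  | smul a f _ hf =>
    obtain ⟨h1, h2⟩ := hf
    exact ⟨h1.const_smul a, Submodule.smul_mem _ a h2⟩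

/-! ### Density of the two systems in L^q. -/

section Density
variable {q : ℝ≥0∞} [Fact (1 ≤ q)]

lemma norm_toLp_le_of_bound {f : ℝ → ℝ} (hf : MemLp f q mu) {C : ℝ} (hC : 0 ≤ C)
    (h : ∀ᵐ x ∂mu, |f x| ≤ C) : ‖hf.toLp f‖ ≤ C := by
  rw [Lp.norm_toLp]
  refine ENNReal.toReal_le_of_le_ofReal hC ?_
  refine (eLpNorm_le_of_ae_bound (C := C) (by simpa using h)).trans ?_
  simp

/-- Approximate `h` uniformly by P(cos πx); the product with `e` stays in the span. Accuracy ε/4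
suffices because |e| ≤ 2. -/
lemma mem_closure_span_of_continuous {b : ℕ → ℝ → ℝ} (hb : ∀ k, MemLp (b k) q mu)
    (hS : ∀ f ∈ Submodule.span ℝ (range b),
      (fun x => Real.cos (Real.pi * x) * f x) ∈ Submodule.span ℝ (range b))
    {e : ℝ → ℝ} (he : e ∈ Submodule.span ℝ (range b)) (he1 : ∀ x, |e x| ≤ 2)
    {h : ℝ → ℝ} (hh : Continuous h) (hm : MemLp (fun x => h x * e x) q mu) :
    hm.toLp _ ∈ (Submodule.span ℝ (range fun k => (hb k).toLp (b k))).topologicalClosure := by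
  rw [← SetLike.mem_coe, Submodule.topologicalClosure_coe, Metric.mem_closure_iff]
  intro ε hε
  obtain ⟨P, hP⟩ := exists_polynomial_cos_near hh (ε := ε / 4) (by positivity)
  obtain ⟨h1, h2⟩ := span_memLp hb (polynomial_cos_mul_mem hS he P)
  refine ⟨_, h2, ?_⟩
  rw [dist_eq_norm, ← MemLp.toLp_sub]
  refine (norm_toLp_le_of_bound _ (C := ε / 2) (by positivity) ?_).trans_lt (by linarith)
  refine ae_mu_of_forall fun x hx => ?_
  have := hP x (Ioo_subset_Icc_self hx)
  simp only [Pi.sub_apply]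
  rw [← sub_mul, abs_mul, abs_sub_comm]
  nlinarith [he1 x, abs_nonneg (e x), abs_nonneg (Polynomial.eval (Real.cos (Real.pi * x)) P - h x)]

lemma span_closure_eq_top_of_continuous (hq : q ≠ ⊤) {S : Submodule ℝ (Lp ℝ q mu)}
    (h : ∀ f : BoundedContinuousFunction ℝ ℝ, BoundedContinuousFunction.toLp q mu ℝ f ∈ S.topologicalClosure) :
    S.topologicalClosure = ⊤ := by
  rw [eq_top_iff]
  intro f _
  have hd := BoundedContinuousFunction.toLp_denseRange (p := q) (E := ℝ) mu ℝ hq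
  have hsub : range (BoundedContinuousFunction.toLp q mu ℝ : BoundedContinuousFunction ℝ ℝ →L[ℝ] Lp ℝ q mu)
      ⊆ S.topologicalClosure := by
    rintro _ ⟨f, rfl⟩; exact h f
  have := closure_minimal hsub S.isClosed_topologicalClosure
  exact this (hd f)

lemma span_cb_closure (hq : q ≠ ⊤) :
    (Submodule.span ℝ (range fun k => (memLp_cb k q).toLp (cb k))).topologicalClosure = ⊤ := by
  refine span_closure_eq_top_of_continuous hq fun f => ?_
  have h1 : (fun _ => (1 : ℝ)) ∈ Submodule.span ℝ (range cb) := Submodule.subset_span ⟨0, rfl⟩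
  have hm : MemLp (fun x => f x * (1 : ℝ)) q mu :=
    memLp_of_continuous_bdd (by fun_prop) (C := ‖f‖) (fun x => by
      simpa using f.norm_coe_le_norm x) q
  have := mem_closure_span_of_continuous (fun k => memLp_cb k q) (fun f hf => cos_mul_mem_span_cb hf)
    h1 (by simp) f.continuous hm
  convert this using 1
  refine Lp.ext ?_
  filter_upwards [BoundedContinuousFunction.coeFn_toLp (p := q) mu ℝ f, hm.coeFn_toLp] with x h1 h2
  rw [h1, h2, mul_one]

/-- The constant function is not a sine polynomial, so the module argument only reaches multiples of
the first sine. Since that sine is positive on (0,1), a continuous f is the L^q limit of such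
multiples. -/
lemma span_sf_closure (hq : q ≠ ⊤) :
    (Submodule.span ℝ (range fun k => (memLp_sf k q).toLp (sf k))).topologicalClosure = ⊤ := by
  refine span_closure_eq_top_of_continuous hq fun f => ?_
  have h1 : sf 0 ∈ Submodule.span ℝ (range sf) := Submodule.subset_span ⟨0, rfl⟩
  -- A regularised quotient of f by the first sine: the product equals f where n times the sine is
  -- at least 1, and is bounded by ‖f‖ everywhere on (0,1).
  set g : ℕ → ℝ → ℝ := fun n x => f x * (n / max 1 (n * sf 0 x)) with hg
  have hgc : ∀ n, Continuous (g n) := fun n => by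
    have := continuous_sf 0
    refine f.continuous.mul (continuous_const.div (by fun_prop) fun x => ?_)
    have : (1 : ℝ) ≤ max 1 (n * sf 0 x) := le_max_left _ _
    positivity
  have hpos : ∀ x ∈ Ioo (0 : ℝ) 1, 0 < sf 0 x := fun x hx => by
    have : 0 < Real.sin (ev 0 * x) := by
      apply Real.sin_pos_of_pos_of_lt_pi
      · exact mul_pos (ev_pos 0) hx.1
      · simp only [ev]; norm_num
        nlinarith [hx.2, Real.pi_pos]
    unfold sf; positivity
  have hle : ∀ n, ∀ x ∈ Ioo (0 : ℝ) 1, |g n x * sf 0 x| ≤ ‖f‖ := fun n x hx => by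
    have h1 := hpos x hx
    have : 0 < max 1 (n * sf 0 x) := lt_of_lt_of_le one_pos (le_max_left _ _)
    have h2 : n / max 1 (n * sf 0 x) * sf 0 x ≤ 1 := by
      rw [div_mul_eq_mul_div, div_le_one this]; exact le_max_right _ _
    simp only [hg]
    rw [mul_assoc, abs_mul, abs_of_nonneg (a := _ * sf 0 x) (by positivity)]
    have := f.norm_coe_le_norm x
    rw [Real.norm_eq_abs] at this
    nlinarith [abs_nonneg (f x), norm_nonneg f]
  have hm : ∀ n, MemLp (fun x => g n x * sf 0 x) q mu := fun n =>
    MemLp.of_bound ((hgc n).mul (continuous_sf 0)).aestronglyMeasurable ‖f‖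
      (ae_mu_of_forall fun x hx => hle n x hx)
  have hmem := fun n => mem_closure_span_of_continuous (fun k => memLp_sf k q)
    (fun f hf => cos_mul_mem_span_sf hf) h1 (abs_sf_le 0) (hgc n) (hm n)
  refine (Submodule.isClosed_topologicalClosure _).mem_of_tendsto (b := atTop)
    (f := fun n => (hm n).toLp _) ?_ (Eventually.of_forall hmem)
  have hfm : MemLp f q mu := memLp_of_continuous_bdd f.continuous (C := ‖f‖)
    (fun x => by simpa using f.norm_coe_le_norm x) q
  have e : BoundedContinuousFunction.toLp q mu ℝ f = hfm.toLp f := by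
    refine Lp.ext ?_
    filter_upwards [BoundedContinuousFunction.coeFn_toLp (p := q) mu ℝ f, hfm.coeFn_toLp] with x h1 h2
    rw [h1, h2]
  rw [e, Lp.tendsto_Lp_iff_tendsto_eLpNorm'' _ hm _ hfm]
  refine tendsto_Lp_finite_of_tendsto_ae Fact.out hq (fun n => (hm n).1) hfm ?_ ?_
  -- All functions are bounded by ‖f‖ on (0,1), so their parts above the level ‖f‖ + 1 vanish.
  · refine unifIntegrable_of' Fact.out hq (fun n => ((hgc n).mul (continuous_sf 0)).stronglyMeasurable) ?_
    intro ε hε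
    refine ⟨⟨‖f‖ + 1, by positivity⟩, by
      change (0 : ℝ) < ‖f‖ + 1; positivity, fun n => ?_⟩
    rw [eLpNorm_congr_ae (g := 0)]
    · simp
    · refine ae_mu_of_forall fun x hx => ?_
      rw [indicator_of_notMem]
      · rfl
      · intro hmem
        have h1 : ‖f‖ + 1 ≤ ‖g n x * sf 0 x‖ := hmem
        have := hle n x hx
        rw [Real.norm_eq_abs] at h1; linarith
  · refine ae_mu_of_forall fun x hx => ?_
    have h1 := hpos x hx
    obtain ⟨N, hN⟩ := exists_nat_gt (1 / sf 0 x)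
    refine tendsto_const_nhds.congr' ?_
    filter_upwards [eventually_ge_atTop (max N 1)] with n hn
    have h2 : (1 : ℝ) ≤ n * sf 0 x := by
      have : (N : ℝ) ≤ n := by exact_mod_cast (le_max_left _ _).trans hn
      rw [div_lt_iff₀ h1] at hN
      nlinarith
    have h3 : (0 : ℝ) < n := by exact_mod_cast lt_of_lt_of_le one_pos ((le_max_right _ _).trans hn)
    simp only [hg]
    rw [max_eq_right h2]; field_simp

end Density

end GBH

/-! ### Spectral series and bounds for the heat kernel. -/

noncomputable section
namespace GBH

/-- The squared frequency. -/
def lam (k : ℕ) : ℝ := ev k ^ 2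

lemma lam_pos (k : ℕ) : 0 < lam k := pow_pos (ev_pos k) 2

lemma hasSum_of_eq {ι : Type*} {f g : ι → ℝ} {a b : ℝ} (h : HasSum f a) (hf : ∀ k, g k = f k)
    (hb : b = a) : HasSum g b := by
  rw [hb, show g = f from funext hf]; exact h

/-- The `2`-periodic heat kernel. -/
def theta (t z : ℝ) : ℝ := 1 / 2 * HurwitzZeta.cosKernel ((z / 2 : ℝ) : UnitAddCircle) (Real.pi * t)

/-- Poisson summation, in the form of the functional equation exchanging the even kernel and the
cosine kernel, turns the cosine series at time t into Gaussians centred at the even integers. -/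
lemma hasSum_theta_images {t : ℝ} (ht : 0 < t) (z : ℝ) :
    HasSum (fun n : ℤ => Real.exp (-(z - 2 * n) ^ 2 / (4 * t)))
      (Real.sqrt (4 * Real.pi * t) * theta t z) := by
  have hpt : 0 < Real.pi * t := mul_pos Real.pi_pos ht
  have h := HurwitzZeta.hasSum_int_evenKernel (-(z / 2)) (t := 1 / (Real.pi * t)) (by positivity)
  have e : HurwitzZeta.evenKernel ((-(z / 2) : ℝ) : UnitAddCircle) (1 / (Real.pi * t))
      = Real.sqrt (4 * Real.pi * t) * theta t z := by
    rw [HurwitzZeta.evenKernel_functional_equation, one_div_one_div, theta, AddCircle.coe_neg,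
      HurwitzZeta.cosKernel_neg, ← mul_assoc]
    congr 1
    rw [one_div (Real.pi * t), Real.inv_rpow hpt.le, one_div, inv_inv, ← Real.sqrt_eq_rpow, mul_assoc 4,
      show (4 : ℝ) * (Real.pi * t) = 2 ^ 2 * (Real.pi * t) by norm_num,
      Real.sqrt_mul (by norm_num) (Real.pi * t), Real.sqrt_sq (by norm_num)]
    ring
  rw [e] at h
  convert h using 2 with n
  congr 1
  have := Real.pi_ne_zero
  field_simp
  ring

lemma theta_nonneg {t : ℝ} (ht : 0 < t) (z : ℝ) : 0 ≤ theta t z := by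
  have h : 0 ≤ Real.sqrt (4 * Real.pi * t) * theta t z :=
    (hasSum_theta_images ht z).nonneg (fun n => (Real.exp_pos _).le)
  have : 0 < Real.sqrt (4 * Real.pi * t) := Real.sqrt_pos.2 (by positivity)
  exact nonneg_of_mul_nonneg_right h this

lemma hasSum_theta {t : ℝ} (ht : 0 < t) (z : ℝ) :
    HasSum (fun k : ℕ => Real.exp (-(lam k * t)) * Real.cos (ev k * z)) (theta t z - 1 / 2) := by
  have := (HurwitzZeta.hasSum_nat_cosKernel₀ (z / 2) (t := Real.pi * t) (by positivity)).mul_left (1 / 2)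
  refine hasSum_of_eq this (fun k => ?_) ?_
  · unfold lam ev
    rw [show 2 * Real.pi * (z / 2) * ((k : ℝ) + 1) = (k + 1) * Real.pi * z by ring,
      show -Real.pi * ((k : ℝ) + 1) ^ 2 * (Real.pi * t) = -(((k + 1) * Real.pi) ^ 2 * t) by ring]
    ring
  · unfold theta; ring

lemma G_eq_theta {t : ℝ} (ht : 0 < t) (x y : ℝ) : G t x y = theta t (y - x) - theta t (y + x) := by
  have h := (hasSum_theta_images ht (y - x)).sub (hasSum_theta_images ht (y + x))
  unfold G
  rw [h.tsum_eq]
  have : Real.sqrt (4 * Real.pi * t) ≠ 0 := (Real.sqrt_pos.2 (by positivity)).ne'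
  field_simp

lemma sf_mul_sf' (k : ℕ) (x y : ℝ) :
    sf k x * sf k y = Real.cos (ev k * (y - x)) - Real.cos (ev k * (y + x)) := by
  unfold sf
  rw [mul_sub, mul_add, Real.cos_sub, Real.cos_add]
  have h2 : Real.sqrt 2 * Real.sqrt 2 = 2 := Real.mul_self_sqrt (by norm_num)
  linear_combination (Real.sin (ev k * x) * Real.sin (ev k * y)) * h2

lemma cf_mul_cf' (k : ℕ) (x y : ℝ) :
    cf k x * cf k y = Real.cos (ev k * (y - x)) + Real.cos (ev k * (y + x)) := by
  unfold cf
  rw [mul_sub, mul_add, Real.cos_sub, Real.cos_add]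
  have h2 : Real.sqrt 2 * Real.sqrt 2 = 2 := Real.mul_self_sqrt (by norm_num)
  linear_combination (Real.cos (ev k * x) * Real.cos (ev k * y)) * h2

lemma hasSum_G {t : ℝ} (ht : 0 < t) (x y : ℝ) :
    HasSum (fun k => Real.exp (-(lam k * t)) * sf k x * sf k y) (G t x y) := by
  rw [G_eq_theta ht]
  refine hasSum_of_eq ((hasSum_theta ht (y - x)).sub (hasSum_theta ht (y + x))) (fun k => ?_) ?_
  · rw [mul_assoc, sf_mul_sf']; ring
  · ring

lemma hasSum_neumann {t : ℝ} (ht : 0 < t) (x y : ℝ) :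
    HasSum (fun k => Real.exp (-(lam k * t)) * cf k x * cf k y)
      (theta t (y - x) + theta t (y + x) - 1) := by
  refine hasSum_of_eq ((hasSum_theta ht (y - x)).add (hasSum_theta ht (y + x))) (fun k => ?_) ?_
  · rw [mul_assoc, cf_mul_cf']; ring
  · ring

/-- The constant `∑ ev k ^ (-5/4)`. -/
def Zc : ℝ := ∑' k, ev k ^ (-(5 / 4 : ℝ))

lemma summable_ev_rpow : Summable fun k => ev k ^ (-(5 / 4 : ℝ)) := by
  have h := (summable_nat_add_iff 1).2 (Real.summable_nat_rpow.2 (show (-(5 / 4 : ℝ)) < -1 by norm_num))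
  have := h.mul_right (Real.pi ^ (-(5 / 4 : ℝ)))
  refine this.congr fun k => ?_
  unfold ev
  rw [Real.mul_rpow (by positivity) Real.pi_pos.le]
  push_cast; rfl

lemma Zc_nonneg : 0 ≤ Zc := tsum_nonneg fun k => Real.rpow_nonneg (ev_pos k).le _

/-- For exponents at most 2, s^a ≤ 1 + s² ≤ 2(1 + s + s²/2) ≤ 2e^s. -/
lemma exp_neg_le_rpow {s a : ℝ} (hs : 0 < s) (ha : 0 ≤ a) (ha2 : a ≤ 2) :
    Real.exp (-s) ≤ 2 * s ^ (-a) := by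
  rw [Real.exp_neg, Real.rpow_neg hs.le]
  have h1 : s ^ a ≤ 1 + s ^ 2 := by
    rcases le_total s 1 with h | h
    · have := Real.rpow_le_one hs.le h ha
      nlinarith
    · have := Real.rpow_le_rpow_of_exponent_le h ha2
      rw [Real.rpow_two] at this
      linarith
  have h2 := Real.quadratic_le_exp_of_nonneg hs.le
  have h3 : 0 < s ^ a := Real.rpow_pos_of_pos hs a
  rw [inv_le_iff_one_le_mul₀ (Real.exp_pos s)]
  rw [mul_assoc, mul_comm, mul_assoc, ← div_eq_inv_mul, le_div_iff₀ h3]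
  nlinarith

/-- Weighted heat multipliers are summable, with an explicit rate. -/
lemma exp_mul_ev_pow_le {t : ℝ} (ht : 0 < t) {n : ℕ} (hn : n ≤ 2) (k : ℕ) :
    Real.exp (-(lam k * t)) * ev k ^ n ≤
      2 * t ^ (-((5 / 4 + n) / 2 : ℝ)) * ev k ^ (-(5 / 4 : ℝ)) := by
  have he := ev_pos k
  have hn' : (n : ℝ) ≤ 2 := by exact_mod_cast hn
  -- The exponent is chosen to leave exactly the summable power -5/4 of the frequency. For n = 0, 1,
  -- 2 the time exponents become 5/8, 9/8 and 13/8.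
  have h := exp_neg_le_rpow (s := lam k * t) (mul_pos (lam_pos k) ht)
    (a := (5 / 4 + n) / 2) (by positivity) (by linarith)
  rw [Real.mul_rpow (lam_pos k).le ht.le,
    show lam k ^ (-((5 / 4 + n) / 2 : ℝ)) = ev k ^ (((2 : ℕ) : ℝ) * -((5 / 4 + n) / 2)) by
      rw [lam, ← Real.rpow_natCast (ev k) 2, ← Real.rpow_mul he.le]] at h
  calc Real.exp (-(lam k * t)) * ev k ^ n
      ≤ (2 * (ev k ^ (((2 : ℕ) : ℝ) * -((5 / 4 + n) / 2)) * t ^ (-((5 / 4 + n) / 2 : ℝ)))) * ev k ^ n := by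
        gcongr
    _ = _ := by
        rw [← Real.rpow_natCast (ev k) n]
        have : ev k ^ (-(5 / 4 : ℝ)) = ev k ^ (((2 : ℕ) : ℝ) * -((5 / 4 + n) / 2)) * ev k ^ (n : ℝ) := by
          rw [← Real.rpow_add he]; congr 1; push_cast; ring
        rw [this]; ring

lemma summable_exp_mul_ev_pow {t : ℝ} (ht : 0 < t) {n : ℕ} (hn : n ≤ 2) :
    Summable fun k => Real.exp (-(lam k * t)) * ev k ^ n :=
  Summable.of_nonneg_of_le (fun k => mul_nonneg (Real.exp_pos _).le (pow_nonneg (ev_pos k).le _))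
    (exp_mul_ev_pow_le ht hn) (summable_ev_rpow.mul_left _)

lemma tsum_exp_mul_ev_pow_le {t : ℝ} (ht : 0 < t) {n : ℕ} (hn : n ≤ 2) :
    ∑' k, Real.exp (-(lam k * t)) * ev k ^ n ≤ 2 * t ^ (-((5 / 4 + n) / 2 : ℝ)) * Zc := by
  refine ((summable_exp_mul_ev_pow ht hn).tsum_le_tsum (exp_mul_ev_pow_le ht hn)
    (summable_ev_rpow.mul_left _)).trans_eq ?_
  rw [tsum_mul_left, Zc]

/-- Termwise differentiation is justified by the majorant 4 e^{-λt} ev, uniform in the space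
variable. -/
lemma hasSum_dG {t : ℝ} (ht : 0 < t) (x y : ℝ) :
    HasSum (fun k => Real.exp (-(lam k * t)) * ev k * sf k x * cf k y) (dG t x y) := by
  have hs := summable_exp_mul_ev_pow ht (n := 1) (by norm_num)
  have hb : ∀ k z, ‖Real.exp (-(lam k * t)) * ev k * sf k x * cf k z‖ ≤
      4 * (Real.exp (-(lam k * t)) * ev k ^ 1) := fun k z => by
    have h1 := abs_sf_le k x
    have h2 := abs_cf_le k z
    have h3 := ev_pos k
    have h4 := Real.exp_pos (-(lam k * t))
    rw [Real.norm_eq_abs, abs_mul, abs_mul, abs_of_pos (mul_pos h4 h3), mul_assoc]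
    have : |sf k x| * |cf k z| ≤ 4 := by nlinarith [abs_nonneg (sf k x), abs_nonneg (cf k z)]
    have : 0 < Real.exp (-(lam k * t)) * ev k := by positivity
    rw [pow_one]; nlinarith
  have h := hasDerivAt_tsum (hs.mul_left 4)
    (g := fun k z => Real.exp (-(lam k * t)) * sf k x * sf k z)
    (g' := fun k z => Real.exp (-(lam k * t)) * ev k * sf k x * cf k z)
    (fun k z => ((hasDerivAt_sf k z).const_mul _).congr_deriv (by ring)) hb
    (hasSum_G ht x 0).summable y
  have e : (fun z => ∑' k, Real.exp (-(lam k * t)) * sf k x * sf k z) = fun z => G t x z := by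
    funext z; exact (hasSum_G ht x z).tsum_eq
  rw [e] at h
  rw [dG, h.deriv]
  exact (Summable.of_norm_bounded (hs.mul_left 4) (fun k => hb k y)).hasSum

/-- Termwise integration of an absolutely convergent series against an integrable function. -/
lemma hasSum_integral_series_mul {a : ℕ → ℝ} (ha : Summable fun k => |a k|) {b : ℕ → ℝ → ℝ}
    (hb : ∀ k, Continuous (b k)) (hb2 : ∀ k x, |b k x| ≤ 2) {S : ℝ → ℝ}
    (hS : ∀ x, HasSum (fun k => a k * b k x) (S x)) {h : ℝ → ℝ} (hh : Integrable h mu) :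
    HasSum (fun k => a k * ∫ x, b k x * h x ∂mu) (∫ x, S x * h x ∂mu) := by
  have hi : ∀ k, Integrable (fun x => b k x * h x) mu := fun k =>
    hh.bdd_mul (hb k).aestronglyMeasurable (ae_of_all _ fun x => by simpa using hb2 k x)
  have key := hasSum_integral_of_summable_integral_norm (μ := mu)
    (F := fun k x => a k * (b k x * h x)) (fun k => (hi k).const_mul _) ?_
  · simp_rw [integral_const_mul] at key
    refine hasSum_of_eq key (fun k => rfl) ?_
    refine integral_congr_ae (ae_of_all _ fun x => ?_)
    have := (hS x).mul_right (h x)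
    simp only [← mul_assoc]
    exact this.tsum_eq.symm
  · refine Summable.of_nonneg_of_le (fun k => integral_nonneg fun x => norm_nonneg _) (fun k => ?_)
      (ha.mul_right (2 * ∫ x, |h x| ∂mu))
    rw [← integral_const_mul, ← integral_const_mul]
    refine integral_mono ((hi k).const_mul _).norm ((hh.abs.const_mul _).const_mul _) fun x => ?_
    simp only [norm_mul, Real.norm_eq_abs]
    gcongr
    exact hb2 k x

lemma continuous_G {t : ℝ} (ht : 0 < t) (x : ℝ) : Continuous fun y => G t x y := by
  have hs := summable_exp_mul_ev_pow ht (n := 0) (by norm_num)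
  have e : (fun y => G t x y) = fun y => ∑' k, Real.exp (-(lam k * t)) * sf k x * sf k y := by
    funext y; exact (hasSum_G ht x y).tsum_eq.symm
  rw [e]
  refine continuous_tsum (fun k => by have := continuous_sf k; fun_prop) (hs.mul_left 4) fun k y => ?_
  have h1 := abs_sf_le k x
  have h2 := abs_sf_le k y
  rw [Real.norm_eq_abs, abs_mul, abs_mul, Real.abs_exp, mul_assoc, pow_zero, mul_one, mul_comm]
  gcongr
  nlinarith [abs_nonneg (sf k x), abs_nonneg (sf k y)]

lemma continuous_dG {t : ℝ} (ht : 0 < t) (x : ℝ) : Continuous fun y => dG t x y := by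
  have hs := summable_exp_mul_ev_pow ht (n := 1) (by norm_num)
  have e : (fun y => dG t x y) = fun y => ∑' k, Real.exp (-(lam k * t)) * ev k * sf k x * cf k y := by
    funext y; exact (hasSum_dG ht x y).tsum_eq.symm
  rw [e]
  refine continuous_tsum (fun k => by have := continuous_cf k; fun_prop) (hs.mul_left 4) fun k y => ?_
  have h1 := abs_sf_le k x
  have h2 := abs_cf_le k y
  have h3 := ev_pos k
  rw [Real.norm_eq_abs, abs_mul, abs_mul, abs_mul, Real.abs_exp, abs_of_pos h3, mul_assoc, pow_one, mul_comm]
  gcongr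
  nlinarith [abs_nonneg (sf k x), abs_nonneg (cf k y)]

lemma abs_G_le {t : ℝ} (ht : 0 < t) (x y : ℝ) : |G t x y| ≤ 8 * Zc * t ^ (-(5 / 8 : ℝ)) := by
  have hs := summable_exp_mul_ev_pow ht (n := 0) (by norm_num)
  have hb : ∀ k, ‖Real.exp (-(lam k * t)) * sf k x * sf k y‖ ≤
      4 * (Real.exp (-(lam k * t)) * ev k ^ 0) := fun k => by
    have h1 := abs_sf_le k x
    have h2 := abs_sf_le k y
    rw [Real.norm_eq_abs, abs_mul, abs_mul, Real.abs_exp, mul_assoc, pow_zero, mul_one, mul_comm]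
    gcongr
    nlinarith [abs_nonneg (sf k x), abs_nonneg (sf k y)]
  rw [← (hasSum_G ht x y).tsum_eq]
  refine (tsum_of_norm_bounded (hs.mul_left 4).hasSum hb).trans ?_
  rw [tsum_mul_left]
  have := tsum_exp_mul_ev_pow_le ht (n := 0) (by norm_num)
  norm_num at this ⊢
  linarith

lemma abs_dG_le {t : ℝ} (ht : 0 < t) (x y : ℝ) : |dG t x y| ≤ 8 * Zc * t ^ (-(9 / 8 : ℝ)) := by
  have hs := summable_exp_mul_ev_pow ht (n := 1) (by norm_num)
  have hb : ∀ k, ‖Real.exp (-(lam k * t)) * ev k * sf k x * cf k y‖ ≤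
      4 * (Real.exp (-(lam k * t)) * ev k ^ 1) := fun k => by
    have h1 := abs_sf_le k x
    have h2 := abs_cf_le k y
    have h3 := ev_pos k
    rw [Real.norm_eq_abs, abs_mul, abs_mul, abs_mul, Real.abs_exp, abs_of_pos h3, mul_assoc, pow_one, mul_comm]
    gcongr
    nlinarith [abs_nonneg (sf k x), abs_nonneg (cf k y)]
  rw [← (hasSum_dG ht x y).tsum_eq]
  refine (tsum_of_norm_bounded (hs.mul_left 4).hasSum hb).trans ?_
  rw [tsum_mul_left]
  have := tsum_exp_mul_ev_pow_le ht (n := 1) (by norm_num)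
  norm_num at this ⊢
  linarith

/-- Parseval for the cosines expresses the integral as the sum of the squared coefficients. One of
the two factors e^{-λt} is dropped, which leaves the weighted series with n = 2. -/
lemma integral_dG_sq_le {t : ℝ} (ht : 0 < t) (x : ℝ) :
    ∫ y, dG t x y * dG t x y ∂mu ≤ 8 * Zc * t ^ (-(13 / 8 : ℝ)) := by
  have hs := summable_exp_mul_ev_pow ht (n := 1) (by norm_num)
  have hs2 := summable_exp_mul_ev_pow ht (n := 2) (by norm_num)
  set a : ℕ → ℝ := fun k => Real.exp (-(lam k * t)) * ev k * sf k x with ha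
  have hab : ∀ k, |a k| ≤ 2 * (Real.exp (-(lam k * t)) * ev k ^ 1) := fun k => by
    have h1 := abs_sf_le k x
    have h3 := ev_pos k
    simp only [ha]
    rw [abs_mul, abs_mul, Real.abs_exp, abs_of_pos h3, pow_one, mul_comm]
    gcongr
  have hsa : Summable fun k => |a k| :=
    Summable.of_nonneg_of_le (fun k => abs_nonneg _) hab (hs.mul_left 2)
  have hcont := continuous_dG ht x
  have h1 := hasSum_integral_series_mul hsa continuous_cf abs_cf_le (fun y => hasSum_dG ht x y)
    (integrable_mu_of_continuous hcont)
  have h2 : ∀ k, ∫ y, cf k y * dG t x y ∂mu = a k := fun k => by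
    have h3 := hasSum_integral_series_mul hsa continuous_cf abs_cf_le (fun y => hasSum_dG ht x y)
      (integrable_mu_of_continuous (continuous_cf k))
    simp_rw [integral_cf_mul_cf] at h3
    have h4 := h3.unique (hasSum_single k (fun j hj => by simp [hj]))
    simp only [if_true, mul_one] at h4
    rw [← h4]
    simp_rw [mul_comm]
  simp_rw [h2] at h1
  have hle : ∀ k, a k * a k ≤ 4 * (Real.exp (-(lam k * t)) * ev k ^ 2) := fun k => by
    have h1 := abs_sf_le k x
    have h3 := ev_pos k
    have h4 : Real.exp (-(lam k * t)) ≤ 1 := by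
      rw [Real.exp_le_one_iff]; have := mul_pos (lam_pos k) ht; linarith
    have h5 := Real.exp_pos (-(lam k * t))
    have h6 : sf k x ^ 2 ≤ 4 := by
      have := abs_le.1 h1; nlinarith
    have : a k * a k = Real.exp (-(lam k * t)) * (Real.exp (-(lam k * t)) * (ev k ^ 2 * sf k x ^ 2)) := by
      simp only [ha]; ring
    rw [this]
    calc _ ≤ Real.exp (-(lam k * t)) * (1 * (ev k ^ 2 * 4)) := by gcongr
      _ = _ := by ring
  refine (hasSum_le hle h1 (hs2.mul_left 4).hasSum).trans ?_
  rw [tsum_mul_left]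
  have := tsum_exp_mul_ev_pow_le ht (n := 2) (by norm_num)
  norm_num at this ⊢
  linarith

/-- Both image sums are nonnegative, so their difference is dominated in absolute value by their
sum, the Neumann kernel. The latter has mass 1 because every nonconstant cosine has mean zero. -/
lemma integral_abs_G_le {t : ℝ} (ht : 0 < t) (x : ℝ) : ∫ y, |G t x y| ∂mu ≤ 1 := by
  have hs := summable_exp_mul_ev_pow ht (n := 0) (by norm_num)
  set a : ℕ → ℝ := fun k => Real.exp (-(lam k * t)) * cf k x with ha
  have hab : ∀ k, |a k| ≤ 2 * (Real.exp (-(lam k * t)) * ev k ^ 0) := fun k => by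
    have h1 := abs_cf_le k x
    simp only [ha]
    rw [abs_mul, Real.abs_exp, pow_zero, mul_comm, mul_one]
    gcongr
  have hsa : Summable fun k => |a k| :=
    Summable.of_nonneg_of_le (fun k => abs_nonneg _) hab (hs.mul_left 2)
  have h1 := hasSum_integral_series_mul hsa continuous_cf abs_cf_le
    (fun y => hasSum_neumann ht x y) (integrable_const 1)
  simp only [mul_one, integral_cf, mul_zero] at h1
  have h2 := h1.unique hasSum_zero
  have hc : Continuous fun y => theta t (y - x) + theta t (y + x) - 1 := by
    have e : (fun y => theta t (y - x) + theta t (y + x) - 1) = fun y => ∑' k, a k * cf k y := by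
      funext y; exact (hasSum_neumann ht x y).tsum_eq.symm
    rw [e]
    refine continuous_tsum (fun k => by have := continuous_cf k; fun_prop) (hsa.mul_left 2) fun k y => ?_
    rw [Real.norm_eq_abs, abs_mul, mul_comm]
    gcongr
    exact abs_cf_le k y
  calc ∫ y, |G t x y| ∂mu ≤ ∫ y, ((theta t (y - x) + theta t (y + x) - 1) + 1) ∂mu := by
        refine integral_mono (integrable_mu_of_continuous (continuous_G ht x).abs)
          (integrable_mu_of_continuous (hc.add continuous_const)) fun y => ?_
        simp only [G_eq_theta ht]
        have h1 := theta_nonneg ht (y - x)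
        have h2 := theta_nonneg ht (y + x)
        rw [abs_le]; constructor <;> linarith
    _ = 1 := by
        rw [integral_add (integrable_mu_of_continuous hc) (integrable_const 1), h2]
        simp

lemma G_symm {t : ℝ} (ht : 0 < t) (x y : ℝ) : G t x y = G t y x := by
  refine (hasSum_G ht x y).unique ?_
  exact hasSum_of_eq (hasSum_G ht y x) (fun k => by ring) rfl

end GBH

/-! ### Heat operators from L^q to bounded continuous functions. -/

noncomputable section
namespace GBH

/-- The Banach space of bounded continuous functions on the line. -/
def X := BoundedContinuousFunction ℝ ℝ

namespace X

instance : NormedAddCommGroup X := inferInstanceAs (NormedAddCommGroup (BoundedContinuousFunction ℝ ℝ))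
instance : NormedSpace ℝ X := inferInstanceAs (NormedSpace ℝ (BoundedContinuousFunction ℝ ℝ))
instance : CompleteSpace X := inferInstanceAs (CompleteSpace (BoundedContinuousFunction ℝ ℝ))
instance : FunLike X ℝ ℝ := inferInstanceAs (FunLike (BoundedContinuousFunction ℝ ℝ) ℝ ℝ)

/-- A bounded continuous function as an element of `X`. -/
def mk (f : ℝ → ℝ) (hf : Continuous f) (C : ℝ) (hC : ∀ x, |f x| ≤ C) : X :=
  BoundedContinuousFunction.ofNormedAddCommGroup f hf C hC

lemma continuous (h : X) : Continuous h := BoundedContinuousFunction.continuous h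

lemma abs_apply_le (h : X) (x : ℝ) : |h x| ≤ ‖h‖ := BoundedContinuousFunction.norm_coe_le_norm h x

lemma norm_le {h : X} {C : ℝ} (hC : 0 ≤ C) : ‖h‖ ≤ C ↔ ∀ x, |h x| ≤ C :=
  BoundedContinuousFunction.norm_le hC

@[simp] lemma add_apply (f g : X) (x : ℝ) : (f + g) x = f x + g x := rfl
@[simp] lemma sub_apply (f g : X) (x : ℝ) : (f - g) x = f x - g x := rfl
@[simp] lemma smul_apply (c : ℝ) (f : X) (x : ℝ) : (c • f) x = c * f x := rfl
@[simp] lemma zero_apply (x : ℝ) : (0 : X) x = 0 := rfl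

/-- Evaluation at a point. -/
def eval (x : ℝ) : X →L[ℝ] ℝ :=
  LinearMap.mkContinuous
    { toFun := fun f => f x, map_add' := fun _ _ => rfl, map_smul' := fun _ _ => rfl } 1
    fun f => by rw [one_mul]; exact f.abs_apply_le x

@[simp] lemma eval_apply (x : ℝ) (f : X) : eval x f = f x := rfl

end X

/-- The inclusion of bounded continuous functions into `L^q(0,1)`. -/
def toE (q : ℝ≥0∞) [Fact (1 ≤ q)] : X →L[ℝ] Lp ℝ q mu :=
  LinearMap.mkContinuous
    { toFun := fun f => (memLp_of_continuous_bdd f.continuous f.abs_apply_le q).toLp f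
      map_add' := fun _ _ => rfl
      map_smul' := fun _ _ => rfl } 1
    fun f => by
      rw [one_mul]
      exact norm_toLp_le_of_bound (memLp_of_continuous_bdd f.continuous f.abs_apply_le q)
        (norm_nonneg _) (ae_of_all _ f.abs_apply_le)

lemma coeFn_toE (q : ℝ≥0∞) [Fact (1 ≤ q)] (f : X) : toE q f =ᵐ[mu] f :=
  (memLp_of_continuous_bdd f.continuous f.abs_apply_le q).coeFn_toLp

lemma norm_toE_apply_le (q : ℝ≥0∞) [Fact (1 ≤ q)] (f : X) : ‖toE q f‖ ≤ ‖f‖ :=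
  norm_toLp_le_of_bound (memLp_of_continuous_bdd f.continuous f.abs_apply_le q)
    (norm_nonneg _) (ae_of_all _ f.abs_apply_le)

/-- The sine function as a bounded continuous function. -/
def sX (k : ℕ) : X := X.mk (sf k) (continuous_sf k) 2 (abs_sf_le k)
/-- The cosine function as a bounded continuous function. -/
def cX (k : ℕ) : X := X.mk (cf k) (continuous_cf k) 2 (abs_cf_le k)

@[simp] lemma sX_apply (k : ℕ) (x : ℝ) : sX k x = sf k x := rfl
@[simp] lemma cX_apply (k : ℕ) (x : ℝ) : cX k x = cf k x := rfl
lemma norm_sX_le (k : ℕ) : ‖sX k‖ ≤ 2 := (X.norm_le (by norm_num)).2 (abs_sf_le k)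
lemma norm_cX_le (k : ℕ) : ‖cX k‖ ≤ 2 := (X.norm_le (by norm_num)).2 (abs_cf_le k)

lemma eLpNorm_mono_exponent {f : ℝ → ℝ} {q r : ℝ≥0∞} (h : q ≤ r) (hf : AEStronglyMeasurable f mu) :
    eLpNorm f q mu ≤ eLpNorm f r mu :=
  eLpNorm_le_eLpNorm_of_exponent_le h hf

lemma summable_smul_of_norm_le {Z : Type*} [NormedAddCommGroup Z] [NormedSpace ℝ Z] {c : ℕ → ℝ}
    (hc : Summable fun k => |c k|) {A : ℕ → Z →L[ℝ] X} (hA : ∀ k, ‖A k‖ ≤ 4) :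
    Summable fun k => c k • A k := by
  refine Summable.of_norm_bounded (g := fun k => |c k| * 4) (hc.mul_right 4) fun k => ?_
  rw [norm_smul, Real.norm_eq_abs]
  exact mul_le_mul_of_nonneg_left (hA k) (abs_nonneg _)

/-- Near t the series converges uniformly in operator norm: on (t/2, ∞) each term is dominated by
its size at t/2. -/
lemma continuousOn_tsum_exp_smul {Z : Type*} [NormedAddCommGroup Z] [NormedSpace ℝ Z]
    {n : ℕ} (hn : n ≤ 2) {A : ℕ → Z →L[ℝ] X} (hA : ∀ k, ‖A k‖ ≤ 4) :
    ContinuousOn (fun t => ∑' k, (Real.exp (-(lam k * t)) * ev k ^ n) • A k) (Ioi 0) := by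
  refine continuousOn_of_forall_continuousAt fun t ht => ?_
  have ht2 : 0 < t / 2 := half_pos ht
  suffices h : ContinuousOn (fun t => ∑' k, (Real.exp (-(lam k * t)) * ev k ^ n) • A k) (Ioi (t / 2)) from
    h.continuousAt (Ioi_mem_nhds (a := t / 2) (b := t) (half_lt_self ht))
  refine continuousOn_tsum (u := fun k => 4 * (Real.exp (-(lam k * (t / 2))) * ev k ^ n))
    (fun k => by fun_prop) ((summable_exp_mul_ev_pow ht2 hn).mul_left 4) (fun k s hs => ?_)
  have h3 := ev_pos k
  rw [norm_smul, Real.norm_eq_abs, abs_of_nonneg (by positivity), mul_comm]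
  have hs' : t / 2 < s := hs
  have h4 := lam_pos k
  gcongr
  exact hA k

section
variable {q : ℝ≥0∞} [hq1 : Fact (1 ≤ q)]

lemma integrable_Lp (f : Lp ℝ q mu) : Integrable f mu :=
  memLp_one_iff_integrable.1 ((Lp.memLp f).mono_exponent hq1.out)

lemma integral_abs_le_norm (f : Lp ℝ q mu) : ∫ x, |f x| ∂mu ≤ ‖f‖ := by
  have h := eLpNorm_mono_exponent hq1.out (Lp.memLp f).1
  rw [Lp.norm_def]
  have h2 : ∫ x, |f x| ∂mu = (eLpNorm f 1 mu).toReal := by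
    rw [eLpNorm_one_eq_lintegral_enorm, integral_eq_lintegral_of_nonneg_ae
      (ae_of_all _ fun x => abs_nonneg _) (Lp.memLp f).1.norm]
    congr 1
    refine lintegral_congr fun x => ?_
    rw [← Real.norm_eq_abs, ofReal_norm]
  rw [h2]
  exact ENNReal.toReal_mono (Lp.memLp f).2.ne h

lemma abs_integral_mul_le_of_bound {b f : ℝ → ℝ} {C : ℝ} (hC : ∀ x, |b x| ≤ C)
    (hf : Integrable f mu) : |∫ x, b x * f x ∂mu| ≤ C * ∫ x, |f x| ∂mu := by
  rw [← integral_const_mul]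
  rw [← Real.norm_eq_abs]
  refine norm_integral_le_of_norm_le (f := fun x => b x * f x) (hf.abs.const_mul C)
    (ae_of_all _ fun x => ?_)
  rw [Real.norm_eq_abs, abs_mul]
  exact mul_le_mul_of_nonneg_right (hC x) (abs_nonneg _)

variable (q) in
/-- Pairing with a bounded continuous function, as a functional on `L^q`. -/
def pairL (b : X) : Lp ℝ q mu →L[ℝ] ℝ :=
  LinearMap.mkContinuous
    { toFun := fun f => ∫ x, b x * f x ∂mu
      map_add' := fun f g => by
        have hi : ∀ f : Lp ℝ q mu, Integrable (fun x => b x * f x) mu := fun f =>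
          (integrable_Lp f).bdd_mul b.continuous.aestronglyMeasurable
            (ae_of_all _ fun x => by simpa using b.abs_apply_le x)
        rw [← integral_add (hi f) (hi g)]
        refine integral_congr_ae ?_
        filter_upwards [Lp.coeFn_add f g] with x hx
        rw [hx, Pi.add_apply]; ring
      map_smul' := fun c f => by
        rw [RingHom.id_apply, smul_eq_mul, ← integral_const_mul]
        refine integral_congr_ae ?_
        filter_upwards [Lp.coeFn_smul c f] with x hx
        rw [hx, Pi.smul_apply, smul_eq_mul]; ring }
    ‖b‖ (fun f => by
      refine (abs_integral_mul_le_of_bound b.abs_apply_le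
        (integrable_Lp f)).trans ?_
      exact mul_le_mul_of_nonneg_left (integral_abs_le_norm f) (norm_nonneg _))

@[simp] lemma pairL_apply (b : X) (f : Lp ℝ q mu) : pairL q b f = ∫ x, b x * f x ∂mu := rfl

lemma norm_pairL_le (b : X) : ‖pairL q b‖ ≤ ‖b‖ := LinearMap.mkContinuous_norm_le _ (norm_nonneg _) _

variable (q) in
/-- The rank-one operator `f ↦ ⟨b, f⟩ s_k`. -/
def rankOne (b : X) (k : ℕ) : Lp ℝ q mu →L[ℝ] X := (pairL q b).smulRight (sX k)

@[simp] lemma rankOne_apply (b : X) (k : ℕ) (f : Lp ℝ q mu) :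
    rankOne q b k f = (∫ x, b x * f x ∂mu) • sX k := rfl

lemma norm_rankOne_le {b : X} (hb : ‖b‖ ≤ 2) (k : ℕ) : ‖rankOne q b k‖ ≤ 4 := by
  refine ContinuousLinearMap.opNorm_le_bound _ (by norm_num) fun f => ?_
  rw [rankOne_apply, norm_smul]
  have h1 := (pairL q b).le_of_opNorm_le (norm_pairL_le b) f
  rw [pairL_apply] at h1
  have h2 := norm_sX_le k
  have h3 := norm_nonneg f
  have h4 : ‖b‖ * ‖f‖ ≤ 2 * ‖f‖ := mul_le_mul_of_nonneg_right hb h3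
  calc _ ≤ (2 * ‖f‖) * 2 := mul_le_mul (h1.trans h4) h2 (norm_nonneg _) (by positivity)
    _ = _ := by ring

variable (q) in
/-- The Fourier multiplier operator with weights `c` from the family `b` to the sines. -/
def mulOp (c : ℕ → ℝ) (b : ℕ → X) : Lp ℝ q mu →L[ℝ] X := ∑' k, c k • rankOne q (b k) k

lemma hasSum_mulOp {c : ℕ → ℝ} (hc : Summable fun k => |c k|) {b : ℕ → X} (hb : ∀ k, ‖b k‖ ≤ 2) :
    HasSum (fun k => c k • rankOne q (b k) k) (mulOp q c b) := by
  exact (summable_smul_of_norm_le hc fun k => norm_rankOne_le (hb k) k).hasSum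

lemma hasSum_mulOp_apply {c : ℕ → ℝ} (hc : Summable fun k => |c k|) {b : ℕ → X}
    (hb : ∀ k, ‖b k‖ ≤ 2) (f : Lp ℝ q mu) :
    HasSum (fun k => (c k * ∫ x, b k x * f x ∂mu) • sX k) (mulOp q c b f) := by
  have h := (hasSum_mulOp (q := q) hc hb).mapL (ContinuousLinearMap.apply ℝ X f)
  simpa [smul_smul] using h

/-- Links the two descriptions of an operator: the norm-convergent series of rank-one maps, used for
continuity in time, and the integral against the summed kernel, used for estimates and in the
integral equation. -/
lemma mulOp_apply_apply {c : ℕ → ℝ} (hc : Summable fun k => |c k|) {b : ℕ → X}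
    (hb : ∀ k, ‖b k‖ ≤ 2) (f : Lp ℝ q mu) {x : ℝ} {S : ℝ → ℝ}
    (hS : ∀ y, HasSum (fun k => c k * sf k x * b k y) (S y)) :
    mulOp q c b f x = ∫ y, S y * f y ∂mu := by
  have h1 := (hasSum_mulOp_apply hc hb f).mapL (X.eval x)
  have hs : Summable fun k => |c k * sf k x| := by
    refine Summable.of_nonneg_of_le (fun k => abs_nonneg _) (fun k => ?_) (hc.mul_right 2)
    rw [abs_mul]
    exact mul_le_mul_of_nonneg_left (abs_sf_le k x) (abs_nonneg _)
  have h2 := hasSum_integral_series_mul hs (b := fun k => b k) (fun k => (b k).continuous)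
    (fun k y => ((b k).abs_apply_le y).trans (hb k)) hS (integrable_Lp f)
  refine HasSum.unique h1 (hasSum_of_eq h2 (fun k => ?_) rfl)
  simp
  ring

lemma integral_sf_mulOp {c : ℕ → ℝ} (hc : Summable fun k => |c k|) {b : ℕ → X}
    (hb : ∀ k, ‖b k‖ ≤ 2) (f : Lp ℝ q mu) (j : ℕ) :
    ∫ x, sf j x * mulOp q c b f x ∂mu = c j * ∫ x, b j x * f x ∂mu := by
  have h1 := (hasSum_mulOp_apply hc hb f).mapL
    ((pairL 1 (sX j)).comp (toE 1))
  have e : ∀ h : X, ((pairL 1 (sX j)).comp (toE 1)) h =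
      ∫ x, sf j x * h x ∂mu := fun h => by
    simp only [ContinuousLinearMap.comp_apply, pairL_apply]
    refine integral_congr_ae ?_
    filter_upwards [coeFn_toE 1 h] with x hx
    rw [hx]; rfl
  simp_rw [e] at h1
  refine h1.unique ?_
  convert hasSum_single (f := fun k => ∫ x, sf j x * ((c k * ∫ x, b k x * f x ∂mu) • sX k) x ∂mu) j
    (fun k hk => ?_) using 1
  · have : ∀ x, sf j x * ((c j * ∫ x, b j x * f x ∂mu) • sX j) x =
      (c j * ∫ x, b j x * f x ∂mu) * (sf j x * sf j x) := fun x => by simp; ring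
    simp_rw [this]
    rw [integral_const_mul, integral_sf_mul_sf]; simp
  · have : ∀ x, sf j x * ((c k * ∫ x, b k x * f x ∂mu) • sX k) x =
      (c k * ∫ x, b k x * f x ∂mu) * (sf j x * sf k x) := fun x => by simp; ring
    simp_rw [this]
    rw [integral_const_mul, integral_sf_mul_sf, if_neg hk.symm, mul_zero]

variable (q) in
/-- The Dirichlet heat semigroup, mapping `L^q` to bounded continuous functions. -/
def S1 (t : ℝ) : Lp ℝ q mu →L[ℝ] X := mulOp q (fun k => Real.exp (-(lam k * t)) * ev k ^ 0) sX

variable (q) in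
/-- The operator with kernel `∂G/∂y`, mapping `L^q` to bounded continuous functions. -/
def D1 (t : ℝ) : Lp ℝ q mu →L[ℝ] X := mulOp q (fun k => Real.exp (-(lam k * t)) * ev k ^ 1) cX

lemma summable_abs_exp_mul_ev_pow {t : ℝ} (ht : 0 < t) {n : ℕ} (hn : n ≤ 2) :
    Summable fun k => |Real.exp (-(lam k * t)) * ev k ^ n| := by
  refine (summable_exp_mul_ev_pow ht hn).congr fun k => ?_
  have := ev_pos k
  rw [abs_of_nonneg (by positivity)]

lemma S1_apply {t : ℝ} (ht : 0 < t) (f : Lp ℝ q mu) (x : ℝ) :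
    S1 q t f x = ∫ y, G t x y * f y ∂mu := by
  refine mulOp_apply_apply (summable_abs_exp_mul_ev_pow ht (by norm_num)) norm_sX_le f fun y => ?_
  exact hasSum_of_eq (hasSum_G ht x y) (fun k => by simp) rfl

lemma D1_apply {t : ℝ} (ht : 0 < t) (f : Lp ℝ q mu) (x : ℝ) :
    D1 q t f x = ∫ y, dG t x y * f y ∂mu := by
  refine mulOp_apply_apply (summable_abs_exp_mul_ev_pow ht (by norm_num)) norm_cX_le f fun y => ?_
  exact hasSum_of_eq (hasSum_dG ht x y) (fun k => by simp) rfl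

lemma integral_sf_S1 {t : ℝ} (ht : 0 < t) (f : Lp ℝ q mu) (j : ℕ) :
    ∫ x, sf j x * S1 q t f x ∂mu = Real.exp (-(lam j * t)) * ∫ x, sf j x * f x ∂mu := by
  have := integral_sf_mulOp (summable_abs_exp_mul_ev_pow ht (n := 0) (by norm_num)) norm_sX_le f j
  simp only [pow_zero, mul_one] at this
  simp only [S1, pow_zero, mul_one]
  exact this

lemma integral_sf_D1 {t : ℝ} (ht : 0 < t) (f : Lp ℝ q mu) (j : ℕ) :
    ∫ x, sf j x * D1 q t f x ∂mu = Real.exp (-(lam j * t)) * (ev j * ∫ x, cf j x * f x ∂mu) := by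
  have := integral_sf_mulOp (summable_abs_exp_mul_ev_pow ht (n := 1) (by norm_num)) norm_cX_le f j
  simp only [pow_one, mul_assoc] at this
  simp only [D1, pow_one]
  exact this

lemma continuousOn_S1 : ContinuousOn (S1 q) (Ioi 0) :=
  continuousOn_tsum_exp_smul (n := 0) (by norm_num) fun k => norm_rankOne_le (norm_sX_le k) k

lemma continuousOn_D1 : ContinuousOn (D1 q) (Ioi 0) :=
  continuousOn_tsum_exp_smul (n := 1) (by norm_num) fun k => norm_rankOne_le (norm_cX_le k) k

/-- The constant in the smoothing estimates. -/
def Dc : ℝ := 1 + 8 * Zc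

lemma Dc_pos : 0 < Dc := by have := Zc_nonneg; unfold Dc; positivity

lemma norm_S1_le {t : ℝ} (ht : 0 < t) : ‖S1 q t‖ ≤ Dc * t ^ (-(5 / 8 : ℝ)) := by
  have h00 : 0 ≤ 8 * Zc * t ^ (-(5 / 8 : ℝ)) := by have := Zc_nonneg; positivity
  have h0 : 8 * Zc * t ^ (-(5 / 8 : ℝ)) ≤ Dc * t ^ (-(5 / 8 : ℝ)) := by
    unfold Dc; gcongr; linarith
  have h1 : 0 ≤ Dc * t ^ (-(5 / 8 : ℝ)) := h00.trans h0
  refine le_trans ?_ h0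
  replace h0 := h00
  refine ContinuousLinearMap.opNorm_le_bound _ h0 fun f => ?_
  refine (X.norm_le (by positivity)).2 fun x => ?_
  rw [S1_apply ht]
  refine (abs_integral_mul_le_of_bound (abs_G_le ht x) (integrable_Lp f)).trans ?_
  exact mul_le_mul_of_nonneg_left (integral_abs_le_norm f) h0

end

lemma fact_three_halves : Fact ((1 : ℝ≥0∞) ≤ ENNReal.ofReal (3 / 2)) :=
  ⟨by rw [ENNReal.one_le_ofReal]; norm_num⟩
attribute [instance] fact_three_halves

/-- The space `L^{3/2}(0,1)`. -/
abbrev L32 := Lp ℝ (ENNReal.ofReal (3 / 2)) mu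

/-- By Hölder it suffices to bound the L³ norm of the kernel. Its cube is at most the supremum, of
order t^(-9/8), times the squared L² norm, of order t^(-13/8), and the cube root of t^(-22/8) is
t^(-11/12). The exponent stays below 1; the supremum bound alone, acting on L¹, would give the
non-integrable t^(-9/8). -/
lemma norm_D1_le {t : ℝ} (ht : 0 < t) :
    ‖D1 (ENNReal.ofReal (3 / 2)) t‖ ≤ Dc * t ^ (-(11 / 12 : ℝ)) := by
  have hZ := Zc_nonneg
  have hD := Dc_pos
  have h0 : 0 ≤ Dc * t ^ (-(11 / 12 : ℝ)) := by positivity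
  refine ContinuousLinearMap.opNorm_le_bound _ h0 fun f => ?_
  refine (X.norm_le (by positivity)).2 fun x => ?_
  rw [D1_apply ht]
  have hdG : MemLp (fun y => dG t x y) (ENNReal.ofReal 3) mu :=
    memLp_of_continuous_bdd (continuous_dG ht x) (abs_dG_le ht x) _
  have h := integral_mul_norm_le_Lp_mul_Lq (μ := mu) (f := fun y => dG t x y) (g := f)
    (p := 3) (q := 3 / 2) ⟨by norm_num, by norm_num, by norm_num⟩ hdG (Lp.memLp f)
  have h1 : |∫ y, dG t x y * f y ∂mu| ≤ ∫ y, ‖dG t x y‖ * ‖f y‖ ∂mu := by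
    refine (abs_integral_le_integral_abs).trans_eq ?_
    simp only [abs_mul, Real.norm_eq_abs]
  have h2 : (∫ y, ‖dG t x y‖ ^ (3 : ℝ) ∂mu) ≤ (Dc * t ^ (-(11 / 12 : ℝ))) ^ (3 : ℝ) := by
    calc (∫ y, ‖dG t x y‖ ^ (3 : ℝ) ∂mu)
        ≤ ∫ y, 8 * Zc * t ^ (-(9 / 8 : ℝ)) * (dG t x y * dG t x y) ∂mu := by
          have hc := continuous_dG ht x
          refine integral_mono (integrable_mu_of_continuous ?_) (integrable_mu_of_continuous
            (by fun_prop)) fun y => ?_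
          · exact (hc.norm).rpow_const fun y => Or.inr (by norm_num)
          · have := abs_dG_le ht x y
            simp only [Real.norm_eq_abs]
            rw [show (3 : ℝ) = ((3 : ℕ) : ℝ) by norm_num, Real.rpow_natCast,
              show |dG t x y| ^ 3 = |dG t x y| * (|dG t x y| * |dG t x y|) by ring, abs_mul_abs_self]
            exact mul_le_mul_of_nonneg_right this (mul_self_nonneg _)
      _ ≤ (8 * Zc * t ^ (-(9 / 8 : ℝ))) * (8 * Zc * t ^ (-(13 / 8 : ℝ))) := by
          rw [integral_const_mul]
          exact mul_le_mul_of_nonneg_left (integral_dG_sq_le ht x) (by positivity)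
      _ ≤ _ := by
          rw [Real.mul_rpow hD.le (by positivity), ← Real.rpow_mul ht.le]
          have e : t ^ (-(9 / 8 : ℝ)) * t ^ (-(13 / 8 : ℝ)) = t ^ (-(11 / 12 : ℝ) * 3) := by
            rw [← Real.rpow_add ht]; norm_num
          have e2 : Dc ^ (3 : ℝ) = Dc ^ 3 := by
            rw [show (3 : ℝ) = ((3 : ℕ) : ℝ) by norm_num, Real.rpow_natCast]
          rw [← e, e2]
          -- The summand 1 in `Dc` serves here: with `Dc` ≥ 1, the square of 8 `Zc` is below the
          -- cube of `Dc`.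
          have : (8 * Zc) * (8 * Zc) ≤ Dc ^ 3 := by
            have h1 : 8 * Zc = Dc - 1 := by unfold Dc; ring
            have h2 : 1 ≤ Dc := by unfold Dc; linarith
            rw [h1]; nlinarith [mul_nonneg hD.le hD.le, mul_nonneg (sub_nonneg.2 h2) (mul_nonneg hD.le hD.le)]
          calc _ = (8 * Zc) * (8 * Zc) * (t ^ (-(9 / 8 : ℝ)) * t ^ (-(13 / 8 : ℝ))) := by ring
            _ ≤ _ := mul_le_mul_of_nonneg_right this (by positivity)
  refine h1.trans (h.trans ?_)
  gcongr
  · calc (∫ y, ‖dG t x y‖ ^ (3 : ℝ) ∂mu) ^ (1 / 3 : ℝ)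
        ≤ ((Dc * t ^ (-(11 / 12 : ℝ))) ^ (3 : ℝ)) ^ (1 / 3 : ℝ) := by
          gcongr
      _ = _ := by rw [← Real.rpow_mul h0]; norm_num
  · rw [Lp.norm_def, (Lp.memLp f).eLpNorm_eq_integral_rpow_norm (by simp) (by simp),
      ENNReal.toReal_ofReal (by positivity), ENNReal.toReal_ofReal (by norm_num), one_div]

/-! ### The heat semigroup on L^q. -/

section
variable {q : ℝ≥0∞} [hq1 : Fact (1 ≤ q)]

lemma continuous_G_prod {t : ℝ} (ht : 0 < t) : Continuous fun z : ℝ × ℝ => G t z.1 z.2 := by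
  have hs := summable_exp_mul_ev_pow ht (n := 0) (by norm_num)
  have e : (fun z : ℝ × ℝ => G t z.1 z.2) =
      fun z : ℝ × ℝ => ∑' k, Real.exp (-(lam k * t)) * sf k z.1 * sf k z.2 := by
    funext z; exact (hasSum_G ht z.1 z.2).tsum_eq.symm
  rw [e]
  refine continuous_tsum (fun k => by have := continuous_sf k; fun_prop) (hs.mul_left 4) fun k z => ?_
  have h1 := abs_sf_le k z.1
  have h2 := abs_sf_le k z.2
  rw [Real.norm_eq_abs, abs_mul, abs_mul, Real.abs_exp, mul_assoc, pow_zero, mul_one, mul_comm]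
  gcongr
  nlinarith [abs_nonneg (sf k z.1), abs_nonneg (sf k z.2)]

lemma lintegral_enorm_G_le {t : ℝ} (ht : 0 < t) (x : ℝ) : ∫⁻ y, ‖G t x y‖ₑ ∂mu ≤ 1 := by
  rw [← ofReal_integral_norm_eq_lintegral_enorm (integrable_mu_of_continuous (continuous_G ht x))]
  simpa using ENNReal.ofReal_le_ofReal (integral_abs_G_le ht x)

/-- Jensen's inequality for sub-probability weights. -/
lemma lintegral_mul_rpow_le {k g : ℝ → ℝ≥0∞} (hk : Measurable k) (hk1 : ∫⁻ y, k y ∂mu ≤ 1)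
    (hg : AEMeasurable g mu) {p : ℝ} (hp : 1 ≤ p) :
    (∫⁻ y, k y * g y ∂mu) ^ p ≤ ∫⁻ y, k y * g y ^ p ∂mu := by
  have hp0 : 0 < p := by linarith
  rcases eq_or_lt_of_le hp with rfl | hp1
  · simp
  have hpq := Real.HolderConjugate.conjExponent hp1
  set r := Real.conjExponent p
  have h := ENNReal.lintegral_mul_le_Lp_mul_Lq mu hpq.symm (f := fun y => k y ^ (1 / r))
    (g := fun y => k y ^ (1 / p) * g y) (by fun_prop) (by fun_prop)
  have e1 : ∀ y, ((fun y => k y ^ (1 / r)) * fun y => k y ^ (1 / p) * g y) y = k y * g y := fun y => by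
    simp only [Pi.mul_apply]
    rw [← mul_assoc, ← ENNReal.rpow_add_of_nonneg _ _ (by have := hpq.symm.pos; positivity) (by positivity)]
    have : 1 / r + 1 / p = 1 := by
      have := hpq.symm.inv_add_inv_eq_one; simpa using this
    rw [this, ENNReal.rpow_one]
  have e2 : ∀ y, (k y ^ (1 / r)) ^ r = k y := fun y => by
    rw [← ENNReal.rpow_mul, one_div_mul_cancel hpq.symm.pos.ne', ENNReal.rpow_one]
  have e3 : ∀ y, (k y ^ (1 / p) * g y) ^ p = k y * g y ^ p := fun y => by
    rw [ENNReal.mul_rpow_of_nonneg _ _ hp0.le, ← ENNReal.rpow_mul, one_div_mul_cancel hp0.ne',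
      ENNReal.rpow_one]
  simp_rw [e2, e3] at h
  rw [lintegral_congr e1] at h
  calc (∫⁻ y, k y * g y ∂mu) ^ p
      ≤ ((∫⁻ y, k y ∂mu) ^ (1 / r) * (∫⁻ y, k y * g y ^ p ∂mu) ^ (1 / p)) ^ p := by gcongr
    _ ≤ (1 * (∫⁻ y, k y * g y ^ p ∂mu) ^ (1 / p)) ^ p := by
        gcongr
        calc _ ≤ (1 : ℝ≥0∞) ^ (1 / r) := by
              have := hpq.symm.pos
              gcongr
          _ = 1 := ENNReal.one_rpow _
    _ = _ := by
        rw [one_mul, ← ENNReal.rpow_mul, one_div_mul_cancel hp0.ne', ENNReal.rpow_one]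

/-- Schur's test: Jensen's inequality for the sub-probability weight |G(x,·)|, then Fubini and the
symmetry of the kernel. -/
lemma norm_toLp_S1_le (hq : q ≠ ⊤) {t : ℝ} (ht : 0 < t) (f : Lp ℝ q mu) :
    ‖toE q (S1 q t f)‖ ≤ ‖f‖ := by
  have hq0 : q ≠ 0 := (zero_lt_one.trans_le hq1.out).ne'
  have hp : 1 ≤ q.toReal := by
    have := ENNReal.toReal_mono hq hq1.out; simpa using this
  rw [Lp.norm_def, Lp.norm_def]
  refine ENNReal.toReal_mono (Lp.memLp f).2.ne ?_
  rw [eLpNorm_congr_ae (coeFn_toE q (S1 q t f)),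
    eLpNorm_eq_lintegral_rpow_enorm_toReal hq0 hq, eLpNorm_eq_lintegral_rpow_enorm_toReal hq0 hq]
  gcongr 1
  have hfm : AEMeasurable (fun y => ‖f y‖ₑ) mu := (Lp.memLp f).1.enorm
  have hGm : Measurable fun z : ℝ × ℝ => ‖G t z.1 z.2‖ₑ := (continuous_G_prod ht).measurable.enorm
  calc ∫⁻ x, ‖S1 q t f x‖ₑ ^ q.toReal ∂mu
      ≤ ∫⁻ x, ∫⁻ y, ‖G t x y‖ₑ * ‖f y‖ₑ ^ q.toReal ∂mu ∂mu := by
        refine lintegral_mono fun x => ?_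
        refine le_trans ?_ (lintegral_mul_rpow_le (continuous_G ht x).measurable.enorm
          (lintegral_enorm_G_le ht x) hfm hp)
        gcongr
        rw [S1_apply ht]
        refine (enorm_integral_le_lintegral_enorm _).trans_eq ?_
        simp only [enorm_mul]
    _ = ∫⁻ y, ∫⁻ x, ‖G t x y‖ₑ * ‖f y‖ₑ ^ q.toReal ∂mu ∂mu := by
        refine lintegral_lintegral_swap ?_
        exact hGm.aemeasurable.mul ((hfm.pow_const _).comp_quasiMeasurePreserving
          Measure.quasiMeasurePreserving_snd)
    _ ≤ ∫⁻ y, ‖f y‖ₑ ^ q.toReal ∂mu := by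
        refine lintegral_mono fun y => ?_
        have hGy : Measurable fun x => ‖G t x y‖ₑ := by
          simp_rw [G_symm ht _ y]; exact (continuous_G ht y).measurable.enorm
        rw [lintegral_mul_const _ hGy]
        have : ∫⁻ x, ‖G t x y‖ₑ ∂mu ≤ 1 := by
          simp_rw [G_symm ht _ y]; exact lintegral_enorm_G_le ht y
        exact mul_le_of_le_one_left' this

variable (q) in
/-- The Dirichlet heat semigroup on `L^q`. -/
def SE (t : ℝ) : Lp ℝ q mu →L[ℝ] Lp ℝ q mu :=
  if 0 < t then (toE q).comp (S1 q t) else ContinuousLinearMap.id ℝ _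

lemma SE_of_pos {t : ℝ} (ht : 0 < t) (f : Lp ℝ q mu) :
    SE q t f = toE q (S1 q t f) := by simp [SE, ht]

@[simp] lemma SE_zero (f : Lp ℝ q mu) : SE q 0 f = f := by simp [SE]

lemma norm_SE_apply_le (hq : q ≠ ⊤) (t : ℝ) (f : Lp ℝ q mu) : ‖SE q t f‖ ≤ ‖f‖ := by
  by_cases ht : 0 < t
  · rw [SE_of_pos ht]; exact norm_toLp_S1_le hq ht f
  · simp [SE, ht]

lemma S1_sf {t : ℝ} (ht : 0 < t) (k : ℕ) :
    S1 q t ((memLp_sf k q).toLp (sf k)) = Real.exp (-(lam k * t)) • sX k := by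
  have h := hasSum_mulOp_apply (summable_abs_exp_mul_ev_pow ht (n := 0) (by norm_num)) norm_sX_le
    ((memLp_sf k q).toLp (sf k))
  have e : ∀ j, ∫ x, sX j x * (memLp_sf k q).toLp (sf k) x ∂mu = if j = k then 1 else 0 := fun j => by
    rw [← integral_sf_mul_sf]
    refine integral_congr_ae ?_
    filter_upwards [(memLp_sf k q).coeFn_toLp] with x hx
    rw [hx]; rfl
  simp_rw [e] at h
  refine h.unique ?_
  convert hasSum_single k (fun j hj => ?_) using 1
  · simp
  · simp [hj]

/-- On a sine mode the semigroup is multiplication by a scalar tending to 1. Density of the sines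
and the uniform bound 1 on the operators extend the convergence to all of L^q. -/
lemma tendsto_SE_zero (hq : q ≠ ⊤) (f : Lp ℝ q mu) :
    Tendsto (fun t => SE q t f) (𝓝[>] 0) (𝓝 f) := by
  have hf : f ∈ (Submodule.span ℝ (range fun k => (memLp_sf k q).toLp (sf k))).topologicalClosure := by
    rw [span_sf_closure hq]; trivial
  have hspan : ∀ g ∈ Submodule.span ℝ (range fun k => (memLp_sf k q).toLp (sf k)),
      Tendsto (fun t => SE q t g) (𝓝[>] 0) (𝓝 g) := by
    intro g hg
    induction hg using Submodule.span_induction with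
    | mem g hg =>
      obtain ⟨k, rfl⟩ := hg
      have h1 : Tendsto (fun t => Real.exp (-(lam k * t)) • (memLp_sf k q).toLp (sf k)) (𝓝[>] 0)
          (𝓝 (Real.exp (-(lam k * 0)) • (memLp_sf k q).toLp (sf k))) := by
        refine Tendsto.mono_left (Continuous.tendsto (by fun_prop) 0) nhdsWithin_le_nhds
      rw [mul_zero, neg_zero, Real.exp_zero, one_smul] at h1
      refine h1.congr' ?_
      filter_upwards [self_mem_nhdsWithin] with t ht
      rw [SE_of_pos ht, S1_sf ht, map_smul]
      refine congrArg _ (Lp.ext ?_)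
      filter_upwards [(memLp_sf k q).coeFn_toLp,
        coeFn_toE q (sX k)] with x h1 h2
      rw [h1, h2]; rfl
    | zero => simp
    | add g h _ _ hg hh => simpa using hg.add hh
    | smul a g _ hg => simpa using hg.const_smul a
  rw [Metric.tendsto_nhds]
  intro ε hε
  rw [← SetLike.mem_coe, Submodule.topologicalClosure_coe, Metric.mem_closure_iff] at hf
  obtain ⟨g, hg, hfg⟩ := hf (ε / 3) (by positivity)
  filter_upwards [Metric.tendsto_nhds.1 (hspan g hg) (ε / 3) (by positivity)] with t ht
  have h1 := norm_SE_apply_le hq t (f - g)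
  rw [map_sub] at h1
  rw [dist_eq_norm] at *
  calc ‖SE q t f - f‖ = ‖(SE q t f - SE q t g) + (SE q t g - g) + (g - f)‖ := by congr 1; abel
    _ ≤ ‖SE q t f - SE q t g‖ + ‖SE q t g - g‖ + ‖g - f‖ := norm_add₃_le
    _ < ε := by rw [norm_sub_rev g f]; linarith

lemma continuousOn_SE (hq : q ≠ ⊤) (f : Lp ℝ q mu) {ν : ℝ} (hν : 0 < ν) :
    ContinuousOn (fun t => SE q (ν * t) f) (Ici 0) := by
  intro t ht
  rcases eq_or_lt_of_le (show (0 : ℝ) ≤ t from ht) with rfl | ht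
  · have h : Tendsto (fun t => SE q (ν * t) f) (𝓝[>] 0) (𝓝 f) := by
      refine (tendsto_SE_zero hq f).comp ?_
      refine tendsto_nhdsWithin_iff.2 ⟨?_, ?_⟩
      · refine Tendsto.mono_left ?_ nhdsWithin_le_nhds
        have : Continuous fun t : ℝ => ν * t := by fun_prop
        simpa using this.tendsto 0
      · filter_upwards [self_mem_nhdsWithin] with t ht
        exact mul_pos hν ht
    rw [← Ioi_insert, continuousWithinAt_insert_self]
    simpa [ContinuousWithinAt] using h
  · refine ContinuousAt.continuousWithinAt ?_
    have h1 : ContinuousOn (fun t => toE q (S1 q (ν * t) f)) (Ioi 0) := by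
      refine (toE q).continuous.comp_continuousOn ?_
      refine ContinuousOn.clm_apply ?_ continuousOn_const
      exact continuousOn_S1.comp (by fun_prop) fun s hs => mul_pos hν hs
    refine (h1.continuousAt (Ioi_mem_nhds ht)).congr ?_
    filter_upwards [Ioi_mem_nhds ht] with s hs
    rw [SE_of_pos (mul_pos hν hs)]

end

end GBH

/-! ### Volterra equations with a weakly singular kernel. -/

noncomputable section
namespace GBH

section Volterra
variable {Y W : Type*} [NormedAddCommGroup Y] [NormedSpace ℝ Y] [NormedAddCommGroup W]
  [NormedSpace ℝ W]

/-- The Duhamel integral `∫₀ᵗ K(t-s) F(s) ds`. -/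
def duh (K : ℝ → Y →L[ℝ] W) (F : ℝ → Y) (t : ℝ) : W := ∫ s in (0 : ℝ)..t, K (t - s) (F s)

/-- A kernel continuous on `(0,∞)` with a weak singularity at `0`. -/
structure WeakSing (K : ℝ → Y →L[ℝ] W) (C a T : ℝ) : Prop where
  cont : ContinuousOn K (Ioi 0)
  bound : ∀ t ∈ Ioc 0 T, ‖K t‖ ≤ C * t ^ (-a)

lemma aestronglyMeasurable_kernel {K : ℝ → Y →L[ℝ] W} (hK : ContinuousOn K (Ioi 0)) {F : ℝ → Y}
    {T : ℝ} (hF : AEStronglyMeasurable F (volume.restrict (Ioc 0 T))) {t : ℝ} (htT : t ≤ T) :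
    AEStronglyMeasurable (fun s => K (t - s) (F s)) (volume.restrict (Ioc 0 t)) := by
  rw [← restrict_Ioo_eq_restrict_Ioc]
  have h1 : AEStronglyMeasurable (fun s => K (t - s)) (volume.restrict (Ioo 0 t)) := by
    refine ContinuousOn.aestronglyMeasurable ?_ measurableSet_Ioo
    exact hK.comp (by fun_prop) fun s hs => sub_pos.2 hs.2
  have h2 : AEStronglyMeasurable F (volume.restrict (Ioo 0 t)) :=
    hF.mono_measure (Measure.restrict_mono (Ioo_subset_Ioc_self.trans (Ioc_subset_Ioc_right htT)) le_rfl)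
  exact (ContinuousLinearMap.id ℝ (Y →L[ℝ] W)).aestronglyMeasurable_comp₂ h1 h2

lemma intervalIntegrable_sub_rpow {a t : ℝ} (ha : a < 1) :
    IntervalIntegrable (fun s => (t - s) ^ (-a)) volume 0 t := by
  have := (intervalIntegral.intervalIntegrable_rpow' (a := 0) (b := t) (r := -a) (by linarith)).comp_sub_left t
  simpa using this.symm

lemma integral_sub_rpow {a t : ℝ} (ha : a < 1) :
    ∫ s in (0 : ℝ)..t, (t - s) ^ (-a) = t ^ (1 - a) / (1 - a) := by
  rw [intervalIntegral.integral_comp_sub_left (fun s => s ^ (-a)) t]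
  rw [sub_self, sub_zero, integral_rpow (Or.inl (by linarith)), neg_add_eq_sub,
    Real.zero_rpow (by linarith), sub_zero]

lemma norm_kernel_ae_le {K : ℝ → Y →L[ℝ] W} {C a T M : ℝ} (hK : WeakSing K C a T)
    {F : ℝ → Y} (hM : ∀ᵐ s ∂(volume.restrict (Ioc 0 T)), ‖F s‖ ≤ M) {t : ℝ} (htT : t ≤ T) :
    ∀ᵐ s ∂(volume.restrict (Ioc 0 t)), ‖K (t - s) (F s)‖ ≤ M * C * (t - s) ^ (-a) := by
  have h1 : ∀ᵐ s ∂(volume.restrict (Ioc 0 t)), ‖F s‖ ≤ M :=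
    ae_mono (Measure.restrict_mono (Ioc_subset_Ioc_right htT) le_rfl) hM
  -- The null endpoint s = t is discarded, since the kernel is controlled only at positive times.
  rw [← restrict_Ioo_eq_restrict_Ioc] at h1 ⊢
  filter_upwards [h1, ae_restrict_mem measurableSet_Ioo] with s h1 hs
  have h2 := hK.bound (t - s) ⟨sub_pos.2 hs.2, by linarith [hs.1]⟩
  calc _ ≤ ‖K (t - s)‖ * ‖F s‖ := (K (t - s)).le_opNorm _
    _ ≤ (C * (t - s) ^ (-a)) * M := mul_le_mul h2 h1 (norm_nonneg _) ((norm_nonneg _).trans h2)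
    _ = _ := by ring

lemma intervalIntegrable_kernel {K : ℝ → Y →L[ℝ] W} {C a T M : ℝ} (hK : WeakSing K C a T)
    (ha : a < 1) {F : ℝ → Y} (hF : AEStronglyMeasurable F (volume.restrict (Ioc 0 T)))
    (hM : ∀ᵐ s ∂(volume.restrict (Ioc 0 T)), ‖F s‖ ≤ M) {t : ℝ} (ht : t ∈ Icc 0 T) :
    IntervalIntegrable (fun s => K (t - s) (F s)) volume 0 t := by
  rw [intervalIntegrable_iff_integrableOn_Ioc_of_le ht.1]
  have h1 := ((intervalIntegrable_sub_rpow ha (t := t)).const_mul (M * C))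
  rw [intervalIntegrable_iff_integrableOn_Ioc_of_le ht.1] at h1
  exact h1.mono' (aestronglyMeasurable_kernel hK.cont hF ht.2) (norm_kernel_ae_le hK hM ht.2)

lemma norm_duh_le {K : ℝ → Y →L[ℝ] W} {C a T M : ℝ} (hK : WeakSing K C a T)
    (ha : a < 1) (hC : 0 ≤ C) (hM0 : 0 ≤ M) {F : ℝ → Y}
    (hM : ∀ᵐ s ∂(volume.restrict (Ioc 0 T)), ‖F s‖ ≤ M) {t : ℝ} (ht : t ∈ Icc 0 T) :
    ‖duh K F t‖ ≤ M * C * (T ^ (1 - a) / (1 - a)) := by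
  have h1 : ‖duh K F t‖ ≤ ∫ s in (0 : ℝ)..t, M * C * (t - s) ^ (-a) := by
    refine intervalIntegral.norm_integral_le_of_norm_le ht.1 ?_
      ((intervalIntegrable_sub_rpow ha).const_mul _)
    exact (ae_restrict_iff' measurableSet_Ioc).1 (norm_kernel_ae_le hK hM ht.2)
  rw [intervalIntegral.integral_const_mul, integral_sub_rpow ha] at h1
  refine h1.trans ?_
  have := ht.1
  have h2 : 0 < 1 - a := by linarith
  gcongr
  exact ht.2

/-- A cutoff vanishing for `r ≤ ε` and equal to one for `r ≥ 2ε`. -/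
def cutoff (ε r : ℝ) : ℝ := max 0 (min 1 (r / ε - 1))

lemma continuous_cutoff (ε : ℝ) : Continuous (cutoff ε) := by unfold cutoff; fun_prop
lemma cutoff_nonneg (ε r : ℝ) : 0 ≤ cutoff ε r := le_max_left _ _
lemma cutoff_le_one (ε r : ℝ) : cutoff ε r ≤ 1 := max_le zero_le_one (min_le_left _ _)
lemma cutoff_eq_zero {ε r : ℝ} (hε : 0 < ε) (h : r ≤ ε) : cutoff ε r = 0 := by
  have : r / ε - 1 ≤ 0 := by rw [sub_nonpos, div_le_one hε]; exact h
  exact max_eq_left ((min_le_right _ _).trans this)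
lemma cutoff_eq_one {ε r : ℝ} (hε : 0 < ε) (h : 2 * ε ≤ r) : cutoff ε r = 1 := by
  have : 1 ≤ r / ε - 1 := by
    rw [le_sub_iff_add_le, le_div_iff₀ hε]; linarith
  unfold cutoff
  rw [min_eq_left this]; simp

lemma continuous_cutoff_smul {K : ℝ → Y →L[ℝ] W} (hK : ContinuousOn K (Ioi 0)) {ε : ℝ} (hε : 0 < ε) :
    Continuous fun r => cutoff ε r • K r := by
  rw [continuous_iff_continuousAt]
  intro r
  rcases lt_or_ge r ε with h | h
  · have : (fun r => cutoff ε r • K r) =ᶠ[𝓝 r] fun _ => 0 := by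
      filter_upwards [Iio_mem_nhds h] with s hs
      rw [cutoff_eq_zero hε (le_of_lt hs), zero_smul]
    exact continuousAt_const.congr this.symm
  · exact (continuous_cutoff ε).continuousAt.smul (hK.continuousAt (Ioi_mem_nhds (hε.trans_le h)))

/-- With the singularity cut off, the kernel is continuous on the whole line, and dominated
convergence applies. -/
lemma continuousOn_duh_cutoff {K : ℝ → Y →L[ℝ] W} {C a T M : ℝ} (hK : WeakSing K C a T)
    (ha0 : 0 ≤ a) (hC : 0 ≤ C) {F : ℝ → Y}
    (hF : AEStronglyMeasurable F (volume.restrict (Ioc 0 T)))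
    (hM : ∀ᵐ s ∂(volume.restrict (Ioc 0 T)), ‖F s‖ ≤ M) {ε : ℝ} (hε : 0 < ε) :
    ContinuousOn (duh (fun r => cutoff ε r • K r) F) (Icc 0 T) := by
  have hc := continuous_cutoff_smul hK.cont hε
  -- The cut-off kernel vanishes for s > t, so the domain of integration can be taken independent of
  -- t.
  have e : EqOn (duh (fun r => cutoff ε r • K r) F)
      (fun t => ∫ s in Ioc 0 T, (cutoff ε (t - s) • K (t - s)) (F s)) (Icc 0 T) := by
    intro t ht
    simp only [duh]
    rw [intervalIntegral.integral_of_le ht.1]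
    refine (setIntegral_eq_of_subset_of_forall_sdiff_eq_zero measurableSet_Ioc
      (Ioc_subset_Ioc_right ht.2) fun s hs => ?_).symm
    have : t - s ≤ ε := by
      have : ¬ s ≤ t := fun h => hs.2 ⟨hs.1.1, h⟩
      linarith
    rw [cutoff_eq_zero hε this, zero_smul, zero_apply]
  refine ContinuousOn.congr ?_ e
  refine continuousOn_of_dominated (bound := fun _ => C * ε ^ (-a) * M) (fun t _ => ?_) (fun t ht => ?_)
    (integrable_const _) ?_
  · have h1 : AEStronglyMeasurable (fun s => cutoff ε (t - s) • K (t - s)) (volume.restrict (Ioc 0 T)) :=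
      (hc.comp (by fun_prop : Continuous fun s => t - s)).aestronglyMeasurable
    exact (ContinuousLinearMap.id ℝ (Y →L[ℝ] W)).aestronglyMeasurable_comp₂ h1 hF
  · filter_upwards [hM, ae_restrict_mem measurableSet_Ioc] with s h1 hs
    have h2 : ‖cutoff ε (t - s) • K (t - s)‖ ≤ C * ε ^ (-a) := by
      rcases le_or_gt (t - s) ε with h | h
      · rw [cutoff_eq_zero hε h, zero_smul, norm_zero]; positivity
      · rw [norm_smul, Real.norm_eq_abs, abs_of_nonneg (cutoff_nonneg _ _)]
        have h3 := hK.bound (t - s) ⟨hε.trans h, by linarith [hs.1, ht.2]⟩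
        have h4 : (t - s) ^ (-a) ≤ ε ^ (-a) :=
          Real.rpow_le_rpow_of_nonpos hε h.le (by linarith)
        calc _ ≤ 1 * (C * ε ^ (-a)) := by
              refine mul_le_mul (cutoff_le_one _ _) (h3.trans (by gcongr)) (norm_nonneg _) zero_le_one
          _ = _ := one_mul _
    refine (ContinuousLinearMap.le_opNorm _ _).trans ?_
    exact mul_le_mul h2 h1 (norm_nonneg _) (by positivity)
  · refine ae_of_all _ fun s => ?_
    refine Continuous.continuousOn ?_
    exact (hc.comp (by fun_prop : Continuous fun t => t - s)).clm_apply continuous_const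

/-- The Duhamel integral is a uniform limit of its cut-off versions. The discarded part lives on r ≤
2ε, where part of the margin 1 - a is converted into a small factor (2ε)^b. -/
lemma continuousOn_duh {K : ℝ → Y →L[ℝ] W} {C a T M : ℝ} (hK : WeakSing K C a T) (hT : 0 ≤ T)
    (ha0 : 0 ≤ a) (ha : a < 1) (hC : 0 ≤ C) (hM0 : 0 ≤ M) {F : ℝ → Y}
    (hF : AEStronglyMeasurable F (volume.restrict (Ioc 0 T)))
    (hM : ∀ᵐ s ∂(volume.restrict (Ioc 0 T)), ‖F s‖ ≤ M) :
    ContinuousOn (duh K F) (Icc 0 T) := by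
  -- Half of the margin is spent on smallness; the other half keeps the exponent a + b below 1.
  set b := (1 - a) / 2 with hb
  have hb0 : 0 < b := by rw [hb]; linarith
  have hkey : ∀ ε : ℝ, 0 < ε → WeakSing (fun r => (1 - cutoff ε r) • K r) (C * (2 * ε) ^ b) (a + b) T := by
    intro ε hε
    refine ⟨(continuousOn_const.sub (continuous_cutoff ε).continuousOn).smul hK.cont, fun r hr => ?_⟩
    have hr0 := hr.1
    rcases le_or_gt (2 * ε) r with h | h
    · rw [cutoff_eq_one hε h, sub_self, zero_smul, norm_zero]; positivity
    · rw [norm_smul, Real.norm_eq_abs, abs_of_nonneg (by linarith [cutoff_le_one ε r])]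
      have h1 : (1 : ℝ) ≤ (2 * ε) ^ b * r ^ (-b) := by
        rw [Real.rpow_neg hr0.le, ← div_eq_mul_inv, le_div_iff₀ (by positivity), one_mul]
        gcongr
      calc (1 - cutoff ε r) * ‖K r‖ ≤ 1 * (C * r ^ (-a)) := by
            refine mul_le_mul (by linarith [cutoff_nonneg ε r]) (hK.bound r hr) (norm_nonneg _) zero_le_one
        _ ≤ ((2 * ε) ^ b * r ^ (-b)) * (C * r ^ (-a)) := by gcongr
        _ = _ := by rw [neg_add, Real.rpow_add hr0]; ring
  have hab : a + b < 1 := by rw [hb]; linarith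
  set D := M * C * (T ^ (1 - (a + b)) / (1 - (a + b)))
  have hlim : Tendsto (fun ε : ℝ => (2 * ε) ^ b * D) (𝓝[>] 0) (𝓝 0) := by
    have h1 : Continuous fun ε : ℝ => (2 * ε) ^ b * D :=
      ((continuous_const.mul continuous_id).rpow_const fun _ => Or.inr hb0.le).mul continuous_const
    have := (h1.tendsto 0).mono_left (nhdsWithin_le_nhds (s := Ioi 0))
    simpa [Real.zero_rpow hb0.ne'] using this
  have hunif : TendstoUniformlyOn (fun ε => duh (fun r => cutoff ε r • K r) F) (duh K F) (𝓝[>] 0)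
      (Icc 0 T) := by
    rw [Metric.tendstoUniformlyOn_iff]
    intro δ hδ
    filter_upwards [hlim.eventually (gt_mem_nhds hδ), self_mem_nhdsWithin] with ε h1 hε t ht
    rw [dist_eq_norm]
    have hε : 0 < ε := hε
    have e : duh K F t - duh (fun r => cutoff ε r • K r) F t = duh (fun r => (1 - cutoff ε r) • K r) F t := by
      simp only [duh]
      rw [← intervalIntegral.integral_sub (intervalIntegrable_kernel hK ha hF hM ht)]
      · refine intervalIntegral.integral_congr fun s _ => ?_
        simp [sub_smul]
      · refine intervalIntegrable_kernel (C := C) (a := a) (K := fun r => cutoff ε r • K r) ?_ ha hF hM ht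
        refine ⟨(continuous_cutoff ε).continuousOn.smul hK.cont, fun r hr => ?_⟩
        have hr0 := hr.1
        rw [norm_smul, Real.norm_eq_abs, abs_of_nonneg (cutoff_nonneg _ _)]
        calc _ ≤ 1 * (C * r ^ (-a)) :=
              mul_le_mul (cutoff_le_one _ _) (hK.bound r hr) (norm_nonneg _) zero_le_one
          _ = _ := one_mul _
    rw [e]
    refine (norm_duh_le (hkey ε hε) hab (by positivity) hM0 hM ht).trans_lt ?_
    convert h1 using 1
    simp only [D]; ring
  refine hunif.continuousOn (Eventually.frequently ?_)
  filter_upwards [self_mem_nhdsWithin] with ε hε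
  exact continuousOn_duh_cutoff hK ha0 hC hF hM hε

variable {K : ℝ → Y →L[ℝ] W} {C a T : ℝ}

/-- Continuous functions on `[0,T]` have bounded measurable superpositions. -/
lemma continuousOn_bdd_aux {F : ℝ → Y} (hF : ContinuousOn F (Icc 0 T)) :
    AEStronglyMeasurable F (volume.restrict (Ioc 0 T)) ∧
    ∃ M, 0 ≤ M ∧ ∀ᵐ s ∂(volume.restrict (Ioc 0 T)), ‖F s‖ ≤ M := by
  refine ⟨(hF.mono Ioc_subset_Icc_self).aestronglyMeasurable measurableSet_Ioc, ?_⟩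
  obtain ⟨M, hM⟩ := isCompact_Icc.exists_bound_of_continuousOn hF
  refine ⟨max M 0, le_max_right _ _, ?_⟩
  filter_upwards [ae_restrict_mem measurableSet_Ioc] with s hs
  exact (hM s (Ioc_subset_Icc_self hs)).trans (le_max_left _ _)

lemma continuousOn_duh_of_continuousOn (hK : WeakSing K C a T) (hT : 0 ≤ T) (ha0 : 0 ≤ a) (ha : a < 1)
    (hC : 0 ≤ C) {F : ℝ → Y} (hF : ContinuousOn F (Icc 0 T)) : ContinuousOn (duh K F) (Icc 0 T) := by
  obtain ⟨h1, M, hM0, hM⟩ := continuousOn_bdd_aux hF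
  exact continuousOn_duh hK hT ha0 ha hC hM0 h1 hM

/-- The exponential weight buys a factor κ^(-b) at the price of a singularity stronger by b. Large κ
thereby makes the Volterra operator small on the whole interval. -/
lemma WeakSing.exp_smul (hK : WeakSing K C a T) (hC : 0 ≤ C) {b κ : ℝ} (hb : 0 ≤ b) (hb2 : b ≤ 2) (hκ : 0 < κ) :
    WeakSing (fun r => Real.exp (-(κ * r)) • K r) (C * (2 * κ ^ (-b))) (a + b) T := by
  refine ⟨(Continuous.continuousOn (by fun_prop : Continuous fun r => Real.exp (-(κ * r)))).smul hK.cont,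
    fun r hr => ?_⟩
  have hr0 := hr.1
  rw [norm_smul, Real.norm_eq_abs, Real.abs_exp]
  calc _ ≤ (2 * (κ * r) ^ (-b)) * (C * r ^ (-a)) :=
        mul_le_mul (exp_neg_le_rpow (by positivity) hb hb2) (hK.bound r hr) (norm_nonneg _) (by positivity)
    _ = _ := by rw [neg_add, Real.rpow_add hr0, Real.mul_rpow hκ.le hr0.le]; ring

/-- A solution of the exponentially weighted Volterra equation corresponds to one of the original. -/
lemma weighted_duh_eq (κ : ℝ) (F : ℝ → W → Y) (w : ℝ → W) (t : ℝ) :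
    duh (fun r => Real.exp (-(κ * r)) • K r)
      (fun s => Real.exp (-(κ * s)) • F s (w s)) t
      = Real.exp (-(κ * t)) • duh K (fun s => F s (w s)) t := by
  simp only [duh]
  rw [← intervalIntegral.integral_smul]
  refine intervalIntegral.integral_congr fun s _ => ?_
  simp only [map_smul, smul_apply, smul_smul]
  rw [← Real.exp_add]
  congr 2
  ring

/-- The contraction associated with a Volterra equation. -/
lemma exists_contraction [CompleteSpace W] (hK : WeakSing K C a T) (hT : 0 ≤ T) (ha0 : 0 ≤ a) (ha : a < 1)
    (hC : 0 ≤ C) {F : ℝ → W → Y} {L : ℝ} (hL : 0 ≤ L)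
    (hLip : ∀ s ∈ Icc 0 T, ∀ u v, ‖F s u - F s v‖ ≤ L * ‖u - v‖)
    (hF : ∀ w : ℝ → W, ContinuousOn w (Icc 0 T) → ContinuousOn (fun s => F s (w s)) (Icc 0 T))
    {b : ℝ → W} (hb : ContinuousOn b (Icc 0 T)) :
    ∃ (κ : ℝ) (Θ : C(Icc 0 T, W) → C(Icc 0 T, W)), ContractingWith (1 / 2) Θ ∧
      ∀ (w : ℝ → W) (hw : ContinuousOn w (Icc 0 T)) (t : Icc 0 T),
        Θ ⟨_, ContinuousOn.domRestrict (f := fun t => Real.exp (-(κ * t)) • w t)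
          (ContinuousOn.smul (by fun_prop) hw)⟩ t
        = Real.exp (-(κ * t)) • (b t + duh K (fun s => F s (w s)) t) := by
  set c := (1 - a) / 2 with hc
  have hc0 : 0 < c := by rw [hc]; linarith
  have hac : a + c < 1 := by rw [hc]; linarith
  set D := L * C * 2 * (T ^ (1 - (a + c)) / (1 - (a + c))) with hD
  -- `D` times κ^(-c) is the Lipschitz constant of the weighted map, so κ can be taken with
  -- contraction factor 1/2 irrespective of T and L.
  have hlim : Tendsto (fun κ : ℝ => D * κ ^ (-c)) atTop (𝓝 0) := by
    simpa using (tendsto_rpow_neg_atTop hc0).const_mul D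
  obtain ⟨κ, hκ1, hκ0⟩ := ((hlim.eventually (gt_mem_nhds (by norm_num : (0 : ℝ) < 1 / 2))).and
    (eventually_gt_atTop 0)).exists
  have hK' := hK.exp_smul (b := c) hC hc0.le (by rw [hc]; linarith) hκ0
  set K' := fun r => Real.exp (-(κ * r)) • K r
  -- The unknown is e^{-κt}w: the weight is undone before the nonlinearity is applied and restored
  -- afterwards, so the Lipschitz constant does not change.
  set Fw : C(Icc 0 T, W) → ℝ → Y := fun w s =>
    Real.exp (-(κ * s)) • F s (Real.exp (κ * s) • IccExtend hT w s) with hFw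
  have hFc : ∀ w, ContinuousOn (Fw w) (Icc 0 T) := fun w => by
    refine ContinuousOn.smul (by fun_prop) (hF _ ?_)
    refine ContinuousOn.smul (by fun_prop) ?_
    exact (w.continuous.Icc_extend' (h := hT)).continuousOn
  have hC' : 0 ≤ C * (2 * κ ^ (-c)) := by positivity
  refine ⟨κ, fun w => ⟨_, ContinuousOn.domRestrict (f := fun t => Real.exp (-(κ * t)) • b t + duh K' (Fw w) t)
    ((ContinuousOn.smul (by fun_prop) hb).add
      (continuousOn_duh_of_continuousOn hK' hT (by positivity) hac hC' (hFc w)))⟩, ⟨?_, ?_⟩, ?_⟩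
  · rw [← NNReal.coe_lt_coe]; norm_num
  · refine LipschitzWith.of_dist_le_mul fun w v => ?_
    rw [ContinuousMap.dist_le (by positivity)]
    intro t
    simp only [ContinuousMap.coe_mk, domRestrict_apply]
    rw [dist_add_left, dist_eq_norm]
    have e : duh K' (Fw w) t - duh K' (Fw v) t = duh K' (fun s => Fw w s - Fw v s) t := by
      obtain ⟨m1, M1, _, hM1⟩ := continuousOn_bdd_aux (hFc w)
      obtain ⟨m2, M2, _, hM2⟩ := continuousOn_bdd_aux (hFc v)
      simp only [duh]
      rw [← intervalIntegral.integral_sub (intervalIntegrable_kernel hK' hac m1 hM1 t.2)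
        (intervalIntegrable_kernel hK' hac m2 hM2 t.2)]
      simp only [map_sub]
    rw [e]
    refine (norm_duh_le hK' hac hC' (M := L * dist w v) (by positivity) ?_ t.2).trans ?_
    · filter_upwards [ae_restrict_mem measurableSet_Ioc] with s hs
      have hs' : s ∈ Icc 0 T := Ioc_subset_Icc_self hs
      simp only [hFw]
      rw [← smul_sub, norm_smul, Real.norm_eq_abs, Real.abs_exp]
      have h1 := hLip s hs' (Real.exp (κ * s) • IccExtend hT w s) (Real.exp (κ * s) • IccExtend hT v s)
      rw [← smul_sub, norm_smul, Real.norm_eq_abs, Real.abs_exp] at h1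
      rw [IccExtend_of_mem _ _ hs', IccExtend_of_mem _ _ hs'] at h1 ⊢
      have h2 : ‖w ⟨s, hs'⟩ - v ⟨s, hs'⟩‖ ≤ dist w v := by
        rw [← dist_eq_norm]; exact ContinuousMap.dist_apply_le_dist _
      calc _ ≤ Real.exp (-(κ * s)) * (L * (Real.exp (κ * s) * ‖w ⟨s, hs'⟩ - v ⟨s, hs'⟩‖)) := by gcongr
        _ = (Real.exp (-(κ * s)) * Real.exp (κ * s)) * (L * ‖w ⟨s, hs'⟩ - v ⟨s, hs'⟩‖) := by ring
        _ ≤ _ := by rw [← Real.exp_add, neg_add_cancel, Real.exp_zero, one_mul]; gcongr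
    · have : L * dist w v * (C * (2 * κ ^ (-c))) * (T ^ (1 - (a + c)) / (1 - (a + c)))
        = (D * κ ^ (-c)) * dist w v := by rw [hD]; ring
      rw [this]
      refine mul_le_mul_of_nonneg_right (hκ1.le.trans_eq ?_) dist_nonneg
      simp
  · intro w hw t
    simp only [ContinuousMap.coe_mk, domRestrict_apply]
    rw [smul_add, ← weighted_duh_eq]
    congr 1
    simp only [duh]
    refine intervalIntegral.integral_congr fun s hs => ?_
    rw [uIcc_of_le t.2.1] at hs
    have hs' : s ∈ Icc 0 T := ⟨hs.1, hs.2.trans t.2.2⟩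
    simp only [hFw]
    rw [IccExtend_of_mem _ _ hs']
    simp only [ContinuousMap.coe_mk, domRestrict_apply]
    rw [smul_smul, ← Real.exp_add, add_neg_cancel, Real.exp_zero, one_smul]

theorem volterra_exists [CompleteSpace W] (hK : WeakSing K C a T) (hT : 0 ≤ T) (ha0 : 0 ≤ a) (ha : a < 1)
    (hC : 0 ≤ C) {F : ℝ → W → Y} {L : ℝ} (hL : 0 ≤ L)
    (hLip : ∀ s ∈ Icc 0 T, ∀ u v, ‖F s u - F s v‖ ≤ L * ‖u - v‖)
    (hF : ∀ w : ℝ → W, ContinuousOn w (Icc 0 T) → ContinuousOn (fun s => F s (w s)) (Icc 0 T))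
    {b : ℝ → W} (hb : ContinuousOn b (Icc 0 T)) :
    ∃ w : ℝ → W, ContinuousOn w (Icc 0 T) ∧
      ∀ t ∈ Icc 0 T, w t = b t + duh K (fun s => F s (w s)) t := by
  obtain ⟨κ, Θ, hΘ, hrep⟩ := exists_contraction hK hT ha0 ha hC hL hLip hF hb
  set z := ContractingWith.fixedPoint Θ hΘ
  have hz : Θ z = z := hΘ.fixedPoint_isFixedPt
  have hw : ContinuousOn (fun t => Real.exp (κ * t) • IccExtend hT z t) (Icc 0 T) :=
    ContinuousOn.smul (by fun_prop) (z.continuous.Icc_extend' (h := hT)).continuousOn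
  refine ⟨_, hw, fun t ht => ?_⟩
  have h1 := hrep _ hw ⟨t, ht⟩
  have h2 : (⟨_, ContinuousOn.domRestrict (f := fun t => Real.exp (-(κ * t)) • (Real.exp (κ * t) • IccExtend hT z t))
          (ContinuousOn.smul (by fun_prop) hw)⟩ : C(Icc 0 T, W)) = z := by
    ext s
    simp only [ContinuousMap.coe_mk, domRestrict_apply]
    rw [smul_smul, ← Real.exp_add, neg_add_cancel, Real.exp_zero, one_smul, IccExtend_of_mem _ _ s.2]
  rw [h2, hz] at h1
  rw [IccExtend_of_mem _ _ ht, h1, smul_smul, ← Real.exp_add, add_neg_cancel, Real.exp_zero, one_smul]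

theorem volterra_unique [CompleteSpace W] (hK : WeakSing K C a T) (hT : 0 ≤ T) (ha0 : 0 ≤ a) (ha : a < 1)
    (hC : 0 ≤ C) {F : ℝ → W → Y} {L : ℝ} (hL : 0 ≤ L)
    (hLip : ∀ s ∈ Icc 0 T, ∀ u v, ‖F s u - F s v‖ ≤ L * ‖u - v‖)
    (hF : ∀ w : ℝ → W, ContinuousOn w (Icc 0 T) → ContinuousOn (fun s => F s (w s)) (Icc 0 T))
    {b : ℝ → W} (hb : ContinuousOn b (Icc 0 T)) {w v : ℝ → W}
    (hw : ContinuousOn w (Icc 0 T)) (hv : ContinuousOn v (Icc 0 T))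
    (hweq : ∀ t ∈ Icc 0 T, w t = b t + duh K (fun s => F s (w s)) t)
    (hveq : ∀ t ∈ Icc 0 T, v t = b t + duh K (fun s => F s (v s)) t) :
    ∀ t ∈ Icc 0 T, w t = v t := by
  obtain ⟨κ, Θ, hΘ, hrep⟩ := exists_contraction hK hT ha0 ha hC hL hLip hF hb
  have key : ∀ (w : ℝ → W) (hw : ContinuousOn w (Icc 0 T))
      (_ : ∀ t ∈ Icc 0 T, w t = b t + duh K (fun s => F s (w s)) t),
      Function.IsFixedPt Θ ⟨_, ContinuousOn.domRestrict (f := fun t => Real.exp (-(κ * t)) • w t)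
          (ContinuousOn.smul (by fun_prop) hw)⟩ := fun w hw h => by
    ext t
    rw [hrep w hw t, ← h t t.2]; rfl
  intro t ht
  have := hΘ.fixedPoint_unique' (key w hw hweq) (key v hv hveq)
  have := congrArg (fun z : C(Icc 0 T, W) => z ⟨t, ht⟩) this
  simp only [ContinuousMap.coe_mk, domRestrict_apply] at this
  exact smul_right_injective W (Real.exp_pos _).ne' this

end Volterra

end GBH

/-! ### Superposition operators of polynomial growth. -/

noncomputable section
namespace GBH

section Nemytskii

/-- Hölder's inequality with one factor `h` at a time; each factor adds 1/M to the reciprocal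
exponent. -/
lemma eLpNorm_pow_mul_le {M : ℝ} (hM : 0 < M) {h z : ℝ → ℝ} (hh : AEStronglyMeasurable h mu)
    (hz : AEStronglyMeasurable z mu) (k : ℕ) :
    eLpNorm (fun x => h x ^ k * z x) (ENNReal.ofReal (M / (k + 1))) mu
      ≤ eLpNorm h (ENNReal.ofReal M) mu ^ k * eLpNorm z (ENNReal.ofReal M) mu := by
  induction k with
  | zero => simp
  | succ k ih =>
    have ht : ENNReal.HolderTriple (ENNReal.ofReal M) (ENNReal.ofReal (M / (k + 1)))
        (ENNReal.ofReal (M / ((k + 1 : ℕ) + 1))) := by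
      constructor
      rw [← ENNReal.ofReal_inv_of_pos hM, ← ENNReal.ofReal_inv_of_pos (by positivity),
        ← ENNReal.ofReal_inv_of_pos (by positivity), ← ENNReal.ofReal_add (by positivity) (by positivity)]
      congr 1
      push_cast
      field_simp
      ring
    have := eLpNorm_smul_le_mul_eLpNorm (p := ENNReal.ofReal M) (q := ENNReal.ofReal (M / (k + 1)))
      (r := ENNReal.ofReal (M / ((k + 1 : ℕ) + 1))) (μ := mu) (f := fun x => h x ^ k * z x) (φ := h) ((hh.pow k).mul hz) hh
    calc _ = eLpNorm (h • fun x => h x ^ k * z x) (ENNReal.ofReal (M / ((k + 1 : ℕ) + 1))) mu := by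
          congr 1; funext x; simp only [Pi.smul_apply', smul_eq_mul]; ring
      _ ≤ _ := this
      _ ≤ eLpNorm h (ENNReal.ofReal M) mu * (eLpNorm h (ENNReal.ofReal M) mu ^ k *
          eLpNorm z (ENNReal.ofReal M) mu) := by gcongr
      _ = _ := by rw [pow_succ']; ring

lemma eLpNorm_pow_mul_le' {M r : ℝ} {h z : ℝ → ℝ} (hh : AEStronglyMeasurable h mu)
    (hz : AEStronglyMeasurable z mu) (k : ℕ) (hr : 0 < r) (hrM : r * (k + 1) ≤ M) :
    eLpNorm (fun x => h x ^ k * z x) (ENNReal.ofReal r) mu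
      ≤ eLpNorm h (ENNReal.ofReal M) mu ^ k * eLpNorm z (ENNReal.ofReal M) mu := by
  refine (eLpNorm_mono_exponent (ENNReal.ofReal_le_ofReal ?_) ((hh.pow k).mul hz)).trans
    (eLpNorm_pow_mul_le (lt_of_lt_of_le (by positivity) hrM) hh hz k)
  rwa [le_div_iff₀ (by positivity)]

/-- A nonlinearity of polynomial growth `k + 1`, with constant `C`. -/
structure PolyGrowth (g : ℝ → ℝ) (C : ℝ) (k : ℕ) : Prop where
  zero : g 0 = 0
  cont : Continuous g
  nonneg : 0 ≤ C
  lip : ∀ a b, |g a - g b| ≤ C * ((1 + |a| + |b|) ^ k * |a - b|)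

variable {g : ℝ → ℝ} {C : ℝ} {k : ℕ} {p r : ℝ}

/-- The pointwise local Lipschitz bound is a product of k + 1 factors, each measured in L^p. The
condition r(k+1) ≤ p is what Hölder requires on a probability space. -/
lemma PolyGrowth.eLpNorm_sub_le (hg : PolyGrowth g C k) (hr : 0 < r) (hrp : r * (k + 1) ≤ p)
    {u v : ℝ → ℝ} (hu : AEStronglyMeasurable u mu) (hv : AEStronglyMeasurable v mu) :
    eLpNorm (fun x => g (u x) - g (v x)) (ENNReal.ofReal r) mu ≤ ENNReal.ofReal C *
      (eLpNorm (fun x => 1 + |u x| + |v x|) (ENNReal.ofReal p) mu ^ k *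
        eLpNorm (fun x => u x - v x) (ENNReal.ofReal p) mu) := by
  have h1 := eLpNorm_pow_mul_le' (M := p) (r := r) (h := fun x => 1 + |u x| + |v x|)
    (z := fun x => u x - v x) ((aestronglyMeasurable_const.add hu.norm).add hv.norm) (hu.sub hv) k hr hrp
  refine le_trans ?_ (mul_le_mul_right h1 _)
  have h2 := eLpNorm_le_mul_eLpNorm_of_ae_le_mul (μ := mu) (f := fun x => g (u x) - g (v x))
    (g := fun x => (1 + |u x| + |v x|) ^ k * (u x - v x)) (c := C) (ae_of_all _ fun x => ?_) (ENNReal.ofReal r)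
  · exact h2
  · rw [Real.norm_eq_abs, Real.norm_eq_abs, abs_mul, abs_of_nonneg (by positivity : 0 ≤ (1 + |u x| + |v x|) ^ k)]
    exact hg.lip _ _

lemma memLp_one_add_abs {q : ℝ≥0∞} {u v : ℝ → ℝ} (hu : MemLp u q mu) (hv : MemLp v q mu) :
    MemLp (fun x => 1 + |u x| + |v x|) q mu :=
  MemLp.add (f := fun x => 1 + |u x|) (g := fun x => |v x|)
    (MemLp.add (f := fun _ => (1 : ℝ)) (g := fun x => |u x|) (memLp_const 1) hu.norm) hv.norm

lemma eLpNorm_one_add_abs_le {q : ℝ≥0∞} (hq : 1 ≤ q) {u v : ℝ → ℝ} (hu : AEStronglyMeasurable u mu)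
    (hv : AEStronglyMeasurable v mu) :
    eLpNorm (fun x => 1 + |u x| + |v x|) q mu ≤ 1 + eLpNorm u q mu + eLpNorm v q mu := by
  have h1 : eLpNorm (fun x => |u x|) q mu = eLpNorm u q mu := eLpNorm_norm u
  have h2 : eLpNorm (fun x => |v x|) q mu = eLpNorm v q mu := eLpNorm_norm v
  have h3 : eLpNorm (fun _ : ℝ => (1 : ℝ)) q mu = 1 := by
    rw [eLpNorm_const _ (zero_lt_one.trans_le hq).ne' (NeZero.ne mu)]; simp
  have h4 := eLpNorm_add_le (μ := mu) (f := fun _ : ℝ => (1 : ℝ)) (g := fun x => |u x|)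
    aestronglyMeasurable_const hu.norm hq
  have h5 := eLpNorm_add_le (μ := mu) (f := fun x => 1 + |u x|) (g := fun x => |v x|)
    (aestronglyMeasurable_const.add hu.norm) hv.norm hq
  rw [← h1, ← h2]
  refine h5.trans (add_le_add (h4.trans ?_) le_rfl)
  rw [h3]

lemma PolyGrowth.memLp (hg : PolyGrowth g C k) (hr : 0 < r) (hrp : r * (k + 1) ≤ p)
    {u : ℝ → ℝ} (hu : MemLp u (ENNReal.ofReal p) mu) : MemLp (fun x => g (u x)) (ENNReal.ofReal r) mu := by
  refine ⟨hg.cont.comp_aestronglyMeasurable hu.1, ?_⟩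
  have h1 := hg.eLpNorm_sub_le hr hrp hu.1 (v := fun _ => 0) aestronglyMeasurable_const
  simp only [hg.zero, sub_zero] at h1
  refine h1.trans_lt (ENNReal.mul_lt_top ENNReal.ofReal_lt_top (ENNReal.mul_lt_top ?_ hu.2))
  exact ENNReal.pow_lt_top (memLp_one_add_abs hu (memLp_const 0)).2

/-- The superposition operator of a nonlinearity. -/
def nemy (hg : PolyGrowth g C k) (hr : 0 < r) (hrp : r * (k + 1) ≤ p) (u : Lp ℝ (ENNReal.ofReal p) mu) :
    Lp ℝ (ENNReal.ofReal r) mu := (hg.memLp hr hrp (Lp.memLp u)).toLp _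

lemma coeFn_nemy (hg : PolyGrowth g C k) (hr : 0 < r) (hrp : r * (k + 1) ≤ p)
    (u : Lp ℝ (ENNReal.ofReal p) mu) : nemy hg hr hrp u =ᵐ[mu] fun x => g (u x) :=
  (hg.memLp hr hrp (Lp.memLp u)).coeFn_toLp

variable [hp1 : Fact (1 ≤ ENNReal.ofReal p)]

lemma norm_nemy_sub_le (hg : PolyGrowth g C k) (hr : 0 < r) (hrp : r * (k + 1) ≤ p)
    (u v : Lp ℝ (ENNReal.ofReal p) mu) :
    ‖nemy hg hr hrp u - nemy hg hr hrp v‖ ≤ C * ((1 + ‖u‖ + ‖v‖) ^ k * ‖u - v‖) := by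
  have h1 := hg.eLpNorm_sub_le hr hrp (Lp.memLp u).1 (Lp.memLp v).1
  rw [nemy, nemy, ← MemLp.toLp_sub, Lp.norm_toLp]
  have hp1 := hp1.out
  have h2 : eLpNorm (fun x => 1 + |u x| + |v x|) (ENNReal.ofReal p) mu ≤
      ENNReal.ofReal (1 + ‖u‖ + ‖v‖) := by
    refine (eLpNorm_one_add_abs_le hp1 (Lp.memLp u).1 (Lp.memLp v).1).trans_eq ?_
    rw [ENNReal.ofReal_add (by positivity) (norm_nonneg _), ENNReal.ofReal_add zero_le_one (norm_nonneg _),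
      Lp.norm_def, Lp.norm_def, ENNReal.ofReal_toReal (Lp.memLp u).2.ne,
      ENNReal.ofReal_toReal (Lp.memLp v).2.ne, ENNReal.ofReal_one]
  have h3 : eLpNorm (fun x => u x - v x) (ENNReal.ofReal p) mu = ENNReal.ofReal ‖u - v‖ := by
    rw [Lp.norm_def, ENNReal.ofReal_toReal (Lp.memLp (u - v)).2.ne]
    exact eLpNorm_congr_ae (Lp.coeFn_sub u v).symm
  refine ENNReal.toReal_le_of_le_ofReal (mul_nonneg hg.nonneg (by positivity)) (h1.trans ?_)
  rw [ENNReal.ofReal_mul hg.nonneg, ENNReal.ofReal_mul (by positivity), ENNReal.ofReal_pow (by positivity), h3]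
  gcongr

lemma continuous_nemy [Fact (1 ≤ ENNReal.ofReal r)] (hg : PolyGrowth g C k) (hr : 0 < r) (hrp : r * (k + 1) ≤ p) :
    Continuous (nemy hg hr hrp) := by
  rw [continuous_iff_continuousAt]
  intro u
  rw [ContinuousAt, tendsto_iff_norm_sub_tendsto_zero]
  have h : Tendsto (fun v : Lp ℝ (ENNReal.ofReal p) mu => C * ((1 + ‖v‖ + ‖u‖) ^ k * ‖v - u‖)) (𝓝 u) (𝓝 0) := by
    have hc : Continuous fun v : Lp ℝ (ENNReal.ofReal p) mu => C * ((1 + ‖v‖ + ‖u‖) ^ k * ‖v - u‖) := by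
      fun_prop
    simpa using hc.tendsto u
  exact squeeze_zero (fun v => norm_nonneg _) (fun v => norm_nemy_sub_le hg hr hrp v u) h

end Nemytskii

lemma abs_pow_sub_pow_le_aux (a b : ℝ) (n : ℕ) :
    |a ^ (n + 1) - b ^ (n + 1)| ≤ (n + 1) * ((1 + |a| + |b|) ^ n * |a - b|) := by
  have h := abs_pow_sub_pow_le a b (n + 1)
  have h2 : max |a| |b| ≤ 1 + |a| + |b| :=
    max_le (by linarith [abs_nonneg b]) (by linarith [abs_nonneg a])
  calc _ ≤ |a - b| * (n + 1 : ℕ) * max |a| |b| ^ n := h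
    _ ≤ |a - b| * (n + 1 : ℕ) * (1 + |a| + |b|) ^ n := by gcongr
    _ = _ := by push_cast; ring

lemma polyGrowth_pp (δ : ℕ) : PolyGrowth (pp δ) (δ + 1) δ where
  zero := by simp [pp]
  cont := by unfold pp; fun_prop
  nonneg := by positivity
  lip a b := abs_pow_sub_pow_le_aux a b δ

lemma cc_eq (γ : ℝ) (δ : ℕ) (u : ℝ) :
    cc γ δ u = (1 + γ) * u ^ (δ + 1) - γ * u - u ^ (2 * δ + 1) := by
  unfold cc; ring

lemma polyGrowth_cc {γ : ℝ} (hγ : 0 < γ) (δ : ℕ) :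
    PolyGrowth (cc γ δ) ((1 + γ) * (δ + 1) + γ + (2 * δ + 1)) (2 * δ) where
  zero := by simp [cc]
  cont := by unfold cc; fun_prop
  nonneg := by positivity
  lip a b := by
    rw [cc_eq, cc_eq]
    have h1 := abs_pow_sub_pow_le_aux a b δ
    have h2 := abs_pow_sub_pow_le_aux a b (2 * δ)
    push_cast at h2
    set h := 1 + |a| + |b| with hh
    have hh1 : 1 ≤ h := by rw [hh]; linarith [abs_nonneg a, abs_nonneg b]
    have h3 : h ^ δ ≤ h ^ (2 * δ) := pow_le_pow_right₀ hh1 (by omega)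
    have h4 : 1 ≤ h ^ (2 * δ) := one_le_pow₀ hh1
    have h5 := abs_nonneg (a - b)
    have e : (1 + γ) * a ^ (δ + 1) - γ * a - a ^ (2 * δ + 1) - ((1 + γ) * b ^ (δ + 1) - γ * b - b ^ (2 * δ + 1))
      = (1 + γ) * (a ^ (δ + 1) - b ^ (δ + 1)) - γ * (a - b) - (a ^ (2 * δ + 1) - b ^ (2 * δ + 1)) := by ring
    rw [e]
    calc _ ≤ |(1 + γ) * (a ^ (δ + 1) - b ^ (δ + 1))| + |γ * (a - b)| + |a ^ (2 * δ + 1) - b ^ (2 * δ + 1)| :=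
          (abs_sub _ _).trans (add_le_add_left (abs_sub _ _) _)
      _ = (1 + γ) * |a ^ (δ + 1) - b ^ (δ + 1)| + γ * (1 * |a - b|) + |a ^ (2 * δ + 1) - b ^ (2 * δ + 1)| := by
          rw [abs_mul, abs_mul, abs_of_pos hγ, abs_of_pos (by linarith : 0 < 1 + γ), one_mul]
      _ ≤ (1 + γ) * ((δ + 1) * (h ^ (2 * δ) * |a - b|)) + γ * (h ^ (2 * δ) * |a - b|)
          + (2 * δ + 1) * (h ^ (2 * δ) * |a - b|) := by
          gcongr
          exact h1.trans (by gcongr)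
      _ = _ := by ring

/-! ### Radial retraction onto a ball. -/

section Retraction
variable {V : Type*} [NormedAddCommGroup V] [NormedSpace ℝ V]

/-- The radial retraction onto the closed ball of radius `R`. -/
def radial (R : ℝ) (x : V) : V := if ‖x‖ ≤ R then x else (R / ‖x‖) • x

lemma radial_of_le {R : ℝ} {x : V} (h : ‖x‖ ≤ R) : radial R x = x := if_pos h

lemma norm_radial_le {R : ℝ} (hR : 0 ≤ R) (x : V) : ‖radial R x‖ ≤ R := by
  unfold radial
  split_ifs with h
  · exact h
  · have : 0 < ‖x‖ := hR.trans_lt (not_le.1 h)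
    rw [norm_smul, Real.norm_eq_abs, abs_of_nonneg (by positivity), div_mul_cancel₀ _ this.ne']

/-- In a general normed space the retraction need not be 1-Lipschitz. Splitting the difference into
a rescaled x - y and a change of length, each at most ‖x - y‖, gives the constant 2. -/
lemma norm_radial_sub_le_aux {R : ℝ} (hR : 0 ≤ R) {x y : V} (hxy : ‖x‖ ≤ ‖y‖) :
    ‖radial R x - radial R y‖ ≤ 2 * ‖x - y‖ := by
  have h0 := norm_sub_norm_le y x
  rw [norm_sub_rev] at h0
  have hn := norm_nonneg (x - y)
  by_cases hy : ‖y‖ ≤ R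
  · rw [radial_of_le hy, radial_of_le (hxy.trans hy)]; linarith
  · have hy0 : 0 < ‖y‖ := hR.trans_lt (not_le.1 hy)
    by_cases hx : ‖x‖ ≤ R
    · rw [radial_of_le hx, radial, if_neg hy]
      have e : x - (R / ‖y‖) • y = (x - y) + (1 - R / ‖y‖) • y := by rw [sub_smul, one_smul]; abel
      rw [e]
      refine (norm_add_le _ _).trans ?_
      rw [norm_smul, Real.norm_eq_abs, abs_of_nonneg, sub_mul, one_mul, div_mul_cancel₀ _ hy0.ne']
      · linarith
      · rw [sub_nonneg, div_le_one hy0]; exact (not_le.1 hy).le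
    · have hx0 : 0 < ‖x‖ := hR.trans_lt (not_le.1 hx)
      rw [radial, radial, if_neg hx, if_neg hy]
      have e : (R / ‖x‖) • x - (R / ‖y‖) • y = (R / ‖x‖) • (x - y) + (R / ‖x‖ - R / ‖y‖) • y := by
        rw [smul_sub, sub_smul]; abel
      rw [e]
      refine (norm_add_le _ _).trans ?_
      rw [norm_smul, norm_smul, Real.norm_eq_abs, Real.norm_eq_abs, abs_of_nonneg (by positivity), abs_of_nonneg,
        sub_mul, div_mul_cancel₀ _ hy0.ne']
      · have h1 : R / ‖x‖ ≤ 1 := by rw [div_le_one hx0]; exact (not_le.1 hx).le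
        have h2 : R / ‖x‖ * ‖y‖ - R ≤ R / ‖x‖ * ‖x - y‖ := by
          have : R = R / ‖x‖ * ‖x‖ := (div_mul_cancel₀ _ hx0.ne').symm
          nth_rewrite 2 [this]
          rw [← mul_sub]
          gcongr
        nlinarith
      · rw [sub_nonneg]; gcongr

lemma norm_radial_sub_le {R : ℝ} (hR : 0 ≤ R) (x y : V) :
    ‖radial R x - radial R y‖ ≤ 2 * ‖x - y‖ := by
  rcases le_total ‖x‖ ‖y‖ with h | h
  · exact norm_radial_sub_le_aux hR h
  · rw [norm_sub_rev, norm_sub_rev x y]; exact norm_radial_sub_le_aux hR h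

lemma continuous_radial {R : ℝ} (hR : 0 ≤ R) : Continuous (radial R : V → V) :=
  (LipschitzWith.of_dist_le_mul (K := 2) fun x y => by
    rw [dist_eq_norm, dist_eq_norm]; exact norm_radial_sub_le hR x y).continuous

end Retraction

end GBH

/-! ### Fourier analysis in L² and the space H¹₀. -/

noncomputable section
namespace GBH

/-- The Hilbert space `L²(0,1)`. -/
abbrev H2 := Lp ℝ 2 mu

/-- The cosine basis as bounded continuous functions. -/
def cbX (k : ℕ) : X := X.mk (cb k) (continuous_cb k) 2 (abs_cb_le k)

@[simp] lemma cbX_apply (k : ℕ) (x : ℝ) : cbX k x = cb k x := rfl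

/-- The sine coefficients of a function. -/
def sc (k : ℕ) (f : ℝ → ℝ) : ℝ := ∫ x, sf k x * f x ∂mu

/-- The coefficients of a function in the cosine basis. -/
def kc (k : ℕ) (f : ℝ → ℝ) : ℝ := ∫ x, cb k x * f x ∂mu

lemma sc_congr {k : ℕ} {f g : ℝ → ℝ} (h : f =ᵐ[mu] g) : sc k f = sc k g :=
  integral_congr_ae (h.mono fun x hx => by simp only [hx])

lemma kc_congr {k : ℕ} {f g : ℝ → ℝ} (h : f =ᵐ[mu] g) : kc k f = kc k g :=
  integral_congr_ae (h.mono fun x hx => by simp only [hx])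

lemma inner_toE (b : X) (f : H2) : inner ℝ (toE 2 b) f = ∫ x, b x * f x ∂mu := by
  rw [L2.inner_def]
  refine integral_congr_ae ?_
  filter_upwards [coeFn_toE 2 b] with x hx
  rw [hx]
  simp [mul_comm]

lemma integral_mul_toE (b c : X) : ∫ x, b x * toE 2 c x ∂mu = ∫ x, b x * c x ∂mu :=
  integral_congr_ae ((coeFn_toE 2 c).mono fun x hx => by simp only [hx])

lemma orthonormal_sX : Orthonormal ℝ fun k => toE 2 (sX k) := by
  rw [orthonormal_iff_ite]
  intro i j
  rw [inner_toE, integral_mul_toE]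
  exact integral_sf_mul_sf i j

lemma orthonormal_cbX : Orthonormal ℝ fun k => toE 2 (cbX k) := by
  rw [orthonormal_iff_ite]
  intro i j
  rw [inner_toE, integral_mul_toE]
  exact integral_cb_mul_cb i j

/-- The sine Hilbert basis. -/
def sB : HilbertBasis ℕ ℝ H2 :=
  HilbertBasis.mk orthonormal_sX (span_sf_closure (q := 2) (by simp)).ge

/-- The cosine Hilbert basis. -/
def cB : HilbertBasis ℕ ℝ H2 :=
  HilbertBasis.mk orthonormal_cbX (span_cb_closure (q := 2) (by simp)).ge

lemma sB_apply (k : ℕ) : sB k = toE 2 (sX k) :=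
  congrFun (HilbertBasis.coe_mk orthonormal_sX _) k
lemma cB_apply (k : ℕ) : cB k = toE 2 (cbX k) :=
  congrFun (HilbertBasis.coe_mk orthonormal_cbX _) k

lemma inner_sB (k : ℕ) (f : H2) : inner ℝ (sB k) f = sc k f := by rw [sB_apply, inner_toE]; rfl
lemma inner_cB (k : ℕ) (f : H2) : inner ℝ (cB k) f = kc k f := by rw [cB_apply, inner_toE]; rfl

lemma hasSum_sc (f : H2) : HasSum (fun k => sc k f • toE 2 (sX k)) f := by
  have h := sB.hasSum_repr f
  have e : (fun k => sc k f • toE 2 (sX k)) = fun k => sB.repr f k • sB k := by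
    funext k; rw [sB.repr_apply_apply, inner_sB, sB_apply]
  rwa [e]

lemma hasSum_kc (f : H2) : HasSum (fun k => kc k f • toE 2 (cbX k)) f := by
  have h := cB.hasSum_repr f
  have e : (fun k => kc k f • toE 2 (cbX k)) = fun k => cB.repr f k • cB k := by
    funext k; rw [cB.repr_apply_apply, inner_cB, cB_apply]
  rwa [e]

lemma hasSum_sc_sq (f : H2) : HasSum (fun k => sc k f ^ 2) (‖f‖ ^ 2) := by
  have h := sB.hasSum_inner_mul_inner f f
  rw [real_inner_self_eq_norm_sq] at h
  have e : (fun k => sc k f ^ 2) = fun k => inner ℝ f (sB k) * inner ℝ (sB k) f := by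
    funext k; rw [real_inner_comm (sB k) f, inner_sB, sq]
  rwa [e]

lemma hasSum_kc_sq (f : H2) : HasSum (fun k => kc k f ^ 2) (‖f‖ ^ 2) := by
  have h := cB.hasSum_inner_mul_inner f f
  rw [real_inner_self_eq_norm_sq] at h
  have e : (fun k => kc k f ^ 2) = fun k => inner ℝ f (cB k) * inner ℝ (cB k) f := by
    funext k; rw [real_inner_comm (cB k) f, inner_cB, sq]
  rwa [e]

lemma eq_of_sc_eq {f g : H2} (h : ∀ k, sc k f = sc k g) : f = g := by
  have hf := hasSum_sc f
  simp only [h] at hf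
  exact hf.unique (hasSum_sc g)

lemma eq_of_kc_eq {f g : H2} (h : ∀ k, kc k f = kc k g) : f = g := by
  have hf := hasSum_kc f
  simp only [h] at hf
  exact hf.unique (hasSum_kc g)

lemma ae_eq_of_sc_eq {f g : ℝ → ℝ} (hf : MemLp f 2 mu) (hg : MemLp g 2 mu) (h : ∀ k, sc k f = sc k g) :
    f =ᵐ[mu] g := by
  have : hf.toLp f = hg.toLp g := eq_of_sc_eq fun k => by
    rw [sc_congr hf.coeFn_toLp, sc_congr hg.coeFn_toLp, h]
  exact hf.coeFn_toLp.symm.trans (this ▸ hg.coeFn_toLp)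

lemma exists_kc_eq {c : ℕ → ℝ} (hc : Summable fun k => c k ^ 2) : ∃ f : H2, ∀ k, kc k f = c k := by
  have hm : Memℓp c 2 := by
    refine memℓp_gen ?_
    simpa using hc
  refine ⟨cB.repr.symm ⟨c, hm⟩, fun k => ?_⟩
  rw [← inner_cB, ← cB.repr_apply_apply, LinearIsometryEquiv.apply_symm_apply]

lemma memLp_X_mul (b : X) (f : H2) : MemLp (fun x => b x * f x) 2 mu :=
  (Lp.memLp f).of_le_mul (c := ‖b‖) (b.continuous.aestronglyMeasurable.mul (Lp.memLp f).1)
    (ae_of_all _ fun x => by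
      rw [norm_mul]; exact mul_le_mul_of_nonneg_right (b.abs_apply_le x) (norm_nonneg _))

/-- Multiplication by a bounded continuous function on `L²(0,1)`. -/
def mulX : X →L[ℝ] H2 →L[ℝ] H2 :=
  LinearMap.mkContinuous₂ (LinearMap.mk₂ ℝ (fun b f => (memLp_X_mul b f).toLp _)
    (fun b c f => by
      rw [← MemLp.toLp_add]; congr 1; funext x; simp; ring)
    (fun r b f => by
      rw [← MemLp.toLp_const_smul]; congr 1; funext x; simp; ring)
    (fun b f g => by
      rw [← MemLp.toLp_add]
      refine (MemLp.toLp_eq_toLp_iff _ _).2 ?_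
      filter_upwards [Lp.coeFn_add f g] with x hx
      simp only [hx, Pi.add_apply]; ring)
    (fun r b f => by
      rw [← MemLp.toLp_const_smul]
      refine (MemLp.toLp_eq_toLp_iff _ _).2 ?_
      filter_upwards [Lp.coeFn_smul r f] with x hx
      simp only [hx, Pi.smul_apply, smul_eq_mul]; ring)) 1
    (fun b f => by
      rw [one_mul]
      refine Lp.norm_le_mul_norm_of_ae_le_mul (f := (memLp_X_mul b f).toLp _) ?_
      filter_upwards [(memLp_X_mul b f).coeFn_toLp] with x hx
      rw [hx, norm_mul]; exact mul_le_mul_of_nonneg_right (b.abs_apply_le x) (norm_nonneg _))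

lemma coeFn_mulX (b : X) (f : H2) : mulX b f =ᵐ[mu] fun x => b x * f x :=
  (memLp_X_mul b f).coeFn_toLp

lemma norm_mulX_le (b : X) (f : H2) : ‖mulX b f‖ ≤ ‖b‖ * ‖f‖ := by
  refine Lp.norm_le_mul_norm_of_ae_le_mul ?_
  filter_upwards [coeFn_mulX b f] with x hx
  rw [hx, norm_mul]; exact mul_le_mul_of_nonneg_right (b.abs_apply_le x) (norm_nonneg _)

lemma inner_mulX (b : X) (f g : H2) : inner ℝ (mulX b f) g = ∫ x, b x * f x * g x ∂mu := by
  rw [L2.inner_def]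
  refine integral_congr_ae ?_
  filter_upwards [coeFn_mulX b f] with x hx
  rw [hx]
  simp [mul_comm]

lemma X.exists_comp_bound (G : ℝ → ℝ) (hG : Continuous G) (f : X) : ∃ C, ∀ x, |G (f x)| ≤ C := by
  obtain ⟨C, hC⟩ := (isCompact_Icc (a := -‖f‖) (b := ‖f‖)).exists_bound_of_continuousOn hG.continuousOn
  exact ⟨C, fun x => hC _ (abs_le.1 (f.abs_apply_le x))⟩

/-- Composition of a continuous function with a bounded continuous function. -/
def X.comp (G : ℝ → ℝ) (hG : Continuous G) (f : X) : X :=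
  X.mk (fun x => G (f x)) (hG.comp f.continuous) (X.exists_comp_bound G hG f).choose
    (X.exists_comp_bound G hG f).choose_spec

@[simp] lemma X.comp_apply (G : ℝ → ℝ) (hG : Continuous G) (f : X) (x : ℝ) :
    X.comp G hG f x = G (f x) := rfl

/-- Functions within distance 1 of S take values in the fixed compact interval of radius ‖S‖ + 1,
where G is uniformly continuous. -/
lemma X.continuous_comp (G : ℝ → ℝ) (hG : Continuous G) : Continuous (X.comp G hG) := by
  rw [Metric.continuous_iff]
  intro S ε hε
  have hu := (isCompact_Icc (a := -(‖S‖ + 1)) (b := ‖S‖ + 1)).uniformContinuousOn_of_continuous hG.continuousOn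
  obtain ⟨η, hη, h⟩ := Metric.uniformContinuousOn_iff.1 hu (ε / 2) (half_pos hε)
  refine ⟨min η 1, lt_min hη one_pos, fun R hR => ?_⟩
  rw [dist_eq_norm] at hR
  have hp : ∀ x, |R x - S x| ≤ ‖R - S‖ := fun x => (R - S).abs_apply_le x
  have hS : ∀ x, S x ∈ Icc (-(‖S‖ + 1)) (‖S‖ + 1) := fun x =>
    abs_le.1 ((S.abs_apply_le x).trans (by linarith))
  have hRm : ∀ x, R x ∈ Icc (-(‖S‖ + 1)) (‖S‖ + 1) := fun x => by
    refine abs_le.1 ?_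
    have h1 := hp x
    have h2 := S.abs_apply_le x
    have h3 := abs_sub_abs_le_abs_sub (R x) (S x)
    have h4 := hR.trans_le (min_le_right _ _)
    linarith
  refine lt_of_le_of_lt (b := ε / 2) ?_ (by linarith)
  rw [dist_eq_norm]
  refine (X.norm_le (by positivity)).2 fun x => ?_
  have := h (R x) (hRm x) (S x) (hS x) (by
    rw [Real.dist_eq]; exact (hp x).trans_lt (hR.trans_le (min_le_left _ _)))
  rw [Real.dist_eq] at this
  exact this.le

lemma summable_inv_ev_sq : Summable fun k => (ev k ^ 2)⁻¹ := by
  refine Summable.of_nonneg_of_le (fun k => by positivity) (fun k => ?_) summable_ev_rpow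
  have h1 : 1 ≤ ev k := by
    unfold ev
    have := Real.pi_gt_three
    have h : (0 : ℝ) ≤ k := Nat.cast_nonneg k
    nlinarith
  rw [← Real.rpow_natCast, ← Real.rpow_neg (by linarith)]
  exact Real.rpow_le_rpow_of_exponent_le h1 (by norm_num)

/-- The one-dimensional Sobolev embedding on the Fourier side: |q| is at most (ev q)² + ev^(-2), and
both are summable. -/
lemma summable_abs_of_summable_ev_mul_sq {q : ℕ → ℝ} (hq : Summable fun k => (ev k * q k) ^ 2) :
    Summable fun k => |q k| := by
  refine Summable.of_nonneg_of_le (fun k => abs_nonneg _) (fun k => ?_) (hq.add summable_inv_ev_sq)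
  have h := ev_pos k
  rw [← sq_abs, abs_mul, abs_of_pos h]
  have e : |q k| = (ev k * |q k|) * (ev k)⁻¹ := by field_simp
  rw [← inv_pow]
  nlinarith [sq_nonneg (ev k * |q k| - (ev k)⁻¹), sq_nonneg (ev k * |q k|), sq_nonneg (ev k)⁻¹]

lemma hasSum_smul_sX {q : ℕ → ℝ} (hq : Summable fun k => |q k|) :
    HasSum (fun k => q k • sX k) (∑' k, q k • sX k) := by
  refine Summable.hasSum (Summable.of_norm_bounded (hq.mul_right 2) fun k => ?_)
  rw [norm_smul, Real.norm_eq_abs]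
  exact mul_le_mul_of_nonneg_left (norm_sX_le k) (abs_nonneg _)

lemma ae_eq_sine_series {f : ℝ → ℝ} (hf : MemLp f 2 mu) (hq : Summable fun k => |sc k f|) :
    f =ᵐ[mu] (∑' k, sc k f • sX k : X) := by
  have h1 := hasSum_sc (hf.toLp f)
  have h2 := (hasSum_smul_sX hq).mapL (toE 2)
  simp only [sc_congr hf.coeFn_toLp] at h1
  simp only [map_smul] at h2
  have := h1.unique h2
  exact hf.coeFn_toLp.symm.trans (this ▸ coeFn_toE 2 _)

lemma normL_two (f : ℝ → ℝ) : normL 2 f = eLpNorm f 2 mu := by simp [normL]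
lemma inL_two {f : ℝ → ℝ} : InL 2 f ↔ MemLp f 2 mu := by simp [InL]

lemma tendsto_eLpNorm_two_zero {h : ℕ → ℝ → ℝ} (hm : ∀ n, AEStronglyMeasurable (h n) mu) {C : ℝ}
    (hC : ∀ n, ∀ᵐ x ∂mu, |h n x| ≤ C) (ht : ∀ᵐ x ∂mu, Tendsto (fun n => h n x) atTop (𝓝 0)) :
    Tendsto (fun n => eLpNorm (h n) 2 mu) atTop (𝓝 0) := by
  have e : ∀ n, eLpNorm (h n) 2 mu = (∫⁻ x, ‖h n x‖ₑ ^ (2 : ℝ) ∂mu) ^ (1 / 2 : ℝ) := fun n => by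
    rw [eLpNorm_eq_lintegral_rpow_enorm_toReal (by simp) (by simp)]; simp
  simp only [e]
  have h0 : Tendsto (fun n => ∫⁻ x, ‖h n x‖ₑ ^ (2 : ℝ) ∂mu) atTop (𝓝 (∫⁻ _, 0 ∂mu)) := by
    refine tendsto_lintegral_of_dominated_convergence' (fun _ => ENNReal.ofReal C ^ (2 : ℝ))
      (fun n => (hm n).enorm.pow_const _) (fun n => ?_) ?_ ?_
    · filter_upwards [hC n] with x hx
      gcongr
      rw [← ofReal_norm, Real.norm_eq_abs]
      exact ENNReal.ofReal_le_ofReal hx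
    · rw [lintegral_const]
      simp
    · filter_upwards [ht] with x hx
      have := (hx.enorm).ennrpow_const 2
      simpa using this
  have h1 := h0.ennrpow_const (1 / 2)
  simpa using h1

/-- Smooth cutoff functions of the interval. -/
def bump (n : ℕ) (x : ℝ) : ℝ :=
  Real.smoothTransition ((n + 1) * x - 1) * Real.smoothTransition ((n + 1) * (1 - x) - 1)

lemma contDiff_bump (n : ℕ) : ContDiff ℝ ∞ (bump n) := by
  unfold bump
  exact (Real.smoothTransition.contDiff.comp (by fun_prop)).mul
    (Real.smoothTransition.contDiff.comp (by fun_prop))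

lemma deriv_smoothTransition_eq_zero {x : ℝ} (hx : x < 0 ∨ 1 < x) : deriv Real.smoothTransition x = 0 := by
  rcases hx with hx | hx
  · have : Real.smoothTransition =ᶠ[𝓝 x] fun _ => 0 := by
      filter_upwards [Iio_mem_nhds hx] with y hy
      exact Real.smoothTransition.zero_of_nonpos (le_of_lt hy)
    rw [this.deriv_eq]; simp
  · have : Real.smoothTransition =ᶠ[𝓝 x] fun _ => 1 := by
      filter_upwards [Ioi_mem_nhds hx] with y hy
      exact Real.smoothTransition.one_of_one_le (le_of_lt hy)
    rw [this.deriv_eq]; simp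

lemma exists_abs_deriv_smoothTransition_le : ∃ B, 0 ≤ B ∧ ∀ x, |deriv Real.smoothTransition x| ≤ B := by
  have hc : Continuous (deriv Real.smoothTransition) :=
    (Real.smoothTransition.contDiff (n := 1)).continuous_deriv le_rfl
  obtain ⟨B, hB⟩ := (isCompact_Icc (a := (0 : ℝ)) (b := 1)).exists_bound_of_continuousOn hc.continuousOn
  refine ⟨B, (norm_nonneg _).trans (hB 0 (by simp)), fun x => ?_⟩
  by_cases hx : x ∈ Icc (0 : ℝ) 1
  · exact hB x hx
  · rw [deriv_smoothTransition_eq_zero, abs_zero]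
    · exact (norm_nonneg _).trans (hB 0 (by simp))
    · rw [mem_Icc, not_and_or, not_le, not_le] at hx; exact hx

lemma hasDerivAt_bump (n : ℕ) (x : ℝ) : HasDerivAt (bump n)
    ((n + 1) * deriv Real.smoothTransition ((n + 1) * x - 1) *
        Real.smoothTransition ((n + 1) * (1 - x) - 1)
      - Real.smoothTransition ((n + 1) * x - 1) *
        ((n + 1) * deriv Real.smoothTransition ((n + 1) * (1 - x) - 1))) x := by
  have hd : ∀ y, HasDerivAt Real.smoothTransition (deriv Real.smoothTransition y) y := fun y =>
    ((Real.smoothTransition.contDiff (n := 1)).differentiable (by simp) y).hasDerivAt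
  have h1 : HasDerivAt (fun x : ℝ => (n + 1) * x - 1) ((n : ℝ) + 1) x := by
    simpa using ((hasDerivAt_id x).const_mul ((n : ℝ) + 1)).sub_const 1
  have h2 : HasDerivAt (fun x : ℝ => (n + 1) * (1 - x) - 1) (-((n : ℝ) + 1)) x := by
    simpa using (((hasDerivAt_id x).const_sub 1).const_mul ((n : ℝ) + 1)).sub_const 1
  have := ((hd _).comp x h1).mul ((hd _).comp x h2)
  refine HasDerivAt.congr_deriv (this : HasDerivAt (bump n) _ x) ?_
  simp only [Function.comp_apply]
  ring

lemma bump_ne_zero {n : ℕ} {x : ℝ} (h : bump n x ≠ 0) :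
    x ∈ Icc (1 / ((n : ℝ) + 1)) (1 - 1 / ((n : ℝ) + 1)) := by
  have hn : (0 : ℝ) < n + 1 := by positivity
  have h1 := left_ne_zero_of_mul h
  have h2 := right_ne_zero_of_mul h
  constructor
  · by_contra hx
    rw [not_le, lt_div_iff₀ hn] at hx
    exact h1 (Real.smoothTransition.zero_of_nonpos (by linarith))
  · by_contra hx
    rw [not_le, sub_lt_comm, lt_div_iff₀ hn] at hx
    exact h2 (Real.smoothTransition.zero_of_nonpos (by linarith))

lemma abs_bump_le (n : ℕ) (x : ℝ) : |bump n x| ≤ 1 := by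
  unfold bump
  rw [abs_of_nonneg (mul_nonneg (Real.smoothTransition.nonneg _) (Real.smoothTransition.nonneg _))]
  exact mul_le_one₀ (Real.smoothTransition.le_one _) (Real.smoothTransition.nonneg _)
    (Real.smoothTransition.le_one _)

/-- The derivative of the cutoff is of order n, but it vanishes once (n+1)z > 2. Where it survives,
a function vanishing linearly at the endpoint is of order 1/n, and the product stays bounded. -/
lemma abs_mul_deriv_smoothTransition_le {B : ℝ} (hB : ∀ x, |deriv Real.smoothTransition x| ≤ B) {n : ℕ}
    {z y L : ℝ} (hL : 0 ≤ L) (hy : |y| ≤ L * z) :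
    |(n + 1) * deriv Real.smoothTransition ((n + 1) * z - 1)| * |y| ≤ 2 * L * B := by
  have hB0 : 0 ≤ B := (abs_nonneg _).trans (hB 0)
  by_cases h : (n + 1) * z ≤ 2
  · rw [abs_mul, abs_of_nonneg (by positivity : (0 : ℝ) ≤ n + 1)]
    calc _ ≤ (n + 1) * B * (L * z) := by gcongr; exact hB _
      _ = ((n + 1) * z) * (L * B) := by ring
      _ ≤ 2 * (L * B) := by gcongr
      _ = _ := by ring
  · rw [deriv_smoothTransition_eq_zero (Or.inr (by linarith))]
    simp; positivity

lemma eventually_one_lt {x : ℝ} (hx : 0 < x) : ∀ᶠ n : ℕ in atTop, 1 < ((n : ℝ) + 1) * x - 1 := by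
  have h : Tendsto (fun n : ℕ => ((n : ℝ) + 1) * x) atTop atTop :=
    (tendsto_atTop_add_const_right _ _ tendsto_natCast_atTop_atTop).atTop_mul_const hx
  filter_upwards [h.eventually_gt_atTop 2] with n hn
  linarith

/-- Multiply f by the cutoffs `bump`. The derivatives converge pointwise because the cutoff is
eventually 1 near each interior point, and they are bounded because f vanishes linearly at both
ends. -/
lemma hasH10Deriv_of_contDiff {f : ℝ → ℝ} (hf : ContDiff ℝ ∞ f) (h0 : f 0 = 0) (h1 : f 1 = 0) :
    HasH10Deriv f (deriv f) := by
  have hfd : Continuous (deriv f) := hf.continuous_deriv (by simp)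
  have hdf : Differentiable ℝ f := hf.differentiable (by simp)
  have hml : ∀ {g : ℝ → ℝ}, Continuous g → InL 2 g := fun {g} hg => by
    rw [inL_two]
    obtain ⟨C, hC⟩ := (isCompact_Icc (a := (0 : ℝ)) (b := 1)).exists_bound_of_continuousOn hg.continuousOn
    exact MemLp.of_bound hg.aestronglyMeasurable C (ae_mu_of_forall fun x hx => hC x ⟨hx.1.le, hx.2.le⟩)
  obtain ⟨L, hL⟩ := (isCompact_Icc (a := (0 : ℝ)) (b := 1)).exists_bound_of_continuousOn hfd.continuousOn
  have hL0 : 0 ≤ L := (norm_nonneg _).trans (hL 0 (by simp))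
  obtain ⟨B, hB0, hB⟩ := exists_abs_deriv_smoothTransition_le
  have hfx : ∀ x ∈ Icc (0 : ℝ) 1, ∀ y ∈ Icc (0 : ℝ) 1, |f y - f x| ≤ L * |y - x| := fun x hx y hy =>
    (convex_Icc (0 : ℝ) 1).norm_image_sub_le_of_norm_deriv_le (fun z _ => hdf z) hL hx hy
  have hb1 : ∀ x ∈ Ioo (0 : ℝ) 1, |f x| ≤ L * x := fun x hx => by
    have := hfx 0 (by simp) x ⟨hx.1.le, hx.2.le⟩
    rwa [h0, sub_zero, sub_zero, abs_of_pos hx.1] at this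
  have hb2 : ∀ x ∈ Ioo (0 : ℝ) 1, |f x| ≤ L * (1 - x) := fun x hx => by
    have := hfx x ⟨hx.1.le, hx.2.le⟩ 1 (by simp)
    rwa [h1, zero_sub, abs_neg, abs_of_pos (sub_pos.2 hx.2)] at this
  have hder : ∀ n x, deriv (fun x => bump n x * f x) x = deriv (bump n) x * f x + bump n x * deriv f x :=
    fun n x => ((hasDerivAt_bump n x).differentiableAt.hasDerivAt.mul (hdf x).hasDerivAt).deriv
  have hev : ∀ x ∈ Ioo (0 : ℝ) 1, ∀ᶠ n in atTop, bump n x = 1 ∧ deriv (bump n) x = 0 := fun x hx => by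
    filter_upwards [eventually_one_lt hx.1, eventually_one_lt (sub_pos.2 hx.2)] with n hn1 hn2
    constructor
    · unfold bump
      rw [Real.smoothTransition.one_of_one_le hn1.le, Real.smoothTransition.one_of_one_le hn2.le, one_mul]
    · rw [(hasDerivAt_bump n x).deriv, deriv_smoothTransition_eq_zero (Or.inr hn1),
        deriv_smoothTransition_eq_zero (Or.inr hn2)]
      simp
  refine ⟨hml hf.continuous, hml hfd, fun n x => bump n x * f x, fun n => ?_, ?_, ?_⟩
  · have hsub : Function.support (fun x => bump n x * f x) ⊆ Icc (1 / ((n : ℝ) + 1)) (1 - 1 / ((n : ℝ) + 1)) :=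
      fun x hx => bump_ne_zero (left_ne_zero_of_mul hx)
    have hts : tsupport (fun x => bump n x * f x) ⊆ Icc (1 / ((n : ℝ) + 1)) (1 - 1 / ((n : ℝ) + 1)) :=
      closure_minimal hsub isClosed_Icc
    have hn : (0 : ℝ) < 1 / ((n : ℝ) + 1) := by positivity
    refine ⟨(contDiff_bump n).mul hf, HasCompactSupport.intro' isCompact_Icc isClosed_Icc
      (fun x hx => by_contra fun h => hx (hsub h)), hts.trans fun x hx => ⟨?_, ?_⟩⟩
    · linarith [hx.1]
    · linarith [hx.2]
  · simp only [normL_two]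
    refine tendsto_eLpNorm_two_zero (C := 2 * L) (fun n =>
      (((contDiff_bump n).continuous.mul hf.continuous).sub hf.continuous).aestronglyMeasurable)
      (fun n => ae_mu_of_forall fun x hx => ?_) (ae_mu_of_forall fun x hx => ?_)
    · have e1 : |bump n x * f x| ≤ |f x| := by
        rw [abs_mul]; exact mul_le_of_le_one_left (abs_nonneg _) (abs_bump_le n x)
      have e2 := hb1 x hx
      have e3 : L * x ≤ L := mul_le_of_le_one_right hL0 hx.2.le
      linarith [abs_sub (bump n x * f x) (f x)]
    · refine tendsto_const_nhds.congr' ?_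
      filter_upwards [hev x hx] with n hn
      rw [hn.1]; ring
  · simp only [normL_two]
    refine tendsto_eLpNorm_two_zero (C := 4 * L * B + 2 * L) (fun n => ?_)
      (fun n => ae_mu_of_forall fun x hx => ?_) (ae_mu_of_forall fun x hx => ?_)
    · exact ((((contDiff_bump n).mul hf).continuous_deriv (by simp)).sub hfd).aestronglyMeasurable
    · rw [hder, (hasDerivAt_bump n x).deriv]
      have e1 := abs_mul_deriv_smoothTransition_le hB (n := n) hL0 (hb1 x hx)
      have e2 := abs_mul_deriv_smoothTransition_le hB (n := n) hL0 (hb2 x hx)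
      have e3 : |deriv f x| ≤ L := hL x ⟨hx.1.le, hx.2.le⟩
      set A1 := (n + 1) * deriv Real.smoothTransition ((n + 1) * x - 1)
      set A2 := (n + 1) * deriv Real.smoothTransition ((n + 1) * (1 - x) - 1)
      have s1 : ∀ y, |Real.smoothTransition y| ≤ 1 := fun y => by
        rw [abs_of_nonneg (Real.smoothTransition.nonneg _)]; exact Real.smoothTransition.le_one _
      have g1 : |A1 * Real.smoothTransition ((n + 1) * (1 - x) - 1) * f x| ≤ |A1| * |f x| := by
        rw [abs_mul, abs_mul]
        exact mul_le_mul_of_nonneg_right (mul_le_of_le_one_right (abs_nonneg _) (s1 _)) (abs_nonneg _)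
      have g2 : |Real.smoothTransition ((n + 1) * x - 1) * A2 * f x| ≤ |A2| * |f x| := by
        rw [abs_mul, abs_mul]
        exact mul_le_mul_of_nonneg_right (mul_le_of_le_one_left (abs_nonneg _) (s1 _)) (abs_nonneg _)
      have g3 : |bump n x * deriv f x| ≤ |deriv f x| := by
        rw [abs_mul]; exact mul_le_of_le_one_left (abs_nonneg _) (abs_bump_le n x)
      rw [sub_mul]
      refine (abs_sub _ _).trans ?_
      have t1 := abs_add_le (A1 * Real.smoothTransition ((n + 1) * (1 - x) - 1) * f x
        - Real.smoothTransition ((n + 1) * x - 1) * A2 * f x) (bump n x * deriv f x)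
      have t2 := abs_sub (A1 * Real.smoothTransition ((n + 1) * (1 - x) - 1) * f x)
        (Real.smoothTransition ((n + 1) * x - 1) * A2 * f x)
      linarith only [e1, e2, e3, g1, g2, g3, t1, t2]
    · refine tendsto_const_nhds.congr' ?_
      filter_upwards [hev x hx] with n hn
      rw [hder, hn.1, hn.2]; ring

lemma tendsto_toLp_of_eLpNorm {f : ℕ → ℝ → ℝ} {g : ℝ → ℝ} (hf : ∀ n, MemLp (f n) 2 mu) (hg : MemLp g 2 mu)
    (h : Tendsto (fun n => eLpNorm (fun x => f n x - g x) 2 mu) atTop (𝓝 0)) :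
    Tendsto (fun n => (hf n).toLp (f n)) atTop (𝓝 (hg.toLp g)) :=
  (Lp.tendsto_Lp_iff_tendsto_eLpNorm'' f hf g hg).2 h

/-- For compactly supported test functions, integration by parts has no boundary terms; the
resulting identities pass to L² limits. The zeroth identity says that a derivative has mean zero. -/
lemma HasH10Deriv.coeff {f g : ℝ → ℝ} (h : HasH10Deriv f g) :
    kc 0 g = 0 ∧ ∀ k, kc (k + 1) g = ev k * sc k f := by
  obtain ⟨hf, hg, ψ, hψ, hl1, hl2⟩ := h
  rw [inL_two] at hf hg
  simp only [normL_two] at hl1 hl2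
  have hc1 : ∀ n, Continuous (ψ n) := fun n => (hψ n).1.continuous
  have hc2 : ∀ n, Continuous (deriv (ψ n)) := fun n => (hψ n).1.continuous_deriv (by simp)
  have hm1 : ∀ n, MemLp (ψ n) 2 mu := fun n => by
    obtain ⟨C, hC⟩ := (hψ n).2.1.exists_bound_of_continuous (hc1 n)
    exact memLp_of_continuous_bdd (hc1 n) hC 2
  have hm2 : ∀ n, MemLp (deriv (ψ n)) 2 mu := fun n => by
    obtain ⟨C, hC⟩ := (hψ n).2.1.deriv.exists_bound_of_continuous (hc2 n)
    exact memLp_of_continuous_bdd (hc2 n) hC 2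
  have z0 : ∀ n, ψ n 0 = 0 := fun n => image_eq_zero_of_notMem_tsupport fun h => by
    simpa using ((hψ n).2.2 h).1
  have z1 : ∀ n, ψ n 1 = 0 := fun n => image_eq_zero_of_notMem_tsupport fun h => by
    simpa using ((hψ n).2.2 h).2
  have hd : ∀ n x, HasDerivAt (ψ n) (deriv (ψ n) x) x := fun n x =>
    ((hψ n).1.differentiable (by simp) x).hasDerivAt
  have t1 := tendsto_toLp_of_eLpNorm hm1 hf hl1
  have t2 := tendsto_toLp_of_eLpNorm hm2 hg hl2
  have l1 : ∀ b : X, Tendsto (fun n => ∫ x, b x * ψ n x ∂mu) atTop (𝓝 (∫ x, b x * f x ∂mu)) := fun b => by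
    have := ((pairL 2 b).continuous.tendsto _).comp t1
    simp only [Function.comp_def, pairL_apply] at this
    convert this using 1
    · funext n
      refine integral_congr_ae ?_
      filter_upwards [(hm1 n).coeFn_toLp] with x hx
      rw [hx]
    · refine congrArg 𝓝 (integral_congr_ae ?_)
      filter_upwards [hf.coeFn_toLp] with x hx
      rw [hx]
  have l2 : ∀ b : X, Tendsto (fun n => ∫ x, b x * deriv (ψ n) x ∂mu) atTop (𝓝 (∫ x, b x * g x ∂mu)) := fun b => by
    have := ((pairL 2 b).continuous.tendsto _).comp t2
    simp only [Function.comp_def, pairL_apply] at this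
    convert this using 1
    · funext n
      refine integral_congr_ae ?_
      filter_upwards [(hm2 n).coeFn_toLp] with x hx
      rw [hx]
    · refine congrArg 𝓝 (integral_congr_ae ?_)
      filter_upwards [hg.coeFn_toLp] with x hx
      rw [hx]
  constructor
  · have := l2 (cbX 0)
    have e : ∀ n, ∫ x, cbX 0 x * deriv (ψ n) x ∂mu = 0 := fun n => by
      simp only [cbX_apply, cb, one_mul]
      rw [integral_mu_eq, intervalIntegral.integral_deriv_eq_sub' (f := ψ n) rfl
        (fun x _ => (hd n x).differentiableAt) (hc2 n).continuousOn, z0, z1, sub_zero]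
    simp only [e] at this
    exact (tendsto_nhds_unique tendsto_const_nhds this).symm
  · intro k
    have t3 := l2 (cbX (k + 1))
    have t4 := (l1 (sX k)).const_mul (ev k)
    have e : ∀ n, ∫ x, cbX (k + 1) x * deriv (ψ n) x ∂mu = ev k * ∫ x, sX k x * ψ n x ∂mu := fun n => by
      simp only [cbX_apply, cb, sX_apply]
      rw [integral_mu_eq, integral_mu_eq, intervalIntegral.integral_mul_deriv_eq_deriv_mul
        (u := cf k) (v := ψ n) (fun x _ => hasDerivAt_cf k x) (fun x _ => hd n x)
        (((continuous_sf k).const_mul _).neg.intervalIntegrable _ _) ((hc2 n).intervalIntegrable _ _),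
        z0, z1, ← intervalIntegral.integral_const_mul]
      simp only [mul_zero, sub_zero, zero_sub, ← intervalIntegral.integral_neg]
      congr 1; funext x; ring
    simp only [e] at t3
    exact tendsto_nhds_unique t3 t4

/-- A diagonal choice: for each n, take a test function within 1/(n+1) of the n-th pair. -/
lemma HasH10Deriv.of_tendsto {F G : ℕ → ℝ → ℝ} {f g : ℝ → ℝ} (h : ∀ n, HasH10Deriv (F n) (G n))
    (hf : MemLp f 2 mu) (hg : MemLp g 2 mu)
    (h1 : Tendsto (fun n => eLpNorm (fun x => F n x - f x) 2 mu) atTop (𝓝 0))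
    (h2 : Tendsto (fun n => eLpNorm (fun x => G n x - g x) 2 mu) atTop (𝓝 0)) : HasH10Deriv f g := by
  have key : ∀ n : ℕ, ∃ ψ : ℝ → ℝ, (ContDiff ℝ ∞ ψ ∧ HasCompactSupport ψ ∧ tsupport ψ ⊆ Ioo 0 1) ∧
      eLpNorm (fun x => ψ x - F n x) 2 mu ≤ ((n : ℝ≥0∞) + 1)⁻¹ ∧
      eLpNorm (fun x => deriv ψ x - G n x) 2 mu ≤ ((n : ℝ≥0∞) + 1)⁻¹ := fun n => by
    obtain ⟨-, -, ψ, hψ, l1, l2⟩ := h n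
    simp only [normL_two] at l1 l2
    have hp : (0 : ℝ≥0∞) < ((n : ℝ≥0∞) + 1)⁻¹ := by
      rw [ENNReal.inv_pos]; exact_mod_cast ENNReal.natCast_ne_top (n + 1)
    obtain ⟨m, hm1, hm2⟩ := ((l1.eventually_le_const hp).and (l2.eventually_le_const hp)).exists
    exact ⟨ψ m, hψ m, hm1, hm2⟩
  choose ψ hψ e1 e2 using key
  have hinv : Tendsto (fun n : ℕ => ((n : ℝ≥0∞) + 1)⁻¹) atTop (𝓝 0) := by
    have := (tendsto_add_atTop_iff_nat 1).2 ENNReal.tendsto_inv_nat_nhds_zero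
    simpa using this
  have hms : ∀ n, AEStronglyMeasurable (ψ n) mu := fun n => (hψ n).1.continuous.aestronglyMeasurable
  have hmd : ∀ n, AEStronglyMeasurable (deriv (ψ n)) mu := fun n =>
    ((hψ n).1.continuous_deriv (by simp)).aestronglyMeasurable
  refine ⟨inL_two.2 hf, inL_two.2 hg, ψ, hψ, ?_, ?_⟩
  · simp only [normL_two]
    refine tendsto_of_tendsto_of_tendsto_of_le_of_le tendsto_const_nhds (by simpa using hinv.add h1)
      (fun _ => zero_le) fun n => ?_
    have hF := (inL_two.1 (h n).1).1
    calc eLpNorm (fun x => ψ n x - f x) 2 mu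
        = eLpNorm ((fun x => ψ n x - F n x) + fun x => F n x - f x) 2 mu := by congr 1; funext x; simp
      _ ≤ _ := (eLpNorm_add_le ((hms n).sub hF) (hF.sub hf.1) (by simp)).trans (add_le_add (e1 n) le_rfl)
  · simp only [normL_two]
    refine tendsto_of_tendsto_of_tendsto_of_le_of_le tendsto_const_nhds (by simpa using hinv.add h2)
      (fun _ => zero_le) fun n => ?_
    have hF := (inL_two.1 (h n).2.1).1
    calc eLpNorm (fun x => deriv (ψ n) x - g x) 2 mu
        = eLpNorm ((fun x => deriv (ψ n) x - G n x) + fun x => G n x - g x) 2 mu := by congr 1; funext x; simp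
      _ ≤ _ := (eLpNorm_add_le ((hmd n).sub hF) (hF.sub hg.1) (by simp)).trans (add_le_add (e2 n) le_rfl)

lemma tendsto_eLpNorm_of_toE {F : ℕ → X} {f : ℝ → ℝ} (hf : MemLp f 2 mu)
    (h : Tendsto (fun n => toE 2 (F n)) atTop (𝓝 (hf.toLp f))) :
    Tendsto (fun n => eLpNorm (fun x => F n x - f x) 2 mu) atTop (𝓝 0) :=
  (Lp.tendsto_Lp_iff_tendsto_eLpNorm'' (fun n => ⇑(F n))
    (fun n => memLp_of_continuous_bdd (F n).continuous (F n).abs_apply_le 2) f hf).1 h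

@[simp] lemma X.sum_apply {ι : Type*} (s : Finset ι) (F : ι → X) (x : ℝ) : (∑ i ∈ s, F i) x = ∑ i ∈ s, F i x :=
  map_sum (X.eval x) F s

lemma contDiff_sf (k : ℕ) : ContDiff ℝ ∞ (sf k) := by
  unfold sf; fun_prop

/-- For the converse, the sine partial sums of f are smooth and vanish at the endpoints. By the
coefficient relation their derivatives are the cosine partial sums of g, so both sequences converge
in L². From here on, spatial derivatives are handled through coefficients only. -/
theorem hasH10Deriv_iff {f g : ℝ → ℝ} (hf : MemLp f 2 mu) (hg : MemLp g 2 mu) :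
    HasH10Deriv f g ↔ kc 0 g = 0 ∧ ∀ k, kc (k + 1) g = ev k * sc k f := by
  refine ⟨HasH10Deriv.coeff, fun ⟨g0, gk⟩ => ?_⟩
  have hs := (hasSum_sc (hf.toLp f)).tendsto_sum_nat
  have hc := ((tendsto_add_atTop_iff_nat 1).2 (hasSum_kc (hg.toLp g)).tendsto_sum_nat)
  simp only [sc_congr hf.coeFn_toLp] at hs
  simp only [kc_congr hg.coeFn_toLp, Finset.sum_range_succ', g0, gk, zero_smul, add_zero] at hc
  refine HasH10Deriv.of_tendsto (F := fun n => (∑ k ∈ Finset.range n, sc k f • sX k : X))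
    (G := fun n => (∑ k ∈ Finset.range n, (ev k * sc k f) • cbX (k + 1) : X)) (fun n => ?_) hf hg
    (tendsto_eLpNorm_of_toE hf (by simpa only [map_sum, map_smul] using hs))
    (tendsto_eLpNorm_of_toE hg (by simpa only [map_sum, map_smul] using hc))
  have hcd : ContDiff ℝ ∞ (fun x => ∑ k ∈ Finset.range n, sc k f * sf k x) :=
    ContDiff.sum fun k _ => contDiff_const.mul (contDiff_sf k)
  have e1 : (⇑(∑ k ∈ Finset.range n, sc k f • sX k : X)) = fun x => ∑ k ∈ Finset.range n, sc k f * sf k x := by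
    funext x; simp
  have e2 : (⇑(∑ k ∈ Finset.range n, (ev k * sc k f) • cbX (k + 1) : X)) =
      deriv (fun x => ∑ k ∈ Finset.range n, sc k f * sf k x) := by
    funext x
    have := HasDerivAt.fun_sum fun k (_ : k ∈ Finset.range n) => (hasDerivAt_sf k x).const_mul (sc k f)
    rw [this.deriv]
    simp only [X.sum_apply, X.smul_apply, cbX_apply, cb]
    exact Finset.sum_congr rfl fun k _ => by ring
  rw [e1, e2]
  exact hasH10Deriv_of_contDiff hcd (by simp [sf_zero]) (by simp [sf_one])

/-! ### The pointwise inequality behind the energy estimate. -/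

/-- Young's inequality with a parameter. -/
lemma young_param {q s ε B a b : ℝ} (hs : 0 < s) (hsq : s < q) (hε : 0 < ε) (hB : 0 ≤ B)
    (ha : 0 ≤ a) (hb : 0 ≤ b) :
    B * b ^ s * a ^ (q - s) ≤ ε * a ^ q +
      s / q * ((q - s) / (q * ε)) ^ ((q - s) / s) * B ^ (q / s) * b ^ q := by
  have hq : 0 < q := hs.trans hsq
  have hqs : 0 < q - s := sub_pos.2 hsq
  -- The scale for which the first term in Young's inequality is exactly ε a^q.
  set m := ε * q / (q - s) with hm
  have hm0 : 0 < m := by positivity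
  have hconj : (q / (q - s)).HolderConjugate (q / s) := by
    rw [Real.holderConjugate_iff]
    refine ⟨by rw [lt_div_iff₀ hqs]; linarith, ?_⟩
    field_simp
    ring
  have h := Real.young_inequality_of_nonneg (a := m ^ ((q - s) / q) * a ^ (q - s))
    (b := B * b ^ s * (m ^ ((q - s) / q))⁻¹) (by positivity) (by positivity) hconj
  have e1 : m ^ ((q - s) / q) * a ^ (q - s) * (B * b ^ s * (m ^ ((q - s) / q))⁻¹)
      = B * b ^ s * a ^ (q - s) := by
    have : m ^ ((q - s) / q) ≠ 0 := (Real.rpow_pos_of_pos hm0 _).ne'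
    field_simp
  have e2 : (m ^ ((q - s) / q) * a ^ (q - s)) ^ (q / (q - s)) / (q / (q - s)) = ε * a ^ q := by
    rw [Real.mul_rpow (by positivity) (by positivity), ← Real.rpow_mul hm0.le, ← Real.rpow_mul ha]
    have h1 : (q - s) / q * (q / (q - s)) = 1 := by field_simp
    have h2 : (q - s) * (q / (q - s)) = q := by field_simp
    rw [h1, h2, Real.rpow_one, hm]
    field_simp
  have e3 : (B * b ^ s * (m ^ ((q - s) / q))⁻¹) ^ (q / s) / (q / s) =
      s / q * ((q - s) / (q * ε)) ^ ((q - s) / s) * B ^ (q / s) * b ^ q := by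
    rw [Real.mul_rpow (by positivity) (by positivity), Real.mul_rpow hB (by positivity),
      ← Real.rpow_mul hb, ← Real.rpow_neg hm0.le, ← Real.rpow_mul hm0.le]
    have h1 : s * (q / s) = q := by field_simp
    have h2 : -((q - s) / q) * (q / s) = -((q - s) / s) := by field_simp
    have h3 : (q - s) / (q * ε) = m⁻¹ := by rw [hm, inv_div, mul_comm]
    rw [h1, h2, h3, Real.inv_rpow hm0.le, ← Real.rpow_neg hm0.le]
    field_simp
  rw [e1, e2, e3] at h
  exact h

lemma abs_pow_succ_sub_le (v φ : ℝ) (n : ℕ) :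
    |(v + φ) ^ (n + 1) - v ^ (n + 1)| ≤ (n + 1) * |φ| * (|v| + |φ|) ^ n := by
  have h := abs_pow_sub_pow_le (v + φ) v (n + 1)
  have h2 : max |v + φ| |v| ≤ |v| + |φ| :=
    max_le (abs_add_le _ _) (by linarith [abs_nonneg φ])
  calc _ ≤ |v + φ - v| * (n + 1 : ℕ) * max |v + φ| |v| ^ n := h
    _ ≤ |v + φ - v| * (n + 1 : ℕ) * (|v| + |φ|) ^ n := by gcongr
    _ = _ := by rw [add_sub_cancel_left]; push_cast; ring

lemma rpow_mul_pow_eq {a p : ℝ} (ha : 0 ≤ a) (hp : 2 < p) (n : ℕ) :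
    a ^ n * a ^ (p - 2) = a ^ (p - 2 + n) := by
  rw [Real.rpow_add_of_nonneg ha (by linarith) (Nat.cast_nonneg n), Real.rpow_natCast, mul_comm]

section Pointwise
variable {ν α β γ : ℝ} {δ : ℕ} {p : ℝ}

/-- When 3|φ| ≤ |v|, one has |v| + |φ| ≤ (4/3)|v|. The resulting powers of 4/3 must fit under the
powers of 2 occurring in K₁ and K₃. -/
lemma pow_four_thirds_le (hδ : 1 ≤ δ) : (4 / 3 : ℝ) ^ (δ + 1) ≤ 2 ^ δ ∧
    (4 / 3 : ℝ) ^ (2 * δ) ≤ 2 ^ (2 * δ - 1) ∧ (4 / 3 : ℝ) ^ (2 * δ) ≤ 2 ^ δ := by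
  obtain ⟨n, rfl⟩ := Nat.exists_eq_add_of_le' hδ
  have h1 : (4 / 3 : ℝ) ^ n ≤ 2 ^ n := by gcongr; norm_num
  have h2 : (16 / 9 : ℝ) ^ n ≤ 4 ^ n := by gcongr; norm_num
  have h3 : (16 / 9 : ℝ) ^ n ≤ 2 ^ n := by gcongr; norm_num
  have e1 : (4 / 3 : ℝ) ^ (2 * (n + 1)) = 16 / 9 * (16 / 9) ^ n := by
    rw [pow_mul, pow_succ]; norm_num; ring
  have e2 : (2 : ℝ) ^ (2 * (n + 1) - 1) = 2 * 4 ^ n := by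
    rw [show 2 * (n + 1) - 1 = 2 * n + 1 by omega, pow_succ, pow_mul]; norm_num; ring
  have p1 : (0 : ℝ) < (4 / 3) ^ n := by positivity
  have p2 : (0 : ℝ) < (16 / 9) ^ n := by positivity
  refine ⟨?_, ?_, ?_⟩
  · rw [pow_succ, pow_succ, pow_succ]; nlinarith
  · rw [e1, e2]; nlinarith
  · rw [e1, pow_succ]; nlinarith

/-- The coefficient of `|v|^p` in the constant `K₁`. -/
def bOne (ν α β γ : ℝ) (δ : ℕ) (p : ℝ) : ℝ :=
  2 ^ δ * (p - 1) ^ 2 * α ^ 2 / (4 * ν) + 2 ^ (2 * δ) * β * (1 + γ) ^ 2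
      + 2 ^ δ * β * (1 + γ) + 2 ^ (2 * δ - 1) * β * (2 * δ + 1)

lemma cc_mul_le (hγ : 0 < γ) (v φ : ℝ) :
    cc γ δ (v + φ) * v ≤ (1 + γ) * ((|v| + |φ|) ^ (δ + 1) * |v|) - γ * |v| ^ 2 + γ * (|v| * |φ|)
      - (v + φ) ^ (2 * δ + 1) * v := by
  have e : cc γ δ (v + φ) * v = (1 + γ) * ((v + φ) ^ (δ + 1) * v) - γ * v ^ 2 - γ * (v * φ)
      - (v + φ) ^ (2 * δ + 1) * v := by unfold cc; ring
  have h1 : (v + φ) ^ (δ + 1) * v ≤ (|v| + |φ|) ^ (δ + 1) * |v| := by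
    refine (le_abs_self _).trans ?_
    rw [abs_mul, abs_pow]
    gcongr
    exact abs_add_le _ _
  have h2 : -(v * φ) ≤ |v| * |φ| := by rw [← abs_mul]; exact neg_le_abs _
  rw [e, sq_abs]
  nlinarith [mul_le_mul_of_nonneg_left h1 (by linarith : 0 ≤ 1 + γ), mul_le_mul_of_nonneg_left h2 hγ.le]

lemma pp_sub_sq_le (v φ : ℝ) :
    (pp δ (v + φ) - pp δ v) ^ 2 ≤ (δ + 1) ^ 2 * (|φ| ^ 2 * (|v| + |φ|) ^ (2 * δ)) := by
  have h := abs_pow_succ_sub_le v φ δ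
  unfold pp
  rw [← sq_abs]
  calc _ ≤ ((δ + 1) * |φ| * (|v| + |φ|) ^ δ) ^ 2 := by gcongr
    _ = _ := by ring

lemma small_combine {c g D a2 ab P Q k1 k2 Z U d : ℝ} (hg : 0 < g) (hD : 1 ≤ D) (ha2 : 0 ≤ a2)
    (h3 : ab ≤ a2) (h1 : P ≤ D * Q) (hk : k1 ≤ k2) (hZ : 0 ≤ Z) (hd : 0 ≤ d) {u : ℝ}
    (hcc : c ≤ (1 + g) * P - g * a2 + g * ab - u)
    (hup : -u ≤ -U + d * k1 * Z) :
    c ≤ (1 + g) * (D * Q) - g * a2 + D * (1 + g) * a2 + (-U + d * k2 * Z) := by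
  have t0 : g ≤ D * (1 + g) := by nlinarith
  have t1 : g * ab ≤ D * (1 + g) * a2 :=
    (mul_le_mul_of_nonneg_left h3 hg.le).trans (mul_le_mul_of_nonneg_right t0 ha2)
  have t2 : d * k1 * Z ≤ d * k2 * Z :=
    mul_le_mul_of_nonneg_right (mul_le_mul_of_nonneg_left hk hd) hZ
  have t3 : (1 + g) * P ≤ (1 + g) * (D * Q) := mul_le_mul_of_nonneg_left h1 (by linarith)
  linarith

-- The regime in which v dominates: |v| + |φ| is replaced by (4/3)|v|, so every error term is a
-- power of |v| times at most |φ|². Three applications of Young's inequality produce the Young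
-- constants of K₃ (s = 1 for the reaction, s = 2 for the flux) and of K₁ (s = 2δ, for the
-- accumulated multiple of |v|^p).
set_option maxHeartbeats 1000000 in
lemma pointwise_small (hν : 0 < ν) (hβ : 0 < β) (hγ : 0 < γ)
    (hδ : 1 ≤ δ) (hp : 2 * (δ : ℝ) + 1 ≤ p) {v φ : ℝ} (hφ : 3 * |φ| ≤ |v|) :
    β * (cc γ δ (v + φ) * (|v| ^ (p - 2) * v) + γ * |v| ^ p + |v| ^ (p + 2 * δ) / 8)
      + (p - 1) / (2 * ν) * (α / (δ + 1)) ^ 2 * (|v| ^ (p - 2) * (pp δ (v + φ) - pp δ v) ^ 2)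
      ≤ K1 ν α β γ δ p + K3 ν α β δ p * |φ| ^ (p + 2 * δ) := by
  have hδ' : (1 : ℝ) ≤ δ := by exact_mod_cast hδ
  have hp2 : 2 < p := by linarith
  obtain ⟨c1, c2, c3⟩ := pow_four_thirds_le hδ
  set a := |v| with ha'
  set b := |φ| with hb'
  have ha : 0 ≤ a := abs_nonneg _
  have hb : 0 ≤ b := abs_nonneg _
  set w := a ^ (p - 2) with hw'
  have hw : 0 ≤ w := Real.rpow_nonneg ha _
  have hab : a + b ≤ 4 / 3 * a := by linarith
  set q := p + 2 * δ with hq'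
  -- Young's inequalities
  have y1 := young_param (q := q) (s := 1) (ε := β / 4) (B := 2 ^ (2 * δ - 1) * β * (2 * δ + 1)) one_pos
    (by rw [hq']; linarith) (by positivity) (by positivity) ha hb
  have y2 := young_param (q := q) (s := 2) (ε := β / 4) (B := 2 ^ δ * (p - 1) ^ 2 * α ^ 2 / (2 * ν)) two_pos
    (by rw [hq']; linarith) (by positivity) (by positivity) ha hb
  have hb1 : 0 ≤ bOne ν α β γ δ p := by unfold bOne; positivity
  have y3 := young_param (q := q) (s := 2 * δ) (ε := β / 8) (B := bOne ν α β γ δ p) (by positivity)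
    (by rw [hq']; linarith) (by positivity) hb1 ha zero_le_one
  -- powers
  have r0 : a ^ 2 * w = a ^ p := by rw [hw', rpow_mul_pow_eq ha hp2]; congr 1; push_cast; ring
  have r1 : a ^ (δ + 2) * w = a ^ (p + δ) := by rw [hw', rpow_mul_pow_eq ha hp2]; congr 1; push_cast; ring
  have r2 : a ^ (2 * δ + 2) * w = a ^ q := by rw [hw', rpow_mul_pow_eq ha hp2]; congr 1; push_cast; ring
  have r3 : a ^ (2 * δ + 1) * w = a ^ (q - 1) := by rw [hw', rpow_mul_pow_eq ha hp2]; congr 1; push_cast; ring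
  have r4 : a ^ (2 * δ) * w = a ^ (q - 2) := by rw [hw', rpow_mul_pow_eq ha hp2]; congr 1; push_cast; ring
  have r5 : q - 2 * δ = p := by rw [hq']; ring
  rw [Real.rpow_one] at y1
  rw [show b ^ (2 : ℝ) = b ^ 2 from Real.rpow_two b] at y2
  rw [r5, Real.one_rpow, Real.one_rpow, mul_one, mul_one] at y3
  -- elementary bounds
  have hup : -((v + φ) ^ (2 * δ + 1) * v) ≤ -a ^ (2 * δ + 2) + (2 * δ + 1) * (4 / 3) ^ (2 * δ) * (b * a ^ (2 * δ + 1)) := by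
    have h := abs_pow_succ_sub_le v φ (2 * δ)
    have h1 : -(((v + φ) ^ (2 * δ + 1) - v ^ (2 * δ + 1)) * v) ≤
        (2 * δ + 1) * b * (a + b) ^ (2 * δ) * a := by
      refine (neg_le_abs _).trans ?_
      rw [abs_mul]
      push_cast at h
      gcongr
    have h2 : (a + b) ^ (2 * δ) ≤ (4 / 3) ^ (2 * δ) * a ^ (2 * δ) := by
      rw [← mul_pow]; gcongr
    have h3 : v ^ (2 * δ + 1) * v = a ^ (2 * δ + 2) := by
      rw [ha', ← pow_succ, show 2 * δ + 1 + 1 = 2 * (δ + 1) by ring, pow_mul, pow_mul, sq_abs]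
    have h4 : (2 * δ + 1) * b * (a + b) ^ (2 * δ) * a ≤ (2 * δ + 1) * b * ((4 / 3) ^ (2 * δ) * a ^ (2 * δ)) * a := by
      gcongr
    have h5 : (2 * δ + 1) * b * ((4 / 3) ^ (2 * δ) * a ^ (2 * δ)) * a = (2 * δ + 1) * (4 / 3) ^ (2 * δ) * (b * a ^ (2 * δ + 1)) := by ring
    linarith
  have hcc := cc_mul_le (δ := δ) hγ v φ
  have hpp := pp_sub_sq_le (δ := δ) v φ
  rw [← ha', ← hb'] at hcc hpp
  have h1 : (a + b) ^ (δ + 1) * a ≤ 2 ^ δ * a ^ (δ + 2) := by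
    calc _ ≤ (4 / 3 * a) ^ (δ + 1) * a := by gcongr
      _ = (4 / 3) ^ (δ + 1) * a ^ (δ + 2) := by rw [mul_pow]; ring
      _ ≤ _ := by gcongr
  have h2 : (a + b) ^ (2 * δ) ≤ 2 ^ δ * a ^ (2 * δ) := by
    calc _ ≤ (4 / 3 * a) ^ (2 * δ) := by gcongr
      _ = (4 / 3) ^ (2 * δ) * a ^ (2 * δ) := by rw [mul_pow]
      _ ≤ _ := by gcongr
  have h3 : a * b ≤ a ^ 2 := by
    rw [sq]; exact mul_le_mul_of_nonneg_left (by linarith only [hφ, hb]) ha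
  have hpd : (1 : ℝ) ≤ 2 ^ δ := one_le_pow₀ (by norm_num)
  -- first part
  have A1 : cc γ δ (v + φ) * v ≤ (1 + γ) * (2 ^ δ * a ^ (δ + 2)) - γ * a ^ 2 + 2 ^ δ * (1 + γ) * a ^ 2
      + (-a ^ (2 * δ + 2) + (2 * δ + 1) * 2 ^ (2 * δ - 1) * (b * a ^ (2 * δ + 1))) := by
    exact small_combine hγ hpd (sq_nonneg a) h3 h1 c2 (by positivity) (by positivity) hcc hup
  have A2 : cc γ δ (v + φ) * (w * v) ≤ 2 ^ δ * (1 + γ) * a ^ (p + δ) - γ * a ^ p + 2 ^ δ * (1 + γ) * a ^ p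
      - a ^ q + (2 * δ + 1) * 2 ^ (2 * δ - 1) * (b * a ^ (q - 1)) := by
    have := mul_le_mul_of_nonneg_right A1 hw
    calc _ = cc γ δ (v + φ) * v * w := by ring
      _ ≤ _ := this
      _ = 2 ^ δ * (1 + γ) * (a ^ (δ + 2) * w) - γ * (a ^ 2 * w) + 2 ^ δ * (1 + γ) * (a ^ 2 * w)
        - (a ^ (2 * δ + 2) * w) + (2 * δ + 1) * 2 ^ (2 * δ - 1) * (b * (a ^ (2 * δ + 1) * w)) := by ring
      _ = _ := by rw [r0, r1, r2, r3]
  -- The flux term needs only one factor p - 1; K₃ carries its square, which is no smaller since p -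
  -- 1 ≥ 1.
  have A3 : (p - 1) / (2 * ν) * (α / (δ + 1)) ^ 2 * (w * (pp δ (v + φ) - pp δ v) ^ 2)
      ≤ 2 ^ δ * (p - 1) ^ 2 * α ^ 2 / (2 * ν) * b ^ 2 * a ^ (q - 2) := by
    have t : (pp δ (v + φ) - pp δ v) ^ 2 ≤ (δ + 1) ^ 2 * (b ^ 2 * (2 ^ δ * a ^ (2 * δ))) :=
      hpp.trans (by gcongr)
    have hp1 : 0 < p - 1 := by linarith
    calc _ ≤ (p - 1) / (2 * ν) * (α / (δ + 1)) ^ 2 * (w * ((δ + 1) ^ 2 * (b ^ 2 * (2 ^ δ * a ^ (2 * δ))))) := by gcongr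
      _ = 2 ^ δ * ((p - 1) * 1) * α ^ 2 / (2 * ν) * b ^ 2 * (a ^ (2 * δ) * w) := by field_simp
      _ ≤ 2 ^ δ * ((p - 1) * (p - 1)) * α ^ 2 / (2 * ν) * b ^ 2 * (a ^ (2 * δ) * w) := by gcongr; linarith
      _ = _ := by rw [r4]; ring
  -- Since a^(p+δ) is the geometric mean of a^p and a^(p+2δ), completing the square suffices.
  have A4 : β * (2 ^ δ * (1 + γ) * a ^ (p + δ)) ≤ β / 4 * a ^ q + 2 ^ (2 * δ) * β * (1 + γ) ^ 2 * a ^ p := by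
    have : a ^ (δ + 2) * a ^ (δ + 2) = a ^ 2 * a ^ (2 * δ + 2) := by ring
    have key : (2 ^ δ * (1 + γ)) * a ^ (δ + 2) ≤ 1 / 4 * a ^ (2 * δ + 2) + (2 ^ δ * (1 + γ)) ^ 2 * a ^ 2 := by
      have : a ^ (2 * δ + 2) = (a ^ (δ + 1)) ^ 2 := by ring
      have e : a ^ (δ + 2) = a ^ (δ + 1) * a := by ring
      rw [this, e]
      linarith only [sq_nonneg (1 / 2 * a ^ (δ + 1) - (2 ^ δ * (1 + γ)) * a)]
    have := mul_le_mul_of_nonneg_right key hw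
    rw [← r1, ← r2, ← r0]
    have e2 : (2 : ℝ) ^ (2 * δ) = (2 ^ δ) ^ 2 := by rw [mul_comm, pow_mul]
    rw [e2]
    calc _ = β * (2 ^ δ * (1 + γ) * a ^ (δ + 2) * w) := by ring
      _ ≤ β * ((1 / 4 * a ^ (2 * δ + 2) + (2 ^ δ * (1 + γ)) ^ 2 * a ^ 2) * w) := by gcongr
      _ = _ := by ring
  have hap : 0 ≤ a ^ p := Real.rpow_nonneg ha _
  have A5 : 2 ^ (2 * δ) * β * (1 + γ) ^ 2 * a ^ p + 2 ^ δ * β * (1 + γ) * a ^ p ≤ bOne ν α β γ δ p * a ^ p := by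
    rw [← add_mul]
    gcongr
    unfold bOne
    have t1 : 0 ≤ 2 ^ δ * (p - 1) ^ 2 * α ^ 2 / (4 * ν) := by positivity
    have t2 : 0 ≤ 2 ^ (2 * δ - 1) * β * (2 * (δ : ℝ) + 1) := by positivity
    linarith
  have eK1 : K1 ν α β γ δ p = 2 * δ / q * (p / (q * (β / 8))) ^ (p / (2 * δ)) * bOne ν α β γ δ p ^ (q / (2 * δ)) := by
    have hq0 : 0 < q := by rw [hq']; linarith only [hp2, hδ']
    have e0 : 8 * p / (β * q) = p / (q * (β / 8)) := by field_simp
    unfold K1 bOne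
    rw [← hq', e0]
  have eK3 : K3 ν α β δ p * b ^ q = 1 / q * ((q - 1) / (q * (β / 4))) ^ ((q - 1) / 1) *
      (2 ^ (2 * δ - 1) * β * (2 * δ + 1)) ^ (q / 1) * b ^ q + 2 / q * ((q - 2) / (q * (β / 4))) ^ ((q - 2) / 2) *
      (2 ^ δ * (p - 1) ^ 2 * α ^ 2 / (2 * ν)) ^ (q / 2) * b ^ q := by
    unfold K3
    rw [← hq']
    have hq0 : 0 < q := by rw [hq']; linarith only [hp2, hδ']
    have e1 : 4 * (q - 1) / (β * q) = (q - 1) / (q * (β / 4)) := by field_simp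
    have e2 : 4 * (q - 2) / (β * q) = (q - 2) / (q * (β / 4)) := by field_simp
    rw [e1, e2, div_one, div_one]
    ring
  rw [eK1, eK3]
  have A2' := mul_le_mul_of_nonneg_left A2 hβ.le
  -- The damping -β a^q is spent exactly: β/4 in `A4`, in `y1` and in `y2`, β/8 in `y3`, and β/8 on
  -- the term kept on the left.
  linarith only [A2', A3, A4, A5, y1, y2, y3]

/-- In a Young constant the powers of β cancel down to a single factor. This makes it comparable
with the bounds of the large regime, which are linear in β. -/
lemma young_const_large {x y : ℝ} (hx : 0 < x) (hy : 1 ≤ y) {β : ℝ} (hβ : 0 < β) {c : ℝ} (hc : 0 < c) {b : ℝ} (hb : 0 < b) :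
    (c / β) ^ (x - 1) * (β * b) ^ x = β * b * (c * b) ^ (x - 1) ∧ 1 + (x * (y - 1)) ≤ y ^ (x + 1) := by
  constructor
  · have : (β * b) ^ x = (β * b) * (β * b) ^ (x - 1) := by
      rw [← Real.rpow_one_add' (by positivity) (by linarith)]; congr 1; ring
    rw [this, mul_left_comm, ← Real.mul_rpow (by positivity) (by positivity)]
    congr 2
    field_simp
  · have h := one_add_mul_self_le_rpow_one_add (s := y - 1) (by linarith) (p := x + 1) (by linarith)
    rw [add_sub_cancel] at h
    nlinarith

/-- With x = (p+2δ)/(2δ) ≥ 2 and b = `bOne`/β ≥ 6, K₁ equals βb(cb)^(x-1)/x for some c ≥ 1.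
Bernoulli's inequality gives (cb)^(x-1) ≥ x, so K₁ ≥ βb. -/
lemma three_mul_le_K1 (hν : 0 < ν) (hβ : 0 < β) (hγ : 0 < γ)
    (hδ : 1 ≤ δ) (hp : 2 * (δ : ℝ) + 1 ≤ p) : 3 * β ≤ K1 ν α β γ δ p := by
  have hδ' : (1 : ℝ) ≤ δ := by exact_mod_cast hδ
  set q := p + 2 * δ with hq
  set x := q / (2 * δ) with hx
  set b := bOne ν α β γ δ p / β with hb
  have hbone : 6 ≤ b := by
    rw [hb, le_div_iff₀ hβ]
    unfold bOne
    have t1 : 0 ≤ 2 ^ δ * (p - 1) ^ 2 * α ^ 2 / (4 * ν) := by positivity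
    have t2 : (2 : ℝ) ≤ 2 ^ (2 * δ - 1) := by
      calc (2 : ℝ) = 2 ^ 1 := by norm_num
        _ ≤ _ := pow_le_pow_right₀ (by norm_num) (by omega)
    have t3 : 6 * β ≤ 2 ^ (2 * δ - 1) * β * (2 * (δ : ℝ) + 1) := by
      calc 6 * β = 2 * β * 3 := by ring
        _ ≤ _ := by gcongr; linarith
    have t4 : 0 ≤ 2 ^ (2 * δ) * β * (1 + γ) ^ 2 + 2 ^ δ * β * (1 + γ) := by positivity
    linarith
  have hx2 : 2 ≤ x := by rw [hx, le_div_iff₀ (by positivity)]; linarith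
  have e : K1 ν α β γ δ p = 1 / x * ((8 * p / q / β) ^ (x - 1) * (β * b) ^ x) := by
    have e1 : x - 1 = p / (2 * δ) := by rw [hx, hq]; field_simp; ring
    have e2 : β * b = bOne ν α β γ δ p := by rw [hb]; field_simp
    have e3 : 1 / x = 2 * δ / q := by rw [hx]; field_simp
    have e4 : 8 * p / q / β = 8 * p / (β * q) := by rw [div_div, mul_comm q β]
    rw [e1, e2, e3, e4]
    unfold K1 bOne
    ring
  have hc : 1 ≤ 8 * p / q := by
    rw [le_div_iff₀ (by rw [hq]; linarith)]; rw [hq]; linarith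
  rw [e, (young_const_large (x := x) (y := 1) (by linarith) le_rfl hβ (c := 8 * p / q) (by linarith) (b := b) (by linarith)).1]
  have h1 : b ≤ 8 * p / q * b := by nlinarith
  have h2 := one_add_mul_self_le_rpow_one_add (s := b - 1) (by linarith) (p := x - 1) (by linarith)
  rw [add_sub_cancel] at h2
  have h3 : b ^ (x - 1) ≤ (8 * p / q * b) ^ (x - 1) := by
    refine Real.rpow_le_rpow (by linarith) h1 (by linarith)
  have h4 : x ≤ (8 * p / q * b) ^ (x - 1) := by nlinarith
  rw [one_div, inv_mul_eq_div, le_div_iff₀ (by linarith)]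
  calc 3 * β * x ≤ β * b * x := by nlinarith [mul_pos hβ (by linarith : 0 < x)]
    _ ≤ _ := by gcongr

/-- The bracket is what the reaction and the flux cost when |v| ≤ 3|φ|, with |v| + |φ| bounded by
N|φ|, N = δ + 3. The first Young term of K₃ alone supplies 10 N^q, twice what the reaction uses; the
reserve and the second Young term pay for the flux. -/
lemma K3_lower (hν : 0 < ν) (hβ : 0 < β)
    (hδ : 1 ≤ δ) (hp : 2 * (δ : ℝ) + 1 ≤ p) {B : ℝ} (hB : B = 2 ^ δ * (p - 1) ^ 2 * α ^ 2 / (2 * ν) / β)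
    (hB0 : 0 < B) :
    β * (5 * (δ + 3) ^ (p + 2 * δ) + B / (2 ^ δ * (p - 1)) * (δ + 3) ^ (p + 2 * δ - 2)) ≤ K3 ν α β δ p := by
  have hδ' : (1 : ℝ) ≤ δ := by exact_mod_cast hδ
  set q := p + 2 * δ with hq
  have hq5 : 5 ≤ q := by linarith
  set Q : ℝ := 2 ^ (2 * δ - 1) * (2 * δ + 1) with hQ
  set N : ℝ := δ + 3 with hN
  have hN4 : 4 ≤ N := by rw [hN]; linarith
  have hQN : 3 / 2 * N ≤ Q := by
    have t2 : (2 : ℝ) ≤ 2 ^ (2 * δ - 1) := by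
      calc (2 : ℝ) = 2 ^ 1 := by norm_num
        _ ≤ _ := pow_le_pow_right₀ (by norm_num) (by omega)
    rw [hQ, hN]; nlinarith
  have hQ0 : 0 < Q := by linarith
  have e1 := (young_const_large (x := q) (y := 1) (by linarith) le_rfl hβ (c := 4 * (q - 1) / q)
    (div_pos (by linarith) (by linarith)) hQ0).1
  have e2 := (young_const_large (x := q / 2) (y := 1) (by linarith) le_rfl hβ (c := 4 * (q - 2) / q)
    (div_pos (by linarith) (by linarith)) hB0).1
  have eK : K3 ν α β δ p = 1 / q * (β * Q * (4 * (q - 1) / q * Q) ^ (q - 1))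
      + 2 / q * (β * B * (4 * (q - 2) / q * B) ^ (q / 2 - 1)) := by
    rw [← e1, ← e2]
    have e3 : β * B = 2 ^ δ * (p - 1) ^ 2 * α ^ 2 / (2 * ν) := by rw [hB]; field_simp
    have e4 : β * Q = 2 ^ (2 * δ - 1) * β * (2 * δ + 1) := by rw [hQ]; ring
    have e5 : q / 2 - 1 = (q - 2) / 2 := by ring
    rw [e3, e4, e5, div_div, div_div, mul_comm q β]
    unfold K3
    rw [← hq]
    ring
  have hNq : 0 < N ^ q := by positivity
  -- first term
  have f1 : 10 * N ^ q ≤ 1 / q * (Q * (4 * (q - 1) / q * Q) ^ (q - 1)) := by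
    have g1 : 16 / 5 ≤ 4 * (q - 1) / q := by rw [le_div_iff₀ (by linarith)]; linarith
    have g2 : 16 / 5 * (3 / 2 * N) ≤ 4 * (q - 1) / q * Q := by gcongr
    have g3 : (16 / 5 * (3 / 2 * N)) ^ (q - 1) ≤ (4 * (q - 1) / q * Q) ^ (q - 1) :=
      Real.rpow_le_rpow (by positivity) g2 (by linarith)
    have g4 : (16 / 5 * (3 / 2 * N)) ^ (q - 1) = (24 / 5) ^ (q - 1) * N ^ (q - 1) := by
      rw [← Real.mul_rpow (by norm_num) (by positivity)]; congr 1; ring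
    -- Bernoulli with base (24/5)² and exponent (q-1)/2: the power must beat a linear function of q
    -- to compensate the prefactor 1/q. The base is 16/5, a lower bound for 4(q-1)/q when q ≥ 5,
    -- times 3/2, from Q ≥ 3N/2.
    have g5 := one_add_mul_self_le_rpow_one_add (s := (24 / 5 : ℝ) ^ 2 - 1) (by norm_num) (p := (q - 1) / 2) (by linarith)
    have g6 : (1 + ((24 / 5 : ℝ) ^ 2 - 1)) ^ ((q - 1) / 2) = (24 / 5) ^ (q - 1) := by
      rw [add_sub_cancel, ← Real.rpow_natCast, ← Real.rpow_mul (by norm_num)]; congr 1; push_cast; ring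
    rw [g6] at g5
    have g7 : 20 / 3 * q ≤ (24 / 5 : ℝ) ^ (q - 1) := by
      refine le_trans ?_ g5
      norm_num
      linarith
    have g8 : N ^ q = N * N ^ (q - 1) := by
      rw [← Real.rpow_one_add' (by positivity) (by linarith)]; congr 1; ring
    rw [one_div, inv_mul_eq_div, le_div_iff₀ (by linarith), g8]
    have g9 : 0 < N ^ (q - 1) := by positivity
    calc 10 * (N * N ^ (q - 1)) * q = (3 / 2 * N) * ((20 / 3 * q) * N ^ (q - 1)) := by ring
      _ ≤ Q * ((24 / 5) ^ (q - 1) * N ^ (q - 1)) := by gcongr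
      _ ≤ _ := by rw [← g4]; gcongr
  have hp1 : 0 < p - 1 := by linarith
  have h2d : (2 : ℝ) ≤ 2 ^ δ := by
    calc (2 : ℝ) = 2 ^ 1 := by norm_num
      _ ≤ _ := pow_le_pow_right₀ (by norm_num) hδ
  have hden : 1 ≤ 2 ^ δ * (p - 1) := by nlinarith
  have hNq2 : N ^ q = N ^ 2 * N ^ (q - 2) := by
    rw [← Real.rpow_natCast, ← Real.rpow_add (by positivity)]; congr 1; push_cast; ring
  have hNp : 0 < N ^ (q - 2) := by positivity
  have f2 : B / (2 ^ δ * (p - 1)) * N ^ (q - 2) ≤ 5 * N ^ q + 2 / q * (B * (4 * (q - 2) / q * B) ^ (q / 2 - 1)) := by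
    -- A small flux coefficient is covered by the spare 5 N^q; a large one by the second Young term,
    -- which grows like B^(q/2).
    rcases le_total B (N ^ 2) with h | h
    · have t1 : B / (2 ^ δ * (p - 1)) ≤ N ^ 2 := (div_le_self hB0.le hden).trans h
      have t2 : 0 ≤ 2 / q * (B * (4 * (q - 2) / q * B) ^ (q / 2 - 1)) := by
        have : 0 ≤ 4 * (q - 2) / q := div_nonneg (by linarith) (by linarith)
        positivity
      have t3 : B / (2 ^ δ * (p - 1)) * N ^ (q - 2) ≤ N ^ 2 * N ^ (q - 2) := by gcongr
      rw [← hNq2] at t3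
      linarith
    · have t1 : N ^ (q - 2) ≤ (4 * (q - 2) / q * B) ^ (q / 2 - 1) := by
        have s1 : N ^ 2 ≤ 4 * (q - 2) / q * B := by
          have : 1 ≤ 4 * (q - 2) / q := by rw [le_div_iff₀ (by linarith)]; linarith
          nlinarith
        have s2 : N ^ (q - 2) = (N ^ 2) ^ (q / 2 - 1) := by
          rw [← Real.rpow_natCast, ← Real.rpow_mul (by positivity)]; congr 1; push_cast; ring
        rw [s2]
        exact Real.rpow_le_rpow (by positivity) s1 (by linarith)
      have t2 : 1 / (2 ^ δ * (p - 1)) ≤ 2 / q := by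
        rw [div_le_div_iff₀ (by positivity) (by linarith)]
        have : q ≤ 2 * p := by linarith
        nlinarith
      have t3 : 0 ≤ 5 * N ^ q := by positivity
      calc _ = 1 / (2 ^ δ * (p - 1)) * (B * N ^ (q - 2)) := by ring
        _ ≤ 2 / q * (B * (4 * (q - 2) / q * B) ^ (q / 2 - 1)) := by gcongr
        _ ≤ _ := by linarith
  rw [eK]
  calc _ ≤ β * (1 / q * (Q * (4 * (q - 1) / q * Q) ^ (q - 1)) + 2 / q * (B * (4 * (q - 2) / q * B) ^ (q / 2 - 1))) := by
        refine mul_le_mul_of_nonneg_left ?_ hβ.le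
        have f3 : 1 / q * (Q * (4 * (q - 1) / q * Q) ^ (q - 1)) + 2 / q * (B * (4 * (q - 2) / q * B) ^ (q / 2 - 1))
          ≥ 5 * N ^ q + B / (2 ^ δ * (p - 1)) * N ^ (q - 2) := by linarith
        exact f3
    _ = _ := by ring

lemma rpow_le_one_add_rpow {x s q : ℝ} (hx : 0 ≤ x) (hs : 0 ≤ s) (hsq : s ≤ q) : x ^ s ≤ 1 + x ^ q := by
  rcases le_total x 1 with h | h
  · have := Real.rpow_le_one hx h hs
    have := Real.rpow_nonneg hx q
    linarith
  · have := Real.rpow_le_rpow_of_exponent_le h hsq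
    linarith

/-- When |v| ≤ 3|φ| there is no use for the damping: all terms are bounded by powers of s =
(δ+3)|φ|. Lower powers are absorbed by 1 + s^q, whose constant part, 3β in total, goes into K₁. -/
lemma pointwise_large (hν : 0 < ν) (hα : 0 < α) (hβ : 0 < β) (hγ : 0 < γ) (hγ1 : γ < 1)
    (hδ : 1 ≤ δ) (hp : 2 * (δ : ℝ) + 1 ≤ p) {v φ : ℝ} (hφ : |v| ≤ 3 * |φ|) :
    β * (cc γ δ (v + φ) * (|v| ^ (p - 2) * v) + γ * |v| ^ p + |v| ^ (p + 2 * δ) / 8)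
      + (p - 1) / (2 * ν) * (α / (δ + 1)) ^ 2 * (|v| ^ (p - 2) * (pp δ (v + φ) - pp δ v) ^ 2)
      ≤ K1 ν α β γ δ p + K3 ν α β δ p * |φ| ^ (p + 2 * δ) := by
  have hδ' : (1 : ℝ) ≤ δ := by exact_mod_cast hδ
  have hp2 : 2 < p := by linarith
  have hp1 : 0 < p - 1 := by linarith
  set a := |v| with ha'
  set b := |φ| with hb'
  have ha : 0 ≤ a := abs_nonneg _
  have hb : 0 ≤ b := abs_nonneg _
  set w := a ^ (p - 2) with hw'
  have hw : 0 ≤ w := Real.rpow_nonneg ha _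
  set q := p + 2 * δ with hq'
  set N : ℝ := δ + 3 with hN
  set s := N * b with hs'
  have hs : 0 ≤ s := by positivity
  have has : a ≤ s := by rw [hs', hN]; nlinarith
  have hab : a + b ≤ s := by rw [hs', hN]; nlinarith
  have hws : w ≤ s ^ (p - 2) := Real.rpow_le_rpow ha has (by linarith)
  set z := s ^ (p - 2) with hz'
  have hz : 0 ≤ z := Real.rpow_nonneg hs _
  have r0 : a ^ 2 * w = a ^ p := by rw [hw', rpow_mul_pow_eq ha hp2]; congr 1; push_cast; ring
  have r2 : a ^ (2 * δ + 2) * w = a ^ q := by rw [hw', rpow_mul_pow_eq ha hp2]; congr 1; push_cast; ring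
  have s1 : s ^ 2 * z = s ^ p := by rw [hz', rpow_mul_pow_eq hs hp2]; congr 1; push_cast; ring
  have s2 : s ^ (δ + 2) * z = s ^ (p + δ) := by rw [hz', rpow_mul_pow_eq hs hp2]; congr 1; push_cast; ring
  have s3 : s ^ (2 * δ + 2) * z = s ^ q := by rw [hz', rpow_mul_pow_eq hs hp2]; congr 1; push_cast; ring
  have s4 : s ^ (2 * δ) * z = s ^ (q - 2) := by rw [hz', rpow_mul_pow_eq hs hp2]; congr 1; push_cast; ring
  have hcc := cc_mul_le (δ := δ) hγ v φ
  have hpp := pp_sub_sq_le (δ := δ) v φ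
  rw [← ha', ← hb'] at hcc hpp
  have hb_s : b ≤ s := by linarith
  have h1 : (a + b) ^ (δ + 1) * a ≤ s ^ (δ + 2) := by
    calc _ ≤ s ^ (δ + 1) * s := by gcongr
      _ = _ := by ring
  have h2 : -((v + φ) ^ (2 * δ + 1) * v) ≤ s ^ (2 * δ + 2) := by
    refine (neg_le_abs _).trans ?_
    rw [abs_mul, abs_pow]
    calc _ ≤ s ^ (2 * δ + 1) * s := by
          gcongr
          exact (abs_add_le _ _).trans hab
      _ = _ := by ring
  have h3 : a * b ≤ s ^ 2 := by
    rw [sq]; exact mul_le_mul has (by linarith only [hab, ha]) hb hs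
  have A1 : cc γ δ (v + φ) * v + γ * a ^ 2 + a ^ (2 * δ + 2) / 8 ≤ 2 * s ^ (δ + 2) + s ^ 2 + 2 * s ^ (2 * δ + 2) := by
    have t1 : (1 + γ) * ((a + b) ^ (δ + 1) * a) ≤ 2 * s ^ (δ + 2) := by gcongr; linarith
    have t2 : γ * (a * b) ≤ 1 * s ^ 2 := by gcongr
    have t3 : a ^ (2 * δ + 2) ≤ s ^ (2 * δ + 2) := by gcongr
    have t4 : 0 ≤ s ^ (2 * δ + 2) := by positivity
    linarith
  have hpq : p ≤ q := by rw [hq']; linarith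
  have A2 : cc γ δ (v + φ) * (w * v) + γ * a ^ p + a ^ q / 8 ≤ 3 + 5 * s ^ q := by
    have t1 := rpow_le_one_add_rpow hs (s := p) (q := q) (by linarith) hpq
    have t2 := rpow_le_one_add_rpow hs (s := p + δ) (q := q) (by linarith) (by rw [hq']; linarith)
    calc _ = (cc γ δ (v + φ) * v + γ * a ^ 2 + a ^ (2 * δ + 2) / 8) * w := by rw [← r0, ← r2]; ring
      _ ≤ (2 * s ^ (δ + 2) + s ^ 2 + 2 * s ^ (2 * δ + 2)) * w := by gcongr
      _ ≤ (2 * s ^ (δ + 2) + s ^ 2 + 2 * s ^ (2 * δ + 2)) * z := by gcongr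
      _ = 2 * (s ^ (δ + 2) * z) + s ^ 2 * z + 2 * (s ^ (2 * δ + 2) * z) := by ring
      _ = 2 * s ^ (p + δ) + s ^ p + 2 * s ^ q := by rw [s1, s2, s3]
      _ ≤ _ := by linarith
  set B := 2 ^ δ * (p - 1) ^ 2 * α ^ 2 / (2 * ν) / β with hB
  have hB0 : 0 < B := by positivity
  have A3 : (p - 1) / (2 * ν) * (α / (δ + 1)) ^ 2 * (w * (pp δ (v + φ) - pp δ v) ^ 2)
      ≤ β * (B / (2 ^ δ * (p - 1)) * (N ^ (q - 2) * b ^ q)) := by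
    have t : (pp δ (v + φ) - pp δ v) ^ 2 ≤ (δ + 1) ^ 2 * (b ^ 2 * s ^ (2 * δ)) :=
      hpp.trans (by gcongr)
    have e1 : b ^ 2 * s ^ (q - 2) = N ^ (q - 2) * b ^ q := by
      have : b ^ q = b ^ (q - 2) * b ^ 2 := by
        rw [← Real.rpow_natCast, ← Real.rpow_add_of_nonneg hb (by linarith) (by norm_num)]
        congr 1; push_cast; ring
      rw [hs', Real.mul_rpow (by positivity) hb, this]; ring
    calc _ ≤ (p - 1) / (2 * ν) * (α / (δ + 1)) ^ 2 * (z * ((δ + 1) ^ 2 * (b ^ 2 * s ^ (2 * δ)))) := by gcongr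
      _ = (p - 1) / (2 * ν) * α ^ 2 * (b ^ 2 * (s ^ (2 * δ) * z)) := by field_simp
      _ = _ := by
          rw [s4, e1, hB]
          field_simp
  have hK1 := three_mul_le_K1 (ν := ν) (α := α) (β := β) (γ := γ) hν hβ hγ hδ hp
  have hK3 := K3_lower (ν := ν) (α := α) (β := β) hν hβ hδ hp hB hB0
  rw [← hN, ← hq'] at hK3
  have hbq : 0 ≤ b ^ q := Real.rpow_nonneg hb _
  have hK3' := mul_le_mul_of_nonneg_right hK3 hbq
  have e3 : s ^ q = N ^ q * b ^ q := Real.mul_rpow (by positivity) hb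
  rw [e3] at A2
  have A2' := mul_le_mul_of_nonneg_left A2 hβ.le
  calc _ ≤ β * (3 + 5 * (N ^ q * b ^ q)) + β * (B / (2 ^ δ * (p - 1)) * (N ^ (q - 2) * b ^ q)) := add_le_add A2' A3
    _ = 3 * β + β * (5 * N ^ q + B / (2 ^ δ * (p - 1)) * N ^ (q - 2)) * b ^ q := by ring
    _ ≤ _ := add_le_add hK1 hK3'

/-- The pointwise inequality behind the energy estimate. -/
theorem pointwise_energy (hν : 0 < ν) (hα : 0 < α) (hβ : 0 < β) (hγ : 0 < γ) (hγ1 : γ < 1)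
    (hδ : 1 ≤ δ) (hp : 2 * (δ : ℝ) + 1 ≤ p) (v φ : ℝ) :
    β * (cc γ δ (v + φ) * (|v| ^ (p - 2) * v) + γ * |v| ^ p + |v| ^ (p + 2 * δ) / 8)
      + (p - 1) / (2 * ν) * (α / (δ + 1)) ^ 2 * (|v| ^ (p - 2) * (pp δ (v + φ) - pp δ v) ^ 2)
      ≤ K1 ν α β γ δ p + K3 ν α β δ p * |φ| ^ (p + 2 * δ) := by
  rcases le_total (3 * |φ|) |v| with h | h
  · exact pointwise_small hν hβ hγ hδ hp h
  · exact pointwise_large hν hα hβ hγ hγ1 hδ hp h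

end Pointwise

end GBH

/-! ### Energy identities through Galerkin truncation. -/

noncomputable section
namespace GBH

/-- A function with bounded continuous second derivative, vanishing to second order at `0`. -/
structure EnergyFun (Φ Φ1 Φ2 : ℝ → ℝ) (L : ℝ≥0) : Prop where
  zero : Φ 0 = 0
  zero1 : Φ1 0 = 0
  d0 : ∀ x, HasDerivAt Φ (Φ1 x) x
  d1 : ∀ x, HasDerivAt Φ1 (Φ2 x) x
  bd : ∀ x, |Φ2 x| ≤ L
  cont2 : Continuous Φ2

namespace EnergyFun
variable {Φ Φ1 Φ2 : ℝ → ℝ} {L : ℝ≥0}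

lemma lip1 (h : EnergyFun Φ Φ1 Φ2 L) : LipschitzWith L Φ1 :=
  lipschitzWith_of_nnnorm_deriv_le (fun x => (h.d1 x).differentiableAt) fun x => by
    rw [(h.d1 x).deriv, ← NNReal.coe_le_coe, coe_nnnorm]; exact h.bd x

lemma abs1_le (h : EnergyFun Φ Φ1 Φ2 L) (x : ℝ) : |Φ1 x| ≤ L * |x| := by
  have := h.lip1.norm_sub_le x 0
  simpa [h.zero1] using this

lemma cont1 (h : EnergyFun Φ Φ1 Φ2 L) : Continuous Φ1 := h.lip1.continuous

lemma cont (h : EnergyFun Φ Φ1 Φ2 L) : Continuous Φ :=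
  continuous_iff_continuousAt.2 fun x => (h.d0 x).continuousAt

/-- The mean value inequality with |Φ'| ≤ L|·|. Quadratic growth makes u ↦ ∫Φ(u) continuous on L²,
as needed for the endpoint terms of the energy identity. -/
lemma polyGrowth (h : EnergyFun Φ Φ1 Φ2 L) : PolyGrowth Φ L 1 where
  zero := h.zero
  cont := h.cont
  nonneg := L.2
  lip a b := by
    have hm : ∀ y ∈ Metric.closedBall (0 : ℝ) (max |a| |b|), ‖Φ1 y‖ ≤ L * max |a| |b| := fun y hy => by
      rw [mem_closedBall_zero_iff] at hy
      exact (h.abs1_le y).trans (mul_le_mul_of_nonneg_left hy L.2)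
    have := (convex_closedBall (0 : ℝ) (max |a| |b|)).norm_image_sub_le_of_norm_hasDerivWithin_le
      (fun y _ => (h.d0 y).hasDerivWithinAt) hm (x := b) (y := a) (by simp) (by simp)
    rw [Real.norm_eq_abs, Real.norm_eq_abs] at this
    refine this.trans ?_
    rw [pow_one, mul_assoc]
    gcongr
    exact max_le (by linarith [abs_nonneg b]) (by linarith [abs_nonneg a])

end EnergyFun

/-- Partial sums of sine series. -/
def Sn (N : ℕ) (a : ℕ → ℝ) : X := ∑ k ∈ Finset.range N, a k • sX k

/-- Partial sums of cosine series. -/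
def Gn (N : ℕ) (g : ℕ → ℝ) : X := ∑ k ∈ Finset.range (N + 1), g k • cbX k

/-- The cosine coefficients of the derivative of a sine series. -/
def dcoef (a : ℕ → ℝ) : ℕ → ℝ
  | 0 => 0
  | k + 1 => ev k * a k

lemma Sn_apply (N : ℕ) (a : ℕ → ℝ) (x : ℝ) : Sn N a x = ∑ k ∈ Finset.range N, a k * sf k x := by
  simp [Sn]

lemma Gn_apply (N : ℕ) (g : ℕ → ℝ) (x : ℝ) :
    Gn N g x = ∑ k ∈ Finset.range N, g (k + 1) * cf k x + g 0 := by
  simp [Gn, Finset.sum_range_succ', cb]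

lemma Gn_dcoef_apply (N : ℕ) (a : ℕ → ℝ) (x : ℝ) :
    Gn N (dcoef a) x = ∑ k ∈ Finset.range N, ev k * a k * cf k x := by
  simp [Gn_apply, dcoef]

lemma hasDerivAt_Sn (N : ℕ) (a : ℕ → ℝ) (x : ℝ) : HasDerivAt (Sn N a) (Gn N (dcoef a) x) x := by
  have h := HasDerivAt.fun_sum fun k (_ : k ∈ Finset.range N) => (hasDerivAt_sf k x).const_mul (a k)
  have e : (⇑(Sn N a)) = fun x => ∑ k ∈ Finset.range N, a k * sf k x := funext (Sn_apply N a)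
  rw [e, Gn_dcoef_apply]
  exact h.congr_deriv (Finset.sum_congr rfl fun k _ => by ring)

lemma hasDerivAt_Gn (N : ℕ) (g : ℕ → ℝ) (x : ℝ) :
    HasDerivAt (Gn N g) (-Sn N (fun k => ev k * g (k + 1)) x) x := by
  have h := (HasDerivAt.fun_sum fun k (_ : k ∈ Finset.range N) =>
    (hasDerivAt_cf k x).const_mul (g (k + 1))).add_const (g 0)
  have e : (⇑(Gn N g)) = fun x => ∑ k ∈ Finset.range N, g (k + 1) * cf k x + g 0 := funext (Gn_apply N g)
  rw [e, Sn_apply, ← Finset.sum_neg_distrib]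
  exact h.congr_deriv (Finset.sum_congr rfl fun k _ => by ring)

lemma Sn_zero (N : ℕ) (a : ℕ → ℝ) : Sn N a 0 = 0 := by simp [Sn_apply, sf_zero]
lemma Sn_one (N : ℕ) (a : ℕ → ℝ) : Sn N a 1 = 0 := by simp [Sn_apply, sf_one]

section
variable {Φ Φ1 Φ2 : ℝ → ℝ} {L : ℝ≥0}

/-- For trigonometric polynomials this is ordinary integration by parts; the boundary terms vanish
because sine polynomials vanish at 0 and 1 and Φ'(0) = 0. The coefficient ev · g(k+1) is that of
-∂ₓg, the constant cosine mode being lost under differentiation. -/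
lemma galerkin_ibp (h : EnergyFun Φ Φ1 Φ2 L) (N : ℕ) (a f g : ℕ → ℝ) (ν : ℝ) :
    ∫ x, Φ1 (Sn N a x) * Sn N (fun k => -(ν * lam k * a k) + f k + ev k * g (k + 1)) x ∂mu
      = -(ν * ∫ x, Φ2 (Sn N a x) * Gn N (dcoef a) x * Gn N (dcoef a) x ∂mu)
        + ∫ x, Φ1 (Sn N a x) * Sn N f x ∂mu
        + ∫ x, Φ2 (Sn N a x) * Gn N (dcoef a) x * Gn N g x ∂mu := by
  have c1 : Continuous Φ1 := h.lip1.continuous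
  have c2 : Continuous Φ2 := h.cont2
  have cS : ∀ a, Continuous (Sn N a) := fun a => (Sn N a).continuous
  have cG : ∀ a, Continuous (Gn N a) := fun a => (Gn N a).continuous
  set W := Gn N (dcoef a) with hW
  have hibp : ∫ x, Φ1 (Sn N a x) * (-(ν * Sn N (fun k => ev k * dcoef a (k + 1)) x)
      + Sn N (fun k => ev k * g (k + 1)) x) ∂mu = -∫ x, Φ2 (Sn N a x) * W x * (ν * W x - Gn N g x) ∂mu := by
    have hv : ∀ x, HasDerivAt (fun x => ν * W x - Gn N g x) (-(ν * Sn N (fun k => ev k * dcoef a (k + 1)) x)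
      + Sn N (fun k => ev k * g (k + 1)) x) x := fun x =>
      (((hasDerivAt_Gn N (dcoef a) x).const_mul ν).sub (hasDerivAt_Gn N g x)).congr_deriv (by ring)
    have hu : ∀ x, HasDerivAt (fun x => Φ1 (Sn N a x)) (Φ2 (Sn N a x) * W x) x := fun x =>
      (h.d1 _).comp x (hasDerivAt_Sn N a x)
    rw [integral_mu_eq, integral_mu_eq, intervalIntegral.integral_mul_deriv_eq_deriv_mul
      (fun x _ => hu x) (fun x _ => hv x)
      (Continuous.intervalIntegrable (by have := cS a; have := cG (dcoef a); fun_prop) _ _)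
      (Continuous.intervalIntegrable (by
        have := cS (fun k => ev k * dcoef a (k + 1)); have := cS (fun k => ev k * g (k + 1)); fun_prop) _ _)]
    simp [Sn_zero, Sn_one, h.zero1]
  have hi : ∀ {F : ℝ → ℝ}, Continuous F → Integrable F mu := fun hF => integrable_mu_of_continuous hF
  have e1 : ∀ x, Φ1 (Sn N a x) * Sn N (fun k => -(ν * lam k * a k) + f k + ev k * g (k + 1)) x
      = Φ1 (Sn N a x) * (-(ν * Sn N (fun k => ev k * dcoef a (k + 1)) x)
      + Sn N (fun k => ev k * g (k + 1)) x) + Φ1 (Sn N a x) * Sn N f x := fun x => by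
    rw [← mul_add]
    congr 1
    simp only [Sn_apply, dcoef, Finset.mul_sum, ← Finset.sum_neg_distrib, ← Finset.sum_add_distrib]
    refine Finset.sum_congr rfl fun k _ => ?_
    unfold lam; ring
  have e2 : ∀ x, Φ2 (Sn N a x) * W x * (ν * W x - Gn N g x) =
      ν * (Φ2 (Sn N a x) * W x * W x) - Φ2 (Sn N a x) * W x * Gn N g x := fun x => by ring
  have k0 := cS a; have k1 := cS f; have k2 := cG (dcoef a); have k3 := cG g
  have k4 := cS (fun k => ev k * dcoef a (k + 1)); have k5 := cS (fun k => ev k * g (k + 1))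
  simp only [e1]
  rw [integral_add (hi (by fun_prop)) (hi (by fun_prop)), hibp]
  simp only [e2]
  rw [integral_sub (hi (by fun_prop)) (hi (by fun_prop)), integral_const_mul]
  ring

/-- The fundamental theorem of calculus in time at each fixed x, followed by Fubini. -/
lemma galerkin_chain (h : EnergyFun Φ Φ1 Φ2 L) (N : ℕ) {q r : ℕ → ℝ → ℝ} {a b : ℝ} (hab : a ≤ b)
    (hq : ∀ k, ContinuousOn (q k) (Icc a b)) (hr : ∀ k, ContinuousOn (r k) (Icc a b))
    (hd : ∀ k, ∀ t ∈ Ioo a b, HasDerivAt (q k) (r k t) t) :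
    ∫ x, Φ (Sn N (fun k => q k b) x) ∂mu - ∫ x, Φ (Sn N (fun k => q k a) x) ∂mu
      = ∫ t in a..b, ∫ x, Φ1 (Sn N (fun k => q k t) x) * Sn N (fun k => r k t) x ∂mu := by
  have c1 : Continuous Φ1 := h.lip1.continuous
  have c0 := h.cont
  have hcq : ∀ k, ContinuousOn (fun z : ℝ × ℝ => q k z.1) (Icc a b ×ˢ Icc 0 1) := fun k =>
    (hq k).comp continuousOn_fst fun z hz => hz.1
  have hcr : ∀ k, ContinuousOn (fun z : ℝ × ℝ => r k z.1) (Icc a b ×ˢ Icc 0 1) := fun k =>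
    (hr k).comp continuousOn_fst fun z hz => hz.1
  have hcs : ∀ k, ContinuousOn (fun z : ℝ × ℝ => sf k z.2) (Icc a b ×ˢ Icc 0 1) := fun k =>
    ((continuous_sf k).comp continuous_snd).continuousOn
  have hcont : ContinuousOn (fun z : ℝ × ℝ => Φ1 (Sn N (fun k => q k z.1) z.2) * Sn N (fun k => r k z.1) z.2)
      (Icc a b ×ˢ Icc 0 1) := by
    simp only [Sn_apply]
    exact (c1.comp_continuousOn (continuousOn_finsetSum _ fun k _ => (hcq k).mul (hcs k))).mul
      (continuousOn_finsetSum _ fun k _ => (hcr k).mul (hcs k))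
  have hint : Integrable (Function.uncurry fun t x => Φ1 (Sn N (fun k => q k t) x) * Sn N (fun k => r k t) x)
      ((volume.restrict (Ioc a b)).prod mu) := by
    rw [Measure.prod_restrict]
    exact (hcont.integrableOn_compact (isCompact_Icc.prod isCompact_Icc)).mono_set
      (prod_mono Ioc_subset_Icc_self Ioo_subset_Icc_self)
  have hi : ∀ {F : ℝ → ℝ}, Continuous F → Integrable F mu := fun hF => integrable_mu_of_continuous hF
  have hΦ : ∀ t, Integrable (fun x => Φ (Sn N (fun k => q k t) x)) mu := fun t =>
    hi (c0.comp (X.continuous _))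
  rw [intervalIntegral.integral_of_le hab, integral_integral_swap hint, ← integral_sub (hΦ b) (hΦ a)]
  refine integral_congr_ae (ae_mu_of_forall fun x hx => ?_)
  simp only
  rw [← intervalIntegral.integral_of_le hab]
  symm
  have hSc : ∀ u : ℕ → ℝ → ℝ, (∀ k, ContinuousOn (u k) (Icc a b)) →
      ContinuousOn (fun t => Sn N (fun k => u k t) x) (Icc a b) := fun u hu => by
    simp only [Sn_apply]
    exact continuousOn_finsetSum _ fun k _ => (hu k).mul continuousOn_const
  refine intervalIntegral.integral_eq_sub_of_hasDerivAt_of_le (f := fun t => Φ (Sn N (fun k => q k t) x)) hab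
    (c0.comp_continuousOn (hSc q hq)) (fun t ht => ?_) ?_
  · refine (h.d0 _).comp t ?_
    simp only [Sn_apply]
    exact HasDerivAt.fun_sum fun k _ => (hd k t ht).mul_const (sf k x)
  · refine ContinuousOn.intervalIntegrable ?_
    rw [uIcc_of_le hab]
    exact (c1.comp_continuousOn (hSc q hq)).mul (hSc r hr)
end

lemma toE_Sn (N : ℕ) (a : ℕ → ℝ) : toE 2 (Sn N a) = ∑ k ∈ Finset.range N, a k • toE 2 (sX k) := by
  simp [Sn]

lemma toE_Gn (N : ℕ) (a : ℕ → ℝ) : toE 2 (Gn N a) = ∑ k ∈ Finset.range (N + 1), a k • toE 2 (cbX k) := by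
  simp [Gn]

lemma tendsto_Sn (f : H2) : Tendsto (fun N => toE 2 (Sn N fun k => sc k f)) atTop (𝓝 f) := by
  simp only [toE_Sn]; exact (hasSum_sc f).tendsto_sum_nat

lemma tendsto_Gn (f : H2) : Tendsto (fun N => toE 2 (Gn N fun k => kc k f)) atTop (𝓝 f) := by
  simp only [toE_Gn]; exact (tendsto_add_atTop_iff_nat 1).2 (hasSum_kc f).tendsto_sum_nat

lemma norm_sum_smul_sq {e : ℕ → H2} (he : Orthonormal ℝ e) (s : Finset ℕ) (a : ℕ → ℝ) :
    ‖∑ k ∈ s, a k • e k‖ ^ 2 = ∑ k ∈ s, a k ^ 2 := by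
  rw [← real_inner_self_eq_norm_sq, he.inner_sum]
  exact Finset.sum_congr rfl fun k _ => by simp [sq]

lemma norm_Sn_le (N : ℕ) (f : H2) : ‖toE 2 (Sn N fun k => sc k f)‖ ≤ ‖f‖ := by
  refine (abs_le_of_sq_le_sq' ?_ (norm_nonneg _)).2
  rw [toE_Sn, norm_sum_smul_sq orthonormal_sX]
  exact sum_le_hasSum _ (fun k _ => sq_nonneg _) (hasSum_sc_sq f)

lemma norm_Gn_le (N : ℕ) (f : H2) : ‖toE 2 (Gn N fun k => kc k f)‖ ≤ ‖f‖ := by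
  refine (abs_le_of_sq_le_sq' ?_ (norm_nonneg _)).2
  rw [toE_Gn, norm_sum_smul_sq orthonormal_cbX]
  exact sum_le_hasSum _ (fun k _ => sq_nonneg _) (hasSum_kc_sq f)

/-- `w` is the weak derivative of `u`, in terms of Fourier coefficients. -/
def HasD (u w : H2) : Prop := ∀ k, kc k w = dcoef (fun k => sc k u) k

/-- The weak derivative of an element of `H¹₀(0,1)`. -/
def derivH (u : H2) : H2 := open Classical in if h : ∃ w : H2, HasD u w then h.choose else 0

lemma hasD_derivH {u w : H2} (h : HasD u w) : HasD u (derivH u) := by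
  have h' : ∃ w : H2, HasD u w := ⟨w, h⟩
  rw [derivH, dif_pos h']
  exact h'.choose_spec

lemma HasD.eq {u w w' : H2} (h : HasD u w) (h' : HasD u w') : w = w' :=
  eq_of_kc_eq fun k => (h k).trans (h' k).symm

lemma hasH10Deriv_iff_hasD {f g : ℝ → ℝ} {u w : H2} (hf : f =ᵐ[mu] u) (hg : g =ᵐ[mu] w) :
    HasH10Deriv f g ↔ HasD u w := by
  rw [hasH10Deriv_iff ((memLp_congr_ae hf).2 (Lp.memLp u)) ((memLp_congr_ae hg).2 (Lp.memLp w))]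
  simp only [kc_congr hg, sc_congr hf, HasD]
  exact ⟨fun h k => by cases k with
    | zero => exact h.1
    | succ k => exact h.2 k, fun h => ⟨h 0, fun k => h (k + 1)⟩⟩

lemma HasD.summable {u w : H2} (h : HasD u w) : Summable fun k => (ev k * sc k u) ^ 2 := by
  have := (summable_nat_add_iff 1).2 (hasSum_kc_sq w).summable
  simpa only [h _, dcoef] using this

lemma exists_hasD {u : H2} (h : Summable fun k => (ev k * sc k u) ^ 2) : ∃ w, HasD u w := by
  refine exists_kc_eq ((summable_nat_add_iff 1).1 ?_)
  exact h

lemma HasD.norm_sq {u w : H2} (h : HasD u w) : HasSum (fun k => (ev k * sc k u) ^ 2) (‖w‖ ^ 2) := by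
  have := hasSum_kc_sq w
  simp only [h _] at this
  rw [← hasSum_nat_add_iff' 1] at this
  simpa [dcoef] using this

lemma integral_mul3 (b A B : X) : ∫ x, b x * A x * B x ∂mu = inner ℝ (mulX b (toE 2 A)) (toE 2 B) := by
  rw [inner_mulX]
  refine integral_congr_ae ?_
  filter_upwards [coeFn_toE 2 A, coeFn_toE 2 B] with x h1 h2
  rw [h1, h2]

lemma integral_mul2 (A B : X) : ∫ x, A x * B x ∂mu = inner ℝ (toE 2 A) (toE 2 B) := by
  rw [inner_toE, integral_mul_toE]

lemma PolyGrowth.continuous_integral {g : ℝ → ℝ} {C : ℝ} {k : ℕ} {p : ℝ} (hg : PolyGrowth g C k) {q : ℝ≥0∞}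
    [hq1 : Fact (1 ≤ q)] (hq : q = ENNReal.ofReal p) (hkp : (k : ℝ) + 1 ≤ p) :
    Continuous fun u : Lp ℝ q mu => ∫ x, g (u x) ∂mu := by
  subst hq
  have hrp : (1 : ℝ) * (k + 1) ≤ p := by rwa [one_mul]
  have : Fact (1 ≤ ENNReal.ofReal 1) := ⟨by simp⟩
  have hc := continuous_nemy hg one_pos hrp
  refine ((pairL (ENNReal.ofReal 1) (cbX 0)).continuous.comp hc).congr fun u => ?_
  simp only [Function.comp_apply, pairL_apply, cbX_apply, cb, one_mul]
  refine integral_congr_ae ?_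
  filter_upwards [coeFn_nemy hg one_pos hrp u] with x hx
  rw [hx]

section
variable {Φ Φ1 Φ2 : ℝ → ℝ} {L : ℝ≥0}

lemma norm_toE_comp_le (h : EnergyFun Φ Φ1 Φ2 L) (S : X) : ‖toE 2 (X.comp Φ1 h.cont1 S)‖ ≤ L * ‖toE 2 S‖ := by
  refine Lp.norm_le_mul_norm_of_ae_le_mul ?_
  filter_upwards [coeFn_toE 2 S, coeFn_toE 2 (X.comp Φ1 h.cont1 S)] with x h1 h2
  rw [h1, h2]
  exact h.abs1_le _

lemma norm_comp_two_le (h : EnergyFun Φ Φ1 Φ2 L) (S : X) : ‖X.comp Φ2 h.cont2 S‖ ≤ L :=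
  (X.norm_le L.2).2 fun _ => h.bd _

/-- The right-hand side of the energy identity at a fixed time. -/
def energyRate (ν : ℝ) (Φ1 Φ2 : ℝ → ℝ) (u w f g : H2) : ℝ :=
  -(ν * ∫ x, Φ2 (u x) * w x * w x ∂mu) + ∫ x, Φ1 (u x) * f x ∂mu + ∫ x, Φ2 (u x) * w x * g x ∂mu

/-- The Galerkin approximation of the energy rate. -/
def galerkinRate (ν : ℝ) (Φ1 : ℝ → ℝ) (N : ℕ) (u f g : H2) : ℝ :=
  ∫ x, Φ1 (Sn N (fun k => sc k u) x) *
    Sn N (fun k => -(ν * lam k * sc k u) + sc k f + ev k * kc (k + 1) g) x ∂mu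

lemma galerkinRate_eq (h : EnergyFun Φ Φ1 Φ2 L) (ν : ℝ) (N : ℕ) {u w : H2} (hw : HasD u w) (f g : H2) :
    galerkinRate ν Φ1 N u f g =
      -(ν * inner ℝ (mulX (X.comp Φ2 h.cont2 (Sn N fun k => sc k u)) (toE 2 (Gn N fun k => kc k w)))
          (toE 2 (Gn N fun k => kc k w)))
        + inner ℝ (toE 2 (X.comp Φ1 h.cont1 (Sn N fun k => sc k u))) (toE 2 (Sn N fun k => sc k f))
        + inner ℝ (mulX (X.comp Φ2 h.cont2 (Sn N fun k => sc k u)) (toE 2 (Gn N fun k => kc k w)))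
          (toE 2 (Gn N fun k => kc k g)) := by
  have e : (fun k => kc k w) = dcoef (fun k => sc k u) := funext hw
  rw [galerkinRate, galerkin_ibp h N (fun k => sc k u) (fun k => sc k f) (fun k => kc k g) ν,
    ← integral_mul3, ← integral_mul3, ← integral_mul2, e]
  rfl

/-- The coefficients of an H¹₀ function are absolutely summable. Uniform convergence is needed
because the partial sums enter the nonlinear multiplier Φ''. -/
lemma tendsto_Sn_X {u w : H2} (hw : HasD u w) :
    ∃ S : X, u =ᵐ[mu] S ∧ Tendsto (fun N => Sn N fun k => sc k u) atTop (𝓝 S) := by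
  have hs := summable_abs_of_summable_ev_mul_sq hw.summable
  exact ⟨_, ae_eq_sine_series (Lp.memLp u) hs, (hasSum_smul_sX hs).tendsto_sum_nat⟩

lemma tendsto_mulX {b : ℕ → X} {S : X} {w : ℕ → H2} {v : H2} (hb : Tendsto b atTop (𝓝 S))
    (hw : Tendsto w atTop (𝓝 v)) : Tendsto (fun n => mulX (b n) (w n)) atTop (𝓝 (mulX S v)) := by
  have h1 : Tendsto (fun n => ‖b n - S‖ * ‖w n‖ + ‖S‖ * ‖w n - v‖) atTop (𝓝 0) := by
    have e1 := (tendsto_iff_norm_sub_tendsto_zero.1 hb).mul hw.norm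
    have e2 := (tendsto_iff_norm_sub_tendsto_zero.1 hw).const_mul ‖S‖
    simpa using e1.add e2
  refine tendsto_iff_norm_sub_tendsto_zero.2 (squeeze_zero (fun n => norm_nonneg _) (fun n => ?_) h1)
  have e : mulX (b n) (w n) - mulX S v = mulX (b n - S) (w n) + mulX S (w n - v) := by
    rw [map_sub, map_sub, sub_apply]; abel
  rw [e]
  exact (norm_add_le _ _).trans (add_le_add (norm_mulX_le _ _) (norm_mulX_le _ _))

/-- The multiplier converges uniformly and the two other factors in L², so the triple product passes
to the limit. -/
lemma tendsto_quad (h : EnergyFun Φ Φ1 Φ2 L) {u w : H2} (hw : HasD u w) (g : H2) :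
    Tendsto (fun N => inner ℝ (mulX (X.comp Φ2 h.cont2 (Sn N fun k => sc k u)) (toE 2 (Gn N fun k => kc k w)))
          (toE 2 (Gn N fun k => kc k g))) atTop (𝓝 (∫ x, Φ2 (u x) * w x * g x ∂mu)) := by
  obtain ⟨S, huS, hS⟩ := tendsto_Sn_X hw
  have e : ∫ x, Φ2 (u x) * w x * g x ∂mu = inner ℝ (mulX (X.comp Φ2 h.cont2 S) w) g := by
    rw [inner_mulX]
    refine integral_congr_ae ?_
    filter_upwards [huS] with x hx
    rw [hx, X.comp_apply]
  rw [e]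
  have t1 : Tendsto (fun N => mulX (X.comp Φ2 h.cont2 (Sn N fun k => sc k u)) (toE 2 (Gn N fun k => kc k w)))
      atTop (𝓝 (mulX (X.comp Φ2 h.cont2 S) w)) :=
    tendsto_mulX (((X.continuous_comp Φ2 h.cont2).tendsto _).comp hS) (tendsto_Gn w)
  exact t1.inner (tendsto_Gn g)

lemma tendsto_galerkinRate (h : EnergyFun Φ Φ1 Φ2 L) (ν : ℝ) {u w : H2} (hw : HasD u w) (f g : H2) :
    Tendsto (fun N => galerkinRate ν Φ1 N u f g) atTop (𝓝 (energyRate ν Φ1 Φ2 u w f g)) := by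
  simp only [galerkinRate_eq h ν _ hw]
  obtain ⟨S, huS, hS⟩ := tendsto_Sn_X hw
  have e : ∫ x, Φ1 (u x) * f x ∂mu = inner ℝ (toE 2 (X.comp Φ1 h.cont1 S)) f := by
    rw [inner_toE]
    refine integral_congr_ae ?_
    filter_upwards [huS] with x hx
    rw [hx, X.comp_apply]
  rw [energyRate, e]
  refine ((((tendsto_quad h hw w).const_mul ν).neg).add ?_).add (tendsto_quad h hw g)
  exact (((toE 2).continuous.tendsto _).comp (((X.continuous_comp Φ1 h.cont1).tendsto _).comp hS)).inner
    (tendsto_Sn f)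

lemma abs_quad_le (h : EnergyFun Φ Φ1 Φ2 L) (N : ℕ) (u w g : H2) :
    |inner ℝ (mulX (X.comp Φ2 h.cont2 (Sn N fun k => sc k u)) (toE 2 (Gn N fun k => kc k w)))
          (toE 2 (Gn N fun k => kc k g))| ≤ L * ‖w‖ * ‖g‖ := by
  refine (abs_real_inner_le_norm _ _).trans ?_
  gcongr
  · refine (norm_mulX_le _ _).trans ?_
    gcongr
    · exact norm_comp_two_le h _
    · exact norm_Gn_le N w
  · exact norm_Gn_le N g

/-- A bound uniform in N, by Bessel's inequality; it is the majorant for dominated convergence in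
time. -/
lemma abs_galerkinRate_le (h : EnergyFun Φ Φ1 Φ2 L) {ν : ℝ} (hν : 0 ≤ ν) (N : ℕ) {u w : H2} (hw : HasD u w)
    (f g : H2) : |galerkinRate ν Φ1 N u f g| ≤ ν * (L * ‖w‖ * ‖w‖) + L * ‖u‖ * ‖f‖ + L * ‖w‖ * ‖g‖ := by
  rw [galerkinRate_eq h ν _ hw]
  refine (abs_add_le _ _).trans (add_le_add ((abs_add_le _ _).trans (add_le_add ?_ ?_)) (abs_quad_le h N u w g))
  · rw [abs_neg, abs_mul, abs_of_nonneg hν]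
    gcongr
    exact abs_quad_le h N u w w
  · refine (abs_real_inner_le_norm _ _).trans ?_
    gcongr
    · refine (norm_toE_comp_le h _).trans ?_
      gcongr
      exact norm_Sn_le N u
    · exact norm_Sn_le N f

end

/-- Multiply the scalar equation by 2q. The flux term 2mqg is at most ν(mq)² + g²/ν and so costs
half of the dissipation 2ν(mq)². -/
lemma mode_energy {ν a b m : ℝ} (hν : 0 < ν) (hab : a ≤ b) {q f g : ℝ → ℝ} (hq : ContinuousOn q (Icc a b))
    (hf : ContinuousOn f (Icc a b)) (hg : ContinuousOn g (Icc a b))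
    (hd : ∀ t ∈ Ioo a b, HasDerivAt q (-(ν * m ^ 2 * q t) + f t + m * g t) t) :
    ν * ∫ t in a..b, (m * q t) ^ 2 ≤ q a ^ 2 + ∫ t in a..b, (q t ^ 2 + f t ^ 2 + g t ^ 2 / ν) := by
  have hu := uIcc_of_le hab
  have h1 : ∫ t in a..b, 2 * q t * (-(ν * m ^ 2 * q t) + f t + m * g t) = q b ^ 2 - q a ^ 2 := by
    refine intervalIntegral.integral_eq_sub_of_hasDerivAt_of_le (f := fun t => q t ^ 2) hab (hq.pow 2) (fun t ht => ?_) ?_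
    · exact ((hd t ht).pow 2).congr_deriv (by simp)
    · exact ContinuousOn.intervalIntegrable (by rw [hu]; fun_prop)
  have h2 : ∫ t in a..b, 2 * q t * (-(ν * m ^ 2 * q t) + f t + m * g t) ≤
      ∫ t in a..b, (-(ν * (m * q t) ^ 2) + (q t ^ 2 + f t ^ 2 + g t ^ 2 / ν)) := by
    refine intervalIntegral.integral_mono_on hab (ContinuousOn.intervalIntegrable (by rw [hu]; fun_prop))
      (ContinuousOn.intervalIntegrable (by rw [hu]; fun_prop)) fun t _ => ?_
    have e : ν * (m * q t) ^ 2 + g t ^ 2 / ν - 2 * q t * (m * g t) = (ν * (m * q t) - g t) ^ 2 / ν := by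
      field_simp; ring
    have : 0 ≤ (ν * (m * q t) - g t) ^ 2 / ν := by positivity
    nlinarith [sq_nonneg (q t - f t)]
  rw [intervalIntegral.integral_add (ContinuousOn.intervalIntegrable (by rw [hu]; fun_prop))
    (ContinuousOn.intervalIntegrable (by rw [hu]; fun_prop)), intervalIntegral.integral_neg,
    intervalIntegral.integral_const_mul] at h2
  nlinarith [sq_nonneg (q b)]

/-- Data for the linear equation `∂ₜV = ν ∂ₓₓV + f - ∂ₓg` on `[a,b]`, in Fourier coefficients. -/
structure LinData (ν a b M : ℝ) (V f g : ℝ → H2) : Prop where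
  hν : 0 < ν
  hab : a ≤ b
  bV : ∀ t ∈ Icc a b, ‖V t‖ ≤ M
  bf : ∀ t ∈ Icc a b, ‖f t‖ ≤ M
  bg : ∀ t ∈ Icc a b, ‖g t‖ ≤ M
  cV : ∀ k, ContinuousOn (fun t => sc k (V t)) (Icc a b)
  cf : ∀ k, ContinuousOn (fun t => sc k (f t)) (Icc a b)
  cg : ∀ k, ContinuousOn (fun t => kc k (g t)) (Icc a b)
  ode : ∀ k, ∀ t ∈ Ioo a b, HasDerivAt (fun t => sc k (V t))
    (-(ν * lam k * sc k (V t)) + sc k (f t) + ev k * kc (k + 1) (g t)) t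

namespace LinData
variable {ν a b M : ℝ} {V f g : ℝ → H2}

lemma M_nonneg (h : LinData ν a b M V f g) : 0 ≤ M :=
  (norm_nonneg _).trans (h.bV a ⟨le_rfl, h.hab⟩)

/-- Sum the mode estimates; Bessel's inequality makes the right-hand side independent of the number
of modes. -/
lemma sum_dissipation_le (h : LinData ν a b M V f g) (N : ℕ) :
    ν * ∑ k ∈ Finset.range N, ∫ t in a..b, (ev k * sc k (V t)) ^ 2 ≤
      M ^ 2 + (M ^ 2 + M ^ 2 + M ^ 2 / ν) * (b - a) := by
  have hu := uIcc_of_le h.hab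
  have hM := h.M_nonneg
  have hν := h.hν
  have c1 := h.cV; have c2 := h.cf; have c3 := h.cg
  have hic : ∀ k, ContinuousOn (fun t => sc k (V t) ^ 2 + sc k (f t) ^ 2 + kc (k + 1) (g t) ^ 2 / ν) (uIcc a b) :=
    fun k => by
      rw [hu]
      exact (((c1 k).pow 2).add ((c2 k).pow 2)).add (((c3 (k + 1)).pow 2).div_const ν)
  have hi := fun k => (hic k).intervalIntegrable (μ := volume)
  rw [Finset.mul_sum]
  have h1 : ∑ k ∈ Finset.range N, ν * ∫ t in a..b, (ev k * sc k (V t)) ^ 2 ≤ ∑ k ∈ Finset.range N,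
      (sc k (V a) ^ 2 + ∫ t in a..b, (sc k (V t) ^ 2 + sc k (f t) ^ 2 + kc (k + 1) (g t) ^ 2 / ν)) :=
    Finset.sum_le_sum fun k _ => mode_energy hν h.hab (h.cV k) (h.cf k) (h.cg (k + 1)) (h.ode k)
  refine h1.trans ?_
  rw [Finset.sum_add_distrib, ← intervalIntegral.integral_finsetSum fun k _ => hi k]
  have sS : ∀ w : H2, ∑ k ∈ Finset.range N, sc k w ^ 2 ≤ ‖w‖ ^ 2 := fun w =>
    sum_le_hasSum _ (fun k _ => sq_nonneg _) (hasSum_sc_sq w)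
  have sK : ∀ w : H2, ∑ k ∈ Finset.range N, kc (k + 1) w ^ 2 ≤ ‖w‖ ^ 2 := fun w => by
    have := sum_le_hasSum (Finset.range (N + 1)) (fun k _ => sq_nonneg _) (hasSum_kc_sq w)
    rw [Finset.sum_range_succ'] at this
    nlinarith [sq_nonneg (kc 0 w)]
  refine add_le_add ((sS _).trans (pow_le_pow_left₀ (norm_nonneg _) (h.bV a ⟨le_rfl, h.hab⟩) 2)) ?_
  calc _ ≤ ∫ _ in a..b, (M ^ 2 + M ^ 2 + M ^ 2 / ν) := by
        refine intervalIntegral.integral_mono_on h.hab (continuousOn_finsetSum _ fun k _ => hic k).intervalIntegrable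
          intervalIntegrable_const fun t ht => ?_
        rw [Finset.sum_add_distrib, Finset.sum_add_distrib, ← Finset.sum_div]
        gcongr
        · exact (sS _).trans (pow_le_pow_left₀ (norm_nonneg _) (h.bV t ht) 2)
        · exact (sS _).trans (pow_le_pow_left₀ (norm_nonneg _) (h.bf t ht) 2)
        · exact (sK _).trans (pow_le_pow_left₀ (norm_nonneg _) (h.bg t ht) 2)
    _ = _ := by rw [intervalIntegral.integral_const, smul_eq_mul]; ring

lemma lintegral_dissipation_lt_top (h : LinData ν a b M V f g) :
    ∫⁻ t in Ioc a b, ∑' k, ENNReal.ofReal ((ev k * sc k (V t)) ^ 2) < ⊤ := by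
  have hc : ∀ k, ContinuousOn (fun t => (ev k * sc k (V t)) ^ 2) (Icc a b) := fun k =>
    ((h.cV k).const_mul _).pow 2
  have hm : ∀ k, AEMeasurable (fun t => ENNReal.ofReal ((ev k * sc k (V t)) ^ 2)) (volume.restrict (Ioc a b)) :=
    fun k => (((hc k).mono Ioc_subset_Icc_self).aemeasurable measurableSet_Ioc).ennreal_ofReal
  rw [lintegral_tsum hm]
  have e : ∀ k, ∫⁻ t in Ioc a b, ENNReal.ofReal ((ev k * sc k (V t)) ^ 2) =
      ENNReal.ofReal (∫ t in a..b, (ev k * sc k (V t)) ^ 2) := fun k => by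
    rw [intervalIntegral.integral_of_le h.hab, ofReal_integral_eq_lintegral_ofReal]
    · exact ((hc k).integrableOn_Icc).mono_set Ioc_subset_Icc_self
    · exact ae_of_all _ fun t => sq_nonneg _
  simp only [e]
  refine lt_of_le_of_lt (b := ENNReal.ofReal ((M ^ 2 + (M ^ 2 + M ^ 2 + M ^ 2 / ν) * (b - a)) / ν)) ?_
    ENNReal.ofReal_lt_top
  refine ENNReal.tsum_le_of_sum_range_le fun N => ?_
  rw [← ENNReal.ofReal_sum_of_nonneg fun k _ => intervalIntegral.integral_nonneg h.hab fun t _ => sq_nonneg _]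
  refine ENNReal.ofReal_le_ofReal ?_
  rw [le_div_iff₀ h.hν, mul_comm]
  exact h.sum_dissipation_le N

lemma summable_of_tsum_ofReal_lt_top {u : ℕ → ℝ} (hu : ∀ k, 0 ≤ u k) (h : ∑' k, ENNReal.ofReal (u k) < ⊤) :
    Summable u := by
  have := ENNReal.summable_toReal h.ne
  simpa only [ENNReal.toReal_ofReal (hu _)] using this

/-- The summed dissipation has finite time integral, hence is finite at almost every time; there the
weighted coefficients are those of an L² function, the derivative. -/
lemma ae_hasD (h : LinData ν a b M V f g) :
    ∀ᵐ t ∂(volume.restrict (Ioc a b)), HasD (V t) (derivH (V t)) := by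
  have hc : ∀ k, ContinuousOn (fun t => (ev k * sc k (V t)) ^ 2) (Icc a b) := fun k =>
    ((h.cV k).const_mul _).pow 2
  have hm : AEMeasurable (fun t => ∑' k, ENNReal.ofReal ((ev k * sc k (V t)) ^ 2)) (volume.restrict (Ioc a b)) :=
    AEMeasurable.tsum fun k =>
    (((hc k).mono Ioc_subset_Icc_self).aemeasurable measurableSet_Ioc).ennreal_ofReal
  filter_upwards [ae_lt_top' hm h.lintegral_dissipation_lt_top.ne] with t ht
  obtain ⟨w, hw⟩ := exists_hasD (summable_of_tsum_ofReal_lt_top (fun k => sq_nonneg _) ht)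
  exact hasD_derivH hw

lemma integrableOn_norm_sq (h : LinData ν a b M V f g) :
    IntegrableOn (fun t => ‖derivH (V t)‖ ^ 2) (Ioc a b) := by
  have hc : ∀ k, ContinuousOn (fun t => (ev k * sc k (V t)) ^ 2) (Icc a b) := fun k =>
    ((h.cV k).const_mul _).pow 2
  have hm : AEMeasurable (fun t => ∑' k, ENNReal.ofReal ((ev k * sc k (V t)) ^ 2)) (volume.restrict (Ioc a b)) :=
    AEMeasurable.tsum fun k =>
    (((hc k).mono Ioc_subset_Icc_self).aemeasurable measurableSet_Ioc).ennreal_ofReal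
  refine (integrable_toReal_of_lintegral_ne_top hm h.lintegral_dissipation_lt_top.ne).congr ?_
  filter_upwards [h.ae_hasD] with t ht
  rw [← ht.norm_sq.tsum_eq, ← ENNReal.ofReal_tsum_of_nonneg (fun k => sq_nonneg _) ht.norm_sq.summable,
    ENNReal.toReal_ofReal (tsum_nonneg fun k => sq_nonneg _)]

lemma integrableOn_norm (h : LinData ν a b M V f g) :
    IntegrableOn (fun t => ‖derivH (V t)‖) (Ioc a b) := by
  have h2 := h.integrableOn_norm_sq
  have hm : AEStronglyMeasurable (fun t => ‖derivH (V t)‖) (volume.restrict (Ioc a b)) := by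
    have := (Real.continuous_sqrt.comp_aestronglyMeasurable h2.1)
    simpa only [Real.sqrt_sq (norm_nonneg _)] using this
  have hc : IntegrableOn (fun _ : ℝ => (1 : ℝ)) (Ioc a b) := integrableOn_const (by simp)
  refine Integrable.mono' (h2.add hc) hm (ae_of_all _ fun t => ?_)
  simp only [norm_norm, Pi.add_apply]
  nlinarith [sq_nonneg (‖derivH (V t)‖ - 1)]

section
variable {Φ Φ1 Φ2 : ℝ → ℝ} {L : ℝ≥0}

lemma continuousOn_Sn (N : ℕ) {q : ℕ → ℝ → ℝ} {s : Set ℝ} (hq : ∀ k, ContinuousOn (q k) s) :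
    ContinuousOn (fun t => Sn N fun k => q k t) s :=
  continuousOn_finsetSum _ fun k _ => (hq k).smul continuousOn_const

lemma continuousOn_Gn (N : ℕ) {q : ℕ → ℝ → ℝ} {s : Set ℝ} (hq : ∀ k, ContinuousOn (q k) s) :
    ContinuousOn (fun t => Gn N fun k => q k t) s :=
  continuousOn_finsetSum _ fun k _ => (hq k).smul continuousOn_const

lemma continuousOn_galerkinRate (h : LinData ν a b M V f g) (hΦ : EnergyFun Φ Φ1 Φ2 L) (N : ℕ) :
    ContinuousOn (fun t => galerkinRate ν Φ1 N (V t) (f t) (g t)) (Icc a b) := by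
  have e : ∀ t, galerkinRate ν Φ1 N (V t) (f t) (g t) =
      inner ℝ (toE 2 (X.comp Φ1 hΦ.cont1 (Sn N fun k => sc k (V t))))
        (toE 2 (Sn N (fun k => -(ν * lam k * sc k (V t)) + sc k (f t) + ev k * kc (k + 1) (g t)))) := fun t => by
    rw [← integral_mul2]; rfl
  simp only [e]
  refine ContinuousOn.inner (𝕜 := ℝ) ?_ ?_
  · exact (toE 2).continuous.comp_continuousOn
      ((X.continuous_comp Φ1 hΦ.cont1).comp_continuousOn (continuousOn_Sn N h.cV))
  · refine (toE 2).continuous.comp_continuousOn (continuousOn_Sn N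
      (q := fun k t => -(ν * lam k * sc k (V t)) + sc k (f t) + ev k * kc (k + 1) (g t)) fun k => ?_)
    have c1 := h.cV k; have c2 := h.cf k; have c3 := h.cg (k + 1)
    fun_prop

/-- Measurability in time comes from the Galerkin versions, which are continuous in t and converge
almost everywhere; the bound on Φ'' then gives integrability. -/
lemma integrableOn_quad (h : LinData ν a b M V f g) (hΦ : EnergyFun Φ Φ1 Φ2 L) :
    IntegrableOn (fun t => ∫ x, Φ2 (V t x) * derivH (V t) x * derivH (V t) x ∂mu) (Ioc a b) := by
  have hlim : ∀ᵐ t ∂(volume.restrict (Ioc a b)), Tendsto (fun N => inner ℝ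
      (mulX (X.comp Φ2 hΦ.cont2 (Sn N fun k => sc k (V t))) (toE 2 (Gn N (dcoef fun k => sc k (V t)))))
          (toE 2 (Gn N (dcoef fun k => sc k (V t))))) atTop
          (𝓝 (∫ x, Φ2 (V t x) * derivH (V t) x * derivH (V t) x ∂mu)) := by
    filter_upwards [h.ae_hasD] with t ht
    have e : (fun k => kc k (derivH (V t))) = dcoef (fun k => sc k (V t)) := funext ht
    rw [← e]
    exact tendsto_quad hΦ ht _
  have hm : AEStronglyMeasurable (fun t => ∫ x, Φ2 (V t x) * derivH (V t) x * derivH (V t) x ∂mu)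
      (volume.restrict (Ioc a b)) := by
    refine aestronglyMeasurable_of_tendsto_ae atTop (fun N => ?_) hlim
    refine (ContinuousOn.mono ?_ Ioc_subset_Icc_self).aestronglyMeasurable measurableSet_Ioc
    have cG : ContinuousOn (fun t => toE 2 (Gn N (dcoef fun k => sc k (V t)))) (Icc a b) := by
      have hd : ∀ k, ContinuousOn (fun t => dcoef (fun k => sc k (V t)) k) (Icc a b) := fun k => by
        cases k with
        | zero => exact continuousOn_const
        | succ k => exact (h.cV k).const_mul _
      exact (toE 2).continuous.comp_continuousOn (continuousOn_Gn N hd)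
    refine ContinuousOn.inner (𝕜 := ℝ) ?_ cG
    exact (mulX.continuous.comp_continuousOn ((X.continuous_comp Φ2 hΦ.cont2).comp_continuousOn
      (continuousOn_Sn N h.cV))).clm_apply cG
  refine Integrable.mono' (h.integrableOn_norm_sq.const_mul (L : ℝ)) hm ?_
  filter_upwards [h.ae_hasD] with t ht
  have e : (fun k => kc k (derivH (V t))) = dcoef (fun k => sc k (V t)) := funext ht
  refine le_of_tendsto (tendsto_quad hΦ ht (derivH (V t))).norm (Eventually.of_forall fun N => ?_)
  refine (abs_quad_le hΦ N (V t) _ _).trans (le_of_eq (by ring))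

/-- The finite-dimensional identity holds for each truncation. Its integrand converges at almost
every time, under a majorant quadratic in the norm of the derivative, and the endpoint terms
converge by continuity of ∫Φ on L². -/
theorem energy_identity (h : LinData ν a b M V f g) (hΦ : EnergyFun Φ Φ1 Φ2 L) :
    IntervalIntegrable (fun t => energyRate ν Φ1 Φ2 (V t) (derivH (V t)) (f t) (g t)) volume a b ∧
    ∫ x, Φ (V b x) ∂mu - ∫ x, Φ (V a x) ∂mu =
      ∫ t in a..b, energyRate ν Φ1 Φ2 (V t) (derivH (V t)) (f t) (g t) := by
  have hM := h.M_nonneg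
  have hu := uIoc_of_le h.hab
  set bd : ℝ → ℝ := fun t => ν * L * ‖derivH (V t)‖ ^ 2 + L * M * M + L * M * ‖derivH (V t)‖ with hbd
  have hbi : IntervalIntegrable bd volume a b := by
    rw [intervalIntegrable_iff, hu]
    exact ((h.integrableOn_norm_sq.const_mul _).add (integrableOn_const (by simp))).add
      (h.integrableOn_norm.const_mul _)
  have hbound : ∀ᵐ t ∂(volume.restrict (Ioc a b)), ∀ N, ‖galerkinRate ν Φ1 N (V t) (f t) (g t)‖ ≤ bd t := by
    filter_upwards [h.ae_hasD, ae_restrict_mem measurableSet_Ioc] with t ht htm N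
    have htm' := Ioc_subset_Icc_self htm
    refine (abs_galerkinRate_le hΦ h.hν.le N ht (f t) (g t)).trans ?_
    have h1 : L * ‖V t‖ * ‖f t‖ ≤ L * M * M := by
      gcongr
      · exact h.bV t htm'
      · exact h.bf t htm'
    have h2 : L * ‖derivH (V t)‖ * ‖g t‖ ≤ L * ‖derivH (V t)‖ * M := by
      gcongr; exact h.bg t htm'
    rw [hbd]
    simp only
    nlinarith [h1, h2]
  have hlim : ∀ᵐ t ∂(volume.restrict (Ioc a b)), Tendsto (fun N => galerkinRate ν Φ1 N (V t) (f t) (g t)) atTop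
      (𝓝 (energyRate ν Φ1 Φ2 (V t) (derivH (V t)) (f t) (g t))) := by
    filter_upwards [h.ae_hasD] with t ht
    exact tendsto_galerkinRate hΦ ν ht (f t) (g t)
  have hmeas : ∀ N, AEStronglyMeasurable (fun t => galerkinRate ν Φ1 N (V t) (f t) (g t))
      (volume.restrict (Ioc a b)) := fun N =>
    ((h.continuousOn_galerkinRate hΦ N).mono Ioc_subset_Icc_self).aestronglyMeasurable measurableSet_Ioc
  constructor
  · rw [intervalIntegrable_iff, hu]
    refine Integrable.mono' (by rwa [intervalIntegrable_iff, hu] at hbi)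
      (aestronglyMeasurable_of_tendsto_ae atTop hmeas hlim) ?_
    filter_upwards [hbound, hlim] with t h1 h2
    exact le_of_tendsto h2.norm (Eventually.of_forall h1)
  · have t1 : Tendsto (fun N => ∫ t in a..b, galerkinRate ν Φ1 N (V t) (f t) (g t)) atTop
        (𝓝 (∫ t in a..b, energyRate ν Φ1 Φ2 (V t) (derivH (V t)) (f t) (g t))) := by
      refine intervalIntegral.tendsto_integral_filter_of_dominated_convergence bd
        (Eventually.of_forall fun N => by rw [hu]; exact hmeas N) (Eventually.of_forall fun N => ?_) hbi ?_
      · rw [hu, ← ae_restrict_iff' measurableSet_Ioc]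
        filter_upwards [hbound] with t ht using ht N
      · rw [hu, ← ae_restrict_iff' measurableSet_Ioc]
        exact hlim
    have e : ∀ N, ∫ t in a..b, galerkinRate ν Φ1 N (V t) (f t) (g t) =
        ∫ x, Φ (Sn N (fun k => sc k (V b)) x) ∂mu - ∫ x, Φ (Sn N (fun k => sc k (V a)) x) ∂mu := fun N =>
      (galerkin_chain hΦ N h.hab (q := fun k t => sc k (V t)) h.cV (fun k => by
        have c1 := h.cV k; have c2 := h.cf k; have c3 := h.cg (k + 1)
        fun_prop) h.ode).symm
    simp only [e] at t1
    refine tendsto_nhds_unique ?_ t1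
    have hΦlim : ∀ u : H2, Tendsto (fun N => ∫ x, Φ (Sn N (fun k => sc k u) x) ∂mu) atTop
        (𝓝 (∫ x, Φ (u x) ∂mu)) := fun u => by
      have hc := hΦ.polyGrowth.continuous_integral (q := 2) (p := 2) (by simp) (by norm_num)
      refine ((hc.tendsto u).comp (tendsto_Sn u)).congr fun N => ?_
      refine integral_congr_ae ?_
      filter_upwards [coeFn_toE 2 (Sn N fun k => sc k u)] with x hx
      rw [hx]
    exact (hΦlim _).sub (hΦlim _)

end
end LinData

/-! ### The integral equation in L^p and its Fourier modes. -/

lemma fact_one_le_ofReal_one : Fact ((1 : ℝ≥0∞) ≤ ENNReal.ofReal 1) := ⟨by simp⟩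
attribute [instance] fact_one_le_ofReal_one

/-- The space `L¹(0,1)`. -/
abbrev L11 := Lp ℝ (ENNReal.ofReal 1) mu

/-- The space of the pairs (reaction, flux). -/
abbrev YY := L11 × L32

/-- The kernel of the integral equation. -/
def kerX (ν α β : ℝ) (δ : ℕ) (t : ℝ) : YY →L[ℝ] X :=
  β • (S1 (ENNReal.ofReal 1) (ν * t)).comp (ContinuousLinearMap.fst ℝ L11 L32)
    + (α / (δ + 1)) • (D1 (ENNReal.ofReal (3 / 2)) (ν * t)).comp (ContinuousLinearMap.snd ℝ L11 L32)

lemma kerX_apply (ν α β : ℝ) (δ : ℕ) (t : ℝ) (y : YY) : kerX ν α β δ t y =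
    β • S1 (ENNReal.ofReal 1) (ν * t) y.1 + (α / (δ + 1)) • D1 (ENNReal.ofReal (3 / 2)) (ν * t) y.2 := rfl

lemma weakSing_S1 {ν T : ℝ} (hν : 0 < ν) :
    WeakSing (fun t => (S1 (ENNReal.ofReal 1) (ν * t)).comp (ContinuousLinearMap.fst ℝ L11 L32))
      (Dc * (ν * T) ^ (7 / 24 : ℝ) * ν ^ (-(11 / 12 : ℝ))) (11 / 12) T where
  cont := by
    have h : ContinuousOn (fun t => S1 (ENNReal.ofReal 1) (ν * t)) (Ioi 0) :=
      continuousOn_S1.comp (by fun_prop) fun t (ht : 0 < t) => mul_pos hν ht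
    exact h.clm_comp continuousOn_const
  bound t ht := by
    have hx : 0 < ν * t := mul_pos hν ht.1
    refine (ContinuousLinearMap.opNorm_comp_le _ _).trans ?_
    have h1 := norm_S1_le (q := ENNReal.ofReal 1) hx
    have h2 : ‖ContinuousLinearMap.fst ℝ L11 L32‖ ≤ 1 := ContinuousLinearMap.norm_fst_le ..
    -- The singularity 5/8 is weakened to 11/12, the difference 7/24 being bounded by a power of T,
    -- so that both kernels share one exponent.
    have e : (ν * t) ^ (-(5 / 8 : ℝ)) = (ν * t) ^ (7 / 24 : ℝ) * (ν ^ (-(11 / 12 : ℝ)) * t ^ (-(11 / 12 : ℝ))) := by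
      rw [← Real.mul_rpow hν.le ht.1.le, ← Real.rpow_add hx]; norm_num
    have hD := Dc_pos
    have ht0 := ht.1
    calc _ ≤ (Dc * (ν * t) ^ (-(5 / 8 : ℝ))) * 1 := by gcongr
      _ = Dc * (ν * t) ^ (7 / 24 : ℝ) * ν ^ (-(11 / 12 : ℝ)) * t ^ (-(11 / 12 : ℝ)) := by rw [e]; ring
      _ ≤ _ := by
        gcongr
        exact ht.2

lemma weakSing_D1 {ν T : ℝ} (hν : 0 < ν) :
    WeakSing (fun t => (D1 (ENNReal.ofReal (3 / 2)) (ν * t)).comp (ContinuousLinearMap.snd ℝ L11 L32))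
      (Dc * ν ^ (-(11 / 12 : ℝ))) (11 / 12) T where
  cont := by
    have h : ContinuousOn (fun t => D1 (ENNReal.ofReal (3 / 2)) (ν * t)) (Ioi 0) :=
      continuousOn_D1.comp (by fun_prop) fun t (ht : 0 < t) => mul_pos hν ht
    exact h.clm_comp continuousOn_const
  bound t ht := by
    have hx : 0 < ν * t := mul_pos hν ht.1
    refine (ContinuousLinearMap.opNorm_comp_le _ _).trans ?_
    have h1 := norm_D1_le hx
    have h2 : ‖ContinuousLinearMap.snd ℝ L11 L32‖ ≤ 1 := ContinuousLinearMap.norm_snd_le ..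
    have hD := Dc_pos
    have ht0 := ht.1
    calc _ ≤ (Dc * (ν * t) ^ (-(11 / 12 : ℝ))) * 1 := by gcongr
      _ = _ := by rw [Real.mul_rpow hν.le ht.1.le]; ring

lemma WeakSing.const_smul {Y W : Type*} [NormedAddCommGroup Y] [NormedSpace ℝ Y] [NormedAddCommGroup W]
    [NormedSpace ℝ W] {K : ℝ → Y →L[ℝ] W} {C a T : ℝ} (h : WeakSing K C a T) (c : ℝ) :
    WeakSing (fun t => c • K t) (|c| * C) a T :=
  ⟨h.cont.const_smul c, fun t ht => by
    rw [norm_smul, Real.norm_eq_abs, mul_assoc]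
    exact mul_le_mul_of_nonneg_left (h.bound t ht) (abs_nonneg c)⟩

lemma WeakSing.add {Y W : Type*} [NormedAddCommGroup Y] [NormedSpace ℝ Y] [NormedAddCommGroup W]
    [NormedSpace ℝ W] {K K' : ℝ → Y →L[ℝ] W} {C C' a T : ℝ} (h : WeakSing K C a T) (h' : WeakSing K' C' a T) :
    WeakSing (fun t => K t + K' t) (C + C') a T :=
  ⟨h.cont.add h'.cont, fun t ht => by
    rw [add_mul]
    exact (norm_add_le _ _).trans (add_le_add (h.bound t ht) (h'.bound t ht))⟩

lemma exists_weakSing_kerX {ν : ℝ} (hν : 0 < ν) (α β : ℝ) (δ : ℕ) {T : ℝ} (hT : 0 ≤ T) :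
    ∃ C, 0 ≤ C ∧ WeakSing (kerX ν α β δ) C (11 / 12) T := by
  have hD := Dc_pos
  exact ⟨_, by positivity, ((weakSing_S1 hν).const_smul β).add ((weakSing_D1 hν).const_smul (α / (δ + 1)))⟩

/-- The sine coefficients, as functionals on bounded continuous functions. -/
def scX (k : ℕ) : X →L[ℝ] ℝ := (pairL 2 (sX k)).comp (toE 2)

lemma scX_apply (k : ℕ) (S : X) : scX k S = sc k S := integral_mul_toE (sX k) S

/-- The sine coefficients of the forcing. -/
def rcL (α β : ℝ) (δ : ℕ) (k : ℕ) : YY →L[ℝ] ℝ :=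
  β • (pairL (ENNReal.ofReal 1) (sX k)).comp (ContinuousLinearMap.fst ℝ L11 L32)
    + (ev k * (α / (δ + 1))) • (pairL (ENNReal.ofReal (3 / 2)) (cbX (k + 1))).comp (ContinuousLinearMap.snd ℝ L11 L32)

lemma rcL_apply (α β : ℝ) (δ k : ℕ) (y : YY) :
    rcL α β δ k y = β * sc k y.1 + ev k * (α / (δ + 1)) * kc (k + 1) y.2 := rfl

/-- On each sine mode the kernel is a scalar exponential, so the integral equation becomes Duhamel's
formula for a scalar linear equation. -/
lemma scX_kerX {ν t : ℝ} (hν : 0 < ν) (ht : 0 < t) (α β : ℝ) (δ k : ℕ) (y : YY) :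
    scX k (kerX ν α β δ t y) = Real.exp (-(ν * lam k * t)) * rcL α β δ k y := by
  have hx := mul_pos hν ht
  rw [kerX_apply, map_add, map_smul, map_smul, scX_apply, scX_apply, rcL_apply]
  unfold sc kc
  rw [integral_sf_S1 hx, integral_sf_D1 hx, show lam k * (ν * t) = ν * lam k * t by ring]
  simp only [smul_eq_mul, cb]
  ring

section
variable {ν α β : ℝ} {δ : ℕ} {T M : ℝ} {F : ℝ → YY}

lemma scX_duh (hν : 0 < ν) (hT : 0 ≤ T) (hF : AEStronglyMeasurable F (volume.restrict (Ioc 0 T)))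
    (hM : ∀ᵐ s ∂(volume.restrict (Ioc 0 T)), ‖F s‖ ≤ M) {t : ℝ} (ht : t ∈ Icc 0 T) (k : ℕ) :
    scX k (duh (kerX ν α β δ) F t) =
      ∫ s in (0 : ℝ)..t, Real.exp (-(ν * lam k * (t - s))) * rcL α β δ k (F s) := by
  obtain ⟨C, hC, hK⟩ := exists_weakSing_kerX hν α β δ hT
  rw [duh, ← ContinuousLinearMap.intervalIntegral_comp_comm _ (intervalIntegrable_kernel hK (by norm_num) hF hM ht)]
  refine intervalIntegral.integral_congr_ae ?_
  have : ∀ᵐ s : ℝ, s ≠ t := by simp [ae_iff]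
  filter_upwards [this] with s hs hst
  rw [uIoc_of_le ht.1] at hst
  exact scX_kerX hν (sub_pos.2 (lt_of_le_of_ne hst.2 hs)) α β δ k _

lemma toE_duh (q : ℝ≥0∞) [Fact (1 ≤ q)] (hν : 0 < ν) (hT : 0 ≤ T)
    (hF : AEStronglyMeasurable F (volume.restrict (Ioc 0 T)))
    (hM : ∀ᵐ s ∂(volume.restrict (Ioc 0 T)), ‖F s‖ ≤ M) {t : ℝ} (ht : t ∈ Icc 0 T) :
    toE q (duh (kerX ν α β δ) F t) = duh (fun r => (toE q).comp (kerX ν α β δ r)) F t := by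
  obtain ⟨C, hC, hK⟩ := exists_weakSing_kerX hν α β δ hT
  rw [duh, ← ContinuousLinearMap.intervalIntegral_comp_comm _ (intervalIntegrable_kernel hK (by norm_num) hF hM ht)]
  rfl

lemma WeakSing.toE_comp {K : ℝ → YY →L[ℝ] X} {C a : ℝ} (h : WeakSing K C a T) (q : ℝ≥0∞) [Fact (1 ≤ q)] :
    WeakSing (fun r => (toE q).comp (K r)) C a T where
  cont := continuousOn_const.clm_comp h.cont
  bound t ht := by
    refine (ContinuousLinearMap.opNorm_comp_le _ _).trans ?_
    have h1 : ‖toE q‖ ≤ 1 := ContinuousLinearMap.opNorm_le_bound _ zero_le_one fun f => by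
      rw [one_mul]; exact norm_toE_apply_le q f
    calc _ ≤ 1 * ‖K t‖ := by gcongr
      _ ≤ _ := by rw [one_mul]; exact h.bound t ht

end

lemma duhamel_eq (c q0 : ℝ) (r : ℝ → ℝ) (t : ℝ) :
    Real.exp (-(c * t)) * q0 + ∫ s in (0 : ℝ)..t, Real.exp (-(c * (t - s))) * r s =
      Real.exp (-(c * t)) * (q0 + ∫ s in (0 : ℝ)..t, Real.exp (c * s) * r s) := by
  rw [mul_add, ← intervalIntegral.integral_const_mul]
  congr 2
  funext s
  rw [← mul_assoc, ← Real.exp_add]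
  congr 2; ring

/-- Pulling e^{-ct} out of the integral removes t from the integrand; what is left is a product to
differentiate. -/
lemma hasDerivAt_duhamel {c q0 T : ℝ} {r : ℝ → ℝ} (hr : ContinuousOn r (Icc 0 T)) {t : ℝ} (ht : t ∈ Ioo 0 T) :
    HasDerivAt (fun t => Real.exp (-(c * t)) * q0 + ∫ s in (0 : ℝ)..t, Real.exp (-(c * (t - s))) * r s)
      (-(c * (Real.exp (-(c * t)) * q0 + ∫ s in (0 : ℝ)..t, Real.exp (-(c * (t - s))) * r s)) + r t) t := by
  simp only [duhamel_eq]
  have hc : ContinuousOn (fun s => Real.exp (c * s) * r s) (Icc 0 T) := by fun_prop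
  have h1 : HasDerivAt (fun t => ∫ s in (0 : ℝ)..t, Real.exp (c * s) * r s) (Real.exp (c * t) * r t) t := by
    refine intervalIntegral.integral_hasDerivAt_right ?_ ?_ ?_
    · refine (hc.mono ?_).intervalIntegrable
      rw [uIcc_of_le ht.1.le]; exact Icc_subset_Icc_right ht.2.le
    · exact (hc.mono Ioo_subset_Icc_self).stronglyMeasurableAtFilter isOpen_Ioo t ht
    · exact (hc.mono Ioo_subset_Icc_self).continuousAt (isOpen_Ioo.mem_nhds ht)
  have h2 : HasDerivAt (fun t => Real.exp (-(c * t))) (Real.exp (-(c * t)) * -c) t := by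
    have := ((hasDerivAt_id t).const_mul c).neg.exp
    simpa using this
  refine (h2.mul (h1.const_add q0)).congr_deriv ?_
  have : Real.exp (-(c * t)) * Real.exp (c * t) = 1 := by rw [← Real.exp_add]; simp
  linear_combination r t * this

lemma continuousOn_duhamel {c q0 T : ℝ} {r : ℝ → ℝ} (hr : ContinuousOn r (Icc 0 T)) (hT : 0 ≤ T) :
    ContinuousOn (fun t => Real.exp (-(c * t)) * q0 + ∫ s in (0 : ℝ)..t, Real.exp (-(c * (t - s))) * r s)
      (Icc 0 T) := by
  simp only [duhamel_eq]
  have hc : ContinuousOn (fun s => Real.exp (c * s) * r s) (uIcc 0 T) := by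
    rw [uIcc_of_le hT]; fun_prop
  have := intervalIntegral.continuousOn_primitive_interval (μ := volume) hc.integrableOn_uIcc
  rw [uIcc_of_le hT] at this
  exact ContinuousOn.mul (by fun_prop) (continuousOn_const.add this)

/-- The standing assumptions on the parameters. -/
structure Params (ν α β γ : ℝ) (δ : ℕ) (p : ℝ) : Prop where
  hν : 0 < ν
  hα : 0 < α
  hβ : 0 < β
  hγ0 : 0 < γ
  hγ1 : γ < 1
  hδ : 1 ≤ δ
  hp : 2 * (δ : ℝ) + 1 ≤ p

namespace Params
variable {ν α β γ : ℝ} {δ : ℕ} {p : ℝ}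

lemma hδ' (P : Params ν α β γ δ p) : (1 : ℝ) ≤ δ := by exact_mod_cast P.hδ
lemma hp3 (P : Params ν α β γ δ p) : 3 ≤ p := by linarith [P.hδ', P.hp]
-- The reaction has degree 2δ+1, so L¹ is reached exactly when p ≥ 2δ+1. The next inequality puts
-- the flux in L^{3/2}, since 3(δ+1)/2 ≤ 2δ+1 for δ ≥ 1.
lemma exp_cc (P : Params ν α β γ δ p) : (1 : ℝ) * ((2 * δ : ℕ) + 1) ≤ p := by push_cast; linarith [P.hp]
lemma exp_pp (P : Params ν α β γ δ p) : (3 / 2 : ℝ) * (δ + 1) ≤ p := by linarith [P.hp, P.hδ']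

end Params

/-- The nonlinearity as a map from `L^p` to `L¹ × L^{3/2}`. -/
def NL {ν α β γ : ℝ} {δ : ℕ} {p : ℝ} (P : Params ν α β γ δ p) (u : Lp ℝ (ENNReal.ofReal p) mu) : YY :=
  (nemy (polyGrowth_cc P.hγ0 δ) one_pos P.exp_cc u, nemy (polyGrowth_pp δ) (by norm_num) P.exp_pp u)

section
variable {ν α β γ : ℝ} {δ : ℕ} {p : ℝ} [hp1 : Fact (1 ≤ ENNReal.ofReal p)] (P : Params ν α β γ δ p)

lemma continuous_NL : Continuous (NL P) :=
  (continuous_nemy _ _ _).prodMk (continuous_nemy _ _ _)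

lemma coeFn_NL_fst (u : Lp ℝ (ENNReal.ofReal p) mu) : (NL P u).1 =ᵐ[mu] fun x => cc γ δ (u x) :=
  coeFn_nemy (polyGrowth_cc P.hγ0 δ) one_pos P.exp_cc u

lemma coeFn_NL_snd (u : Lp ℝ (ENNReal.ofReal p) mu) : (NL P u).2 =ᵐ[mu] fun x => pp δ (u x) :=
  coeFn_nemy (polyGrowth_pp δ) (by norm_num) P.exp_pp u

lemma exists_lipschitz_NL (R : ℝ) : ∃ L, 0 ≤ L ∧ ∀ u v : Lp ℝ (ENNReal.ofReal p) mu, ‖u‖ ≤ R → ‖v‖ ≤ R →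
    ‖NL P u - NL P v‖ ≤ L * ‖u - v‖ := by
  have h1 := (polyGrowth_cc P.hγ0 δ).nonneg
  have h2 := (polyGrowth_pp δ).nonneg
  set C1 := (1 + γ) * (δ + 1) + γ + (2 * δ + 1)
  set C2 : ℝ := δ + 1
  by_cases hR : 0 ≤ R
  · refine ⟨C1 * (1 + R + R) ^ (2 * δ) + C2 * (1 + R + R) ^ δ, by positivity, fun u v hu hv => ?_⟩
    rw [Prod.norm_def]
    refine max_le ?_ ?_
    · refine (norm_nemy_sub_le (polyGrowth_cc P.hγ0 δ) one_pos P.exp_cc u v).trans ?_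
      have : C1 * ((1 + ‖u‖ + ‖v‖) ^ (2 * δ) * ‖u - v‖) ≤ C1 * ((1 + R + R) ^ (2 * δ) * ‖u - v‖) := by gcongr
      have h3 : 0 ≤ C2 * (1 + R + R) ^ δ * ‖u - v‖ := by positivity
      linarith
    · refine (norm_nemy_sub_le (polyGrowth_pp δ) (by norm_num) P.exp_pp u v).trans ?_
      have : C2 * ((1 + ‖u‖ + ‖v‖) ^ δ * ‖u - v‖) ≤ C2 * ((1 + R + R) ^ δ * ‖u - v‖) := by gcongr
      have h3 : 0 ≤ C1 * (1 + R + R) ^ (2 * δ) * ‖u - v‖ := by positivity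
      linarith
  · exact ⟨0, le_rfl, fun u v hu _ => absurd ((norm_nonneg u).trans hu) hR⟩

/-- Solutions of the integral equation in `C([0,T]; L^p)`, for data continuous in time. -/
structure MildE (T : ℝ) (φ : ℝ → Lp ℝ (ENNReal.ofReal p) mu) (u₀ : Lp ℝ (ENNReal.ofReal p) mu)
    (v : ℝ → Lp ℝ (ENNReal.ofReal p) mu) : Prop where
  hT : 0 ≤ T
  contφ : ContinuousOn φ (Icc 0 T)
  cont : ContinuousOn v (Icc 0 T)
  eq : ∀ t ∈ Icc 0 T, v t = SE _ (ν * t) u₀ + toE _ (duh (kerX ν α β δ) (fun s => NL P (v s + φ s)) t)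

/-- The continuous representative of the solution at positive times. -/
def VX (φ : ℝ → Lp ℝ (ENNReal.ofReal p) mu) (u₀ : Lp ℝ (ENNReal.ofReal p) mu)
    (v : ℝ → Lp ℝ (ENNReal.ofReal p) mu) (t : ℝ) : X :=
  S1 _ (ν * t) u₀ + duh (kerX ν α β δ) (fun s => NL P (v s + φ s)) t

namespace MildE
variable {P} {T : ℝ} {φ v : ℝ → Lp ℝ (ENNReal.ofReal p) mu} {u₀ : Lp ℝ (ENNReal.ofReal p) mu}

lemma mono (h : MildE P T φ u₀ v) {T' : ℝ} (hT0 : 0 ≤ T') (hT' : T' ≤ T) : MildE P T' φ u₀ v where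
  hT := hT0
  contφ := h.contφ.mono (Icc_subset_Icc_right hT')
  cont := h.cont.mono (Icc_subset_Icc_right hT')
  eq t ht := h.eq t ⟨ht.1, ht.2.trans hT'⟩

lemma contNL (h : MildE P T φ u₀ v) : ContinuousOn (fun s => NL P (v s + φ s)) (Icc 0 T) :=
  (continuous_NL P).comp_continuousOn (h.cont.add h.contφ)

lemma toE_VX (h : MildE P T φ u₀ v) {t : ℝ} (ht : t ∈ Ioc 0 T) : toE _ (VX P φ u₀ v t) = v t := by
  rw [h.eq t ⟨ht.1.le, ht.2⟩, VX, map_add, SE_of_pos (mul_pos P.hν ht.1)]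

lemma ae_eq_VX (h : MildE P T φ u₀ v) {t : ℝ} (ht : t ∈ Ioc 0 T) : v t =ᵐ[mu] VX P φ u₀ v t := by
  rw [← h.toE_VX ht]; exact coeFn_toE _ _

lemma eq_zero (h : MildE P T φ u₀ v) : v 0 = u₀ := by
  rw [h.eq 0 ⟨le_rfl, h.hT⟩]
  simp [duh]

lemma continuousOn_VX (h : MildE P T φ u₀ v) : ContinuousOn (VX P φ u₀ v) (Ioc 0 T) := by
  obtain ⟨C, hC, hK⟩ := exists_weakSing_kerX P.hν α β δ h.hT
  refine ContinuousOn.add ?_ ((continuousOn_duh_of_continuousOn hK h.hT (by norm_num) (by norm_num) hC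
    h.contNL).mono Ioc_subset_Icc_self)
  have : ContinuousOn (fun t => S1 (ENNReal.ofReal p) (ν * t)) (Ioc 0 T) :=
    continuousOn_S1.comp (by fun_prop) fun t ht => mul_pos P.hν ht.1
  exact this.clm_apply continuousOn_const

/-- Only the free evolution of initial data in L^p is singular as t → 0, with the smoothing rate
5/8; the Duhamel part is bounded up to t = 0. -/
lemma exists_norm_VX_le (h : MildE P T φ u₀ v) :
    ∃ C, 0 ≤ C ∧ ∀ t ∈ Ioc 0 T, ‖VX P φ u₀ v t‖ ≤ C * t ^ (-(5 / 8 : ℝ)) := by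
  obtain ⟨C, hC, hK⟩ := exists_weakSing_kerX P.hν α β δ h.hT
  obtain ⟨B, hB⟩ := isCompact_Icc.exists_bound_of_continuousOn
    (continuousOn_duh_of_continuousOn hK h.hT (by norm_num) (by norm_num) hC h.contNL)
  have hB0 : 0 ≤ B := (norm_nonneg _).trans (hB 0 ⟨le_rfl, h.hT⟩)
  have hD := Dc_pos
  have hν := P.hν
  have hT := h.hT
  refine ⟨Dc * ν ^ (-(5 / 8 : ℝ)) * ‖u₀‖ + B * T ^ (5 / 8 : ℝ), by positivity, fun t ht => ?_⟩
  have ht0 := ht.1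
  rw [add_mul]
  refine (norm_add_le _ _).trans (add_le_add ?_ ?_)
  · refine (ContinuousLinearMap.le_of_opNorm_le _ (norm_S1_le (mul_pos hν ht0)) _).trans ?_
    rw [Real.mul_rpow hν.le ht0.le]
    exact le_of_eq (by ring)
  · refine (hB t ⟨ht0.le, ht.2⟩).trans ?_
    have e : t ^ (5 / 8 : ℝ) * t ^ (-(5 / 8 : ℝ)) = 1 := by rw [← Real.rpow_add ht0]; norm_num
    calc B = B * (t ^ (5 / 8 : ℝ) * t ^ (-(5 / 8 : ℝ))) := by rw [e, mul_one]
      _ ≤ B * (T ^ (5 / 8 : ℝ) * t ^ (-(5 / 8 : ℝ))) := by gcongr; exact ht.2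
      _ = _ := by ring

lemma sc_VX (h : MildE P T φ u₀ v) {t : ℝ} (ht : t ∈ Ioc 0 T) (k : ℕ) :
    sc k (VX P φ u₀ v t) = Real.exp (-(ν * lam k * t)) * sc k u₀ +
      ∫ s in (0 : ℝ)..t, Real.exp (-(ν * lam k * (t - s))) * rcL α β δ k (NL P (v s + φ s)) := by
  obtain ⟨hm, M, hM0, hM⟩ := continuousOn_bdd_aux h.contNL
  rw [← scX_apply, VX, map_add, scX_duh P.hν h.hT hm hM ⟨ht.1.le, ht.2⟩, scX_apply]
  unfold sc
  rw [integral_sf_S1 (mul_pos P.hν ht.1), show lam k * (ν * t) = ν * lam k * t by ring]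

end MildE
end

/-! ### Regularity of mild solutions at positive times. -/

/-- A function as an element of `L²(0,1)`. -/
def toH (f : ℝ → ℝ) : H2 := open Classical in if h : MemLp f 2 mu then h.toLp f else 0

lemma toH_eq {f : ℝ → ℝ} (h : MemLp f 2 mu) : toH f = h.toLp f := dif_pos h

lemma coeFn_toH {f : ℝ → ℝ} (h : MemLp f 2 mu) : toH f =ᵐ[mu] f := by
  rw [toH_eq h]; exact h.coeFn_toLp

lemma norm_toH_le {f : ℝ → ℝ} {c : ℝ} (hc : 0 ≤ c) (h : eLpNorm f 2 mu ≤ ENNReal.ofReal c) : ‖toH f‖ ≤ c := by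
  by_cases hf : MemLp f 2 mu
  · rw [toH_eq hf, Lp.norm_toLp]
    exact ENNReal.toReal_le_of_le_ofReal hc h
  · rw [toH, dif_neg hf, norm_zero]; exact hc

lemma norm_sq_eq_integral (f : H2) : ‖f‖ ^ 2 = ∫ x, f x ^ 2 ∂mu := by
  rw [← real_inner_self_eq_norm_sq, L2.inner_def]
  refine integral_congr_ae (ae_of_all _ fun x => ?_)
  simp [sq]

lemma PolyGrowth.eLpNorm_le {g : ℝ → ℝ} {C r m : ℝ} {k : ℕ} (hg : PolyGrowth g C k) (hr : 0 < r)
    (hrm : r * (k + 1) ≤ m) (hm : 1 ≤ m) {u : ℝ → ℝ} (hu : AEStronglyMeasurable u mu) {R : ℝ} (hR : 0 ≤ R)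
    (huR : eLpNorm u (ENNReal.ofReal m) mu ≤ ENNReal.ofReal R) :
    eLpNorm (fun x => g (u x)) (ENNReal.ofReal r) mu ≤ ENNReal.ofReal (C * ((1 + R) ^ k * R)) := by
  have hm' : 1 ≤ ENNReal.ofReal m := by simpa using ENNReal.ofReal_le_ofReal hm
  have h1 := hg.eLpNorm_sub_le hr hrm hu (v := fun _ => 0) aestronglyMeasurable_const
  simp only [hg.zero, sub_zero] at h1
  refine h1.trans ?_
  rw [ENNReal.ofReal_mul hg.nonneg, ENNReal.ofReal_mul (by positivity), ENNReal.ofReal_pow (by positivity)]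
  gcongr
  refine (eLpNorm_one_add_abs_le hm' hu aestronglyMeasurable_const).trans ?_
  rw [ENNReal.ofReal_add zero_le_one hR, ENNReal.ofReal_one]
  simpa using huR

lemma Ioc_zero_eq_iUnion {T : ℝ} (hT : 0 < T) : Ioc 0 T = ⋃ n : ℕ, Ioc (T / (n + 2)) T := by
  ext t
  simp only [mem_Ioc, mem_iUnion]
  constructor
  · rintro ⟨h1, h2⟩
    obtain ⟨n, hn⟩ := exists_nat_gt (T / t)
    refine ⟨n, ?_, h2⟩
    rw [div_lt_iff₀ h1] at hn
    rw [div_lt_iff₀ (by positivity)]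
    linarith
  · rintro ⟨n, h1, h2⟩
    exact ⟨lt_trans (by positivity) h1, h2⟩

lemma div_add_two_mem {T : ℝ} (hT : 0 < T) (n : ℕ) : T / (n + 2) ∈ Ioo 0 T := by
  refine ⟨by positivity, ?_⟩
  rw [div_lt_iff₀ (by positivity)]
  have : (0 : ℝ) ≤ n := Nat.cast_nonneg n
  nlinarith

/-- Regularity is available only on intervals bounded away from 0; countably many of them exhaust
(0,T]. -/
lemma ae_Ioc_zero_of_forall {Q : ℝ → Prop} {T : ℝ}
    (h : ∀ a ∈ Ioo 0 T, ∀ᵐ t ∂(volume.restrict (Ioc a T)), Q t) : ∀ᵐ t ∂(volume.restrict (Ioc 0 T)), Q t := by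
  rcases le_or_gt T 0 with hT | hT
  · rw [Ioc_eq_empty (by linarith)]; simp
  · rw [Ioc_zero_eq_iUnion hT, ae_restrict_iUnion_iff]
    exact fun n => h _ (div_add_two_mem hT n)

lemma lintegral_Ioc_le_of_forall {F : ℝ → ℝ≥0∞} {T : ℝ} {B : ℝ≥0∞}
    (h : ∀ a ∈ Ioo 0 T, ∫⁻ t in Ioc a T, F t ≤ B) : ∫⁻ t in Ioc 0 T, F t ≤ B := by
  rcases le_or_gt T 0 with hT | hT
  · rw [Ioc_eq_empty (by linarith)]; simp
  · rw [Ioc_zero_eq_iUnion hT, setLIntegral_iUnion_of_directed]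
    · exact iSup_le fun n => h _ (div_add_two_mem hT n)
    · refine directed_of_isDirected_le fun m n hmn => Ioc_subset_Ioc_left ?_
      have : (m : ℝ) ≤ n := by exact_mod_cast hmn
      gcongr

namespace MildE
variable {ν α β γ : ℝ} {δ : ℕ} {p : ℝ} [hp1 : Fact (1 ≤ ENNReal.ofReal p)] {P : Params ν α β γ δ p}
  {T : ℝ} {φ v : ℝ → Lp ℝ (ENNReal.ofReal p) mu} {u₀ : Lp ℝ (ENNReal.ofReal p) mu}

/-- The reaction term as an element of `L²`. -/
def fH (β γ : ℝ) (δ : ℕ) (v φ : ℝ → Lp ℝ (ENNReal.ofReal p) mu) (t : ℝ) : H2 :=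
  toH fun x => β * cc γ δ ((v t + φ t : Lp ℝ (ENNReal.ofReal p) mu) x)

/-- The flux as an element of `L²`. -/
def gH (α : ℝ) (δ : ℕ) (v φ : ℝ → Lp ℝ (ENNReal.ofReal p) mu) (t : ℝ) : H2 :=
  toH fun x => α / (δ + 1) * pp δ ((v t + φ t : Lp ℝ (ENNReal.ofReal p) mu) x)

lemma eLpNorm_add_le (h : MildE P T φ u₀ v) {B : ℝ} (hB0 : 0 ≤ B) {t : ℝ} (ht : t ∈ Ioc 0 T)
    (hB : eLpNorm (φ t) (ENNReal.ofReal (p * (δ + 1))) mu ≤ ENNReal.ofReal B) {m : ℝ} (hm : 1 ≤ m)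
    (hmp : m ≤ p * (δ + 1)) :
    eLpNorm (v t + φ t : Lp ℝ (ENNReal.ofReal p) mu) (ENNReal.ofReal m) mu
      ≤ ENNReal.ofReal (‖VX P φ u₀ v t‖ + B) := by
  have hm' : 1 ≤ ENNReal.ofReal m := by simpa using ENNReal.ofReal_le_ofReal hm
  have e : (v t + φ t : Lp ℝ (ENNReal.ofReal p) mu) =ᵐ[mu] (VX P φ u₀ v t : ℝ → ℝ) + φ t :=
    (Lp.coeFn_add _ _).trans ((h.ae_eq_VX ht).add (ae_eq_refl _))
  rw [eLpNorm_congr_ae e, ENNReal.ofReal_add (norm_nonneg _) hB0]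
  refine (MeasureTheory.eLpNorm_add_le (VX P φ u₀ v t).continuous.aestronglyMeasurable (Lp.memLp _).1 hm').trans
    (add_le_add ?_ ?_)
  · have := eLpNorm_le_of_ae_bound (μ := mu) (p := ENNReal.ofReal m)
      (f := VX P φ u₀ v t) (C := ‖VX P φ u₀ v t‖) (ae_of_all _ (VX P φ u₀ v t).abs_apply_le)
    simpa using this
  · exact (eLpNorm_mono_exponent (ENNReal.ofReal_le_ofReal hmp) (Lp.memLp _).1).trans hB

/-- Here the bound on φ in L^{p(δ+1)} is used: it is strong enough to put the reaction, of degree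
2δ+1, in L². The L^p norm of φ only gives L¹. -/
lemma exp_two_cc (P : Params ν α β γ δ p) : (2 : ℝ) * ((2 * δ : ℕ) + 1) ≤ p * (δ + 1) := by
  have h1 := P.hp; have h2 := P.hδ'
  push_cast
  nlinarith

lemma exp_two_pp (P : Params ν α β γ δ p) : (2 : ℝ) * (δ + 1) ≤ p * (δ + 1) := by
  have h1 := P.hp3; have h2 := P.hδ'
  nlinarith

lemma one_le_exp (P : Params ν α β γ δ p) : 1 ≤ p * (δ + 1) := by
  have h1 := P.hp3; have h2 := P.hδ'
  nlinarith

lemma eLpNorm_f_le (h : MildE P T φ u₀ v) {B : ℝ} (hB0 : 0 ≤ B) {t : ℝ} (ht : t ∈ Ioc 0 T)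
    (hB : eLpNorm (φ t) (ENNReal.ofReal (p * (δ + 1))) mu ≤ ENNReal.ofReal B) {R : ℝ} (hR : ‖VX P φ u₀ v t‖ + B ≤ R) :
    eLpNorm (fun x => β * cc γ δ ((v t + φ t : Lp ℝ (ENNReal.ofReal p) mu) x)) 2 mu ≤
      ENNReal.ofReal (β * (((1 + γ) * (δ + 1) + γ + (2 * δ + 1)) * ((1 + R) ^ (2 * δ) * R))) := by
  have hR0 : 0 ≤ R := (add_nonneg (norm_nonneg _) hB0).trans hR
  have h1 := (polyGrowth_cc P.hγ0 δ).eLpNorm_le two_pos (exp_two_cc P) (one_le_exp P)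
    (Lp.memLp (v t + φ t)).1 hR0 ((h.eLpNorm_add_le hB0 ht hB (one_le_exp P) le_rfl).trans
      (ENNReal.ofReal_le_ofReal hR))
  rw [ENNReal.ofReal_ofNat] at h1
  have h2 := eLpNorm_const_smul β (fun x => cc γ δ ((v t + φ t : Lp ℝ (ENNReal.ofReal p) mu) x)) 2 mu
  rw [ENNReal.ofReal_mul P.hβ.le]
  refine (le_of_eq h2).trans ?_
  rw [← ofReal_norm, Real.norm_eq_abs, abs_of_pos P.hβ]
  gcongr

lemma eLpNorm_g_le (h : MildE P T φ u₀ v) {B : ℝ} (hB0 : 0 ≤ B) {t : ℝ} (ht : t ∈ Ioc 0 T)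
    (hB : eLpNorm (φ t) (ENNReal.ofReal (p * (δ + 1))) mu ≤ ENNReal.ofReal B) {R : ℝ} (hR : ‖VX P φ u₀ v t‖ + B ≤ R) :
    eLpNorm (fun x => α / (δ + 1) * pp δ ((v t + φ t : Lp ℝ (ENNReal.ofReal p) mu) x)) 2 mu ≤
      ENNReal.ofReal (α / (δ + 1) * ((δ + 1) * ((1 + R) ^ δ * R))) := by
  have hα := P.hα
  have hc : 0 < α / ((δ : ℝ) + 1) := by positivity
  have hR0 : 0 ≤ R := (add_nonneg (norm_nonneg _) hB0).trans hR
  have h1 := (polyGrowth_pp δ).eLpNorm_le two_pos (exp_two_pp P) (one_le_exp P)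
    (Lp.memLp (v t + φ t)).1 hR0 ((h.eLpNorm_add_le hB0 ht hB (one_le_exp P) le_rfl).trans
      (ENNReal.ofReal_le_ofReal hR))
  rw [ENNReal.ofReal_ofNat] at h1
  have h2 := eLpNorm_const_smul (α / ((δ : ℝ) + 1)) (fun x => pp δ ((v t + φ t : Lp ℝ (ENNReal.ofReal p) mu) x)) 2 mu
  rw [ENNReal.ofReal_mul hc.le]
  refine (le_of_eq h2).trans ?_
  rw [← ofReal_norm, Real.norm_eq_abs, abs_of_pos hc]
  gcongr

lemma coeFn_fH (h : MildE P T φ u₀ v) {B : ℝ} (hB0 : 0 ≤ B) {t : ℝ} (ht : t ∈ Ioc 0 T)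
    (hB : eLpNorm (φ t) (ENNReal.ofReal (p * (δ + 1))) mu ≤ ENNReal.ofReal B) :
    fH β γ δ v φ t =ᵐ[mu] fun x => β * cc γ δ ((v t + φ t : Lp ℝ (ENNReal.ofReal p) mu) x) :=
  coeFn_toH ⟨((polyGrowth_cc P.hγ0 δ).cont.comp_aestronglyMeasurable (Lp.memLp _).1).const_mul β,
    (h.eLpNorm_f_le hB0 ht hB le_rfl).trans_lt ENNReal.ofReal_lt_top⟩

lemma coeFn_gH (h : MildE P T φ u₀ v) {B : ℝ} (hB0 : 0 ≤ B) {t : ℝ} (ht : t ∈ Ioc 0 T)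
    (hB : eLpNorm (φ t) (ENNReal.ofReal (p * (δ + 1))) mu ≤ ENNReal.ofReal B) :
    gH α δ v φ t =ᵐ[mu] fun x => α / (δ + 1) * pp δ ((v t + φ t : Lp ℝ (ENNReal.ofReal p) mu) x) :=
  coeFn_toH ⟨((polyGrowth_pp δ).cont.comp_aestronglyMeasurable (Lp.memLp _).1).const_mul _,
    (h.eLpNorm_g_le hB0 ht hB le_rfl).trans_lt ENNReal.ofReal_lt_top⟩

lemma sc_fH (h : MildE P T φ u₀ v) {B : ℝ} (hB0 : 0 ≤ B) {t : ℝ} (ht : t ∈ Ioc 0 T)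
    (hB : eLpNorm (φ t) (ENNReal.ofReal (p * (δ + 1))) mu ≤ ENNReal.ofReal B) (k : ℕ) :
    sc k (fH β γ δ v φ t) = β * sc k (NL P (v t + φ t)).1 := by
  rw [sc_congr (h.coeFn_fH hB0 ht hB), sc_congr (coeFn_NL_fst P (v t + φ t))]
  unfold sc
  rw [← integral_const_mul]
  congr 1; funext x; ring

lemma kc_gH (h : MildE P T φ u₀ v) {B : ℝ} (hB0 : 0 ≤ B) {t : ℝ} (ht : t ∈ Ioc 0 T)
    (hB : eLpNorm (φ t) (ENNReal.ofReal (p * (δ + 1))) mu ≤ ENNReal.ofReal B) (k : ℕ) :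
    kc k (gH α δ v φ t) = α / (δ + 1) * kc k (NL P (v t + φ t)).2 := by
  rw [kc_congr (h.coeFn_gH hB0 ht hB), kc_congr (coeFn_NL_snd P (v t + φ t))]
  unfold kc
  rw [← integral_const_mul]
  congr 1; funext x; ring

/-- Away from t = 0 the representative `VX` is bounded, so reaction and flux are bounded in L².
Their modes are continuous since the nonlinearity is continuous in time with values in L¹ × L^{3/2},
and differentiating Duhamel's formula gives the equation of each mode. -/
theorem linData (h : MildE P T φ u₀ v) {B : ℝ} (hB0 : 0 ≤ B)
    (hB : ∀ t ∈ Icc 0 T, eLpNorm (φ t) (ENNReal.ofReal (p * (δ + 1))) mu ≤ ENNReal.ofReal B)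
    {a : ℝ} (ha : a ∈ Ioo 0 T) :
    ∃ R M, (∀ t ∈ Icc a T, ‖VX P φ u₀ v t‖ ≤ R) ∧
      LinData ν a T M (fun t => toE 2 (VX P φ u₀ v t)) (fH β γ δ v φ) (gH α δ v φ) := by
  have hsub : Icc a T ⊆ Ioc 0 T := fun t ht => ⟨ha.1.trans_le ht.1, ht.2⟩
  have hcV := h.continuousOn_VX.mono hsub
  obtain ⟨R, hR⟩ := isCompact_Icc.exists_bound_of_continuousOn hcV
  have hR0 : 0 ≤ R := (norm_nonneg _).trans (hR a ⟨le_rfl, ha.2.le⟩)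
  have hα := P.hα; have hβ := P.hβ; have hγ := P.hγ0
  set M1 := β * (((1 + γ) * (δ + 1) + γ + (2 * δ + 1)) * ((1 + (R + B)) ^ (2 * δ) * (R + B))) with hM1
  set M2 := α / (δ + 1) * ((δ + 1) * ((1 + (R + B)) ^ δ * (R + B))) with hM2
  have hM1p : 0 ≤ M1 := by positivity
  have hM2p : 0 ≤ M2 := by positivity
  have hs0 : Ioo a T ⊆ Ioo 0 T := Ioo_subset_Ioo_left ha.1.le
  have hcNL : ContinuousOn (fun s => NL P (v s + φ s)) (Icc a T) := h.contNL.mono (Icc_subset_Icc_left ha.1.le)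
  have hscf : ∀ k, ∀ t ∈ Icc a T, sc k (fH β γ δ v φ t) = β * sc k (NL P (v t + φ t)).1 := fun k t ht =>
    h.sc_fH hB0 (hsub ht) (hB t ⟨(hsub ht).1.le, ht.2⟩) k
  have hkcg : ∀ k, ∀ t ∈ Icc a T, kc k (gH α δ v φ t) = α / (δ + 1) * kc k (NL P (v t + φ t)).2 := fun k t ht =>
    h.kc_gH hB0 (hsub ht) (hB t ⟨(hsub ht).1.le, ht.2⟩) k
  have hscV : ∀ k t, sc k (toE 2 (VX P φ u₀ v t)) = sc k (VX P φ u₀ v t) := fun k t => sc_congr (coeFn_toE 2 _)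
  refine ⟨R, R + M1 + M2, hR, P.hν, ha.2.le, fun t ht => ?_, fun t ht => ?_, fun t ht => ?_, fun k => ?_,
    fun k => ?_, fun k => ?_, fun k t ht => ?_⟩
  · have := (norm_toE_apply_le 2 (VX P φ u₀ v t)).trans (hR t ht)
    linarith
  · have := norm_toH_le hM1p (h.eLpNorm_f_le hB0 (hsub ht) (hB t ⟨(hsub ht).1.le, ht.2⟩)
      (R := R + B) (by linarith [hR t ht]))
    unfold fH; linarith
  · have := norm_toH_le hM2p (h.eLpNorm_g_le hB0 (hsub ht) (hB t ⟨(hsub ht).1.le, ht.2⟩)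
      (R := R + B) (by linarith [hR t ht]))
    unfold gH; linarith
  · simp only [hscV, ← scX_apply]
    exact (scX k).continuous.comp_continuousOn hcV
  · refine ContinuousOn.congr ?_ (hscf k)
    exact ((pairL (ENNReal.ofReal 1) (sX k)).continuous.comp_continuousOn
      (continuous_fst.comp_continuousOn hcNL)).const_mul β
  · refine ContinuousOn.congr ?_ (hkcg k)
    exact ((pairL (ENNReal.ofReal (3 / 2)) (cbX k)).continuous.comp_continuousOn
      (continuous_snd.comp_continuousOn hcNL)).const_mul _
  · have hr : ContinuousOn (fun s => rcL α β δ k (NL P (v s + φ s))) (Icc 0 T) :=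
      (rcL α β δ k).continuous.comp_continuousOn h.contNL
    have hd := hasDerivAt_duhamel (c := ν * lam k) (q0 := sc k u₀) hr (hs0 ht)
    have e1 : (fun t => sc k (toE 2 (VX P φ u₀ v t))) =ᶠ[𝓝 t] fun t => Real.exp (-(ν * lam k * t)) * sc k u₀ +
      ∫ s in (0 : ℝ)..t, Real.exp (-(ν * lam k * (t - s))) * rcL α β δ k (NL P (v s + φ s)) := by
      filter_upwards [Ioo_mem_nhds ht.1 ht.2] with s hs
      rw [hscV]
      exact h.sc_VX (hsub ⟨hs.1.le, hs.2.le⟩) k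
    have ht' : t ∈ Icc a T := ⟨ht.1.le, ht.2.le⟩
    refine (hd.congr_of_eventuallyEq e1).congr_deriv ?_
    rw [hscf k t ht', hkcg (k + 1) t ht', ← h.sc_VX (hsub ht') k, rcL_apply, ← hscV]
    ring

end MildE

lemma energyFun_sq : EnergyFun (fun u => u ^ 2) (fun u => 2 * u) (fun _ => 2) 2 where
  zero := by simp
  zero1 := by simp
  d0 x := by simpa using hasDerivAt_pow 2 x
  d1 x := by simpa using (hasDerivAt_id x).const_mul 2
  bd x := by simp
  cont2 := continuous_const

/-- One factor |a| is split off, to be measured in the sup norm; the remaining power 2δ+1 is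
integrable for a in L^p. -/
lemma pp_add_sq_le (δ : ℕ) (a b : ℝ) :
    pp δ (a + b) ^ 2 ≤ 2 ^ δ * 2 ^ (δ + 1) * (|a| * |pp (2 * δ) a| + pp δ b ^ 2) := by
  have e1 : pp δ (a + b) ^ 2 = ((a + b) ^ 2) ^ (δ + 1) := by
    unfold pp; rw [← pow_mul, ← pow_mul, mul_comm]
  have e2 : |a| * |pp (2 * δ) a| = (a ^ 2) ^ (δ + 1) := by
    unfold pp
    rw [abs_pow, ← pow_succ', ← sq_abs a, ← pow_mul]; congr 1
  have e3 : pp δ b ^ 2 = (b ^ 2) ^ (δ + 1) := by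
    unfold pp; rw [← pow_mul, ← pow_mul, mul_comm]
  rw [e1, e2, e3]
  have h1 : (a + b) ^ 2 ≤ 2 * a ^ 2 + 2 * b ^ 2 := by nlinarith [sq_nonneg (a - b)]
  calc _ ≤ (2 * a ^ 2 + 2 * b ^ 2) ^ (δ + 1) := by gcongr
    _ ≤ 2 ^ (δ + 1 - 1) * ((2 * a ^ 2) ^ (δ + 1) + (2 * b ^ 2) ^ (δ + 1)) := add_pow_le (by positivity) (by positivity) _
    _ = _ := by rw [mul_pow, mul_pow, Nat.add_sub_cancel]; ring

namespace MildE
variable {ν α β γ : ℝ} {δ : ℕ} {p : ℝ} [hp1 : Fact (1 ≤ ENNReal.ofReal p)] {P : Params ν α β γ δ p}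
  {T : ℝ} {φ v : ℝ → Lp ℝ (ENNReal.ofReal p) mu} {u₀ : Lp ℝ (ENNReal.ofReal p) mu}

/-- Of the 2δ+2 factors of v in the squared flux, one costs t^(-5/8) and the others form an L¹
function bounded uniformly in time. The singularity is integrable, so the L² energy estimate can be
carried down to t = 0. -/
lemma exists_norm_gH_sq_le (h : MildE P T φ u₀ v) {B : ℝ} (hB0 : 0 ≤ B)
    (hB : ∀ t ∈ Icc 0 T, eLpNorm (φ t) (ENNReal.ofReal (p * (δ + 1))) mu ≤ ENNReal.ofReal B) :
    ∃ C, 0 ≤ C ∧ ∀ t ∈ Ioc 0 T, ‖gH α δ v φ t‖ ^ 2 ≤ C * t ^ (-(5 / 8 : ℝ)) := by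
  obtain ⟨C1, hC1, hV⟩ := h.exists_norm_VX_le
  have hnem : ContinuousOn (fun t => nemy (polyGrowth_pp (2 * δ)) one_pos P.exp_cc (v t)) (Icc 0 T) :=
    (continuous_nemy _ _ _).comp_continuousOn h.cont
  obtain ⟨A, hA⟩ := isCompact_Icc.exists_bound_of_continuousOn hnem
  have hA0 : 0 ≤ A := (norm_nonneg _).trans (hA 0 ⟨le_rfl, h.hT⟩)
  have hT := h.hT
  set K := ((δ : ℝ) + 1) * ((1 + B) ^ δ * B) with hK
  have hK0 : 0 ≤ K := by positivity
  set c := α / ((δ : ℝ) + 1) with hc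
  set D : ℝ := 2 ^ δ * 2 ^ (δ + 1) with hD
  refine ⟨c ^ 2 * D * (C1 * A + K ^ 2 * T ^ (5 / 8 : ℝ)), by positivity, fun t ht => ?_⟩
  have htI : t ∈ Icc 0 T := ⟨ht.1.le, ht.2⟩
  have ht0 := ht.1
  have hφp := (polyGrowth_pp δ).eLpNorm_le two_pos (exp_two_pp P) (one_le_exp P) (Lp.memLp (φ t)).1 hB0 (hB t htI)
  rw [ENNReal.ofReal_ofNat] at hφp
  have hφm : MemLp (fun x => pp δ (φ t x)) 2 mu :=
    ⟨(polyGrowth_pp δ).cont.comp_aestronglyMeasurable (Lp.memLp _).1, hφp.trans_lt ENNReal.ofReal_lt_top⟩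
  have hφi : ∫ x, pp δ (φ t x) ^ 2 ∂mu ≤ K ^ 2 := by
    have e : ∫ x, pp δ (φ t x) ^ 2 ∂mu = ‖toH fun x => pp δ (φ t x)‖ ^ 2 := by
      rw [norm_sq_eq_integral]
      exact integral_congr_ae ((coeFn_toH hφm).mono fun x hx => by simp only [hx])
    rw [e]
    have := norm_toH_le hK0 hφp
    gcongr
  have hVi : ∫ x, |pp (2 * δ) (v t x)| ∂mu ≤ A := by
    refine le_trans (le_of_eq ?_) ((integral_abs_le_norm _).trans (hA t htI))
    refine integral_congr_ae ?_
    filter_upwards [coeFn_nemy (polyGrowth_pp (2 * δ)) one_pos P.exp_cc (v t)] with x hx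
    rw [hx]
  have hVint : Integrable (fun x => |pp (2 * δ) (v t x)|) mu := by
    refine Integrable.congr (integrable_Lp (nemy (polyGrowth_pp (2 * δ)) one_pos P.exp_cc (v t))).abs ?_
    filter_upwards [coeFn_nemy (polyGrowth_pp (2 * δ)) one_pos P.exp_cc (v t)] with x hx
    rw [hx]
  rw [norm_sq_eq_integral]
  have h1 : ∫ x, gH α δ v φ t x ^ 2 ∂mu ≤ ∫ x, c ^ 2 * D * (‖VX P φ u₀ v t‖ * |pp (2 * δ) (v t x)| + pp δ (φ t x) ^ 2) ∂mu := by
    refine integral_mono_ae (Lp.memLp _).integrable_sq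
      (((hVint.const_mul _).add hφm.integrable_sq).const_mul _) ?_
    filter_upwards [h.coeFn_gH hB0 ht (hB t htI), h.ae_eq_VX ht, Lp.coeFn_add (v t) (φ t)] with x h1 h2 h3
    rw [h1, h3, Pi.add_apply, mul_pow, mul_assoc]
    refine mul_le_mul_of_nonneg_left ((pp_add_sq_le δ _ _).trans ?_) (sq_nonneg _)
    gcongr
    rw [h2]; exact X.abs_apply_le _ x
  refine h1.trans ?_
  rw [integral_const_mul, integral_add (hVint.const_mul _) hφm.integrable_sq, integral_const_mul, mul_assoc (c ^ 2 * D)]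
  have hDp : 0 ≤ c ^ 2 * D := by positivity
  refine mul_le_mul_of_nonneg_left ?_ hDp
  rw [add_mul]
  refine add_le_add ?_ ?_
  · calc _ ≤ (C1 * t ^ (-(5 / 8 : ℝ))) * A := by
          gcongr
          exact hV t ht
      _ = _ := by ring
  · have e : t ^ (5 / 8 : ℝ) * t ^ (-(5 / 8 : ℝ)) = 1 := by rw [← Real.rpow_add ht0]; norm_num
    calc _ ≤ K ^ 2 := hφi
      _ = K ^ 2 * (t ^ (5 / 8 : ℝ) * t ^ (-(5 / 8 : ℝ))) := by rw [e, mul_one]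
      _ ≤ K ^ 2 * (T ^ (5 / 8 : ℝ) * t ^ (-(5 / 8 : ℝ))) := by gcongr; exact ht.2
      _ = _ := by ring

lemma integral_abs_fH_le (h : MildE P T φ u₀ v) {B : ℝ} (hB0 : 0 ≤ B)
    (hB : ∀ t ∈ Icc 0 T, eLpNorm (φ t) (ENNReal.ofReal (p * (δ + 1))) mu ≤ ENNReal.ofReal B) :
    ∃ A, 0 ≤ A ∧ ∀ t ∈ Ioc 0 T, ∫ x, |fH β γ δ v φ t x| ∂mu ≤ A := by
  obtain ⟨A, hA⟩ := isCompact_Icc.exists_bound_of_continuousOn (continuous_fst.comp_continuousOn h.contNL)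
  have hA0 : 0 ≤ A := (norm_nonneg _).trans (hA 0 ⟨le_rfl, h.hT⟩)
  have hβ := P.hβ
  refine ⟨β * A, by positivity, fun t ht => ?_⟩
  have htI : t ∈ Icc 0 T := ⟨ht.1.le, ht.2⟩
  have e : ∫ x, |fH β γ δ v φ t x| ∂mu = β * ∫ x, |(NL P (v t + φ t)).1 x| ∂mu := by
    rw [← integral_const_mul]
    refine integral_congr_ae ?_
    filter_upwards [h.coeFn_fH hB0 ht (hB t htI), coeFn_NL_fst P (v t + φ t)] with x h1 h2
    rw [h1, h2, abs_mul, abs_of_pos hβ]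
  rw [e]
  gcongr
  exact (integral_abs_le_norm _).trans (hA t htI)

lemma norm_toE_VX_le (h : MildE P T φ u₀ v) {t : ℝ} (ht : t ∈ Ioc 0 T) : ‖toE 2 (VX P φ u₀ v t)‖ ≤ ‖v t‖ := by
  have e : eLpNorm (toE 2 (VX P φ u₀ v t)) 2 mu = eLpNorm (v t) 2 mu :=
    eLpNorm_congr_ae ((coeFn_toE 2 _).trans (h.ae_eq_VX ht).symm)
  rw [Lp.norm_def, Lp.norm_def, e]
  refine ENNReal.toReal_mono (Lp.memLp _).2.ne (eLpNorm_mono_exponent ?_ (Lp.memLp _).1)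
  rw [← ENNReal.ofReal_ofNat 2]
  exact ENNReal.ofReal_le_ofReal (by linarith [P.hp3])

lemma energyRate_sq_le {ν : ℝ} (hν : 0 < ν) (V : X) (w f g : H2) :
    energyRate ν (fun u => 2 * u) (fun _ => 2) (toE 2 V) w f g ≤
      -(ν * ‖w‖ ^ 2) + (2 * (‖V‖ * ∫ x, |f x| ∂mu) + ‖g‖ ^ 2 / ν) := by
  have e1 : ∫ x, 2 * w x * w x ∂mu = 2 * ‖w‖ ^ 2 := by
    rw [norm_sq_eq_integral, ← integral_const_mul]; congr 1; funext x; ring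
  have e2 : ∫ x, 2 * w x * g x ∂mu = 2 * inner ℝ w g := by
    rw [L2.inner_def, ← integral_const_mul]; congr 1; funext x; simp; ring
  have e3 : ∫ x, 2 * toE 2 V x * f x ∂mu ≤ 2 * (‖V‖ * ∫ x, |f x| ∂mu) := by
    have : ∫ x, 2 * toE 2 V x * f x ∂mu = 2 * ∫ x, V x * f x ∂mu := by
      rw [← integral_const_mul]
      refine integral_congr_ae ?_
      filter_upwards [coeFn_toE 2 V] with x hx
      rw [hx]; ring
    rw [this]
    have := (le_abs_self _).trans (abs_integral_mul_le_of_bound V.abs_apply_le (integrable_Lp f))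
    linarith
  have e4 : 2 * inner ℝ w g ≤ ν * ‖w‖ ^ 2 + ‖g‖ ^ 2 / ν := by
    have h1 := real_inner_le_norm w g
    have h2 : ν * ‖w‖ ^ 2 + ‖g‖ ^ 2 / ν - 2 * (‖w‖ * ‖g‖) = (ν * ‖w‖ - ‖g‖) ^ 2 / ν := by field_simp; ring
    have h3 : 0 ≤ (ν * ‖w‖ - ‖g‖) ^ 2 / ν := by positivity
    linarith
  rw [energyRate, e1, e2]
  linarith

/-- The term C t^(-5/8) integrates to at most C T^(3/8)/(3/8), so the dissipation is bounded
independently of the initial time a. -/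
lemma lintegral_le_of_energy {ν a T C M : ℝ} (hν : 0 < ν) (ha : a ∈ Ioo 0 T) {N e : ℝ → ℝ} {E0 E1 : ℝ}
    (hN : IntegrableOn N (Ioc a T)) (hN0 : ∀ t, 0 ≤ N t) (he : IntervalIntegrable e volume a T)
    (hE : E1 - E0 = ∫ t in a..T, e t) (hE1 : 0 ≤ E1) (hE0 : E0 ≤ M) (hC : 0 ≤ C)
    (hle : ∀ᵐ t ∂(volume.restrict (Ioc a T)), e t ≤ -(ν * N t) + C * t ^ (-(5 / 8 : ℝ))) :
    ∫⁻ t in Ioc a T, ENNReal.ofReal (N t) ≤ ENNReal.ofReal ((M + C * (T ^ (3 / 8 : ℝ) / (3 / 8))) / ν) := by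
  have hr : IntervalIntegrable (fun t : ℝ => t ^ (-(5 / 8 : ℝ))) volume a T :=
    intervalIntegral.intervalIntegrable_rpow' (by norm_num)
  have hNi : IntervalIntegrable N volume a T := by
    rwa [intervalIntegrable_iff_integrableOn_Ioc_of_le ha.2.le]
  have h1 : ∫ t in a..T, e t ≤ ∫ t in a..T, (-(ν * N t) + C * t ^ (-(5 / 8 : ℝ))) := by
    rw [intervalIntegral.integral_of_le ha.2.le, intervalIntegral.integral_of_le ha.2.le]
    refine integral_mono_ae ?_ ?_ hle
    · rwa [intervalIntegrable_iff_integrableOn_Ioc_of_le ha.2.le] at he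
    · have := ((hNi.const_mul ν).neg).add (hr.const_mul C)
      rwa [intervalIntegrable_iff_integrableOn_Ioc_of_le ha.2.le] at this
  have hneg : IntervalIntegrable (fun t => -(ν * N t)) volume a T := (hNi.const_mul ν).neg
  rw [intervalIntegral.integral_add hneg (hr.const_mul C), intervalIntegral.integral_neg,
    intervalIntegral.integral_const_mul, intervalIntegral.integral_const_mul,
    integral_rpow (Or.inl (by norm_num)), show (-(5 / 8 : ℝ) + 1) = 3 / 8 by norm_num] at h1
  have h2 : 0 ≤ a ^ (3 / 8 : ℝ) := Real.rpow_nonneg ha.1.le _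
  rw [← ofReal_integral_eq_lintegral_ofReal hN (ae_of_all _ hN0), ← intervalIntegral.integral_of_le ha.2.le]
  refine ENNReal.ofReal_le_ofReal ?_
  rw [le_div_iff₀ hν]
  have h3 : C * ((T ^ (3 / 8 : ℝ) - a ^ (3 / 8 : ℝ)) / (3 / 8)) ≤ C * (T ^ (3 / 8 : ℝ) / (3 / 8)) := by
    gcongr; linarith
  linarith

/-- The energy identity with Φ = u² on [a,T], with bounds uniform in a: the reaction, bounded in L¹,
is paired with the sup norm of the solution, and the squared flux in L² is controlled; both are
O(t^(-5/8)). -/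
theorem spaceDeriv (h : MildE P T φ u₀ v) {B : ℝ} (hB0 : 0 ≤ B)
    (hB : ∀ t ∈ Icc 0 T, eLpNorm (φ t) (ENNReal.ofReal (p * (δ + 1))) mu ≤ ENNReal.ofReal B) :
    (∀ᵐ t ∂(volume.restrict (Ioc 0 T)), HasD (toE 2 (VX P φ u₀ v t)) (derivH (toE 2 (VX P φ u₀ v t)))) ∧
    ∫⁻ t in Ioc 0 T, ENNReal.ofReal (‖derivH (toE 2 (VX P φ u₀ v t))‖ ^ 2) < ⊤ := by
  refine ⟨ae_Ioc_zero_of_forall fun a ha => ?_, ?_⟩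
  · obtain ⟨R, M, -, hL⟩ := h.linData hB0 hB ha
    exact hL.ae_hasD
  have hν := P.hν
  obtain ⟨C1, hC1, hV⟩ := h.exists_norm_VX_le
  obtain ⟨C2, hC2, hg⟩ := h.exists_norm_gH_sq_le hB0 hB
  obtain ⟨A, hA0, hA⟩ := h.integral_abs_fH_le hB0 hB
  obtain ⟨M0, hM0⟩ := isCompact_Icc.exists_bound_of_continuousOn h.cont
  refine lt_of_le_of_lt (lintegral_Ioc_le_of_forall (B := ENNReal.ofReal
    ((M0 ^ 2 + (2 * (C1 * A) + C2 / ν) * (T ^ (3 / 8 : ℝ) / (3 / 8))) / ν)) fun a ha => ?_) ENNReal.ofReal_lt_top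
  obtain ⟨R, M, -, hL⟩ := h.linData hB0 hB ha
  obtain ⟨hi, hid⟩ := hL.energy_identity energyFun_sq
  simp only [← norm_sq_eq_integral] at hid
  have haI : a ∈ Ioc 0 T := ⟨ha.1, ha.2.le⟩
  refine lintegral_le_of_energy hν ha hL.integrableOn_norm_sq (fun t => sq_nonneg _) hi hid (sq_nonneg _) ?_
    (by positivity) ?_
  · exact pow_le_pow_left₀ (norm_nonneg _) ((h.norm_toE_VX_le haI).trans (hM0 a ⟨ha.1.le, ha.2.le⟩)) 2
  · filter_upwards [ae_restrict_mem measurableSet_Ioc] with t ht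
    have ht' : t ∈ Ioc 0 T := ⟨ha.1.trans ht.1, ht.2⟩
    have ht0 := ht'.1
    refine (energyRate_sq_le hν _ _ _ _).trans ?_
    have h1 : ‖VX P φ u₀ v t‖ * ∫ x, |fH β γ δ v φ t x| ∂mu ≤ C1 * t ^ (-(5 / 8 : ℝ)) * A := 
      mul_le_mul (hV t ht') (hA t ht') (integral_nonneg fun x => abs_nonneg _) (by positivity)
    have h2 : ‖gH α δ v φ t‖ ^ 2 / ν ≤ C2 * t ^ (-(5 / 8 : ℝ)) / ν := by
      gcongr; exact hg t ht'
    have e : (2 * (C1 * A) + C2 / ν) * t ^ (-(5 / 8 : ℝ)) =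
      2 * (C1 * t ^ (-(5 / 8 : ℝ)) * A) + C2 * t ^ (-(5 / 8 : ℝ)) / ν := by ring
    rw [e]
    linarith

end MildE

/-! ### The L^p energy estimate. -/

lemma continuous_integral_comp {g : ℝ → ℝ} (hg : Continuous g) : Continuous fun S : X => ∫ x, g (S x) ∂mu := by
  have e : (fun S : X => ∫ x, g (S x) ∂mu) = fun S => pairL 2 (cbX 0) (toE 2 (X.comp g hg S)) := by
    funext S
    rw [pairL_apply, integral_mul_toE]
    simp only [cbX_apply, cb, one_mul, X.comp_apply]
  rw [e]
  exact (pairL 2 (cbX 0)).continuous.comp ((toE 2).continuous.comp (X.continuous_comp g hg))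

/-- The integrand is the derivative of an antiderivative of g evaluated at u, and u vanishes at both
ends. For sine polynomials this is the fundamental theorem of calculus; the limit uses uniform
convergence. -/
lemma integral_comp_mul_eq_zero {g : ℝ → ℝ} (hg : Continuous g) {u w : H2} (hw : HasD u w) :
    ∫ x, g (u x) * w x ∂mu = 0 := by
  obtain ⟨S, huS, hS⟩ := tendsto_Sn_X hw
  have e : ∫ x, g (u x) * w x ∂mu = inner ℝ (toE 2 (X.comp g hg S)) w := by
    rw [inner_toE]
    refine integral_congr_ae ?_
    filter_upwards [huS] with x hx
    rw [hx, X.comp_apply]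
  have ht : Tendsto (fun N => inner ℝ (toE 2 (X.comp g hg (Sn N fun k => sc k u))) (toE 2 (Gn N fun k => kc k w)))
      atTop (𝓝 (inner ℝ (toE 2 (X.comp g hg S)) w)) :=
    (((toE 2).continuous.tendsto _).comp (((X.continuous_comp g hg).tendsto _).comp hS)).inner (tendsto_Gn w)
  have h0 : ∀ N, inner ℝ (toE 2 (X.comp g hg (Sn N fun k => sc k u))) (toE 2 (Gn N fun k => kc k w)) = (0 : ℝ) := by
    intro N
    have ek : (fun k => kc k w) = dcoef fun k => sc k u := funext hw
    rw [← integral_mul2, ek, integral_mu_eq]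
    simp only [X.comp_apply]
    have cS := (Sn N fun k => sc k u).continuous
    have cG := (Gn N (dcoef fun k => sc k u)).continuous
    rw [intervalIntegral.integral_eq_sub_of_hasDerivAt
      (f := fun x => ∫ s in (0 : ℝ)..(Sn N (fun k => sc k u) x), g s)
      (fun x _ => ((hg.integral_hasStrictDerivAt 0 _).hasDerivAt).comp x (hasDerivAt_Sn N (fun k => sc k u) x))
      (Continuous.intervalIntegrable (by fun_prop) _ _)]
    simp [Sn_zero, Sn_one]
  simp only [h0] at ht
  rw [e]
  exact tendsto_nhds_unique ht tendsto_const_nhds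

/-- Away from 0 this is the product rule; at 0 the derivative extends continuously, which suffices.
-/
lemma hasDerivAt_abs_rpow_mul {r : ℝ} (hr : 0 < r) (x : ℝ) :
    HasDerivAt (fun x : ℝ => |x| ^ r * x) ((r + 1) * |x| ^ r) x := by
  have hc : Continuous fun x : ℝ => |x| ^ r := continuous_abs.rpow_const fun _ => Or.inr hr.le
  have hne : ∀ y : ℝ, y ≠ 0 → HasDerivAt (fun x : ℝ => |x| ^ r * x) ((r + 1) * |y| ^ r) y := by
    intro y hy
    have hy' : 0 < |y| := abs_pos.2 hy
    refine (((hasDerivAt_abs hy).rpow_const (Or.inl hy'.ne') (p := r)).mul (hasDerivAt_id y)).congr_deriv ?_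
    have e1 : (SignType.sign y : ℝ) * y = |y| := sign_mul_self y
    have e2 : |y| ^ (r - 1) * |y| = |y| ^ r := by rw [Real.rpow_sub_one hy'.ne']; field_simp
    simp only [id, mul_one]
    linear_combination r * |y| ^ (r - 1) * e1 + r * e2
  exact hasDerivAt_of_hasDerivAt_of_ne' (x := 0) hne (hc.mul continuous_id).continuousAt
    (hc.const_mul _).continuousAt x

/-- The second derivative of the power `|u|^p`, truncated at level `M`. -/
def pow2 (p M u : ℝ) : ℝ := p * (p - 1) * (min |u| M) ^ (p - 2)

/-- The first derivative of the truncated power. -/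
def pow1 (p M u : ℝ) : ℝ := ∫ s in (0 : ℝ)..u, pow2 p M s

/-- The power `|u|^p`, extended quadratically beyond the level `M`. -/
def pow0 (p M u : ℝ) : ℝ := ∫ s in (0 : ℝ)..u, pow1 p M s

section
variable {p M : ℝ}

lemma continuous_pow2 (hp : 3 ≤ p) : Continuous (pow2 p M) :=
  ((continuous_abs.min continuous_const).rpow_const fun _ => Or.inr (by linarith)).const_mul _

lemma hasDerivAt_pow1 (hp : 3 ≤ p) (x : ℝ) : HasDerivAt (pow1 p M) (pow2 p M x) x :=
  ((continuous_pow2 hp).integral_hasStrictDerivAt 0 x).hasDerivAt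

/-- The second derivative of |u|^p is frozen beyond the level M to make it bounded. On [a,T] the
solution is bounded by such an M, so the modification is never seen. -/
lemma energyFun_pow (hp : 3 ≤ p) (hM : 0 ≤ M) :
    EnergyFun (pow0 p M) (pow1 p M) (pow2 p M) (p * (p - 1) * M ^ (p - 2)).toNNReal where
  zero := by simp [pow0]
  zero1 := by simp [pow1]
  d0 x := by
    have : Continuous (pow1 p M) := continuous_iff_continuousAt.2 fun x => (hasDerivAt_pow1 hp x).continuousAt
    exact (this.integral_hasStrictDerivAt 0 x).hasDerivAt
  d1 := hasDerivAt_pow1 hp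
  bd x := by
    have h1 : 0 ≤ p * (p - 1) := by nlinarith
    have h2 : 0 ≤ min |x| M := le_min (abs_nonneg x) hM
    rw [Real.coe_toNNReal _ (by positivity), pow2, abs_of_nonneg (by positivity)]
    gcongr
    · linarith
    · exact min_le_right _ _
  cont2 := continuous_pow2 hp

lemma pow2_of_le {u : ℝ} (hu : |u| ≤ M) : pow2 p M u = p * (p - 1) * |u| ^ (p - 2) := by
  rw [pow2, min_eq_left hu]

lemma abs_le_of_mem_uIcc_zero {s u : ℝ} (hs : s ∈ uIcc 0 u) : |s| ≤ |u| := by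
  have := abs_sub_left_of_mem_uIcc hs
  simpa using this

lemma pow1_of_le (hp : 3 ≤ p) {u : ℝ} (hu : |u| ≤ M) : pow1 p M u = p * (|u| ^ (p - 2) * u) := by
  have hp2 : 0 < p - 2 := by linarith
  have hc : Continuous fun x : ℝ => |x| ^ (p - 2) := continuous_abs.rpow_const fun _ => Or.inr hp2.le
  have e : pow1 p M u = ∫ s in (0 : ℝ)..u, p * ((p - 2 + 1) * |s| ^ (p - 2)) :=
    intervalIntegral.integral_congr fun s hs => by
      rw [pow2_of_le ((abs_le_of_mem_uIcc_zero hs).trans hu)]; ring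
  rw [e, intervalIntegral.integral_eq_sub_of_hasDerivAt
    (fun x _ => (hasDerivAt_abs_rpow_mul hp2 x).const_mul p) (Continuous.intervalIntegrable (by fun_prop) _ _)]
  simp

lemma pow0_of_le (hp : 3 ≤ p) {u : ℝ} (hu : |u| ≤ M) : pow0 p M u = |u| ^ p := by
  have hp2 : 0 < p - 2 := by linarith
  have hc : Continuous fun x : ℝ => |x| ^ (p - 2) := continuous_abs.rpow_const fun _ => Or.inr hp2.le
  have e : pow0 p M u = ∫ s in (0 : ℝ)..u, p * |s| ^ (p - 2) * s :=
    intervalIntegral.integral_congr fun s hs => by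
      rw [pow1_of_le hp ((abs_le_of_mem_uIcc_zero hs).trans hu)]; ring
  rw [e, intervalIntegral.integral_eq_sub_of_hasDerivAt
    (fun x _ => hasDerivAt_abs_rpow x (by linarith)) (Continuous.intervalIntegrable (by fun_prop) _ _)]
  simp [Real.zero_rpow (by linarith : p ≠ 0)]

end

section
variable {ν α β γ : ℝ} {δ : ℕ} {p : ℝ}

/-- After subtraction of the null term, the flux enters only through d = 𝔭(u+φ) - 𝔭(u). Young's
inequality trades cwd for half of the viscous term plus c²d²/(2ν), and the scalar inequality
`pointwise_energy` handles the rest. -/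
lemma energy_integrand_le (P : Params ν α β γ δ p) (u φ w : ℝ) :
    -(ν * (p * (p - 1) * |u| ^ (p - 2) * w * w)) + p * (|u| ^ (p - 2) * u) * (β * cc γ δ (u + φ))
      + p * (p - 1) * |u| ^ (p - 2) * w * (α / (δ + 1) * pp δ (u + φ))
      - α / (δ + 1) * (p * (p - 1) * |u| ^ (p - 2) * pp δ u * w)
    ≤ -(ν * p * (p - 1) / 2 * (|u| ^ (p - 2) * w * w) + β * p * γ * |u| ^ p + β * p / 8 * |u| ^ (p + 2 * δ))
      + p * (K1 ν α β γ δ p + K3 ν α β δ p * |φ| ^ (p + 2 * δ)) := by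
  have hν := P.hν
  have hp := P.hp3
  have h := mul_le_mul_of_nonneg_left (pointwise_energy P.hν P.hα P.hβ P.hγ0 P.hγ1 P.hδ P.hp u φ) (by linarith : 0 ≤ p)
  set a := |u| ^ (p - 2) with ha
  have ha0 : 0 ≤ a := by positivity
  set c := α / ((δ : ℝ) + 1)
  set d := pp δ (u + φ) - pp δ u with hd
  have hy : c * w * d - (ν / 2 * w ^ 2 + c ^ 2 * d ^ 2 / (2 * ν)) = -((ν * w - c * d) ^ 2 / (2 * ν)) := by
    field_simp; ring
  have hy2 : 0 ≤ (ν * w - c * d) ^ 2 / (2 * ν) := by positivity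
  have hy3 : c * w * d ≤ ν / 2 * w ^ 2 + c ^ 2 * d ^ 2 / (2 * ν) := by linarith
  have hy4 := mul_le_mul_of_nonneg_left hy3 (mul_nonneg (mul_nonneg (by linarith : 0 ≤ p) (by linarith : 0 ≤ p - 1)) ha0)
  have e1 : p * (p - 1) * a * (c * w * d) = p * (p - 1) * a * w * (c * pp δ (u + φ)) - c * (p * (p - 1) * a * pp δ u * w) := by
    rw [hd]; ring
  have e2 : p * (p - 1) * a * (ν / 2 * w ^ 2 + c ^ 2 * d ^ 2 / (2 * ν)) =
      ν * p * (p - 1) / 2 * (a * w * w) + p * ((p - 1) / (2 * ν) * c ^ 2 * (a * d ^ 2)) := by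
    field_simp
  rw [e1, e2] at hy4
  linarith

lemma integral_lin4 {A B C D : ℝ → ℝ} (a d : ℝ) (hA : Integrable A mu) (hB : Integrable B mu) (hC : Integrable C mu)
    (hD : Integrable D mu) : Integrable (fun x => -(a * A x) + B x + C x - d * D x) mu ∧
    ∫ x, (-(a * A x) + B x + C x - d * D x) ∂mu =
      -(a * ∫ x, A x ∂mu) + ∫ x, B x ∂mu + ∫ x, C x ∂mu - d * ∫ x, D x ∂mu := by
  have h1 : Integrable (fun x => -(a * A x)) mu := (hA.const_mul a).neg
  have h2 : Integrable (fun x => -(a * A x) + B x) mu := h1.add hB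
  have h3 : Integrable (fun x => -(a * A x) + B x + C x) mu := h2.add hC
  refine ⟨h3.sub (hD.const_mul d), ?_⟩
  rw [integral_sub h3 (hD.const_mul d), integral_add h2 hC, integral_add h1 hB, integral_neg,
    integral_const_mul, integral_const_mul]

lemma integral_lin5 {A B C D : ℝ → ℝ} (a b c d k l : ℝ) (hA : Integrable A mu) (hB : Integrable B mu)
    (hC : Integrable C mu) (hD : Integrable D mu) :
    Integrable (fun x => -(a * A x + b * B x + c * C x) + d * (k + l * D x)) mu ∧
    ∫ x, (-(a * A x + b * B x + c * C x) + d * (k + l * D x)) ∂mu =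
      -(a * ∫ x, A x ∂mu + b * ∫ x, B x ∂mu + c * ∫ x, C x ∂mu) + d * (k + l * ∫ x, D x ∂mu) := by
  have h1 : Integrable (fun x => a * A x + b * B x) mu := (hA.const_mul a).add (hB.const_mul b)
  have h2 : Integrable (fun x => a * A x + b * B x + c * C x) mu := h1.add (hC.const_mul c)
  have h3 : Integrable (fun x => -(a * A x + b * B x + c * C x)) mu := h2.neg
  have h4 : Integrable (fun x => k + l * D x) mu := (integrable_const k).add (hD.const_mul l)
  refine ⟨h3.add (h4.const_mul d), ?_⟩
  rw [integral_add h3 (h4.const_mul d), integral_neg, integral_add h1 (hC.const_mul c),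
    integral_add (hA.const_mul a) (hB.const_mul b), integral_const_mul, integral_const_mul, integral_const_mul,
    integral_const_mul, integral_add (integrable_const k) (hD.const_mul l), integral_const_mul]
  simp

/-- The dissipation terms of the energy estimate. -/
def dissip (ν β γ : ℝ) (δ : ℕ) (p : ℝ) (u w : ℝ → ℝ) : ℝ :=
  ν * p * (p - 1) / 2 * (∫ x, |u x| ^ (p - 2) * w x * w x ∂mu) + β * p * γ * (∫ x, |u x| ^ p ∂mu)
    + β * p / 8 * ∫ x, |u x| ^ (p + 2 * δ) ∂mu

lemma energyRate_pow_le (P : Params ν α β γ δ p) {V : X} {M : ℝ} (hM : ‖V‖ ≤ M) {w f g : H2} (hw : HasD (toE 2 V) w)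
    {φ : ℝ → ℝ} (hf : f =ᵐ[mu] fun x => β * cc γ δ (V x + φ x))
    (hg : g =ᵐ[mu] fun x => α / (δ + 1) * pp δ (V x + φ x)) (hφ : Integrable (fun x => |φ x| ^ (p + 2 * δ)) mu) :
    energyRate ν (pow1 p M) (pow2 p M) (toE 2 V) w f g ≤
      -dissip ν β γ δ p V w + p * (K1 ν α β γ δ p + K3 ν α β δ p * ∫ x, |φ x| ^ (p + 2 * δ) ∂mu) := by
  have hp := P.hp3
  have hδ := P.hδ'
  have hM0 : 0 ≤ M := (norm_nonneg V).trans hM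
  have hE := energyFun_pow hp hM0
  have hVM : ∀ x, |V x| ≤ M := fun x => (V.abs_apply_le x).trans hM
  have hca : ∀ {r : ℝ}, 0 ≤ r → Continuous fun x : ℝ => |x| ^ r := fun hr =>
    continuous_abs.rpow_const fun _ => Or.inr hr
  have hmul : ∀ (b : X) (A B : H2), Integrable (fun x => b x * A x * B x) mu := fun b A B =>
    (MemLp.integrable_mul (memLp_X_mul b A) (Lp.memLp B) : _)
  have hmul1 : ∀ (b : X) (A : H2), Integrable (fun x => b x * A x) mu := fun b A =>
    (memLp_X_mul b A).integrable (by norm_num)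
  have hcX : ∀ {h : ℝ → ℝ}, Continuous h → Integrable (fun x => h (V x)) mu := fun hh =>
    integrable_mu_of_continuous (hh.comp V.continuous)
  have hu := coeFn_toE 2 V
  -- The flux of v alone does no work against |v|^{p-2}v. This zero integral is inserted so that the
  -- two sides can be compared pointwise.
  have hz := integral_comp_mul_eq_zero (g := fun u => pow2 p M u * pp δ u)
    ((continuous_pow2 hp).mul (polyGrowth_pp δ).cont) hw
  have i1 : Integrable (fun x => pow2 p M (toE 2 V x) * w x * w x) mu := by
    refine (hmul (X.comp _ (continuous_pow2 (M := M) hp) V) w w).congr ?_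
    filter_upwards [hu] with x hx
    rw [X.comp_apply, hx]
  have i2 : Integrable (fun x => pow1 p M (toE 2 V x) * f x) mu := by
    refine (hmul1 (X.comp _ hE.cont1 V) f).congr ?_
    filter_upwards [hu] with x hx
    rw [X.comp_apply, hx]
  have i3 : Integrable (fun x => pow2 p M (toE 2 V x) * w x * g x) mu := by
    refine (hmul (X.comp _ (continuous_pow2 (M := M) hp) V) w g).congr ?_
    filter_upwards [hu] with x hx
    rw [X.comp_apply, hx]
  have i4 : Integrable (fun x => pow2 p M (toE 2 V x) * pp δ (toE 2 V x) * w x) mu := by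
    refine (hmul1 (X.comp (fun u => pow2 p M u * pp δ u) ((continuous_pow2 hp).mul (polyGrowth_pp δ).cont) V) w).congr ?_
    filter_upwards [hu] with x hx
    rw [X.comp_apply, hx]
  have i5 : Integrable (fun x => |V x| ^ (p - 2) * w x * w x) mu :=
    hmul (X.comp _ (hca (by linarith)) V) w w
  have i6 : Integrable (fun x => |V x| ^ p) mu := hcX (hca (by linarith))
  have i7 : Integrable (fun x => |V x| ^ (p + 2 * δ)) mu := hcX (hca (by linarith))
  set c := α / ((δ : ℝ) + 1) with hc
  set d1 := ν * p * (p - 1) / 2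
  set d2 := β * p * γ
  set d3 := β * p / 8
  have eL : energyRate ν (pow1 p M) (pow2 p M) (toE 2 V) w f g =
      ∫ x, (-(ν * (pow2 p M (toE 2 V x) * w x * w x)) + pow1 p M (toE 2 V x) * f x
        + pow2 p M (toE 2 V x) * w x * g x - c * (pow2 p M (toE 2 V x) * pp δ (toE 2 V x) * w x)) ∂mu := by
    rw [(integral_lin4 ν c i1 i2 i3 i4).2, hz, mul_zero, sub_zero]
    rfl
  have eR : -dissip ν β γ δ p V w + p * (K1 ν α β γ δ p + K3 ν α β δ p * ∫ x, |φ x| ^ (p + 2 * δ) ∂mu) =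
      ∫ x, (-(d1 * (|V x| ^ (p - 2) * w x * w x) + d2 * |V x| ^ p + d3 * |V x| ^ (p + 2 * δ))
      + p * (K1 ν α β γ δ p + K3 ν α β δ p * |φ x| ^ (p + 2 * δ))) ∂mu := by
    rw [(integral_lin5 d1 d2 d3 p _ _ i5 i6 i7 hφ).2]
    rfl
  rw [eL, eR]
  refine integral_mono_ae (integral_lin4 ν c i1 i2 i3 i4).1 (integral_lin5 d1 d2 d3 p _ _ i5 i6 i7 hφ).1 ?_
  filter_upwards [hu, hf, hg] with x h1 h2 h3
  rw [h1, h2, h3, pow2_of_le (hVM x), pow1_of_le hp (hVM x)]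
  exact energy_integrand_le P (V x) (φ x) (w x)

end

lemma norm_rpow_eq_integral {p : ℝ} [Fact (1 ≤ ENNReal.ofReal p)] (hp : 0 < p) (u : Lp ℝ (ENNReal.ofReal p) mu) :
    ‖u‖ ^ p = ∫ x, |u x| ^ p ∂mu := by
  have h := (Lp.memLp u).eLpNorm_eq_integral_rpow_norm (by simpa using hp) ENNReal.ofReal_ne_top
  have h0 : 0 ≤ ∫ x, ‖u x‖ ^ p ∂mu := integral_nonneg fun x => by positivity
  rw [ENNReal.toReal_ofReal hp.le] at h
  rw [Lp.norm_def, h, ENNReal.toReal_ofReal (by positivity), Real.rpow_inv_rpow h0 hp.ne']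
  simp only [Real.norm_eq_abs]

lemma K3_nonneg {ν α β γ : ℝ} {δ : ℕ} {p : ℝ} (P : Params ν α β γ δ p) : 0 ≤ K3 ν α β δ p := by
  have h1 := P.hν; have h2 := P.hβ; have h3 := P.hp3; have h4 := P.hδ'
  have e1 : 0 ≤ p + 2 * δ - 1 := by linarith
  have e2 : 0 ≤ p + 2 * δ - 2 := by linarith
  unfold K3
  positivity

lemma integrable_rpow_of_eLpNorm_le {φ : ℝ → ℝ} (hφ : AEStronglyMeasurable φ mu) {m r B : ℝ} (hr : 0 < r) (hrm : r ≤ m)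
    (hB : eLpNorm φ (ENNReal.ofReal m) mu ≤ ENNReal.ofReal B) : Integrable (fun x => |φ x| ^ r) mu := by
  have h : MemLp φ (ENNReal.ofReal r) mu :=
    MemLp.mono_exponent ⟨hφ, hB.trans_lt ENNReal.ofReal_lt_top⟩ (ENNReal.ofReal_le_ofReal hrm)
  have := h.integrable_norm_rpow (by simpa using hr) ENNReal.ofReal_ne_top
  simpa only [ENNReal.toReal_ofReal hr.le, Real.norm_eq_abs] using this

namespace MildE
variable {ν α β γ : ℝ} {δ : ℕ} {p : ℝ} [hp1 : Fact (1 ≤ ENNReal.ofReal p)] {P : Params ν α β γ δ p}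
  {T : ℝ} {φ v : ℝ → Lp ℝ (ENNReal.ofReal p) mu} {u₀ : Lp ℝ (ENNReal.ofReal p) mu}

lemma exp_q_le (P : Params ν α β γ δ p) : p + 2 * δ ≤ p * (δ + 1) := by
  have h3 := P.hp3; have h4 := P.hδ'
  nlinarith

lemma integral_abs_VX_rpow (h : MildE P T φ u₀ v) {t : ℝ} (ht : t ∈ Ioc 0 T) :
    ∫ x, |VX P φ u₀ v t x| ^ p ∂mu = ‖v t‖ ^ p := by
  have hp := P.hp3
  rw [norm_rpow_eq_integral (by linarith)]
  refine integral_congr_ae ?_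
  filter_upwards [h.ae_eq_VX ht] with x hx
  rw [hx]

lemma continuousOn_integral_VX_rpow (h : MildE P T φ u₀ v) {r : ℝ} (hr : 0 ≤ r) :
    ContinuousOn (fun t => ∫ x, |VX P φ u₀ v t x| ^ r ∂mu) (Ioc 0 T) :=
  (continuous_integral_comp (g := fun x => |x| ^ r) (continuous_abs.rpow_const fun _ => Or.inr hr)).comp_continuousOn
    h.continuousOn_VX

/-- Integrate the rate inequality over [a,T], where the representative is bounded and the truncated
power agrees with |u|^p. -/
lemma energy_interval (h : MildE P T φ u₀ v) {B : ℝ} (hB0 : 0 ≤ B)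
    (hB : ∀ t ∈ Icc 0 T, eLpNorm (φ t) (ENNReal.ofReal (p * (δ + 1))) mu ≤ ENNReal.ofReal B) {m : ℝ}
    (hm : ∀ t ∈ Icc 0 T, ∫ x, |φ t x| ^ (p + 2 * δ) ∂mu ≤ m) {a : ℝ} (ha : a ∈ Ioo 0 T) :
    IntegrableOn (fun t => ∫ x, |VX P φ u₀ v t x| ^ (p - 2) * derivH (toE 2 (VX P φ u₀ v t)) x *
      derivH (toE 2 (VX P φ u₀ v t)) x ∂mu) (Ioc a T) ∧
    IntegrableOn (fun t => dissip ν β γ δ p (VX P φ u₀ v t) (derivH (toE 2 (VX P φ u₀ v t)))) (Ioc a T) ∧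
    ‖v T‖ ^ p + ∫ t in Ioc a T, dissip ν β γ δ p (VX P φ u₀ v t) (derivH (toE 2 (VX P φ u₀ v t))) ≤
      ‖v a‖ ^ p + p * (K1 ν α β γ δ p + K3 ν α β δ p * m) * (T - a) := by
  have hp := P.hp3
  have hδ := P.hδ'
  have hK3 := K3_nonneg P
  obtain ⟨R, M, hR, hL⟩ := h.linData hB0 hB ha
  have hR0 : 0 ≤ R := (norm_nonneg _).trans (hR a ⟨le_rfl, ha.2.le⟩)
  have hsub : Icc a T ⊆ Ioc 0 T := fun t ht => ⟨ha.1.trans_le ht.1, ht.2⟩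
  have hE := energyFun_pow hp hR0
  obtain ⟨hi, hid⟩ := hL.energy_identity hE
  have hVR : ∀ t ∈ Icc a T, ∀ x, |VX P φ u₀ v t x| ≤ R := fun t ht x => (X.abs_apply_le _ x).trans (hR t ht)
  have hpow : ∀ t ∈ Icc a T, ∫ x, pow0 p R (toE 2 (VX P φ u₀ v t) x) ∂mu = ‖v t‖ ^ p := fun t ht => by
    rw [← h.integral_abs_VX_rpow (hsub ht)]
    refine integral_congr_ae ?_
    filter_upwards [coeFn_toE 2 (VX P φ u₀ v t)] with x hx
    rw [hx, pow0_of_le hp (hVR t ht x)]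
  have iD : IntegrableOn (fun t => ∫ x, |VX P φ u₀ v t x| ^ (p - 2) * derivH (toE 2 (VX P φ u₀ v t)) x *
      derivH (toE 2 (VX P φ u₀ v t)) x ∂mu) (Ioc a T) := by
    refine IntegrableOn.congr_fun ((hL.integrableOn_quad hE).const_mul (p * (p - 1))⁻¹) (fun t ht => ?_) measurableSet_Ioc
    have h0 : p ≠ 0 := by linarith
    have h1 : p - 1 ≠ 0 := by linarith
    rw [← integral_const_mul]
    refine integral_congr_ae ?_
    filter_upwards [coeFn_toE 2 (VX P φ u₀ v t)] with x hx
    rw [hx, pow2_of_le (hVR t (Ioc_subset_Icc_self ht) x)]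
    field_simp
  have iA : ∀ {r : ℝ}, 0 ≤ r → IntegrableOn (fun t => ∫ x, |VX P φ u₀ v t x| ^ r ∂mu) (Ioc a T) := fun hr =>
    ((h.continuousOn_integral_VX_rpow hr).mono hsub).integrableOn_Icc.mono_set Ioc_subset_Icc_self
  have iS : IntegrableOn (fun t => dissip ν β γ δ p (VX P φ u₀ v t) (derivH (toE 2 (VX P φ u₀ v t)))) (Ioc a T) :=
    ((iD.const_mul _).add ((iA (by linarith)).const_mul _)).add ((iA (by linarith)).const_mul _)
  refine ⟨iD, iS, ?_⟩
  rw [hpow T ⟨ha.2.le, le_rfl⟩, hpow a ⟨le_rfl, ha.2.le⟩, intervalIntegral.integral_of_le ha.2.le] at hid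
  set c := p * (K1 ν α β γ δ p + K3 ν α β δ p * m) with hc
  have iS' : IntegrableOn (fun t => -dissip ν β γ δ p (VX P φ u₀ v t) (derivH (toE 2 (VX P φ u₀ v t)))) (Ioc a T) := iS.neg
  have ic : IntegrableOn (fun _ : ℝ => c) (Ioc a T) := integrableOn_const (by simp)
  have hle : ∫ t in Ioc a T, energyRate ν (pow1 p R) (pow2 p R) (toE 2 (VX P φ u₀ v t))
      (derivH (toE 2 (VX P φ u₀ v t))) (fH β γ δ v φ t) (gH α δ v φ t) ≤
      ∫ t in Ioc a T, (-dissip ν β γ δ p (VX P φ u₀ v t) (derivH (toE 2 (VX P φ u₀ v t))) + c) := by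
    refine integral_mono_ae ((intervalIntegrable_iff_integrableOn_Ioc_of_le ha.2.le).1 hi) (iS'.add ic) ?_
    filter_upwards [hL.ae_hasD, ae_restrict_mem measurableSet_Ioc] with t hw ht
    have htI := Ioc_subset_Icc_self ht
    have ht0 := hsub htI
    have ht1 : t ∈ Icc 0 T := ⟨ht0.1.le, ht0.2⟩
    have hsum : (v t + φ t : Lp ℝ (ENNReal.ofReal p) mu) =ᵐ[mu] fun x => VX P φ u₀ v t x + φ t x := by
      filter_upwards [Lp.coeFn_add (v t) (φ t), h.ae_eq_VX ht0] with x h1 h2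
      rw [h1, Pi.add_apply, h2]
    refine (energyRate_pow_le P (hR t htI) hw (φ := φ t) ?_ ?_ ?_).trans ?_
    · filter_upwards [h.coeFn_fH hB0 ht0 (hB t ht1), hsum] with x h1 h2
      rw [h1, h2]
    · filter_upwards [h.coeFn_gH hB0 ht0 (hB t ht1), hsum] with x h1 h2
      rw [h1, h2]
    · exact integrable_rpow_of_eLpNorm_le (Lp.memLp _).1 (by linarith) (exp_q_le P) (hB t ht1)
    · have : p * (K1 ν α β γ δ p + K3 ν α β δ p * ∫ x, |φ t x| ^ (p + 2 * δ) ∂mu) ≤ c := by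
        rw [hc]
        have := hm t ht1
        gcongr
      linarith
  rw [integral_add iS' ic, integral_neg, setIntegral_const] at hle
  simp only [Measure.real, Real.volume_Ioc, ENNReal.toReal_ofReal (sub_nonneg.2 ha.2.le), smul_eq_mul] at hle
  linarith

lemma dissip_nonneg (P : Params ν α β γ δ p) (u w : ℝ → ℝ) : 0 ≤ dissip ν β γ δ p u w := by
  have h1 := P.hν; have h2 := P.hβ; have h3 := P.hp3; have h4 := P.hγ0
  have h5 : 0 ≤ p - 1 := by linarith
  have i1 : 0 ≤ ∫ x, |u x| ^ (p - 2) * w x * w x ∂mu := integral_nonneg fun x => by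
    simp only [Pi.zero_apply]
    rw [mul_assoc]
    exact mul_nonneg (by positivity) (mul_self_nonneg _)
  have i2 : 0 ≤ ∫ x, |u x| ^ p ∂mu := integral_nonneg fun x => by positivity
  have i3 : 0 ≤ ∫ x, |u x| ^ (p + 2 * δ) ∂mu := integral_nonneg fun x => by positivity
  have : 0 ≤ p := by linarith
  unfold dissip
  positivity

/-- The initial time a tends to 0; no regularity of u₀ beyond L^p is needed, because v is continuous
into L^p. -/
theorem energy (h : MildE P T φ u₀ v) (hT : 0 < T) {B : ℝ} (hB0 : 0 ≤ B)
    (hB : ∀ t ∈ Icc 0 T, eLpNorm (φ t) (ENNReal.ofReal (p * (δ + 1))) mu ≤ ENNReal.ofReal B) {m : ℝ}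
    (hm : ∀ t ∈ Icc 0 T, ∫ x, |φ t x| ^ (p + 2 * δ) ∂mu ≤ m) :
    ENNReal.ofReal (‖v T‖ ^ p) + ∫⁻ t in Ioc 0 T,
        ENNReal.ofReal (dissip ν β γ δ p (VX P φ u₀ v t) (derivH (toE 2 (VX P φ u₀ v t)))) ≤
      ENNReal.ofReal (‖u₀‖ ^ p + p * (K1 ν α β γ δ p + K3 ν α β δ p * m) * T) := by
  have hp := P.hp3
  set c := p * (K1 ν α β γ δ p + K3 ν α β δ p * m) with hc
  have hv0 : Tendsto (fun a => ‖v a‖ ^ p + c * (T - a)) (𝓝[>] 0) (𝓝 (‖u₀‖ ^ p + c * T)) := by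
    have h1 : Tendsto v (𝓝[>] 0) (𝓝 u₀) := by
      have := (h.cont 0 ⟨le_rfl, hT.le⟩).mono_left (nhdsWithin_mono _ Ioc_subset_Icc_self)
      rwa [h.eq_zero, nhdsWithin_Ioc_eq_nhdsGT hT] at this
    have h2 : Tendsto (fun a : ℝ => c * (T - a)) (𝓝[>] 0) (𝓝 (c * (T - 0))) :=
      ((by fun_prop : Continuous fun a : ℝ => c * (T - a)).tendsto 0).mono_left nhdsWithin_le_nhds
    rw [sub_zero] at h2
    exact ((h1.norm.rpow_const (Or.inr (by linarith))).add h2)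
  have key : ∀ b ∈ Ioo 0 T, ∫ t in Ioc b T, dissip ν β γ δ p (VX P φ u₀ v t) (derivH (toE 2 (VX P φ u₀ v t))) ≤
      ‖u₀‖ ^ p + c * T - ‖v T‖ ^ p := fun b hb => by
    rw [le_sub_iff_add_le']
    -- With b fixed, the dissipation over (b,T] is at most that over (a,T] for a < b, while ‖v a‖
    -- tends to ‖u₀‖.
    refine ge_of_tendsto hv0 ?_
    filter_upwards [Ioo_mem_nhdsGT hb.1] with a ha
    have haT : a ∈ Ioo 0 T := ⟨ha.1, ha.2.trans hb.2⟩
    obtain ⟨-, i, hle⟩ := h.energy_interval hB0 hB hm haT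
    refine le_trans ?_ hle
    gcongr
    · exact ae_of_all _ fun t => dissip_nonneg P _ _
    · exact ha.2.le
  have hX : 0 ≤ ‖u₀‖ ^ p + c * T - ‖v T‖ ^ p :=
    (integral_nonneg fun t => dissip_nonneg P _ _).trans (key (T / 2) ⟨by linarith, by linarith⟩)
  have hlin : ∫⁻ t in Ioc 0 T, ENNReal.ofReal (dissip ν β γ δ p (VX P φ u₀ v t) (derivH (toE 2 (VX P φ u₀ v t)))) ≤
      ENNReal.ofReal (‖u₀‖ ^ p + c * T - ‖v T‖ ^ p) := by
    refine lintegral_Ioc_le_of_forall fun b hb => ?_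
    obtain ⟨-, i, -⟩ := h.energy_interval hB0 hB hm hb
    rw [← ofReal_integral_eq_lintegral_ofReal i (ae_of_all _ fun t => dissip_nonneg P _ _)]
    exact ENNReal.ofReal_le_ofReal (key b hb)
  refine (add_le_add le_rfl hlin).trans ?_
  rw [← ENNReal.ofReal_add (by positivity) hX]
  exact ENNReal.ofReal_le_ofReal (by linarith)

end MildE

/-! ### Global existence and uniqueness of mild solutions. -/

lemma duh_congr {Y W : Type*} [NormedAddCommGroup Y] [NormedSpace ℝ Y] [NormedAddCommGroup W] [NormedSpace ℝ W]
    (K : ℝ → Y →L[ℝ] W) {F F' : ℝ → Y} {t : ℝ} (ht : 0 ≤ t) (h : ∀ s ∈ Ico 0 t, F s = F' s) :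
    duh K F t = duh K F' t := by
  refine intervalIntegral.integral_congr_ae ?_
  have : ∀ᵐ s : ℝ, s ≠ t := by simp [ae_iff]
  filter_upwards [this] with s hs hst
  rw [uIoc_of_le ht] at hst
  rw [h s ⟨hst.1.le, lt_of_le_of_ne hst.2 hs⟩]

section
variable {ν α β γ : ℝ} {δ : ℕ} {p : ℝ} [hp1 : Fact (1 ≤ ENNReal.ofReal p)] (P : Params ν α β γ δ p)
  {T : ℝ} {φ v : ℝ → Lp ℝ (ENNReal.ofReal p) mu} {u₀ : Lp ℝ (ENNReal.ofReal p) mu}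

/-- The nonlinearity truncated at norm `R`. -/
def NLt (φ : ℝ → Lp ℝ (ENNReal.ofReal p) mu) (R s : ℝ) (w : Lp ℝ (ENNReal.ofReal p) mu) : YY :=
  NL P (radial R w + φ s)

lemma exists_lipschitz_NLt (hφ : ContinuousOn φ (Icc 0 T)) {R : ℝ} (hR : 0 ≤ R) :
    ∃ L, 0 ≤ L ∧ ∀ s ∈ Icc 0 T, ∀ u v, ‖NLt P φ R s u - NLt P φ R s v‖ ≤ L * ‖u - v‖ := by
  obtain ⟨M, hM⟩ := isCompact_Icc.exists_bound_of_continuousOn hφ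
  obtain ⟨L, hL, h⟩ := exists_lipschitz_NL P (R + M)
  refine ⟨L * 2, by positivity, fun s hs u v => ?_⟩
  have hb : ∀ u, ‖radial R u + φ s‖ ≤ R + M := fun u =>
    (norm_add_le _ _).trans (add_le_add (norm_radial_le hR u) (hM s hs))
  refine (h _ _ (hb u) (hb v)).trans ?_
  rw [add_sub_add_right_eq_sub, mul_assoc]
  exact mul_le_mul_of_nonneg_left (norm_radial_sub_le hR u v) hL

lemma continuousOn_NLt (hφ : ContinuousOn φ (Icc 0 T)) {R : ℝ} (hR : 0 ≤ R) (w : ℝ → Lp ℝ (ENNReal.ofReal p) mu)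
    (hw : ContinuousOn w (Icc 0 T)) : ContinuousOn (fun s => NLt P φ R s (w s)) (Icc 0 T) :=
  (continuous_NL P).comp_continuousOn (((continuous_radial hR).comp_continuousOn hw).add hφ)

variable {P}

lemma MildE.eq_duh (h : MildE P T φ u₀ v) {R : ℝ} (hR : ∀ s ∈ Icc 0 T, ‖v s‖ ≤ R) {t : ℝ} (ht : t ∈ Icc 0 T) :
    v t = SE _ (ν * t) u₀ + duh (fun r => (toE _).comp (kerX ν α β δ r)) (fun s => NLt P φ R s (v s)) t := by
  obtain ⟨hm, M, -, hM⟩ := continuousOn_bdd_aux h.contNL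
  rw [h.eq t ht, toE_duh _ P.hν h.hT hm hM ht]
  congr 1
  refine duh_congr _ ht.1 fun s hs => ?_
  rw [NLt, radial_of_le (hR s ⟨hs.1, hs.2.le.trans ht.2⟩)]

lemma continuousOn_SE_mul (hν : 0 < ν) (u₀ : Lp ℝ (ENNReal.ofReal p) mu) :
    ContinuousOn (fun t => SE (ENNReal.ofReal p) (ν * t) u₀) (Icc 0 T) :=
  (continuousOn_SE ENNReal.ofReal_ne_top u₀ hν).mono fun _ ht => ht.1

/-- Both solutions are bounded on [0,T]. With the retraction radius above both bounds they solve the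
same globally Lipschitz Volterra equation. -/
theorem MildE.unique (h : MildE P T φ u₀ v) {v' : ℝ → Lp ℝ (ENNReal.ofReal p) mu} (h' : MildE P T φ u₀ v') :
    ∀ t ∈ Icc 0 T, v t = v' t := by
  obtain ⟨R1, hR1⟩ := isCompact_Icc.exists_bound_of_continuousOn h.cont
  obtain ⟨R2, hR2⟩ := isCompact_Icc.exists_bound_of_continuousOn h'.cont
  have hR : 0 ≤ max R1 R2 := ((norm_nonneg _).trans (hR1 0 ⟨le_rfl, h.hT⟩)).trans (le_max_left _ _)
  obtain ⟨C, hC, hK⟩ := exists_weakSing_kerX P.hν α β δ h.hT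
  obtain ⟨L, hL, hLip⟩ := exists_lipschitz_NLt P h.contφ hR
  exact volterra_unique (hK.toE_comp _) h.hT (by norm_num) (by norm_num) hC hL hLip (continuousOn_NLt P h.contφ hR)
    (continuousOn_SE_mul P.hν u₀) h.cont h'.cont
    (fun t ht => h.eq_duh (fun s hs => (hR1 s hs).trans (le_max_left _ _)) ht)
    (fun t ht => h'.eq_duh (fun s hs => (hR2 s hs).trans (le_max_right _ _)) ht)

variable (P)

/-- Solve the equation truncated at a radius above the a priori bound. Up to the first time at which
the norm reaches R the solution is genuinely mild, so the energy estimate applies and forbids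
reaching R. -/
theorem exists_mildE (hT : 0 ≤ T) (hφ : ContinuousOn φ (Icc 0 T)) {B : ℝ} (hB0 : 0 ≤ B)
    (hB : ∀ t ∈ Icc 0 T, eLpNorm (φ t) (ENNReal.ofReal (p * (δ + 1))) mu ≤ ENNReal.ofReal B) {m : ℝ}
    (hm : ∀ t ∈ Icc 0 T, ∫ x, |φ t x| ^ (p + 2 * δ) ∂mu ≤ m) (u₀ : Lp ℝ (ENNReal.ofReal p) mu) :
    ∃ v, MildE P T φ u₀ v := by
  have hp := P.hp3
  set c := p * (K1 ν α β γ δ p + K3 ν α β δ p * m) with hc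
  set Z := ‖u₀‖ ^ p + |c| * T with hZ
  have hZ0 : 0 ≤ Z := by positivity
  -- `Z` bounds the p-th power of the norm of any mild solution on a subinterval; the added 1 makes
  -- the comparison with R strict.
  set R := Z ^ p⁻¹ + 1 with hRdef
  have hR : 0 ≤ R := by positivity
  have bound : ∀ u : Lp ℝ (ENNReal.ofReal p) mu, ‖u‖ ^ p ≤ Z → ‖u‖ < R := fun u hu => by
    have := Real.rpow_le_rpow (by positivity) hu (by positivity : 0 ≤ p⁻¹)
    rw [Real.rpow_rpow_inv (norm_nonneg _) (by linarith)] at this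
    linarith
  obtain ⟨C, hC, hK⟩ := exists_weakSing_kerX P.hν α β δ hT
  obtain ⟨L, hL, hLip⟩ := exists_lipschitz_NLt P hφ hR
  obtain ⟨w, hw, hweq⟩ := volterra_exists (hK.toE_comp (ENNReal.ofReal p)) hT (by norm_num) (by norm_num) hC hL hLip
    (continuousOn_NLt P hφ hR) (continuousOn_SE_mul P.hν u₀)
  have mild : ∀ T' ∈ Icc 0 T, (∀ s ∈ Ico 0 T', ‖w s‖ ≤ R) → MildE P T' φ u₀ w := fun T' hT' hs => by
    have hsub : Icc 0 T' ⊆ Icc 0 T := Icc_subset_Icc_right hT'.2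
    have hcN : ContinuousOn (fun s => NL P (w s + φ s)) (Icc 0 T') := (continuous_NL P).comp_continuousOn ((hw.mono hsub).add (hφ.mono hsub))
    refine ⟨hT'.1, hφ.mono hsub, hw.mono hsub, fun t ht => ?_⟩
    obtain ⟨hm, M, -, hM⟩ := continuousOn_bdd_aux hcN
    rw [hweq t (hsub ht)]
    refine congrArg _ (Eq.trans ?_ (toE_duh _ P.hν hT'.1 hm hM ht).symm)
    refine duh_congr _ ht.1 fun s hst => ?_
    rw [NLt, radial_of_le (hs s ⟨hst.1, hst.2.trans_le ht.2⟩)]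
  have hlt : ∀ t ∈ Icc 0 T, ‖w t‖ < R := by
    by_contra! hcon
    set A : Set ℝ := Icc 0 T ∩ (fun t => ‖w t‖) ⁻¹' Ici R with hA
    have hAc : IsCompact A := by
      refine isCompact_Icc.of_isClosed_subset ?_ inter_subset_left
      exact hw.norm.preimage_isClosed_of_isClosed isClosed_Icc isClosed_Ici
    have hAn : A.Nonempty := hcon
    have hmem := hAc.sInf_mem hAn
    -- Control strictly before the exit time suffices, since the Duhamel integral ignores its
    -- endpoint. The solution is therefore mild up to and including the exit time.
    have hbelow : ∀ s ∈ Ico 0 (sInf A), ‖w s‖ ≤ R := fun s hs => by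
      by_contra! hsR
      exact absurd (csInf_le hAc.bddBelow ⟨⟨hs.1, hs.2.le.trans hmem.1.2⟩, hsR.le⟩) (not_le.2 hs.2)
    have hMild := mild _ hmem.1 hbelow
    have hle : ‖w (sInf A)‖ ^ p ≤ Z := by
      rcases hmem.1.1.eq_or_lt with h0 | h0
      · rw [← h0, hMild.eq_zero]
        have : 0 ≤ |c| * T := by positivity
        linarith
      · have hen := le_trans le_self_add (hMild.energy h0 hB0 (fun t ht => hB t ⟨ht.1, ht.2.trans hmem.1.2⟩)
          (fun t ht => hm t ⟨ht.1, ht.2.trans hmem.1.2⟩))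
        have h1 : c * sInf A ≤ |c| * T :=
          mul_le_mul (le_abs_self c) hmem.1.2 h0.le (abs_nonneg c)
        exact (ENNReal.ofReal_le_ofReal_iff hZ0).1 (hen.trans (ENNReal.ofReal_le_ofReal (by linarith)))
    exact absurd (bound _ hle) (not_lt.2 hmem.2)
  exact ⟨w, mild T ⟨hT, le_rfl⟩ fun s hs => (hlt s ⟨hs.1, hs.2.le⟩).le⟩

end

/-! ### From classes in L^q back to functions. -/

/-- A function as an element of `L^q(0,1)`. -/
def liftL (q : ℝ≥0∞) (f : ℝ → ℝ) : Lp ℝ q mu := open Classical in if h : MemLp f q mu then h.toLp f else 0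

lemma coeFn_liftL {q : ℝ≥0∞} {f : ℝ → ℝ} (h : MemLp f q mu) : liftL q f =ᵐ[mu] f := by
  rw [liftL, dif_pos h]; exact h.coeFn_toLp

lemma liftL_eq {q : ℝ≥0∞} {f : ℝ → ℝ} {u : Lp ℝ q mu} (h : f =ᵐ[mu] u) : liftL q f = u :=
  Lp.ext ((coeFn_liftL ((memLp_congr_ae h).2 (Lp.memLp u))).trans h)

lemma contL_iff {q T : ℝ} [Fact (1 ≤ ENNReal.ofReal q)] {v : ℝ → ℝ → ℝ} {V : ℝ → Lp ℝ (ENNReal.ofReal q) mu}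
    (hv : ∀ t ∈ Icc 0 T, v t =ᵐ[mu] V t) : ContL T q v ↔ ContinuousOn V (Icc 0 T) := by
  have key : ∀ t ∈ Icc 0 T, (Tendsto (fun s => normL q (fun x => v s x - v t x)) (𝓝[Icc 0 T] t) (𝓝 0) ↔
      ContinuousWithinAt V (Icc 0 T) t) := fun t ht => by
    rw [ContinuousWithinAt, Lp.tendsto_Lp_iff_tendsto_eLpNorm']
    refine tendsto_congr' ?_
    filter_upwards [self_mem_nhdsWithin] with s hs
    exact eLpNorm_congr_ae ((hv s hs).sub (hv t ht))
  exact ⟨fun h t ht => (key t ht).1 (h.2 t ht), fun h =>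
    ⟨fun t ht => (memLp_congr_ae (hv t ht)).2 (Lp.memLp _), fun t ht => (key t ht).2 (h t ht)⟩⟩

lemma ContL.ae_eq {q T : ℝ} {v : ℝ → ℝ → ℝ} (h : ContL T q v) :
    ∀ t ∈ Icc 0 T, v t =ᵐ[mu] liftL (ENNReal.ofReal q) (v t) := fun t ht => (coeFn_liftL (h.1 t ht)).symm

lemma ContL.continuousOn {q T : ℝ} [Fact (1 ≤ ENNReal.ofReal q)] {v : ℝ → ℝ → ℝ} (h : ContL T q v) :
    ContinuousOn (fun t => liftL (ENNReal.ofReal q) (v t)) (Icc 0 T) := (contL_iff h.ae_eq).1 h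

/-- Point evaluation is continuous on bounded continuous functions and so commutes with the Bochner
integral. The formula and the absolute convergence then hold at every x. -/
lemma eval_duh {ν α β T : ℝ} {δ : ℕ} (hν : 0 < ν) (hT : 0 ≤ T) {F : ℝ → YY} (hF : ContinuousOn F (Icc 0 T))
    {f g : ℝ → ℝ → ℝ} (hf : ∀ s ∈ Icc 0 T, (F s).1 =ᵐ[mu] f s) (hg : ∀ s ∈ Icc 0 T, (F s).2 =ᵐ[mu] g s)
    {t : ℝ} (ht : t ∈ Ioc 0 T) (x : ℝ) :
    IntervalIntegrable (fun s => ∫ y, G (ν * (t - s)) x y * f s y ∂mu) volume 0 t ∧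
    IntervalIntegrable (fun s => ∫ y, dG (ν * (t - s)) x y * g s y ∂mu) volume 0 t ∧
    duh (kerX ν α β δ) F t x = β * (∫ s in (0 : ℝ)..t, ∫ y, G (ν * (t - s)) x y * f s y ∂mu)
      + α / (δ + 1) * ∫ s in (0 : ℝ)..t, ∫ y, dG (ν * (t - s)) x y * g s y ∂mu := by
  obtain ⟨hm, M, -, hM⟩ := continuousOn_bdd_aux hF
  obtain ⟨C, hC, hK⟩ := exists_weakSing_kerX hν α β δ hT
  have ht' : t ∈ Icc 0 T := ⟨ht.1.le, ht.2⟩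
  have hi1 := intervalIntegrable_kernel (weakSing_S1 (T := T) hν) (by norm_num) hm hM ht'
  have hi2 := intervalIntegrable_kernel (weakSing_D1 (T := T) hν) (by norm_num) hm hM ht'
  have hi := intervalIntegrable_kernel hK (by norm_num) hm hM ht'
  have hne : ∀ᵐ s : ℝ, s ∈ uIoc 0 t → s ∈ Ioo 0 t := by
    have : ∀ᵐ s : ℝ, s ≠ t := by simp [ae_iff]
    filter_upwards [this] with s hs hst
    rw [uIoc_of_le ht.1.le] at hst
    exact ⟨hst.1, lt_of_le_of_ne hst.2 hs⟩
  have e1 : ∀ᵐ s : ℝ, s ∈ uIoc 0 t → X.eval x (S1 (ENNReal.ofReal 1) (ν * (t - s)) (F s).1) =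
      ∫ y, G (ν * (t - s)) x y * f s y ∂mu := by
    filter_upwards [hne] with s hs hst
    have hs' := hs hst
    refine (S1_apply (mul_pos hν (sub_pos.2 hs'.2)) _ x).trans (integral_congr_ae ?_)
    filter_upwards [hf s ⟨hs'.1.le, hs'.2.le.trans ht.2⟩] with y hy
    rw [hy]
  have e2 : ∀ᵐ s : ℝ, s ∈ uIoc 0 t → X.eval x (D1 (ENNReal.ofReal (3 / 2)) (ν * (t - s)) (F s).2) =
      ∫ y, dG (ν * (t - s)) x y * g s y ∂mu := by
    filter_upwards [hne] with s hs hst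
    have hs' := hs hst
    refine (D1_apply (mul_pos hν (sub_pos.2 hs'.2)) _ x).trans (integral_congr_ae ?_)
    filter_upwards [hg s ⟨hs'.1.le, hs'.2.le.trans ht.2⟩] with y hy
    rw [hy]
  have j1 : IntervalIntegrable (fun s => X.eval x (S1 (ENNReal.ofReal 1) (ν * (t - s)) (F s).1)) volume 0 t :=
    ⟨(X.eval x).integrable_comp hi1.1, (X.eval x).integrable_comp hi1.2⟩
  have j2 : IntervalIntegrable (fun s => X.eval x (D1 (ENNReal.ofReal (3 / 2)) (ν * (t - s)) (F s).2)) volume 0 t :=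
    ⟨(X.eval x).integrable_comp hi2.1, (X.eval x).integrable_comp hi2.2⟩
  refine ⟨j1.congr_ae ((ae_restrict_iff' measurableSet_uIoc).2 e1),
    j2.congr_ae ((ae_restrict_iff' measurableSet_uIoc).2 e2), ?_⟩
  have e3 : duh (kerX ν α β δ) F t x = X.eval x (duh (kerX ν α β δ) F t) := rfl
  rw [e3, duh, ← ContinuousLinearMap.intervalIntegral_comp_comm _ hi, ← intervalIntegral.integral_congr_ae e1,
    ← intervalIntegral.integral_congr_ae e2, ← intervalIntegral.integral_const_mul, ← intervalIntegral.integral_const_mul,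
    ← intervalIntegral.integral_add (j1.const_mul _) (j2.const_mul _)]
  congr 1

section
variable {ν α β γ : ℝ} {δ : ℕ} {p : ℝ} [hp1 : Fact (1 ≤ ENNReal.ofReal p)] {P : Params ν α β γ δ p}
  {T : ℝ} {φ v : ℝ → ℝ → ℝ} {u₀ : ℝ → ℝ} {φE V : ℝ → Lp ℝ (ENNReal.ofReal p) mu} {uE : Lp ℝ (ENNReal.ofReal p) mu}

lemma NL_ae (P : Params ν α β γ δ p) {f g : ℝ → ℝ} {u w : Lp ℝ (ENNReal.ofReal p) mu} (hf : f =ᵐ[mu] u) (hg : g =ᵐ[mu] w) :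
    (NL P (u + w)).1 =ᵐ[mu] (fun y => cc γ δ (f y + g y)) ∧ (NL P (u + w)).2 =ᵐ[mu] (fun y => pp δ (f y + g y)) := by
  constructor
  · filter_upwards [coeFn_NL_fst P (u + w), Lp.coeFn_add u w, hf, hg] with y h1 h2 h3 h4
    rw [h1, h2, Pi.add_apply, h3, h4]
  · filter_upwards [coeFn_NL_snd P (u + w), Lp.coeFn_add u w, hf, hg] with y h1 h2 h3 h4
    rw [h1, h2, Pi.add_apply, h3, h4]

theorem isMildSolution_iff (P : Params ν α β γ δ p) (hT : 0 ≤ T) (hφ : ∀ t ∈ Icc 0 T, φ t =ᵐ[mu] φE t)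
    (hφc : ContinuousOn φE (Icc 0 T)) (hu : u₀ =ᵐ[mu] uE) (hv : ∀ t ∈ Icc 0 T, v t =ᵐ[mu] V t) :
    IsMildSolution ν α β γ δ p T φ u₀ v ↔ MildE P T φE uE V := by
  have hNL : ContinuousOn V (Icc 0 T) → ContinuousOn (fun s => NL P (V s + φE s)) (Icc 0 T) := fun hV =>
    (continuous_NL P).comp_continuousOn (hV.add hφc)
  have hev := fun (hV : ContinuousOn V (Icc 0 T)) {t : ℝ} (ht : t ∈ Ioc 0 T) (x : ℝ) =>
    eval_duh (α := α) (β := β) (δ := δ) P.hν hT (hNL hV) (fun s hs => (NL_ae P (hv s hs) (hφ s hs)).1)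
      (fun s hs => (NL_ae P (hv s hs) (hφ s hs)).2) ht x
  have hS : ∀ {t : ℝ}, t ∈ Ioc 0 T → ∀ x, S1 (ENNReal.ofReal p) (ν * t) uE x = ∫ y, G (ν * t) x y * u₀ y ∂mu := fun ht x => by
    rw [S1_apply (mul_pos P.hν ht.1)]
    refine integral_congr_ae ?_
    filter_upwards [hu] with y hy
    rw [hy]
  constructor
  · rintro ⟨h1, h2, h3⟩
    have hV := (contL_iff hv).1 h1
    refine ⟨hT, hφc, hV, fun t ht => ?_⟩
    rcases ht.1.eq_or_lt with rfl | h0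
    · have : V 0 = uE := Lp.ext ((hv 0 ht).symm.trans (h2.trans hu))
      simp [duh, this]
    · have ht' : t ∈ Ioc 0 T := ⟨h0, ht.2⟩
      rw [SE_of_pos (mul_pos P.hν h0), ← map_add]
      refine Lp.ext ((hv t ht).symm.trans (EventuallyEq.trans ?_ (coeFn_toE _ _).symm))
      filter_upwards [h3 t ht'] with x hx
      rw [hx.2.2, X.add_apply, hS ht', (hev hV ht' x).2.2, add_assoc]
  · intro h
    refine ⟨(contL_iff hv).2 h.cont, ?_, fun t ht => ?_⟩
    · refine (hv 0 ⟨le_rfl, hT⟩).trans ?_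
      rw [h.eq_zero]; exact hu.symm
    · filter_upwards [hv t ⟨ht.1.le, ht.2⟩, h.ae_eq_VX ht] with x h1 h2
      refine ⟨(hev h.cont ht x).1, (hev h.cont ht x).2.1, ?_⟩
      rw [h1, h2, VX, X.add_apply, hS ht, (hev h.cont ht x).2.2, add_assoc]

end

/-! ### Mild solutions are weak solutions. -/

lemma hasSum_inner_sc (f g : H2) : HasSum (fun k => sc k f * sc k g) (inner ℝ f g) := by
  have e : (fun k => sc k f * sc k g) = fun k => inner ℝ f (sB k) * inner ℝ (sB k) g := by
    funext k; rw [real_inner_comm, inner_sB, inner_sB]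
  rw [e]
  exact sB.hasSum_inner_mul_inner f g

lemma hasSum_inner_kc (f g : H2) : HasSum (fun k => kc k f * kc k g) (inner ℝ f g) := by
  have e : (fun k => kc k f * kc k g) = fun k => inner ℝ f (cB k) * inner ℝ (cB k) g := by
    funext k; rw [real_inner_comm, inner_cB, inner_cB]
  rw [e]
  exact cB.hasSum_inner_mul_inner f g

lemma HasD.hasSum_inner {u w : H2} (h : HasD u w) (g : H2) :
    HasSum (fun k => kc (k + 1) g * (ev k * sc k u)) (inner ℝ g w) := by
  have := hasSum_inner_kc g w
  simp only [h _] at this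
  rw [← hasSum_nat_add_iff' 1] at this
  simpa [dcoef] using this

lemma abs_sum_mul_le {a b : ℕ → ℝ} {A B : ℝ} {s : Finset ℕ} (ha : ∑ k ∈ s, a k ^ 2 ≤ A) (hb : ∑ k ∈ s, b k ^ 2 ≤ B) :
    |∑ k ∈ s, a k * b k| ≤ (A + B) / 2 := by
  refine (Finset.abs_sum_le_sum_abs _ _).trans ?_
  have : ∑ k ∈ s, |a k * b k| ≤ ∑ k ∈ s, (a k ^ 2 + b k ^ 2) / 2 := Finset.sum_le_sum fun k _ => by
    rw [abs_mul, ← sq_abs (a k), ← sq_abs (b k)]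
    nlinarith [sq_nonneg (|a k| - |b k|)]
  rw [← Finset.sum_div, Finset.sum_add_distrib] at this
  linarith

lemma integral_duhamel {c q0 T : ℝ} {q r : ℝ → ℝ} (hr : ContinuousOn r (Icc 0 T))
    (hq : ∀ t ∈ Icc 0 T, q t = Real.exp (-(c * t)) * q0 + ∫ s in (0 : ℝ)..t, Real.exp (-(c * (t - s))) * r s)
    {t : ℝ} (ht : t ∈ Icc 0 T) : ContinuousOn q (Icc 0 T) ∧ ∫ s in (0 : ℝ)..t, (-(c * q s) + r s) = q t - q0 := by
  have hT : 0 ≤ T := ht.1.trans ht.2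
  have hqc : ContinuousOn q (Icc 0 T) := (continuousOn_duhamel hr hT).congr hq
  have hsub : Icc 0 t ⊆ Icc 0 T := Icc_subset_Icc_right ht.2
  have h0 : q 0 = q0 := by rw [hq 0 ⟨le_rfl, hT⟩]; simp
  refine ⟨hqc, ?_⟩
  rw [intervalIntegral.integral_eq_sub_of_hasDerivAt_of_le ht.1 (hqc.mono hsub) (f' := fun s => -(c * q s) + r s), h0]
  · intro s hs
    have hs' : s ∈ Ioo 0 T := ⟨hs.1, hs.2.trans_le ht.2⟩
    have e : q =ᶠ[𝓝 s] fun t => Real.exp (-(c * t)) * q0 + ∫ s in (0 : ℝ)..t, Real.exp (-(c * (t - s))) * r s := by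
      filter_upwards [Ioo_mem_nhds hs'.1 hs'.2] with x hx
      exact hq x ⟨hx.1.le, hx.2.le⟩
    have := (hasDerivAt_duhamel (c := c) (q0 := q0) hr hs').congr_of_eventuallyEq e
    rwa [← hq s ⟨hs'.1.le, hs'.2.le⟩] at this
  · refine ContinuousOn.intervalIntegrable ?_
    rw [uIcc_of_le ht.1]
    exact ((hqc.mono hsub).const_mul c).neg.add (hr.mono hsub)

lemma integrableOn_and_tendsto_of_dominated {F : ℕ → ℝ → ℝ} {f bd : ℝ → ℝ} {s : Set ℝ}
    (hF : ∀ n, AEStronglyMeasurable (F n) (volume.restrict s)) (hbd : IntegrableOn bd s)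
    (hle : ∀ᵐ t ∂(volume.restrict s), ∀ n, |F n t| ≤ bd t)
    (hlim : ∀ᵐ t ∂(volume.restrict s), Tendsto (fun n => F n t) atTop (𝓝 (f t))) :
    IntegrableOn f s ∧ Tendsto (fun n => ∫ t in s, F n t) atTop (𝓝 (∫ t in s, f t)) := by
  refine ⟨Integrable.mono' hbd (aestronglyMeasurable_of_tendsto_ae atTop hF hlim) ?_,
    tendsto_integral_of_dominated_convergence bd hF hbd (fun n => hle.mono fun t ht => ht n) hlim⟩
  filter_upwards [hle, hlim] with t h1 h2
  exact le_of_tendsto h2.norm (Eventually.of_forall h1)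

namespace MildE
variable {ν α β γ : ℝ} {δ : ℕ} {p : ℝ} [hp1 : Fact (1 ≤ ENNReal.ofReal p)] {P : Params ν α β γ δ p}
  {T : ℝ} {φ v : ℝ → Lp ℝ (ENNReal.ofReal p) mu} {u₀ : Lp ℝ (ENNReal.ofReal p) mu}

lemma integrableOn_norm_sq (h : MildE P T φ u₀ v) {B : ℝ} (hB0 : 0 ≤ B)
    (hB : ∀ t ∈ Icc 0 T, eLpNorm (φ t) (ENNReal.ofReal (p * (δ + 1))) mu ≤ ENNReal.ofReal B) :
    IntegrableOn (fun t => ‖derivH (toE 2 (VX P φ u₀ v t))‖ ^ 2) (Ioc 0 T) := by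
  refine ⟨?_, (hasFiniteIntegral_iff_ofReal (ae_of_all _ fun t => sq_nonneg _)).2 (h.spaceDeriv hB0 hB).2⟩
  rcases le_or_gt T 0 with hT | hT
  · rw [Ioc_eq_empty (by linarith), Measure.restrict_empty]; exact aestronglyMeasurable_zero_measure _
  · rw [Ioc_zero_eq_iUnion hT, aestronglyMeasurable_iUnion_iff]
    intro n
    obtain ⟨R, M, -, hL⟩ := h.linData hB0 hB (div_add_two_mem hT n)
    exact hL.integrableOn_norm_sq.1

lemma sc_eq (h : MildE P T φ u₀ v) {t : ℝ} (ht : t ∈ Icc 0 T) (k : ℕ) :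
    sc k (v t) = Real.exp (-(ν * lam k * t)) * sc k u₀ +
      ∫ s in (0 : ℝ)..t, Real.exp (-(ν * lam k * (t - s))) * rcL α β δ k (NL P (v s + φ s)) := by
  rcases ht.1.eq_or_lt with rfl | h0
  · rw [h.eq_zero]; simp
  · rw [sc_congr (h.ae_eq_VX ⟨h0, ht.2⟩), h.sc_VX ⟨h0, ht.2⟩]

/-- The right-hand side of the weak formulation. -/
def weakRate (ν : ℝ) (w f g z z' : H2) : ℝ := -(ν * inner ℝ w z') + inner ℝ f z + inner ℝ g z'

/-- Each sine coefficient satisfies its equation in integrated form. Multiply by the coefficient of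
the test function, sum over modes, and pass to the limit by dominated convergence; the limit is
recognised by Parseval. -/
theorem weak_formula (h : MildE P T φ u₀ v) {B : ℝ} (hB0 : 0 ≤ B)
    (hB : ∀ t ∈ Icc 0 T, eLpNorm (φ t) (ENNReal.ofReal (p * (δ + 1))) mu ≤ ENNReal.ofReal B)
    {z z' : H2} (hz : HasD z z') {t : ℝ} (ht : t ∈ Icc 0 T) :
    IntegrableOn (fun s => weakRate ν (derivH (toE 2 (VX P φ u₀ v s))) (fH β γ δ v φ s) (gH α δ v φ s) z z') (Ioc 0 t) ∧
    ∫ s in Ioc 0 t, weakRate ν (derivH (toE 2 (VX P φ u₀ v s))) (fH β γ δ v φ s) (gH α δ v φ s) z z' =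
      (∫ x, v t x * z x ∂mu) - ∫ x, u₀ x * z x ∂mu := by
  set w : ℝ → H2 := fun s => derivH (toE 2 (VX P φ u₀ v s)) with hw
  set r : ℕ → ℝ → ℝ := fun k s => rcL α β δ k (NL P (v s + φ s)) with hrdef
  have hr : ∀ k, ContinuousOn (r k) (Icc 0 T) := fun k => (rcL α β δ k).continuous.comp_continuousOn h.contNL
  have hq := fun k => integral_duhamel (hr k) (fun s hs => h.sc_eq hs k) ht
  have hν := P.hν
  have hsub : Icc 0 t ⊆ Icc 0 T := Icc_subset_Icc_right ht.2
  set F : ℕ → ℝ → ℝ := fun N s => ∑ k ∈ Finset.range N, sc k z * (-(ν * lam k * sc k (v s)) + r k s) with hF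
  have hFk : ∀ k, ContinuousOn (fun s => sc k z * (-(ν * lam k * sc k (v s)) + r k s)) (Icc 0 T) := fun k =>
    ((((hq k).1.const_mul _).neg).add (hr k)).const_mul _
  have hFc : ∀ N, ContinuousOn (F N) (Icc 0 T) := fun N => continuousOn_finsetSum _ fun k _ => hFk k
  have hFint : ∀ N, ∫ s in Ioc 0 t, F N s = ∑ k ∈ Finset.range N, (sc k (v t) * sc k z - sc k u₀ * sc k z) := fun N => by
    rw [← intervalIntegral.integral_of_le ht.1, hF, intervalIntegral.integral_finsetSum fun k _ => ?_]
    · refine Finset.sum_congr rfl fun k _ => ?_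
      rw [intervalIntegral.integral_const_mul, (hq k).2]; ring
    · refine ContinuousOn.intervalIntegrable ?_
      rw [uIcc_of_le ht.1]
      exact (hFk k).mono hsub
  obtain ⟨C, hC0, hC⟩ := h.exists_norm_gH_sq_le hB0 hB
  obtain ⟨A, hA0, hA⟩ := h.integral_abs_fH_le hB0 hB
  have hS : Summable fun k => |sc k z| := summable_abs_of_summable_ev_mul_sq hz.summable
  set S := ∑' k, |sc k z| with hSdef
  have hae := (h.mono ht.1 ht.2).spaceDeriv hB0 (fun s hs => hB s (hsub hs))
  have hFs : ∀ s ∈ Ioc 0 t, HasD (toE 2 (VX P φ u₀ v s)) (w s) → ∀ N, F N s =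
      -(ν * ∑ k ∈ Finset.range N, kc (k + 1) (w s) * (ev k * sc k z))
        + ∑ k ∈ Finset.range N, sc k (fH β γ δ v φ s) * sc k z
        + ∑ k ∈ Finset.range N, kc (k + 1) (gH α δ v φ s) * (ev k * sc k z) := fun s hs hD N => by
    have hs' : s ∈ Ioc 0 T := ⟨hs.1, hs.2.trans ht.2⟩
    have hBs := hB s ⟨hs'.1.le, hs'.2⟩
    rw [hF, Finset.mul_sum, ← Finset.sum_neg_distrib, ← Finset.sum_add_distrib, ← Finset.sum_add_distrib]
    refine Finset.sum_congr rfl fun k _ => ?_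
    rw [h.sc_fH hB0 hs' hBs, h.kc_gH hB0 hs' hBs, hD (k + 1),
      show r k s = _ from rcL_apply α β δ k (NL P (v s + φ s)), sc_congr (h.ae_eq_VX hs'), dcoef,
      sc_congr (coeFn_toE 2 (VX P φ u₀ v s))]
    unfold lam; ring
  have hsum1 : ∀ (y : H2) (N : ℕ), ∑ k ∈ Finset.range N, kc (k + 1) y ^ 2 ≤ ‖y‖ ^ 2 := fun y N => by
    have := sum_le_hasSum (Finset.range (N + 1)) (fun k _ => sq_nonneg _) (hasSum_kc_sq y)
    rw [Finset.sum_range_succ'] at this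
    nlinarith only [this, sq_nonneg (kc 0 y)]
  have hsum2 : ∀ N : ℕ, ∑ k ∈ Finset.range N, (ev k * sc k z) ^ 2 ≤ ‖z'‖ ^ 2 := fun N =>
    sum_le_hasSum _ (fun k _ => sq_nonneg _) hz.norm_sq
  -- The viscous and flux sums are bounded by Bessel. The reaction is uniformly bounded only in L¹
  -- near t = 0, but that suffices because the coefficients of an H¹₀ test function are absolutely
  -- summable.
  set bd : ℝ → ℝ := fun s => ν * ((‖w s‖ ^ 2 + ‖z'‖ ^ 2) / 2) + 2 * A * S + (C * s ^ (-(5 / 8 : ℝ)) + ‖z'‖ ^ 2) / 2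
    with hbd
  have ibd : IntegrableOn bd (Ioc 0 t) := by
    have i1 : IntegrableOn (fun s => ‖w s‖ ^ 2) (Ioc 0 t) :=
      (h.integrableOn_norm_sq hB0 hB).mono_set (Ioc_subset_Ioc_right ht.2)
    have i2 : IntegrableOn (fun s : ℝ => s ^ (-(5 / 8 : ℝ))) (Ioc 0 t) := by
      rw [← intervalIntegrable_iff_integrableOn_Ioc_of_le ht.1]
      exact intervalIntegral.intervalIntegrable_rpow' (by norm_num)
    have ic : ∀ c : ℝ, IntegrableOn (fun _ : ℝ => c) (Ioc 0 t) := fun c => integrableOn_const (by simp)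
    exact ((((i1.add (ic _)).div_const 2).const_mul ν).add (ic _)).add (((i2.const_mul C).add (ic _)).div_const 2)
  have hle : ∀ᵐ s ∂(volume.restrict (Ioc 0 t)), ∀ N, |F N s| ≤ bd s := by
    filter_upwards [hae.1, ae_restrict_mem measurableSet_Ioc] with s hD hs N
    have hs' : s ∈ Ioc 0 T := ⟨hs.1, hs.2.trans ht.2⟩
    rw [hFs s hs hD N]
    refine (abs_add_le _ _).trans (add_le_add ((abs_add_le _ _).trans (add_le_add ?_ ?_)) ?_)
    · rw [abs_neg, abs_mul, abs_of_pos hν]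
      exact mul_le_mul_of_nonneg_left (abs_sum_mul_le (hsum1 _ N) (hsum2 N)) hν.le
    · refine (Finset.abs_sum_le_sum_abs _ _).trans ?_
      have h1 : ∑ k ∈ Finset.range N, |sc k z| ≤ S := hS.sum_le_tsum _ fun k _ => abs_nonneg _
      have h2 : ∑ k ∈ Finset.range N, |sc k (fH β γ δ v φ s) * sc k z| ≤ ∑ k ∈ Finset.range N, 2 * A * |sc k z| :=
        Finset.sum_le_sum fun k _ => by
          rw [abs_mul]
          refine mul_le_mul_of_nonneg_right ?_ (abs_nonneg _)
          exact (abs_integral_mul_le_of_bound (abs_sf_le k) (integrable_Lp _)).trans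
            (mul_le_mul_of_nonneg_left (hA s hs') zero_le_two)
      rw [← Finset.mul_sum] at h2
      exact h2.trans (mul_le_mul_of_nonneg_left h1 (by positivity))
    · exact abs_sum_mul_le ((hsum1 _ N).trans (hC s hs')) (hsum2 N)
  have hlim : ∀ᵐ s ∂(volume.restrict (Ioc 0 t)), Tendsto (fun N => F N s) atTop
      (𝓝 (weakRate ν (w s) (fH β γ δ v φ s) (gH α δ v φ s) z z')) := by
    filter_upwards [hae.1, ae_restrict_mem measurableSet_Ioc] with s hD hs
    simp only [hFs s hs hD]
    exact ((((hz.hasSum_inner _).tendsto_sum_nat.const_mul ν).neg).add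
      (hasSum_inner_sc _ _).tendsto_sum_nat).add (hz.hasSum_inner _).tendsto_sum_nat
  obtain ⟨hI, hT⟩ := integrableOn_and_tendsto_of_dominated
    (fun N => ((hFc N).mono (Ioc_subset_Icc_self.trans hsub)).aestronglyMeasurable measurableSet_Ioc) ibd hle hlim
  refine ⟨hI, tendsto_nhds_unique hT ?_⟩
  have hi : ∀ u : Lp ℝ (ENNReal.ofReal p) mu, HasSum (fun k => sc k u * sc k z) (∫ x, u x * z x ∂mu) := fun u => by
    have hu : MemLp u 2 mu := (Lp.memLp u).mono_exponent (by
      rw [← ENNReal.ofReal_ofNat 2]; exact ENNReal.ofReal_le_ofReal (by linarith [P.hp3]))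
    have h1 := hasSum_inner_sc (toH u) z
    have e : inner ℝ (toH u) z = ∫ x, u x * z x ∂mu := by
      rw [L2.inner_def]
      refine integral_congr_ae ?_
      filter_upwards [coeFn_toH hu] with x hx
      simp [hx, mul_comm]
    simpa only [sc_congr (coeFn_toH hu), e] using h1
  simp only [hFint]
  exact ((hi (v t)).sub (hi u₀)).tendsto_sum_nat

end MildE

section
variable {ν α β γ : ℝ} {δ : ℕ} {p : ℝ} [hp1 : Fact (1 ≤ ENNReal.ofReal p)] {P : Params ν α β γ δ p}
  {T : ℝ} {φ v : ℝ → ℝ → ℝ} {u₀ : ℝ → ℝ} {φE V : ℝ → Lp ℝ (ENNReal.ofReal p) mu} {uE : Lp ℝ (ENNReal.ofReal p) mu}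

lemma Params.two_le (P : Params ν α β γ δ p) : (2 : ℝ≥0∞) ≤ ENNReal.ofReal p := by
  rw [← ENNReal.ofReal_ofNat 2]; exact ENNReal.ofReal_le_ofReal (by linarith [P.hp3])

lemma ContL.two (P : Params ν α β γ δ p) (h : ContL T p v) : ContL T 2 v := by
  refine ⟨fun t ht => inL_two.2 ((h.1 t ht).mono_exponent P.two_le), fun t ht => ?_⟩
  refine tendsto_of_tendsto_of_tendsto_of_le_of_le' tendsto_const_nhds (h.2 t ht)
    (Eventually.of_forall fun _ => zero_le) ?_
  filter_upwards [self_mem_nhdsWithin] with s hs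
  rw [normL_two]
  exact eLpNorm_le_eLpNorm_of_exponent_le P.two_le ((h.1 s hs).1.sub (h.1 t ht).1)

lemma inner_eq_integral {f g : ℝ → ℝ} {u w : H2} (hf : f =ᵐ[mu] u) (hg : g =ᵐ[mu] w) :
    inner ℝ u w = ∫ x, f x * g x ∂mu := by
  rw [L2.inner_def]
  refine integral_congr_ae ?_
  filter_upwards [hf, hg] with x h1 h2
  simp [h1, h2, mul_comm]

lemma restrict_Icc_eq_Ioc (a b : ℝ) : (volume : Measure ℝ).restrict (Icc a b) = volume.restrict (Ioc a b) :=
  (Measure.restrict_congr_set Ioc_ae_eq_Icc).symm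

lemma normL_two_coe_sq (w : H2) : normL 2 w ^ 2 = ENNReal.ofReal (‖w‖ ^ 2) := by
  rw [normL_two, ENNReal.ofReal_pow (norm_nonneg _), Lp.norm_def, ENNReal.ofReal_toReal (Lp.memLp w).2.ne]

theorem MildE.hasSpaceDeriv (h : MildE P T φE uE V) (hv : ∀ t ∈ Icc 0 T, v t =ᵐ[mu] V t) {B : ℝ} (hB0 : 0 ≤ B)
    (hB : ∀ t ∈ Icc 0 T, eLpNorm (φE t) (ENNReal.ofReal (p * (δ + 1))) mu ≤ ENNReal.ofReal B) :
    HasSpaceDeriv T v fun t => derivH (toE 2 (VX P φE uE V t)) := by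
  obtain ⟨h1, h2⟩ := h.spaceDeriv hB0 hB
  rw [HasSpaceDeriv, restrict_Icc_eq_Ioc]
  refine ⟨?_, ?_⟩
  · filter_upwards [h1, ae_restrict_mem measurableSet_Ioc] with t hD ht
    refine (hasH10Deriv_iff_hasD ?_ (ae_eq_refl _)).2 hD
    exact ((hv t ⟨ht.1.le, ht.2⟩).trans (h.ae_eq_VX ht)).trans (coeFn_toE 2 _).symm
  · simpa only [normL_two_coe_sq] using h2

/-- The spatial derivative of a solution is determined almost everywhere. -/
lemma MildE.spaceDeriv_ae_eq (h : MildE P T φE uE V) (hv : ∀ t ∈ Icc 0 T, v t =ᵐ[mu] V t) {w : ℝ → ℝ → ℝ}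
    (hw : HasSpaceDeriv T v w) :
    ∀ᵐ t ∂(volume.restrict (Ioc 0 T)), w t =ᵐ[mu] derivH (toE 2 (VX P φE uE V t)) := by
  have h1 := hw.1
  rw [restrict_Icc_eq_Ioc] at h1
  filter_upwards [h1, ae_restrict_mem measurableSet_Ioc] with t ht htI
  have hm : MemLp (w t) 2 mu := inL_two.1 ht.2.1
  have e := ((hv t ⟨htI.1.le, htI.2⟩).trans (h.ae_eq_VX htI)).trans (coeFn_toE 2 _).symm
  have hD := (hasH10Deriv_iff_hasD e (coeFn_toH hm).symm).1 ht
  rw [← hD.eq (hasD_derivH hD)]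
  exact (coeFn_toH hm).symm

theorem MildE.isWeakSolution (h : MildE P T φE uE V) (hφ : ∀ t ∈ Icc 0 T, φ t =ᵐ[mu] φE t)
    (hu : u₀ =ᵐ[mu] uE) (hv : ∀ t ∈ Icc 0 T, v t =ᵐ[mu] V t) {B : ℝ} (hB0 : 0 ≤ B)
    (hB : ∀ t ∈ Icc 0 T, eLpNorm (φE t) (ENNReal.ofReal (p * (δ + 1))) mu ≤ ENNReal.ofReal B) :
    IsWeakSolution ν α β γ δ p T φ u₀ v := by
  refine ⟨((contL_iff hv).2 h.cont).two P, ?_, _, h.hasSpaceDeriv hv hB0 hB, fun ζ ζ' hζ t ht => ?_⟩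
  · obtain ⟨M, hM⟩ := isCompact_Icc.exists_bound_of_continuousOn h.cont
    refine ⟨M.toNNReal, ?_⟩
    filter_upwards [ae_restrict_mem measurableSet_Icc] with t ht
    have e : normL p (v t) = ENNReal.ofReal ‖V t‖ := by
      rw [normL, eLpNorm_congr_ae (hv t ht), Lp.norm_def, ENNReal.ofReal_toReal (Lp.memLp _).2.ne]
    rw [e]
    exact ENNReal.ofReal_le_ofReal (hM t ht)
  have hz2 : MemLp ζ 2 mu := inL_two.1 hζ.1
  have hz2' : MemLp ζ' 2 mu := inL_two.1 hζ.2.1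
  have hz : HasD (toH ζ) (toH ζ') := (hasH10Deriv_iff_hasD (coeFn_toH hz2).symm (coeFn_toH hz2').symm).1 hζ
  obtain ⟨h1, h2⟩ := h.weak_formula hB0 hB hz ht
  have key : ∀ s ∈ Ioc 0 t, pairing ν α β γ δ (φ s) (v s) (derivH (toE 2 (VX P φE uE V s))) ζ ζ' =
      -MildE.weakRate ν (derivH (toE 2 (VX P φE uE V s))) (MildE.fH β γ δ V φE s) (MildE.gH α δ V φE s) (toH ζ) (toH ζ') := by
    intro s hs
    have hs' : s ∈ Ioc 0 T := ⟨hs.1, hs.2.trans ht.2⟩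
    have hsI : s ∈ Icc 0 T := ⟨hs'.1.le, hs'.2⟩
    have hsum : (V s + φE s : Lp ℝ (ENNReal.ofReal p) mu) =ᵐ[mu] fun x => v s x + φ s x := by
      filter_upwards [Lp.coeFn_add (V s) (φE s), hv s hsI, hφ s hsI] with x h1 h2 h3
      rw [h1, h2, h3, Pi.add_apply]
    have ef : (fun x => β * cc γ δ (v s x + φ s x)) =ᵐ[mu] MildE.fH β γ δ V φE s := by
      filter_upwards [h.coeFn_fH hB0 hs' (hB s hsI), hsum] with x h1 h2
      rw [h1, h2]
    have eg : (fun x => α / (δ + 1) * pp δ (v s x + φ s x)) =ᵐ[mu] MildE.gH α δ V φE s := by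
      filter_upwards [h.coeFn_gH hB0 hs' (hB s hsI), hsum] with x h1 h2
      rw [h1, h2]
    rw [MildE.weakRate, inner_eq_integral ef (coeFn_toH hz2).symm, inner_eq_integral eg (coeFn_toH hz2').symm,
      inner_eq_integral (ae_eq_refl _) (coeFn_toH hz2').symm, pairing]
    simp only [mul_assoc]
    rw [integral_const_mul, integral_const_mul]
    ring
  refine ⟨?_, ?_⟩
  · rw [intervalIntegrable_iff_integrableOn_Ioc_of_le ht.1]
    exact IntegrableOn.congr_fun h1.neg (fun s hs => (key s hs).symm) measurableSet_Ioc
  · rw [intervalIntegral.integral_of_le ht.1, setIntegral_congr_fun measurableSet_Ioc key, integral_neg, h2]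
    have e1 : ∫ x, V t x * toH ζ x ∂mu = ∫ x, v t x * ζ x ∂mu := integral_congr_ae ((hv t ht).mul (coeFn_toH hz2).symm).symm
    have e2 : ∫ x, uE x * toH ζ x ∂mu = ∫ x, u₀ x * ζ x ∂mu := integral_congr_ae (hu.mul (coeFn_toH hz2).symm).symm
    rw [e1, e2]
    ring

end

/-! ### Weak solutions are mild solutions. -/

/-- Variation of constants for a forcing that is merely integrable: q is absolutely continuous, and
integration by parts against e^{cs} replaces differentiation. -/
lemma duhamel_of_integral {c q0 T : ℝ} {q r : ℝ → ℝ} (hq : ContinuousOn q (Icc 0 T))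
    (hr : IntervalIntegrable r volume 0 T)
    (h : ∀ t ∈ Icc 0 T, q t = q0 + ∫ s in (0 : ℝ)..t, (-(c * q s) + r s)) {t : ℝ} (ht : t ∈ Icc 0 T) :
    q t = Real.exp (-(c * t)) * q0 + ∫ s in (0 : ℝ)..t, Real.exp (-(c * (t - s))) * r s := by
  have hsub : uIcc 0 t ⊆ Icc 0 T := by rw [uIcc_of_le ht.1]; exact Icc_subset_Icc_right ht.2
  have hrt : IntervalIntegrable r volume 0 t :=
    hr.mono_set (hsub.trans Icc_subset_uIcc)
  set g : ℝ → ℝ := fun s => -(c * q s) + r s with hg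
  have hgi : IntervalIntegrable g volume 0 t := ((hq.mono hsub).intervalIntegrable.const_mul c).neg.add hrt
  have hac1 : AbsolutelyContinuousOnInterval (fun x => ∫ s in (0 : ℝ)..x, g s) 0 t :=
    hgi.absolutelyContinuousOnInterval_intervalIntegral (by simp)
  have hexp : ∀ s, HasDerivAt (fun s => Real.exp (c * s)) (Real.exp (c * s) * c) s := fun s => by
    simpa using ((hasDerivAt_id s).const_mul c).exp
  have hac2 : AbsolutelyContinuousOnInterval (fun s => Real.exp (c * s)) 0 t :=
    ContDiffOn.absolutelyContinuousOnInterval (by fun_prop)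
  have hibp := hac2.integral_mul_deriv_eq_deriv_mul hac1
  have hder : ∫ s in (0 : ℝ)..t, Real.exp (c * s) * deriv (fun x => ∫ s in (0 : ℝ)..x, g s) s =
      ∫ s in (0 : ℝ)..t, Real.exp (c * s) * g s := by
    refine intervalIntegral.integral_congr_ae ?_
    filter_upwards [hgi.ae_hasDerivAt_integral] with s hs hst
    rw [(hs (uIoc_subset_uIcc hst) 0 (by simp)).deriv]
  have hder2 : ∫ s in (0 : ℝ)..t, deriv (fun s => Real.exp (c * s)) s * ∫ x in (0 : ℝ)..s, g x =
      ∫ s in (0 : ℝ)..t, (c * (Real.exp (c * s) * q s) - q0 * (Real.exp (c * s) * c)) := by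
    refine intervalIntegral.integral_congr fun s hs => ?_
    have := h s (hsub hs)
    simp only [(hexp s).deriv]
    rw [this]; ring
  have hcq : ContinuousOn (fun s => Real.exp (c * s) * q s) (uIcc 0 t) :=
    ContinuousOn.mul (by fun_prop) (hq.mono hsub)
  have i1 := hcq.intervalIntegrable (μ := volume)
  have i2 : IntervalIntegrable (fun s => Real.exp (c * s) * r s) volume 0 t :=
    hrt.continuousOn_mul (by fun_prop)
  have e0 : ∫ s in (0 : ℝ)..t, Real.exp (c * s) * c = Real.exp (c * t) - 1 := by
    rw [intervalIntegral.integral_eq_sub_of_hasDerivAt (fun s _ => hexp s) (Continuous.intervalIntegrable (by fun_prop) _ _)]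
    simp
  have e1 : ∫ s in (0 : ℝ)..t, Real.exp (c * s) * g s =
      -(c * ∫ s in (0 : ℝ)..t, Real.exp (c * s) * q s) + ∫ s in (0 : ℝ)..t, Real.exp (c * s) * r s := by
    rw [← intervalIntegral.integral_const_mul, ← intervalIntegral.integral_neg, ← intervalIntegral.integral_add ?_ i2]
    · congr 1; funext s; simp only [hg]; ring
    · exact (i1.const_mul c).neg
  rw [hder, hder2, e1, intervalIntegral.integral_sub (i1.const_mul c)
    (Continuous.intervalIntegrable (by fun_prop) _ _), intervalIntegral.integral_const_mul,
    intervalIntegral.integral_const_mul, e0, intervalIntegral.integral_same, mul_zero, sub_zero] at hibp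
  have hqt := h t ht
  rw [duhamel_eq]
  have e2 : ∫ s in (0 : ℝ)..t, Real.exp (c * s) * r s = Real.exp (c * t) * q t - q0 := by
    have : ∫ s in (0 : ℝ)..t, g s = q t - q0 := by rw [hqt]; ring
    rw [this] at hibp
    linear_combination hibp
  have e3 : Real.exp (-(c * t)) * Real.exp (c * t) = 1 := by rw [← Real.exp_add]; simp
  rw [e2]
  linear_combination (-q t) * e3

lemma ContL.continuousOn_toH {T : ℝ} {v : ℝ → ℝ → ℝ} (h : ContL T 2 v) : ContinuousOn (fun t => toH (v t)) (Icc 0 T) := by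
  intro t ht
  have hv : ∀ s ∈ Icc 0 T, toH (v s) =ᵐ[mu] v s := fun s hs => coeFn_toH (inL_two.1 (h.1 s hs))
  rw [ContinuousWithinAt, Lp.tendsto_Lp_iff_tendsto_eLpNorm']
  refine (h.2 t ht).congr' ?_
  filter_upwards [self_mem_nhdsWithin] with s hs
  rw [normL_two]
  exact (eLpNorm_congr_ae ((hv s hs).sub (hv t ht))).symm

section
variable {ν α β γ : ℝ} {δ : ℕ} {p : ℝ} [hp1 : Fact (1 ≤ ENNReal.ofReal p)] {P : Params ν α β γ δ p}
  {T : ℝ} {φ v : ℝ → ℝ → ℝ} {u₀ : ℝ → ℝ} {φE V : ℝ → Lp ℝ (ENNReal.ofReal p) mu} {uE : Lp ℝ (ENNReal.ofReal p) mu}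

lemma exists_norm_NL_le (P : Params ν α β γ δ p) (R : ℝ) : ∃ M, 0 ≤ M ∧ ∀ u : Lp ℝ (ENNReal.ofReal p) mu, ‖u‖ ≤ R → ‖NL P u‖ ≤ M := by
  obtain ⟨L, hL, h⟩ := exists_lipschitz_NL P (max R 0)
  refine ⟨L * max R 0 + ‖NL P 0‖, by positivity, fun u hu => ?_⟩
  have h1 := h u 0 (hu.trans (le_max_left _ _)) (by simp)
  rw [sub_zero] at h1
  calc ‖NL P u‖ = ‖(NL P u - NL P 0) + NL P 0‖ := by rw [sub_add_cancel]
    _ ≤ _ := (norm_add_le _ _).trans (by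
      gcongr
      exact h1.trans (mul_le_mul_of_nonneg_left (hu.trans (le_max_left _ _)) hL))

/-- A function continuous into `L²` with values in `L^p` is strongly measurable into `L^p`. -/
lemma aestronglyMeasurable_liftL (hc : ContL T 2 v)
    (hp : ∀ᵐ t ∂(volume.restrict (Ioc 0 T)), MemLp (v t) (ENNReal.ofReal p) mu) :
    AEStronglyMeasurable (fun t => liftL (ENNReal.ofReal p) (v t)) (volume.restrict (Ioc 0 T)) := by
  -- The heat flow at time 1/(n+1) maps L² continuously into L^p, so the regularised curves are
  -- continuous in t; they converge in L^p at almost every time.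
  refine aestronglyMeasurable_of_tendsto_ae atTop
    (f := fun (n : ℕ) t => toE (ENNReal.ofReal p) (S1 2 (1 / ((n : ℝ) + 1)) (toH (v t)))) (fun n => ?_) ?_
  · exact (((toE _).continuous.comp (S1 2 _).continuous).comp_continuousOn
      (hc.continuousOn_toH.mono Ioc_subset_Icc_self)).aestronglyMeasurable measurableSet_Ioc
  · filter_upwards [hp, ae_restrict_mem measurableSet_Ioc] with t ht htI
    have h2 : MemLp (v t) 2 mu := inL_two.1 (hc.1 t (Ioc_subset_Icc_self htI))
    have e : ∀ n : ℕ, toE (ENNReal.ofReal p) (S1 2 (1 / ((n : ℝ) + 1)) (toH (v t))) =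
        SE (ENNReal.ofReal p) (1 / ((n : ℝ) + 1)) (liftL (ENNReal.ofReal p) (v t)) := fun n => by
      have hn : 0 < 1 / ((n : ℝ) + 1) := by positivity
      rw [SE_of_pos hn]
      refine Lp.ext ((coeFn_toE _ _).trans (EventuallyEq.trans (ae_of_all _ fun x => ?_) (coeFn_toE _ _).symm))
      rw [S1_apply hn, S1_apply hn]
      refine integral_congr_ae ?_
      filter_upwards [coeFn_toH h2, coeFn_liftL ht] with y h1 h2
      rw [h1, h2]
    simp only [e]
    refine (tendsto_SE_zero ENNReal.ofReal_ne_top _).comp ?_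
    exact tendsto_nhdsWithin_iff.2 ⟨tendsto_one_div_add_atTop_nhds_zero_nat,
      Eventually.of_forall fun n => by simp only [mem_Ioi]; positivity⟩

lemma sc_SE {t : ℝ} (ht : 0 ≤ t) (u : Lp ℝ (ENNReal.ofReal p) mu) (k : ℕ) :
    sc k (SE (ENNReal.ofReal p) t u) = Real.exp (-(lam k * t)) * sc k u := by
  rcases ht.eq_or_lt with rfl | h
  · simp
  · rw [SE_of_pos h, sc_congr (coeFn_toE _ _)]
    exact integral_sf_S1 h u k

lemma hasH10Deriv_sf (k : ℕ) : HasH10Deriv (sf k) (fun x => ev k * cf k x) := by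
  have := hasH10Deriv_of_contDiff (contDiff_sf k) (sf_zero k) (sf_one k)
  rwa [show deriv (sf k) = fun x => ev k * cf k x from funext fun x => (hasDerivAt_sf k x).deriv] at this

/-- Tested with a sine, the weak formulation reduces to the equation of a single coefficient, forced
by the same functional as in the mild formulation. -/
lemma pairing_sf (P : Params ν α β γ δ p) {f g w : ℝ → ℝ} {u y : Lp ℝ (ENNReal.ofReal p) mu} (hf : f =ᵐ[mu] u) (hg : g =ᵐ[mu] y)
    (hw : HasH10Deriv f w) (k : ℕ) :
    pairing ν α β γ δ g f w (sf k) (fun x => ev k * cf k x) = ν * lam k * sc k f - rcL α β δ k (NL P (u + y)) := by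
  obtain ⟨h1, h2⟩ := NL_ae P hf hg
  have e1 : ∫ x, w x * (ev k * cf k x) ∂mu = ev k * (ev k * sc k f) := by
    rw [← ((hasH10Deriv_iff (inL_two.1 hw.1) (inL_two.1 hw.2.1)).1 hw).2 k, kc, ← integral_const_mul]
    congr 1; funext x; simp only [cb]; ring
  have e2 : ∫ x, pp δ (f x + g x) * (ev k * cf k x) ∂mu = ev k * kc (k + 1) (NL P (u + y)).2 := by
    rw [kc_congr h2, kc, ← integral_const_mul]
    congr 1; funext x; simp only [cb]; ring
  have e3 : ∫ x, cc γ δ (f x + g x) * sf k x ∂mu = sc k (NL P (u + y)).1 := by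
    rw [sc_congr h1, sc]
    congr 1; funext x; ring
  rw [pairing, e1, e2, e3, rcL_apply]
  unfold lam; ring

lemma integrable_sf_mul {q : ℝ≥0∞} [Fact (1 ≤ q)] (k : ℕ) (u : Lp ℝ q mu) : Integrable (fun x => sf k x * u x) mu :=
  (integrable_Lp u).bdd_mul (continuous_sf k).aestronglyMeasurable (ae_of_all _ (abs_sf_le k))

lemma sc_add_duh (P : Params ν α β γ δ p) (hT : 0 ≤ T) {F : ℝ → YY} {M : ℝ}
    (hFm : AEStronglyMeasurable F (volume.restrict (Ioc 0 T))) (hFM : ∀ᵐ s ∂(volume.restrict (Ioc 0 T)), ‖F s‖ ≤ M)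
    (uE : Lp ℝ (ENNReal.ofReal p) mu) {t : ℝ} (ht : t ∈ Icc 0 T) (k : ℕ) :
    sc k (SE (ENNReal.ofReal p) (ν * t) uE + toE (ENNReal.ofReal p) (duh (kerX ν α β δ) F t) :
      Lp ℝ (ENNReal.ofReal p) mu) = Real.exp (-(ν * lam k * t)) * sc k uE +
      ∫ s in (0 : ℝ)..t, Real.exp (-(ν * lam k * (t - s))) * rcL α β δ k (F s) := by
  rw [← scX_duh P.hν hT hFm hFM ht, scX_apply, ← sc_congr (coeFn_toE (ENNReal.ofReal p) (duh (kerX ν α β δ) F t)),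
    show ν * lam k * t = lam k * (ν * t) by ring, ← sc_SE (mul_nonneg P.hν.le ht.1), sc_congr (Lp.coeFn_add _ _), sc, sc,
    sc, ← integral_add (integrable_sf_mul k _) (integrable_sf_mul k _)]
  congr 1; funext x; rw [Pi.add_apply, mul_add]

lemma sc_eq_of_weak {u : Lp ℝ (ENNReal.ofReal p) mu} {a r : ℝ → ℝ} {c : ℝ} {k : ℕ} (hc2 : ContL T 2 v)
    (h : ∀ t ∈ Icc 0 T, IntervalIntegrable a volume 0 t ∧
      ∫ x, v t x * sf k x ∂mu = ∫ x, u₀ x * sf k x ∂mu - ∫ s in (0 : ℝ)..t, a s)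
    (hu : u₀ =ᵐ[mu] u) (hr : IntervalIntegrable r volume 0 T)
    (ha : ∀ᵐ s ∂(volume.restrict (Ioc 0 T)), a s = c * sc k (v s) - r s) :
    ∀ t ∈ Icc 0 T, sc k (v t) = Real.exp (-(c * t)) * sc k u + ∫ s in (0 : ℝ)..t, Real.exp (-(c * (t - s))) * r s := by
  intro t ht
  have e : ∀ t ∈ Icc 0 T, sc k (toH (v t)) = sc k (v t) := fun t ht =>
    sc_congr (coeFn_toH (inL_two.1 (hc2.1 t ht)))
  rw [← e t ht]
  refine duhamel_of_integral (q := fun t => sc k (toH (v t))) (T := T) ?_ hr (fun t ht => ?_) ht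
  · exact (pairL 2 (sX k)).continuous.comp_continuousOn hc2.continuousOn_toH
  · have h1 := (h t ht).2
    have e1 : ∫ x, v t x * sf k x ∂mu = sc k (v t) := by
      rw [sc]; congr 1; funext x; ring
    have e2 : ∫ x, u₀ x * sf k x ∂mu = sc k u := by
      rw [← sc_congr hu, sc]; congr 1; funext x; ring
    rw [e t ht, ← e1, h1, e2, sub_eq_add_neg, ← intervalIntegral.integral_neg]
    refine congrArg _ (intervalIntegral.integral_congr_ae ((ae_restrict_iff' measurableSet_uIoc).1 ?_))
    rw [uIoc_of_le ht.1]
    have hsub : Ioc 0 t ⊆ Ioc 0 T := Ioc_subset_Ioc_right ht.2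
    filter_upwards [ae_mono (Measure.restrict_mono hsub le_rfl) ha, ae_restrict_mem measurableSet_Ioc] with s h1 hs
    rw [h1, e s (Ioc_subset_Icc_self (hsub hs))]
    ring

/-- A weak solution is a priori only essentially bounded in L^p, which suffices to form the
right-hand side `V` of the integral equation and to know that it is continuous in L^p. Both have the
same sine coefficients at every time, hence agree, and `V` satisfies its own equation. -/
theorem IsWeakSolution.exists_mildE (P : Params ν α β γ δ p) (hT : 0 ≤ T) (hφ : ∀ t ∈ Icc 0 T, φ t =ᵐ[mu] φE t)
    (hφc : ContinuousOn φE (Icc 0 T)) (hu : u₀ =ᵐ[mu] uE) (h : IsWeakSolution ν α β γ δ p T φ u₀ v) :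
    ∃ V, (∀ t ∈ Icc 0 T, v t =ᵐ[mu] V t) ∧ MildE P T φE uE V := by
  obtain ⟨hc2, ⟨C, hC⟩, w, ⟨hw, -⟩, hweak⟩ := h
  rw [restrict_Icc_eq_Ioc] at hC hw
  have hmem : ∀ᵐ t ∂(volume.restrict (Ioc 0 T)), MemLp (v t) (ENNReal.ofReal p) mu := by
    filter_upwards [hC, ae_restrict_mem measurableSet_Ioc] with t h1 ht
    exact ⟨(hc2.1 t (Ioc_subset_Icc_self ht)).1, h1.trans_lt ENNReal.coe_lt_top⟩
  set U : ℝ → Lp ℝ (ENNReal.ofReal p) mu := fun t => liftL (ENNReal.ofReal p) (v t) with hU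
  have hUm : AEStronglyMeasurable U (volume.restrict (Ioc 0 T)) := aestronglyMeasurable_liftL hc2 hmem
  have hUC : ∀ᵐ t ∂(volume.restrict (Ioc 0 T)), ‖U t‖ ≤ C := by
    filter_upwards [hC, hmem] with t h1 h2
    rw [hU, Lp.norm_def, eLpNorm_congr_ae (coeFn_liftL h2)]
    exact ENNReal.toReal_le_coe_of_le_coe h1
  obtain ⟨Mφ, hMφ⟩ := isCompact_Icc.exists_bound_of_continuousOn hφc
  set F : ℝ → YY := fun s => NL P (U s + φE s) with hF
  have hFm : AEStronglyMeasurable F (volume.restrict (Ioc 0 T)) :=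
    (continuous_NL P).comp_aestronglyMeasurable
      (hUm.add ((hφc.mono Ioc_subset_Icc_self).aestronglyMeasurable measurableSet_Ioc))
  obtain ⟨M, hM0, hM⟩ := exists_norm_NL_le P (C + Mφ)
  have hFM : ∀ᵐ s ∂(volume.restrict (Ioc 0 T)), ‖F s‖ ≤ M := by
    filter_upwards [hUC, ae_restrict_mem measurableSet_Ioc] with s h1 hs
    exact hM _ ((norm_add_le _ _).trans (add_le_add h1 (hMφ s (Ioc_subset_Icc_self hs))))
  obtain ⟨CK, hCK, hK⟩ := exists_weakSing_kerX P.hν α β δ hT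
  set V : ℝ → Lp ℝ (ENNReal.ofReal p) mu := fun t =>
    SE _ (ν * t) uE + toE _ (duh (kerX ν α β δ) F t) with hV
  have hVc : ContinuousOn V (Icc 0 T) := (continuousOn_SE_mul P.hν uE).add
    ((toE _).continuous.comp_continuousOn (continuousOn_duh hK hT (by norm_num) (by norm_num) hCK hM0 hFm hFM))
  have hscv := fun k => sc_eq_of_weak hc2 (c := ν * lam k) (hweak _ _ (hasH10Deriv_sf k)) hu
    (((intervalIntegrable_iff_integrableOn_Ioc_of_le hT).2
      ((rcL α β δ k).integrable_comp (Integrable.of_bound hFm M hFM)))) (by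
      filter_upwards [hw, hmem, ae_restrict_mem measurableSet_Ioc] with s h1 h2 hs
      exact pairing_sf P (coeFn_liftL h2).symm (hφ s (Ioc_subset_Icc_self hs)) h1 k)
  have hvV : ∀ t ∈ Icc 0 T, v t =ᵐ[mu] V t := fun t ht =>
    ae_eq_of_sc_eq (inL_two.1 (hc2.1 t ht)) ((Lp.memLp (V t)).mono_exponent P.two_le) fun k =>
      (hscv k t ht).trans (sc_add_duh P hT hFm hFM uE ht k).symm
  have hFV : ∀ s ∈ Icc 0 T, F s = NL P (V s + φE s) := fun s hs => by
    rw [show F s = NL P (U s + φE s) from rfl, show U s = V s from liftL_eq (hvV s hs)]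
  refine ⟨V, hvV, ⟨hT, hφc, hVc, fun t ht => ?_⟩⟩
  rw [← duh_congr (kerX ν α β δ) (F := F) (F' := fun s => NL P (V s + φE s)) ht.1
    fun s hs => hFV s ⟨hs.1, hs.2.le.trans ht.2⟩]

end

/-! ### The energy estimate in terms of norms. -/

lemma normL_rpow {r : ℝ} (hr : 0 < r) {f : ℝ → ℝ} (hf : MemLp f (ENNReal.ofReal r) mu) :
    normL r f ^ r = ENNReal.ofReal (∫ x, |f x| ^ r ∂mu) := by
  have h0 : 0 ≤ ∫ x, ‖f x‖ ^ r ∂mu := integral_nonneg fun x => by positivity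
  rw [normL, hf.eLpNorm_eq_integral_rpow_norm (by simpa using hr) ENNReal.ofReal_ne_top, ENNReal.toReal_ofReal hr.le,
    ENNReal.ofReal_rpow_of_nonneg (by positivity) hr.le, Real.rpow_inv_rpow h0 hr.ne']
  simp only [Real.norm_eq_abs]

lemma normL_weight_sq {p : ℝ} (hp : 3 ≤ p) (S : X) (w : H2) {f g : ℝ → ℝ} (hf : f =ᵐ[mu] S) (hg : g =ᵐ[mu] w) :
    normL 2 (fun x => |f x| ^ ((p - 2) / 2) * g x) ^ 2 = ENNReal.ofReal (∫ x, |S x| ^ (p - 2) * w x * w x ∂mu) := by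
  have hc : Continuous fun x : ℝ => |x| ^ ((p - 2) / 2) := continuous_abs.rpow_const fun _ => Or.inr (by linarith)
  have e : (fun x => |f x| ^ ((p - 2) / 2) * g x) =ᵐ[mu] mulX (X.comp _ hc S) w := by
    filter_upwards [coeFn_mulX (X.comp _ hc S) w, hf, hg] with x h1 h2 h3
    rw [h1, h2, h3, X.comp_apply]
  rw [normL, eLpNorm_congr_ae e, ← normL, normL_two_coe_sq, norm_sq_eq_integral]
  congr 1
  refine integral_congr_ae ?_
  filter_upwards [coeFn_mulX (X.comp _ hc S) w] with x h1
  rw [h1, X.comp_apply, mul_pow, ← Real.rpow_natCast, ← Real.rpow_mul (abs_nonneg _)]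
  push_cast
  rw [div_mul_cancel₀ _ two_ne_zero]
  ring

lemma K1_nonneg {ν α β γ : ℝ} {δ : ℕ} {p : ℝ} (P : Params ν α β γ δ p) : 0 ≤ K1 ν α β γ δ p := by
  have h1 := P.hν; have h2 := P.hβ; have h3 := P.hp3; have h4 := P.hδ'; have h5 := P.hγ0
  have h6 : 0 < p := by linarith
  unfold K1
  positivity

section
variable {ν α β γ : ℝ} {δ : ℕ} {p : ℝ} [hp1 : Fact (1 ≤ ENNReal.ofReal p)] {P : Params ν α β γ δ p}
  {T : ℝ} {φ v : ℝ → ℝ → ℝ} {u₀ : ℝ → ℝ} {φE V : ℝ → Lp ℝ (ENNReal.ofReal p) mu} {uE : Lp ℝ (ENNReal.ofReal p) mu}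

lemma MildE.lintegral_dissip (h : MildE P T φE uE V) (hv : ∀ t ∈ Icc 0 T, v t =ᵐ[mu] V t) {w : ℝ → ℝ → ℝ}
    (hw : HasSpaceDeriv T v w) {t : ℝ} (ht : t ∈ Icc 0 T) :
    ENNReal.ofReal (ν * p * (p - 1) / 2) *
        (∫⁻ s in Icc 0 t, normL 2 (fun x => |v s x| ^ ((p - 2) / 2) * w s x) ^ 2)
      + ENNReal.ofReal (β * p * γ) * (∫⁻ s in Icc 0 t, normL p (v s) ^ p)
      + ENNReal.ofReal (β * p / 8) * (∫⁻ s in Icc 0 t, normL (p + 2 * δ) (v s) ^ (p + 2 * δ)) =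
    ∫⁻ s in Ioc 0 t, ENNReal.ofReal (dissip ν β γ δ p (VX P φE uE V s) (derivH (toE 2 (VX P φE uE V s)))) := by
  have hp := P.hp3; have hν := P.hν; have hβ := P.hβ; have hγ := P.hγ0; have hδ := P.hδ'
  have hp0 : 0 < p := by linarith
  have hp1' : 0 < p - 1 := by linarith
  have hsub : Ioc 0 t ⊆ Ioc 0 T := Ioc_subset_Ioc_right ht.2
  simp only [restrict_Icc_eq_Ioc]
  have hvX : ∀ s ∈ Ioc 0 T, v s =ᵐ[mu] VX P φE uE V s := fun s hs => (hv s ⟨hs.1.le, hs.2⟩).trans (h.ae_eq_VX hs)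
  have hpow : ∀ {r : ℝ}, 0 < r → ∫⁻ s in Ioc 0 t, normL r (v s) ^ r =
      ∫⁻ s in Ioc 0 t, ENNReal.ofReal (∫ x, |VX P φE uE V s x| ^ r ∂mu) := fun hr =>
    setLIntegral_congr_fun measurableSet_Ioc fun s hs => by
      rw [← normL_rpow hr (memLp_of_continuous_bdd (VX P φE uE V s).continuous (VX P φE uE V s).abs_apply_le _), normL,
        normL, eLpNorm_congr_ae (hvX s (hsub hs))]
  have hmeas : ∀ {r : ℝ} (c : ℝ), 0 ≤ r → AEMeasurable (fun s => ENNReal.ofReal (c * ∫ x, |VX P φE uE V s x| ^ r ∂mu))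
      (volume.restrict (Ioc 0 t)) := fun c hr =>
    ((((h.continuousOn_integral_VX_rpow hr).mono hsub).aemeasurable measurableSet_Ioc).const_mul c).ennreal_ofReal
  have hD : ∫⁻ s in Ioc 0 t, normL 2 (fun x => |v s x| ^ ((p - 2) / 2) * w s x) ^ 2 =
      ∫⁻ s in Ioc 0 t, ENNReal.ofReal (∫ x, |VX P φE uE V s x| ^ (p - 2) * derivH (toE 2 (VX P φE uE V s)) x *
        derivH (toE 2 (VX P φE uE V s)) x ∂mu) := by
    refine lintegral_congr_ae ?_
    filter_upwards [ae_mono (Measure.restrict_mono hsub le_rfl) (h.spaceDeriv_ae_eq hv hw),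
      ae_restrict_mem measurableSet_Ioc] with s h1 hs
    exact normL_weight_sq hp _ _ (hvX s (hsub hs)) h1
  have hm : ∀ {a : ℝ}, 0 ≤ a → ∀ F : ℝ → ℝ, ENNReal.ofReal a * ∫⁻ s in Ioc 0 t, ENNReal.ofReal (F s) =
      ∫⁻ s in Ioc 0 t, ENNReal.ofReal (a * F s) := fun ha F => by
    rw [← lintegral_const_mul' _ _ ENNReal.ofReal_ne_top]
    simp only [ENNReal.ofReal_mul ha]
  -- Additivity is used with measurability of the right summand only, so the gradient term needs no
  -- measurability argument.
  rw [hD, hpow hp0, hpow (by positivity), hm (by positivity), hm (by positivity), hm (by positivity),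
    ← lintegral_add_right' _ (hmeas _ hp0.le), ← lintegral_add_right' _ (hmeas _ (by positivity))]
  refine lintegral_congr fun s => ?_
  have n1 : 0 ≤ ∫ x, |VX P φE uE V s x| ^ (p - 2) * derivH (toE 2 (VX P φE uE V s)) x *
        derivH (toE 2 (VX P φE uE V s)) x ∂mu := integral_nonneg fun x => by
    simp only [Pi.zero_apply]
    rw [mul_assoc]
    exact mul_nonneg (by positivity) (mul_self_nonneg _)
  have n2 : ∀ r : ℝ, 0 ≤ ∫ x, |VX P φE uE V s x| ^ r ∂mu := fun r => integral_nonneg fun x => by positivity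
  have n3 := n2 p
  have n4 := n2 (p + 2 * δ)
  rw [dissip, ← ENNReal.ofReal_add (by positivity) (by positivity), ← ENNReal.ofReal_add (by positivity) (by positivity)]

theorem MildE.energy_bound (h : MildE P T φE uE V) (hv : ∀ t ∈ Icc 0 T, v t =ᵐ[mu] V t) (hu : u₀ =ᵐ[mu] uE) {B : ℝ}
    (hB0 : 0 ≤ B) (hB : ∀ t ∈ Icc 0 T, eLpNorm (φE t) (ENNReal.ofReal (p * (δ + 1))) mu ≤ ENNReal.ofReal B) {S : ℝ≥0∞}
    (hS : S ≠ ⊤) (hφS : ∀ t ∈ Icc 0 T, normL (p + 2 * δ) (φE t) ^ (p + 2 * δ) ≤ S)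
    {w : ℝ → ℝ → ℝ} (hw : HasSpaceDeriv T v w) {t : ℝ} (ht : t ∈ Icc 0 T) :
    normL p (v t) ^ p
      + ENNReal.ofReal (ν * p * (p - 1) / 2) *
        (∫⁻ s in Icc 0 t, normL 2 (fun x => |v s x| ^ ((p - 2) / 2) * w s x) ^ 2)
      + ENNReal.ofReal (β * p * γ) * (∫⁻ s in Icc 0 t, normL p (v s) ^ p)
      + ENNReal.ofReal (β * p / 8) * (∫⁻ s in Icc 0 t, normL (p + 2 * δ) (v s) ^ (p + 2 * δ)) ≤
    normL p u₀ ^ p + ENNReal.ofReal (p * K1 ν α β γ δ p * T) + ENNReal.ofReal (p * K3 ν α β δ p * T) * S := by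
  have hp := P.hp3; have hδ := P.hδ'
  have hp0 : 0 < p := by linarith
  have hT : 0 ≤ T := h.hT
  have hK1 := K1_nonneg P
  have hK3 := K3_nonneg P
  have hN : ∀ {f : ℝ → ℝ} {U : Lp ℝ (ENNReal.ofReal p) mu}, f =ᵐ[mu] U → normL p f ^ p = ENNReal.ofReal (‖U‖ ^ p) :=
    fun {f U} hf => by
      rw [normL, eLpNorm_congr_ae hf, ← normL, normL_rpow hp0 (Lp.memLp U), norm_rpow_eq_integral hp0]
  rw [add_assoc, add_assoc, ← add_assoc (ENNReal.ofReal (ν * p * (p - 1) / 2) * _), h.lintegral_dissip hv hw ht,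
    hN (hv t ht), hN hu]
  rcases ht.1.eq_or_lt with rfl | h0
  · rw [h.eq_zero, Ioc_self, Measure.restrict_empty, lintegral_zero_measure, add_zero, add_assoc]
    exact le_self_add
  · have hm : ∀ s ∈ Icc 0 t, ∫ x, |φE s x| ^ (p + 2 * δ) ∂mu ≤ S.toReal := fun s hs => by
      have hs' : s ∈ Icc 0 T := ⟨hs.1, hs.2.trans ht.2⟩
      have hmem : MemLp (φE s) (ENNReal.ofReal (p + 2 * δ)) mu :=
        MemLp.mono_exponent ⟨(Lp.memLp _).1, (hB s hs').trans_lt ENNReal.ofReal_lt_top⟩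
          (ENNReal.ofReal_le_ofReal (MildE.exp_q_le P))
      have := hφS s hs'
      rw [normL_rpow (by positivity) hmem] at this
      exact (ENNReal.ofReal_le_iff_le_toReal hS).1 this
    refine ((h.mono ht.1 ht.2).energy h0 hB0 (fun s hs => hB s ⟨hs.1, hs.2.trans ht.2⟩) hm).trans ?_
    have e : ENNReal.ofReal (p * K3 ν α β δ p * T) * S = ENNReal.ofReal (p * K3 ν α β δ p * T * S.toReal) := by
      rw [ENNReal.ofReal_mul (p := p * K3 ν α β δ p * T) (by positivity), ENNReal.ofReal_toReal hS]
    rw [e, ← ENNReal.ofReal_add (by positivity) (by positivity), ← ENNReal.ofReal_add (by positivity) (by positivity)]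
    refine ENNReal.ofReal_le_ofReal ?_
    have h1 : p * (K1 ν α β γ δ p + K3 ν α β δ p * S.toReal) * t ≤ p * (K1 ν α β γ δ p + K3 ν α β δ p * S.toReal) * T := by
      have := ht.2
      gcongr
    linarith

end
end GBH
end

/-! ### Conclusion. -/

theorem proposition4p4 (ν α β γ : ℝ) (δ : ℕ) (p T : ℝ)
    (hν : 0 < ν) (hα : 0 < α) (hβ : 0 < β) (hγ₀ : 0 < γ) (hγ₁ : γ < 1) (hδ : 1 ≤ δ)
    (hp : 2 * (δ : ℝ) + 1 ≤ p) (hT : 0 < T)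
    (φ : ℝ → ℝ → ℝ) (hφ : GBH.ContL T p φ)
    (hφ_bdd : (⨆ r ∈ Icc 0 T, GBH.normL (p * (δ + 1)) (φ r)) < ⊤)
    (u₀ : ℝ → ℝ) (hu₀ : GBH.InL p u₀) :
    ∃ v : ℝ → ℝ → ℝ,
      GBH.IsMildSolution ν α β γ δ p T φ u₀ v ∧
      (∀ v' : ℝ → ℝ → ℝ, GBH.IsMildSolution ν α β γ δ p T φ u₀ v' →
        ∀ t ∈ Icc 0 T, v' t =ᵐ[GBH.mu] v t) ∧
      GBH.IsWeakSolution ν α β γ δ p T φ u₀ v ∧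
      (∀ v' : ℝ → ℝ → ℝ, GBH.IsWeakSolution ν α β γ δ p T φ u₀ v' →
        ∀ t ∈ Icc 0 T, v' t =ᵐ[GBH.mu] v t) ∧
      ∀ w : ℝ → ℝ → ℝ, GBH.HasSpaceDeriv T v w → ∀ t ∈ Icc 0 T,
        GBH.normL p (v t) ^ p
          + ENNReal.ofReal (ν * p * (p - 1) / 2) *
              (∫⁻ s in Icc 0 t, GBH.normL 2 (fun x => |v s x| ^ ((p - 2) / 2) * w s x) ^ 2)
          + ENNReal.ofReal (β * p * γ) * (∫⁻ s in Icc 0 t, GBH.normL p (v s) ^ p)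
          + ENNReal.ofReal (β * p / 8) *
              (∫⁻ s in Icc 0 t, GBH.normL (p + 2 * δ) (v s) ^ (p + 2 * δ))
        ≤ GBH.normL p u₀ ^ p
          + ENNReal.ofReal (p * GBH.K1 ν α β γ δ p * T)
          + ENNReal.ofReal (p * GBH.K2 ν α β γ δ p * T) *
              (⨆ r ∈ Icc 0 T, GBH.normL (p * (δ + 1)) (φ r) ^ (p * (δ + 1)))
          + ENNReal.ofReal (p * GBH.K3 ν α β δ p * T) *
              (⨆ r ∈ Icc 0 T, GBH.normL (p + 2 * δ) (φ r) ^ (p + 2 * δ)) := by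
  have P : GBH.Params ν α β γ δ p := ⟨hν, hα, hβ, hγ₀, hγ₁, hδ, hp⟩
  have hp3 := P.hp3
  have : Fact (1 ≤ ENNReal.ofReal p) := ⟨by simpa using ENNReal.ofReal_le_ofReal (show (1 : ℝ) ≤ p by linarith)⟩
  have hφE := hφ.ae_eq
  have hφc := hφ.continuousOn
  have hu := (GBH.coeFn_liftL hu₀).symm
  set S := ⨆ r ∈ Icc 0 T, GBH.normL (p * (δ + 1)) (φ r) with hSdef
  set S' := ⨆ r ∈ Icc 0 T, GBH.normL (p + 2 * δ) (φ r) ^ (p + 2 * δ) with hS'def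
  have hS : ∀ t ∈ Icc 0 T, GBH.normL (p * (δ + 1)) (φ t) ≤ S := fun t ht =>
    le_iSup₂ (f := fun r (_ : r ∈ Icc 0 T) => GBH.normL (p * (δ + 1)) (φ r)) t ht
  have hq0 : 0 ≤ p + 2 * (δ : ℝ) := by positivity
  have hB : ∀ t ∈ Icc 0 T, eLpNorm (GBH.liftL (ENNReal.ofReal p) (φ t)) (ENNReal.ofReal (p * (δ + 1))) GBH.mu ≤
      ENNReal.ofReal S.toReal := fun t ht => by
    rw [ENNReal.ofReal_toReal hφ_bdd.ne, eLpNorm_congr_ae (hφE t ht).symm]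
    exact hS t ht
  -- Finite because p + 2δ ≤ p(δ+1) and norms increase with the exponent on a probability space.
  have hS'top : S' ≠ ⊤ := by
    refine ne_top_of_le_ne_top (b := S ^ (p + 2 * (δ : ℝ))) (ENNReal.rpow_ne_top_of_nonneg hq0 hφ_bdd.ne) ?_
    refine iSup₂_le fun t ht => ENNReal.rpow_le_rpow (le_trans ?_ (hS t ht)) hq0
    exact eLpNorm_le_eLpNorm_of_exponent_le (ENNReal.ofReal_le_ofReal (GBH.MildE.exp_q_le P)) (hφ.1 t ht).1
  have hS' : ∀ t ∈ Icc 0 T, GBH.normL (p + 2 * δ) (GBH.liftL (ENNReal.ofReal p) (φ t)) ^ (p + 2 * (δ : ℝ)) ≤ S' :=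
    fun t ht => by
      rw [GBH.normL, eLpNorm_congr_ae (hφE t ht).symm]
      exact le_iSup₂ (f := fun r (_ : r ∈ Icc 0 T) => GBH.normL (p + 2 * δ) (φ r) ^ (p + 2 * (δ : ℝ))) t ht
  have hm : ∀ t ∈ Icc 0 T, ∫ x, |GBH.liftL (ENNReal.ofReal p) (φ t) x| ^ (p + 2 * (δ : ℝ)) ∂GBH.mu ≤ S'.toReal := fun t ht => by
    have hmem : MemLp (GBH.liftL (ENNReal.ofReal p) (φ t)) (ENNReal.ofReal (p + 2 * δ)) GBH.mu :=
      MemLp.mono_exponent ⟨(Lp.memLp _).1, (hB t ht).trans_lt ENNReal.ofReal_lt_top⟩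
        (ENNReal.ofReal_le_ofReal (GBH.MildE.exp_q_le P))
    have := hS' t ht
    rw [GBH.normL_rpow (by positivity) hmem] at this
    exact (ENNReal.ofReal_le_iff_le_toReal hS'top).1 this
  obtain ⟨V, hV⟩ := GBH.exists_mildE P hT.le hφc ENNReal.toReal_nonneg hB hm (GBH.liftL (ENNReal.ofReal p) u₀)
  have hVV : ∀ t ∈ Icc 0 T, (V t : ℝ → ℝ) =ᵐ[GBH.mu] V t := fun t _ => ae_eq_refl _
  refine ⟨fun t => V t, (GBH.isMildSolution_iff P hT.le hφE hφc hu hVV).2 hV, fun v' hv' t ht => ?_,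
    hV.isWeakSolution hφE hu hVV ENNReal.toReal_nonneg hB, fun v' hv' t ht => ?_, fun w hw t ht => ?_⟩
  · have h' := (GBH.isMildSolution_iff P hT.le hφE hφc hu hv'.1.ae_eq).1 hv'
    show v' t =ᵐ[GBH.mu] V t
    rw [hV.unique h' t ht]
    exact hv'.1.ae_eq t ht
  · obtain ⟨V', hv'V, hV'⟩ := hv'.exists_mildE P hT.le hφE hφc hu
    show v' t =ᵐ[GBH.mu] V t
    rw [hV.unique hV' t ht]
    exact hv'V t ht
  · refine (hV.energy_bound hVV hu ENNReal.toReal_nonneg hB hS'top hS' hw ht).trans ?_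
    -- The bound is already proved without the K₂ term; adding this nonnegative quantity only
    -- weakens it.
    exact add_le_add le_self_add le_rfl
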